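/- **Theorem.** Let $k$ be a field, let $A$ be a small dg category over $k$ (cohomological grading), and let $n\in\mathbb Z$. *Conventions.* For a dg category $C$ let $CB(C)$ be its (normalized) cyclic bar complex, i.e. the Hochschild chain complex, spanned by the cyclically composable words $a_0[a_1|\dots|a_m]$ in degree $|a_0|+\sum_{i\ge 1}(|a_i|-1)$, with the Hochschild differential $b$ of degree $1$ and Connes' operator $B$ of degree $-1$. With a variable $u$ of degree $2$ put $$NC(C)=(CB(C)[[u]],\,b+uB),\qquad CC(C)=(CB(C)[u^{-1}],\,b+uB)$$ (negative cyclic complex and cyclic complex, where $u$ acts on $CB(C)[u^{-1}]$ with $u\cdot u^0=0$). A complex over $k$ is perfect if its total cohomology is finite dimensional. $C$ is *smooth* if its diagonal bimodule is perfect, i.e. compact in the derived category of dg $C$-bimodules; $C$ is *proper* if all complexes $C(x,y)$ are perfect. An object $p$ of $A$ is *locally perfect* if $A(a,p)$ is perfect for every object $a$ of $A$. *Left Calabi-Yau structures.* Let $C$ be smooth and let $C^!$ be its inverse dualizing bimodule, $C^!(s,t)=R\mathrm{Hom}_{C^e}\big(C,\;C(s,-)\otimes_k C(-,t)\big)$.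 Pairing Hochschild chains with Hochschild cochains gives a map $\Phi\colon CB(C)\to R\mathrm{Hom}_{C^e}(C^!,C)$ by $\Phi(a_0[w])(\varphi)=\sum\pm\, g\,a_0f$ for $\varphi[w]=\sum f\otimes g$. An $n$-dimensional left Calabi-Yau structure on $C$ is a cycle $\widetilde{[C]}=\sum_{j\ge0}\xi_ju^j$ of degree $-n$ in $NC(C)$, i.e. a map of complexes $k[n]\to NC(C)$, whose image $[C]=\xi_0$ in $CB(C)$ is such that $\Phi([C])\colon C^!\to C[-n]$ is a quasi-isomorphism. *Right Calabi-Yau structures.* Let $C$ be proper and let $C^*$ be the bimodule $C^*(x,y)=\mathrm{Hom}_k(C(y,x),k)$. An $n$-dimensional right Calabi-Yau structure on $C$ is a map of complexes $\widetilde\omega\colon CC(C)\to k[-n]$ such that, for its pullback $\omega$ to $CB(C)$, the corresponding morphism of bimodules $C[n]\to C^*$, given on $C(x,y)$ by $a\mapsto(g\mapsto\pm\,\omega(ga[\,]))$, is a quasi-isomorphism. *The map $\widetilde\Theta$.* Let $P\subset A$ be a full dg subcategory spanned by a set of locally perfect objects. The dg functor $A^{op}\otimes P\to\mathrm{Perf}_k$,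 $(a,p)\mapsto A(a,p)$, together with $CB(A)\simeq CB(A^{op})$, the shuffle product, and the trace equivalence $CB(\mathrm{Perf}_k)\simeq k$, induces a map $$\Theta\colon CB(A)\longrightarrow \mathrm{Hom}_k(CB(P),k)$$ that is compatible with the circle actions (the isomorphism $CB(A)\simeq CB(A^{op})$ reverses the circle, so that it corresponds to $u\mapsto -u$), and hence a map $\widetilde\Theta\colon NC(A)\to\mathrm{Hom}_k(CC(P),k)$. Explicitly, $\widetilde\Theta(\sum_j\xi_ju^j)$ sends $\beta u^{-j}$ to $(-1)^j\,\Theta(\xi_j)(\beta)$, and $$\Theta(a_0[a_1|\dots|a_m])(p_0[p_1|\dots|p_l])=\sum_{\text{shuffles}}\pm\,\tau\big(\lambda(a_0)\rho(p_0)\,[\,f_1|\dots|f_{m+l}\,]\big),$$ where $\lambda(a)v=\pm va$ and $\rho(p)v=pv$ are the operators on the complexes $V=A(a,p)$ defined by the functor, where $[f_1|\dots|f_{m+l}]$ runs over the shuffles of $[\lambda(a_m)|\dots|\lambda(a_1)]$ and $[\rho(p_1)|\dots|\rho(p_l)]$, and where $$\tau(f_0[f_1|\dots|f_r])=\mathrm{str}\Big(f_0\sum_{i=0}^{r}\pm\,h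 f_1h\cdots hf_i\,e\,f_{i+1}h\cdots f_rh\Big)$$ for any choice, on each complex $V=A(a,p)$, of an operator $h$ of degree $-1$ with $h^2=0$, $hdh=h$, $dhd=d$, and $e=1-dh-hd$ (the projector onto a space of representatives of the cohomology; such $h$ always exist). All signs are Koszul signs. **Claim.** Suppose that $A$ is smooth, let $\widetilde{[A]}$ be an $n$-dimensional left Calabi-Yau structure on $A$, and let $P\subset A$ be a full dg subcategory spanned by a set of locally perfect objects. Then $P$ is proper and, for every choice of the operators $h$, the functional $\widetilde\Theta(\widetilde{[A]})$ is an $n$-dimensional right Calabi-Yau structure on $P$. -/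

import Mathlib

open CategoryTheory

universe u

set_option linter.unusedSectionVars false

namespace DGCY

/-! ## Signs -/

/-- The sign `(-1)^i` as an element of the ground field. -/
def sgn (k : Type u) [Field k] (i : ℤ) : k := ((i.negOnePow : ℤ) : k)

section Signs
variable (k : Type u) [Field k]

lemma sgn_add (i j : ℤ) : sgn k (i + j) = sgn k i * sgn k j := by
  simp [sgn, Int.negOnePow_add]

lemma sgn_zero : sgn k 0 = 1 := by simp [sgn]

lemma sgn_one : sgn k 1 = -1 := by simp [sgn]

lemma sgn_neg (i : ℤ) : sgn k (-i) = sgn k i := by simp [sgn]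

lemma sgn_sub (i j : ℤ) : sgn k (i - j) = sgn k i * sgn k j := by
  rw [sub_eq_add_neg, sgn_add, sgn_neg]

lemma sgn_mul_self (i : ℤ) : sgn k i * sgn k i = 1 := by
  rw [← sgn_add, sgn, Int.negOnePow_even _ (Even.add_self i)]; simp

lemma sgn_sq (i : ℤ) : sgn k i ^ 2 = 1 := by rw [pow_two, sgn_mul_self]

lemma negOnePow_smul {V : Type*} [AddCommGroup V] [Module k V] (i : ℤ) (x : V) :
    i.negOnePow • x = sgn k i • x := by
  rw [sgn, Units.smul_def, Int.cast_smul_eq_zsmul]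

end Signs

/-! ## Differential graded categories -/

/-- A (small) differential graded category over `k`: a category enriched in cochain complexes of
`k`-vector spaces. The composition `Hom y z ⊗ Hom x y ⟶ Hom x z` is given by its homogeneous
components `comp h f g = f ∘ g`; that it is a chain map is the graded Leibniz rule. -/
structure DGCategory (k : Type u) [Field k] where
  Obj : Type u
  Hom : Obj → Obj → CochainComplex (ModuleCat.{u} k) ℤ
  one : ∀ x, (Hom x x).X 0
  comp : ∀ {x y z : Obj} {i j l : ℤ}, i + j = l →
    ((Hom y z).X i →ₗ[k] (Hom x y).X j →ₗ[k] (Hom x z).X l)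
  one_comp : ∀ {x y : Obj} {i : ℤ} (f : (Hom x y).X i), comp (zero_add i) (one y) f = f
  comp_one : ∀ {x y : Obj} {i : ℤ} (f : (Hom x y).X i), comp (add_zero i) f (one x) = f
  assoc : ∀ {w x y z : Obj} {i j l ij jl m : ℤ} (hij : i + j = ij) (hjl : j + l = jl)
    (h : ij + l = m) (h' : i + jl = m)
    (f : (Hom y z).X i) (g : (Hom x y).X j) (e : (Hom w x).X l),
    comp h (comp hij f g) e = comp h' f (comp hjl g e)
  d_one : ∀ x, (Hom x x).d 0 1 (one x) = 0
  d_comp : ∀ {x y z : Obj} {i j l i' j' l' : ℤ} (h : i + j = l) (hi : i + 1 = i')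
    (hj : j + 1 = j') (hl : l + 1 = l') (f : (Hom y z).X i) (g : (Hom x y).X j),
    (Hom x z).d l l' (comp h f g) =
      comp (show i' + j = l' by omega) ((Hom y z).d i i' f) g +
        sgn k i • comp (show i + j' = l' by omega) f ((Hom x y).d j j' g)

variable {k : Type u} [Field k]

/-- The opposite dg category, with the Koszul sign in the composition. -/
def DGCategory.op (A : DGCategory k) : DGCategory k where
  Obj := A.Obj
  Hom x y := A.Hom y x
  one := A.one
  comp {x y z i j l} h := sgn k (i * j) • (A.comp (show j + i = l by omega)).flip
  one_comp f := by simp [sgn_zero, A.comp_one]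
  comp_one f := by simp [sgn_zero, A.one_comp]
  assoc {w x y z i j l ij jl m} hij hjl h h' f g e := by
    subst hij hjl h
    simp only [LinearMap.smul_apply, LinearMap.flip_apply, map_smul, smul_smul]
    rw [A.assoc (show l + j = j + l by omega) (show j + i = i + j by omega) _
      (show l + (i + j) = i + j + l by omega)]
    congr 1
    simp only [add_mul, mul_add, sgn_add]
    ring
  d_one := A.d_one
  d_comp {x y z i j l i' j' l'} h hi hj hl f g := by
    subst hi hj hl h
    simp only [LinearMap.smul_apply, LinearMap.flip_apply, map_smul, smul_smul]
    have := A.d_comp (show j + i = i + j by omega) rfl rfl rfl g f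
    rw [this, smul_add, smul_smul]
    refine (add_comm _ _).trans ?_
    congr 1
    · congr 1
      simp only [add_mul, one_mul, sgn_add]
    · congr 1
      simp only [mul_add, mul_one, sgn_add]
      linear_combination (-sgn k (i * j)) * sgn_mul_self k i

/-- The full dg subcategory spanned by a set of objects. -/
def DGCategory.full (A : DGCategory k) (P : Set A.Obj) : DGCategory k where
  Obj := P
  Hom x y := A.Hom x y
  one x := A.one x
  comp h := A.comp h
  one_comp := A.one_comp
  comp_one := A.comp_one
  assoc := A.assoc
  d_one x := A.d_one x
  d_comp := A.d_comp

open CochainComplex.HomComplex in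
/-- The full dg subcategory of the dg category of cochain complexes spanned by a family `V`. -/
def endoCategory {I : Type u} (V : I → CochainComplex (ModuleCat.{u} k) ℤ) : DGCategory k where
  Obj := I
  Hom x y :=
    { X := fun i => ModuleCat.of k (Cochain (V x) (V y) i)
      d := fun i j => ModuleCat.ofHom (δ_hom k (V x) (V y) i j)
      shape := fun i j hij => by
        refine ModuleCat.hom_ext (LinearMap.ext fun z => ?_)
        exact δ_shape i j hij z
      d_comp_d' := fun i j l _ _ => by
        refine ModuleCat.hom_ext (LinearMap.ext fun z => ?_)
        exact δ_δ i j l z }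
  one x := Cochain.ofHom (𝟙 (V x))
  comp {x y z i j l} h :=
    LinearMap.mk₂ k (fun f g => Cochain.comp (show Cochain (V x) (V y) j from g)
        (show Cochain (V y) (V z) i from f) (show j + i = l by omega))
      (fun _ _ _ => Cochain.comp_add _ _ _ _) (fun c f g => Cochain.comp_smul _ _ _ _)
      (fun _ _ _ => Cochain.add_comp _ _ _ _) (fun c f g => Cochain.smul_comp _ _ _ _)
  one_comp {x y i} f := Cochain.comp_id (show Cochain (V x) (V y) i from f)
  comp_one {x y i} f := Cochain.id_comp (show Cochain (V x) (V y) i from f)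
  assoc {w x y z i j l ij jl m} hij hjl h h' f g e :=
    (Cochain.comp_assoc (show Cochain (V w) (V x) l from e) (show Cochain (V x) (V y) j from g)
      (show Cochain (V y) (V z) i from f) (by omega) (by omega) (by omega)).symm
  d_one x := δ_ofHom _
  d_comp {x y z i j l i' j' l'} h hi hj hl f g := by
    have := δ_comp (show Cochain (V x) (V y) j from g) (show Cochain (V y) (V z) i from f)
      (show j + i = l by omega) j' i' l' hl hj hi
    rw [negOnePow_smul k] at this
    exact this

/-! ## Dg bimodules -/

/-- A dg bimodule over `A`, i.e. a dg functor `Aᵒᵖ ⊗ A ⟶ Ch(k)`, `(x, y) ↦ M x y`, given by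
two-sided actions by post- and precomposition that are compatible with the differentials. -/
structure DGBimodule (A : DGCategory k) where
  M : A.Obj → A.Obj → CochainComplex (ModuleCat.{u} k) ℤ
  lact : ∀ {x y z : A.Obj} {i j l : ℤ}, i + j = l →
    ((A.Hom y z).X i →ₗ[k] (M x y).X j →ₗ[k] (M x z).X l)
  ract : ∀ {x y z : A.Obj} {i j l : ℤ}, i + j = l →
    ((M y z).X i →ₗ[k] (A.Hom x y).X j →ₗ[k] (M x z).X l)
  one_lact : ∀ {x y : A.Obj} {i : ℤ} (m : (M x y).X i), lact (zero_add i) (A.one y) m = m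
  ract_one : ∀ {x y : A.Obj} {i : ℤ} (m : (M x y).X i), ract (add_zero i) m (A.one x) = m
  lact_lact : ∀ {w x y z : A.Obj} {i j l ij jl m : ℤ} (hij : i + j = ij) (hjl : j + l = jl)
    (h : ij + l = m) (h' : i + jl = m)
    (f : (A.Hom y z).X i) (g : (A.Hom x y).X j) (e : (M w x).X l),
    lact h (A.comp hij f g) e = lact h' f (lact hjl g e)
  ract_ract : ∀ {w x y z : A.Obj} {i j l ij jl m : ℤ} (hij : i + j = ij) (hjl : j + l = jl)
    (h : ij + l = m) (h' : i + jl = m)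
    (f : (M y z).X i) (g : (A.Hom x y).X j) (e : (A.Hom w x).X l),
    ract h (ract hij f g) e = ract h' f (A.comp hjl g e)
  lact_ract : ∀ {w x y z : A.Obj} {i j l ij jl m : ℤ} (hij : i + j = ij) (hjl : j + l = jl)
    (h : ij + l = m) (h' : i + jl = m)
    (f : (A.Hom y z).X i) (g : (M x y).X j) (e : (A.Hom w x).X l),
    ract h (lact hij f g) e = lact h' f (ract hjl g e)
  d_lact : ∀ {x y z : A.Obj} {i j l i' j' l' : ℤ} (h : i + j = l) (hi : i + 1 = i')
    (hj : j + 1 = j') (hl : l + 1 = l') (f : (A.Hom y z).X i) (g : (M x y).X j),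
    (M x z).d l l' (lact h f g) =
      lact (show i' + j = l' by omega) ((A.Hom y z).d i i' f) g +
        sgn k i • lact (show i + j' = l' by omega) f ((M x y).d j j' g)
  d_ract : ∀ {x y z : A.Obj} {i j l i' j' l' : ℤ} (h : i + j = l) (hi : i + 1 = i')
    (hj : j + 1 = j') (hl : l + 1 = l') (f : (M y z).X i) (g : (A.Hom x y).X j),
    (M x z).d l l' (ract h f g) =
      ract (show i' + j = l' by omega) ((M y z).d i i' f) g +
        sgn k i • ract (show i + j' = l' by omega) f ((A.Hom x y).d j j' g)

/-- The `k`-linear dual `A^*` of the diagonal bimodule: `(x, y) ↦ Hom_k(A(y, x), k)`, with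
`(d f)(g) = -(-1)^{|f|} f (d g)`, `(f · a)(g) = f (a g)` and
`(a · f)(g) = (-1)^{|a| (|f| + |g|)} f (g a)`, where `|f| + |g| = -|a|`. -/
def dualBimodule (A : DGCategory k) : DGBimodule A where
  M x y :=
    { X := fun q => ModuleCat.of k (Module.Dual k ((A.Hom y x).X (-q)))
      d := fun q q' => ModuleCat.ofHom
        ((-sgn k q) • LinearMap.lcomp k k ((A.Hom y x).d (-q') (-q)).hom)
      shape := fun q q' h => by
        have h0 : (A.Hom y x).d (-q') (-q) = 0 := (A.Hom y x).shape _ _ (by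
          simp only [ComplexShape.up_Rel] at h ⊢; omega)
        ext f : 2
        ext g
        simp [h0]
      d_comp_d' := fun p q r _ _ => by
        ext f : 2
        ext g
        have h0 : (A.Hom y x).d (-q) (-p) ((A.Hom y x).d (-r) (-q) g) = 0 := by
          rw [← ModuleCat.comp_apply, HomologicalComplex.d_comp_d]; rfl
        simp [h0] }
  lact {x y z i j l} h :=
    LinearMap.mk₂ k (fun a f => sgn k i •
        (f.comp ((A.comp (show -l + i = -j by omega)).flip a) : Module.Dual k _))
      (by intros; ext; simp [mul_add]) (by intros; ext; simp [mul_left_comm])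
      (by intros; ext; simp [mul_add]) (by intros; ext; simp [mul_left_comm])
  ract {x y z i j l} h :=
    LinearMap.mk₂ k (fun f a => (f.comp (A.comp (show j + -l = -i by omega) a) : Module.Dual k _))
      (by intros; ext; simp) (by intros; ext; simp)
      (by intros; ext; simp) (by intros; ext; simp)
  one_lact := by
    intros x y i m
    ext g
    simp [sgn_zero, A.comp_one]
  ract_one := by
    intros x y i m
    ext g
    exact congrArg m (A.one_comp g)
  lact_lact := by
    intro w x y z i j l ij jl m hij hjl h h' f g e
    subst hij
    ext t
    simp only [LinearMap.mk₂_apply, LinearMap.smul_apply, LinearMap.comp_apply,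
      LinearMap.flip_apply, smul_smul]
    rw [A.assoc _ (show i + j = i + j from rfl) _ (show -m + (i + j) = -l by omega), sgn_add]
  ract_ract := by
    intro w x y z i j l ij jl m hij hjl h h' f g e
    ext t
    exact congrArg f (A.assoc hjl (show l + -m = -ij by omega) (show jl + -m = -i by omega) _
      g e t).symm
  lact_ract := by
    intro w x y z i j l ij jl m hij hjl h h' f g e
    ext t
    exact congrArg (fun v => sgn k i • g v) (A.assoc (show l + -m = -ij by omega)
      (show -m + i = -jl by omega) _ (show l + -jl = -j by omega) e t f)
  d_lact := by
    intro x y z i j l i' j' l' h hi hj hl f g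
    subst hi hj hl h
    ext t
    have := A.d_comp (show -(i + j + 1) + i = -(j + 1) by omega)
      (show -(i + j + 1) + 1 = -(i + j) by omega) rfl (show -(j + 1) + 1 = -j by omega) t f
    have e := congrArg (show Module.Dual k ((A.Hom y x).X (-j)) from g) this
    simp at e ⊢
    erw [e]
    simp only [sgn_add, sgn_neg, sgn_one]
    set S := sgn k i
    set T := sgn k j
    have hS : S * S = 1 := sgn_mul_self k i
    have hT : T * T = 1 := sgn_mul_self k j
    generalize g _ = a
    generalize g _ = b
    linear_combination (-(S * b * T * T)) * hS - S * b * hT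
  d_ract := by
    intro x y z i j l i' j' l' h hi hj hl f g
    subst hi hj hl h
    ext t
    have := A.d_comp (show j + -(i + j + 1) = -(i + 1) by omega) rfl
      (show -(i + j + 1) + 1 = -(i + j) by omega) (show -(i + 1) + 1 = -i by omega) g t
    have e := congrArg (show Module.Dual k ((A.Hom z y).X (-i)) from f) this
    simp at e ⊢
    erw [e]
    simp only [sgn_add]
    ring

open scoped DirectSum

/-- The direct sum of a family of dg bimodules. -/
noncomputable def directSum {A : DGCategory k} {ι : Type u} (N : ι → DGBimodule A) :
    DGBimodule A where
  M x y :=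
    { X := fun q => ModuleCat.of k (⨁ a, ((N a).M x y).X q)
      d := fun q q' => ModuleCat.ofHom (DirectSum.lmap fun a => (((N a).M x y).d q q').hom)
      shape := fun q q' h => by
        refine ModuleCat.hom_ext (LinearMap.ext fun m => DFinsupp.ext fun a => ?_)
        have h0 : ((N a).M x y).d q q' = 0 := ((N a).M x y).shape _ _ h
        change (((N a).M x y).d q q').hom (m a) = 0
        rw [h0]; rfl
      d_comp_d' := fun p q r _ _ => by
        refine ModuleCat.hom_ext (LinearMap.ext fun m => DFinsupp.ext fun a => ?_)
        change (((N a).M x y).d q r).hom ((((N a).M x y).d p q).hom (m a)) = 0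
        rw [← ModuleCat.comp_apply, HomologicalComplex.d_comp_d]; rfl }
  lact {x y z i j l} h :=
    LinearMap.mk₂ k (fun f m => DirectSum.lmap (fun a => (N a).lact h f) m)
      (fun _ _ _ => DFinsupp.ext fun a => by simp)
      (fun _ _ _ => DFinsupp.ext fun a => by simp; rfl)
      (fun _ _ _ => map_add _ _ _) (fun _ _ _ => map_smul _ _ _)
  ract {x y z i j l} h :=
    LinearMap.mk₂ k (fun m f => DirectSum.lmap (fun a => ((N a).ract h).flip f) m)
      (fun _ _ _ => map_add _ _ _) (fun _ _ _ => map_smul _ _ _)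
      (fun _ _ _ => DFinsupp.ext fun a => by simp)
      (fun _ _ _ => DFinsupp.ext fun a => by simp; rfl)
  one_lact m := DFinsupp.ext fun a => (N a).one_lact _
  ract_one m := DFinsupp.ext fun a => (N a).ract_one _
  lact_lact hij hjl h h' f g e := DFinsupp.ext fun a => (N a).lact_lact hij hjl h h' f g (e a)
  ract_ract hij hjl h h' f g e := DFinsupp.ext fun a => (N a).ract_ract hij hjl h h' (f a) g e
  lact_ract hij hjl h h' f g e := DFinsupp.ext fun a => (N a).lact_ract hij hjl h h' f (g a) e
  d_lact h hi hj hl f g := DFinsupp.ext fun a => (N a).d_lact h hi hj hl f (g a)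
  d_ract {x y z i j l i' j' l'} h hi hj hl f g :=
    DFinsupp.ext fun a => (N a).d_ract h hi hj hl (f a) g

/-- A morphism of dg bimodules: a natural family of chain maps. -/
structure DGBimodule.Hom {A : DGCategory k} (M N : DGBimodule A) where
  app : ∀ x y, M.M x y ⟶ N.M x y
  app_lact : ∀ {x y z : A.Obj} {i j l : ℤ} (h : i + j = l) (f : (A.Hom y z).X i)
    (m : (M.M x y).X j), (app x z).f l (M.lact h f m) = N.lact h f ((app x y).f j m)
  app_ract : ∀ {x y z : A.Obj} {i j l : ℤ} (h : i + j = l) (m : (M.M y z).X i)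
    (f : (A.Hom x y).X j), (app x z).f l (M.ract h m f) = N.ract h ((app y z).f i m) f

open Classical in
/-- The inclusion of a summand. -/
noncomputable def directSumIncl {A : DGCategory k} {ι : Type u} (N : ι → DGBimodule A) (a : ι) :
    (N a).Hom (directSum N) where
  app x y :=
    { f := fun q => ModuleCat.ofHom (DirectSum.lof k ι (fun a => ((N a).M x y).X q) a)
      comm' := fun p q _ => by
        refine ModuleCat.hom_ext (LinearMap.ext fun m => ?_)
        exact DirectSum.lmap_lof _ _ _ }
  app_lact {x y z i j l} h f m :=
    (DirectSum.lmap_lof (R := k) (fun a => (N a).lact (x := x) (y := y) (z := z) h f) a m).symm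
  app_ract {x y z i j l} h m f :=
    (DirectSum.lmap_lof (R := k) (fun a => ((N a).ract (x := x) (y := y) (z := z) h).flip f)
      a m).symm

/-! ## The representable bimodules -/

section Representable
variable (A : DGCategory k) (s t : A.Obj)

/-- The degree `q` part of the complex `A(s, y) ⊗ A(x, t)`. -/
abbrev TensorX (x y : A.Obj) (q : ℤ) : Type u :=
  ⨁ p : {p : ℤ × ℤ // p.1 + p.2 = q},
    TensorProduct k ((A.Hom s y).X p.1.1) ((A.Hom x t).X p.1.2)

/-- The homogeneous tensor `f ⊗ g`. -/
noncomputable def tmk (x y : A.Obj) {a b q : ℤ} (h : a + b = q) :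
    (A.Hom s y).X a →ₗ[k] (A.Hom x t).X b →ₗ[k] TensorX A s t x y q :=
  (TensorProduct.mk k _ _).compr₂ (DirectSum.lof k {p : ℤ × ℤ // p.1 + p.2 = q}
    (fun p => TensorProduct k ((A.Hom s y).X p.1.1) ((A.Hom x t).X p.1.2)) ⟨(a, b), h⟩)

/-- A linear map out of `A(s, y) ⊗ A(x, t)` is given by bilinear maps on bihomogeneous parts. -/
noncomputable def tlift {x y : A.Obj} {q : ℤ} {V : Type u} [AddCommGroup V] [Module k V]
    (F : ∀ a b : ℤ, a + b = q → ((A.Hom s y).X a →ₗ[k] (A.Hom x t).X b →ₗ[k] V)) :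
    TensorX A s t x y q →ₗ[k] V :=
  DirectSum.toModule k _ V fun p => TensorProduct.lift (F p.1.1 p.1.2 p.2)

variable {A s t}

@[simp] lemma tlift_tmk {x y : A.Obj} {q : ℤ} {V : Type u} [AddCommGroup V] [Module k V]
    (F : ∀ a b : ℤ, a + b = q → ((A.Hom s y).X a →ₗ[k] (A.Hom x t).X b →ₗ[k] V))
    {a b : ℤ} (h : a + b = q) (f : (A.Hom s y).X a) (g : (A.Hom x t).X b) :
    tlift A s t F (tmk A s t x y h f g) = F a b h f g := by
  simp [tlift, tmk]

lemma tensor_hom_ext {x y : A.Obj} {q : ℤ} {V : Type u} [AddCommGroup V] [Module k V]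
    {F G : TensorX A s t x y q →ₗ[k] V}
    (H : ∀ (a b : ℤ) (h : a + b = q) (f : (A.Hom s y).X a) (g : (A.Hom x t).X b),
      F (tmk A s t x y h f g) = G (tmk A s t x y h f g)) : F = G := by
  refine DirectSum.linearMap_ext _ fun p => TensorProduct.ext' fun f g => ?_
  exact H p.1.1 p.1.2 p.2 f g

lemma tensor_induction {x y : A.Obj} {q : ℤ} {p : TensorX A s t x y q → Prop}
    (h0 : p 0) (hadd : ∀ m n, p m → p n → p (m + n))
    (htmk : ∀ (a b : ℤ) (h : a + b = q) (f : (A.Hom s y).X a) (g : (A.Hom x t).X b),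
      p (tmk A s t x y h f g)) (m : TensorX A s t x y q) : p m := by
  induction m using DirectSum.induction_on with
  | zero => exact h0
  | of i z =>
    induction z using TensorProduct.induction_on with
    | zero => rw [map_zero]; exact h0
    | tmul f g => exact htmk i.1.1 i.1.2 i.2 f g
    | add z w hz hw => rw [map_add]; exact hadd _ _ hz hw
  | add z w hz hw => exact hadd _ _ hz hw

variable (A s t)

/-- The differential `d (f ⊗ g) = df ⊗ g + (-1)^{|f|} f ⊗ dg`. -/
noncomputable def tensorD (x y : A.Obj) {q q' : ℤ} (hq : q + 1 = q') :
    TensorX A s t x y q →ₗ[k] TensorX A s t x y q' :=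
  tlift A s t fun a b h =>
    (tmk A s t x y (show (a + 1) + b = q' by omega)).comp ((A.Hom s y).d a (a + 1)).hom +
    sgn k a • (tmk A s t x y (show a + (b + 1) = q' by omega)).compl₂
      ((A.Hom x t).d b (b + 1)).hom

/-- The left action `c · (f ⊗ g) = (c f) ⊗ g`. -/
noncomputable def tensorL {x y z : A.Obj} {i j l : ℤ} (h : i + j = l) (c : (A.Hom y z).X i) :
    TensorX A s t x y j →ₗ[k] TensorX A s t x z l :=
  tlift A s t fun a b hab =>
    (tmk A s t x z (show (i + a) + b = l by omega)).comp (A.comp rfl c)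

/-- The right action `(f ⊗ g) · c = f ⊗ (g c)`. -/
noncomputable def tensorR {x y z : A.Obj} {i j l : ℤ} (h : i + j = l) (c : (A.Hom x y).X j) :
    TensorX A s t y z i →ₗ[k] TensorX A s t x z l :=
  tlift A s t fun a b hab =>
    (tmk A s t x z (show a + (b + j) = l by omega)).compl₂ ((A.comp rfl).flip c)

variable {A s t}

lemma tmk_congr {x y : A.Obj} {a a' b b' q : ℤ} (ha : a = a') (hb : b = b') (h : a + b = q)
    (h' : a' + b' = q) (f : (A.Hom s y).X a) (f' : (A.Hom s y).X a') (g : (A.Hom x t).X b)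
    (g' : (A.Hom x t).X b') (hf : HEq f f') (hg : HEq g g') :
    tmk A s t x y h f g = tmk A s t x y h' f' g' := by
  subst ha hb
  cases hf; cases hg; rfl

lemma tensorD_tmk {x y : A.Obj} {q q' a b a' b' : ℤ} (hq : q + 1 = q') (h : a + b = q)
    (ha : a + 1 = a') (hb : b + 1 = b')
    (f : (A.Hom s y).X a) (g : (A.Hom x t).X b) :
    tensorD A s t x y hq (tmk A s t x y h f g) =
      tmk A s t x y (show a' + b = q' by omega) ((A.Hom s y).d a a' f) g +
      sgn k a • tmk A s t x y (show a + b' = q' by omega) f ((A.Hom x t).d b b' g) := by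
  subst ha hb
  simp [tensorD]

lemma tensorL_tmk {x y z : A.Obj} {i j l a b a' : ℤ} (h : i + j = l) (hab : a + b = j)
    (ha : i + a = a') (c : (A.Hom y z).X i) (f : (A.Hom s y).X a) (g : (A.Hom x t).X b) :
    tensorL A s t h c (tmk A s t x y hab f g) =
      tmk A s t x z (show a' + b = l by omega) (A.comp ha c f) g := by
  subst ha
  simp [tensorL]

lemma tensorR_tmk {x y z : A.Obj} {i j l a b b' : ℤ} (h : i + j = l) (hab : a + b = i)
    (hb : b + j = b') (c : (A.Hom x y).X j) (f : (A.Hom s z).X a) (g : (A.Hom y t).X b) :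
    tensorR A s t h c (tmk A s t y z hab f g) =
      tmk A s t x z (show a + b' = l by omega) f (A.comp hb g c) := by
  subst hb
  simp [tensorR]

lemma tensorL_add {x y z : A.Obj} {i j l : ℤ} (h : i + j = l) (c c' : (A.Hom y z).X i)
    (m : TensorX A s t x y j) :
    tensorL A s t h (c + c') m = tensorL A s t h c m + tensorL A s t h c' m := by
  induction m using tensor_induction with
  | h0 => simp
  | hadd m n hm hn => simp only [map_add, hm, hn]; abel
  | htmk a b hab f g => simp [tensorL_tmk h hab rfl]

lemma tensorL_smul {x y z : A.Obj} {i j l : ℤ} (h : i + j = l) (r : k) (c : (A.Hom y z).X i)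
    (m : TensorX A s t x y j) :
    tensorL A s t h (r • c) m = r • tensorL A s t h c m := by
  induction m using tensor_induction with
  | h0 => simp
  | hadd m n hm hn => simp only [map_add, hm, hn, smul_add]
  | htmk a b hab f g => simp [tensorL_tmk h hab rfl]

lemma tensorR_add {x y z : A.Obj} {i j l : ℤ} (h : i + j = l) (c c' : (A.Hom x y).X j)
    (m : TensorX A s t y z i) :
    tensorR A s t h (c + c') m = tensorR A s t h c m + tensorR A s t h c' m := by
  induction m using tensor_induction with
  | h0 => simp
  | hadd m n hm hn => simp only [map_add, hm, hn]; abel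
  | htmk a b hab f g => simp [tensorR_tmk h hab rfl]

lemma tensorR_smul {x y z : A.Obj} {i j l : ℤ} (h : i + j = l) (r : k) (c : (A.Hom x y).X j)
    (m : TensorX A s t y z i) :
    tensorR A s t h (r • c) m = r • tensorR A s t h c m := by
  induction m using tensor_induction with
  | h0 => simp
  | hadd m n hm hn => simp only [map_add, hm, hn, smul_add]
  | htmk a b hab f g => simp [tensorR_tmk h hab rfl]

lemma tensorD_tensorD {x y : A.Obj} {p q r : ℤ} (hp : p + 1 = q) (hq : q + 1 = r)
    (m : TensorX A s t x y p) : tensorD A s t x y hq (tensorD A s t x y hp m) = 0 := by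
  induction m using tensor_induction with
  | h0 => simp
  | hadd m n hm hn => simp only [map_add, hm, hn, add_zero]
  | htmk a b hab f g =>
    have h1 : (A.Hom s y).d (a + 1) (a + 1 + 1) ((A.Hom s y).d a (a + 1) f) = 0 := by
      rw [← ModuleCat.comp_apply, HomologicalComplex.d_comp_d]; rfl
    have h2 : (A.Hom x t).d (b + 1) (b + 1 + 1) ((A.Hom x t).d b (b + 1) g) = 0 := by
      rw [← ModuleCat.comp_apply, HomologicalComplex.d_comp_d]; rfl
    rw [tensorD_tmk hp hab rfl rfl, map_add, map_smul, tensorD_tmk hq _ rfl rfl,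
      tensorD_tmk hq _ rfl rfl, h1, h2]
    simp only [map_zero, LinearMap.zero_apply, zero_add, smul_zero, add_zero, sgn_add, sgn_one,
      mul_neg, mul_one]
    rw [← add_smul, neg_add_cancel, zero_smul]

lemma tensorL_one {x y : A.Obj} {i : ℤ} (m : TensorX A s t x y i) :
    tensorL A s t (zero_add i) (A.one y) m = m := by
  induction m using tensor_induction with
  | h0 => simp
  | hadd m n hm hn => simp only [map_add, hm, hn]
  | htmk a b hab f g => rw [tensorL_tmk _ hab (zero_add a), A.one_comp]

lemma tensorR_one {x y : A.Obj} {i : ℤ} (m : TensorX A s t x y i) :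
    tensorR A s t (add_zero i) (A.one x) m = m := by
  induction m using tensor_induction with
  | h0 => simp
  | hadd m n hm hn => simp only [map_add, hm, hn]
  | htmk a b hab f g => rw [tensorR_tmk _ hab (add_zero b), A.comp_one]

lemma tensorL_tensorL {w x y z : A.Obj} {i j l ij jl m : ℤ} (hij : i + j = ij) (hjl : j + l = jl)
    (h : ij + l = m) (h' : i + jl = m)
    (f : (A.Hom y z).X i) (g : (A.Hom x y).X j) (e : TensorX A s t w x l) :
    tensorL A s t h (A.comp hij f g) e = tensorL A s t h' f (tensorL A s t hjl g e) := by
  induction e using tensor_induction with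
  | h0 => simp
  | hadd m n hm hn => simp only [map_add, hm, hn]
  | htmk a b hab f' g' =>
    rw [tensorL_tmk h hab rfl, tensorL_tmk hjl hab rfl,
      tensorL_tmk h' _ (show i + (j + a) = ij + a by omega), A.assoc hij rfl rfl]

lemma tensorR_tensorR {w x y z : A.Obj} {i j l ij jl m : ℤ} (hij : i + j = ij) (hjl : j + l = jl)
    (h : ij + l = m) (h' : i + jl = m)
    (f : TensorX A s t y z i) (g : (A.Hom x y).X j) (e : (A.Hom w x).X l) :
    tensorR A s t h e (tensorR A s t hij g f) = tensorR A s t h' (A.comp hjl g e) f := by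
  induction f using tensor_induction with
  | h0 => simp
  | hadd m n hm hn => simp only [map_add, hm, hn]
  | htmk a b hab f' g' =>
    rw [tensorR_tmk hij hab rfl, tensorR_tmk h' hab rfl,
      tensorR_tmk h _ (show b + j + l = b + jl by omega), A.assoc rfl hjl _ rfl]

lemma tensorL_tensorR {w x y z : A.Obj} {i j l ij jl m : ℤ} (hij : i + j = ij) (hjl : j + l = jl)
    (h : ij + l = m) (h' : i + jl = m)
    (f : (A.Hom y z).X i) (g : TensorX A s t x y j) (e : (A.Hom w x).X l) :
    tensorR A s t h e (tensorL A s t hij f g) = tensorL A s t h' f (tensorR A s t hjl e g) := by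
  induction g using tensor_induction with
  | h0 => simp
  | hadd m n hm hn => simp only [map_add, hm, hn]
  | htmk a b hab f' g' =>
    rw [tensorL_tmk hij hab rfl, tensorR_tmk hjl hab rfl, tensorL_tmk h' _ rfl,
      tensorR_tmk h _ rfl]

lemma tensorD_tensorL {x y z : A.Obj} {i j l i' j' l' : ℤ} (h : i + j = l) (hi : i + 1 = i')
    (hj : j + 1 = j') (hl : l + 1 = l') (f : (A.Hom y z).X i) (g : TensorX A s t x y j) :
    tensorD A s t x z hl (tensorL A s t h f g) =
      tensorL A s t (show i' + j = l' by omega) ((A.Hom y z).d i i' f) g +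
        sgn k i • tensorL A s t (show i + j' = l' by omega) f (tensorD A s t x y hj g) := by
  induction g using tensor_induction with
  | h0 => simp
  | hadd m n hm hn => simp only [map_add, hm, hn, smul_add]; abel
  | htmk a b hab f' g' =>
    rw [tensorL_tmk h hab rfl, tensorL_tmk _ hab (show i' + a = i + a + 1 by omega),
      tensorD_tmk hj hab rfl rfl,
      tensorD_tmk hl _ rfl rfl, map_add, map_smul,
      tensorL_tmk _ _ (show i + (a + 1) = i + a + 1 by omega), tensorL_tmk _ _ rfl,
      A.d_comp rfl hi rfl rfl, map_add, map_smul, sgn_add]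
    simp only [LinearMap.add_apply, LinearMap.smul_apply, smul_add, smul_smul]
    abel

lemma tensorD_tensorR {x y z : A.Obj} {i j l i' j' l' : ℤ} (h : i + j = l) (hi : i + 1 = i')
    (hj : j + 1 = j') (hl : l + 1 = l') (f : TensorX A s t y z i) (g : (A.Hom x y).X j) :
    tensorD A s t x z hl (tensorR A s t h g f) =
      tensorR A s t (show i' + j = l' by omega) g (tensorD A s t y z hi f) +
        sgn k i • tensorR A s t (show i + j' = l' by omega) ((A.Hom x y).d j j' g) f := by
  induction f using tensor_induction with
  | h0 => simp
  | hadd m n hm hn => simp only [map_add, hm, hn, smul_add]; abel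
  | htmk a b hab f' g' =>
    rw [tensorR_tmk h hab rfl, tensorR_tmk _ hab (show b + j' = b + j + 1 by omega),
      tensorD_tmk hi hab rfl rfl,
      tensorD_tmk hl _ rfl rfl, map_add, map_smul,
      tensorR_tmk _ _ rfl, tensorR_tmk _ _ (show b + 1 + j = b + j + 1 by omega),
      A.d_comp rfl rfl hj rfl, map_add, map_smul,
      show sgn k i = sgn k a * sgn k b by rw [← hab, sgn_add]]
    simp only [smul_add, smul_smul]
    abel

variable (A s t)

/-- The representable dg bimodule `(x, y) ↦ A(s, y) ⊗ A(x, t)`, i.e. the dg functor on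
`Aᵒᵖ ⊗ A` represented by `(t, s)`, with `d (f ⊗ g) = df ⊗ g + (-1)^{|f|} f ⊗ dg` and
`a · (f ⊗ g) · b = (a f) ⊗ (g b)`. -/
noncomputable def representable : DGBimodule A where
  M x y :=
    { X := fun q => ModuleCat.of k (TensorX A s t x y q)
      d := fun q q' => ModuleCat.ofHom (if hq : q + 1 = q' then tensorD A s t x y hq else 0)
      shape := fun q q' h => congrArg ModuleCat.ofHom (dif_neg h)
      d_comp_d' := fun p q r hq hr => by
        have hq' : p + 1 = q := hq
        have hr' : q + 1 = r := hr
        rw [dif_pos hq', dif_pos hr']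
        exact ModuleCat.hom_ext (LinearMap.ext fun m => tensorD_tensorD hq' hr' m) }
  lact {x y z i j l} h := LinearMap.mk₂ k (fun c m => tensorL A s t h c m)
    (tensorL_add h) (tensorL_smul h) (fun _ _ _ => map_add _ _ _) (fun _ _ _ => map_smul _ _ _)
  ract {x y z i j l} h := LinearMap.mk₂ k (fun m c => tensorR A s t h c m)
    (fun _ _ _ => map_add _ _ _) (fun _ _ _ => map_smul _ _ _)
    (fun m c c' => tensorR_add h c c' m) (fun r m c => tensorR_smul h r c m)
  one_lact m := tensorL_one m
  ract_one m := tensorR_one m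
  lact_lact hij hjl h h' f g e := tensorL_tensorL hij hjl h h' f g e
  ract_ract hij hjl h h' f g e := tensorR_tensorR hij hjl h h' f g e
  lact_ract hij hjl h h' f g e := tensorL_tensorR hij hjl h h' f g e
  d_lact h hi hj hl f g := by
    simp only [ModuleCat.hom_ofHom, dif_pos hl, dif_pos hj]
    exact tensorD_tensorL h hi hj hl f g
  d_ract h hi hj hl f g := by
    simp only [ModuleCat.hom_ofHom, dif_pos hl, dif_pos hi]
    exact tensorD_tensorR h hi hj hl f g

end Representable

/-! ## Bar words -/

/-- A bar word `[a₁ | … | a_m]` from `x` to `y`: a string of homogeneous morphisms of a dg category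
such that the composition `a₁ a₂ ⋯ a_m : x → y` is defined. Each letter records its degree. -/
inductive BarWord (A : DGCategory k) : A.Obj → A.Obj → Type u
  | nil (x : A.Obj) : BarWord A x x
  | cons {x y z : A.Obj} (i : ℤ) (a : (A.Hom y z).X i) (w : BarWord A x y) : BarWord A x z

namespace BarWord
variable {A : DGCategory k} {N : Type*} [AddCommGroup N] [Module k N]

/-- The degree `∑ (|aᵢ| - 1)`. -/
def deg {x : A.Obj} : ∀ {y : A.Obj}, BarWord A x y → ℤ
  | _, nil _ => 0
  | _, cons i _ w => i - 1 + deg w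

/-- Concatenation. -/
def append {x y : A.Obj} : ∀ {z : A.Obj}, BarWord A y z → BarWord A x y → BarWord A x z
  | _, nil _, v => v
  | _, cons i a w, v => cons i a (append w v)

/-- `w` is obtained from `w₁` and `w₂`, which differ in one letter only, `a` and `b` say, by
replacing this letter by `a + c • b`. -/
inductive IsLinComb (c : k) : ∀ {x y : A.Obj}, BarWord A x y → BarWord A x y → BarWord A x y → Prop
  | head {x y z : A.Obj} (i : ℤ) (a b : (A.Hom y z).X i) (w : BarWord A x y) :
      IsLinComb c (cons i (a + c • b) w) (cons i a w) (cons i b w)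
  | tail {x y z : A.Obj} (i : ℤ) (a : (A.Hom y z).X i) {w w₁ w₂ : BarWord A x y} :
      IsLinComb c w w₁ w₂ → IsLinComb c (cons i a w) (cons i a w₁) (cons i a w₂)

/-- One of the letters of `w` is an identity morphism. -/
inductive IsDegenerate : ∀ {x y : A.Obj}, BarWord A x y → Prop
  | head {x y : A.Obj} (w : BarWord A x y) : IsDegenerate (cons 0 (A.one y) w)
  | tail {x y z : A.Obj} (i : ℤ) (a : (A.Hom y z).X i) {w : BarWord A x y} :
      IsDegenerate w → IsDegenerate (cons i a w)

/-- Evaluate `F` on the first letter and the remaining word; `0` on the empty word. -/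
def first {x : A.Obj} : ∀ {y : A.Obj}, BarWord A x y →
    (∀ (z : A.Obj) (j : ℤ) (_ : (A.Hom z y).X j), BarWord A x z → N) → N
  | _, nil _, _ => 0
  | _, cons j b v, F => F _ j b v

/-- Evaluate `F` on the last letter and the remaining word; `0` on the empty word. -/
def last {x : A.Obj} : ∀ {y : A.Obj}, BarWord A x y →
    (∀ (z : A.Obj), BarWord A z y → ∀ (j : ℤ) (_ : (A.Hom x z).X j), N) → N
  | _, nil _, _ => 0
  | _, cons i a (nil _), F => F _ (nil _) i a
  | _, cons i a (cons j b w), F =>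
      last (cons j b w) (fun z v l c => F z (cons i a v) l c)

/-- The sum of the values of `F` over the terms of the inner part of the bar differential,
`∂ [a₁ | … | a_m] = - ∑ ± [a₁ | … | d aᵢ | … | a_m] - ∑ ± (-1)^{|aᵢ|} [a₁ | … | aᵢ aᵢ₊₁ | … | a_m]`
where `±` is the sign `(-1)^{(|a₁| - 1) + … + (|aᵢ₋₁| - 1)}`. -/
def bdry {x : A.Obj} : ∀ {y : A.Obj}, BarWord A x y → (BarWord A x y → N) → N
  | _, nil _, _ => 0
  | _, cons i a w, F =>
      -F (cons (i + 1) ((A.Hom _ _).d i (i + 1) a) w) - sgn k i • bdry w (fun v => F (cons i a v)) -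
        sgn k i • first w (fun _ j b v => F (cons (i + j) (A.comp rfl a b) v))

/-- A function on bar words that is linear in each letter and vanishes on words containing an
identity. These are the linear maps out of the normalized bar construction. -/
structure IsNormalized {x y : A.Obj} (F : BarWord A x y → N) : Prop where
  lin : ∀ {c : k} {w w₁ w₂}, IsLinComb c w w₁ w₂ → F w = F w₁ + c • F w₂
  degenerate : ∀ {w}, IsDegenerate w → F w = 0

section lemmas

@[simp] lemma bdry_nil (x : A.Obj) (F : BarWord A x x → N) : bdry (nil x) F = 0 := by
  simp [bdry]

lemma bdry_cons {x y z : A.Obj} (i : ℤ) (a : (A.Hom y z).X i) (w : BarWord A x y)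
    (F : BarWord A x z → N) : bdry (cons i a w) F =
      -F (cons (i + 1) ((A.Hom _ _).d i (i + 1) a) w) - sgn k i • bdry w (fun v => F (cons i a v)) -
        sgn k i • first w (fun _ j b v => F (cons (i + j) (A.comp rfl a b) v)) := by
  rw [bdry]

@[simp] lemma first_nil (x : A.Obj)
    (F : ∀ (z : A.Obj) (j : ℤ) (_ : (A.Hom z x).X j), BarWord A x z → N) :
    first (nil x) F = 0 := by simp [first]

@[simp] lemma first_cons {x y z : A.Obj} (i : ℤ) (a : (A.Hom y z).X i) (w : BarWord A x y)
    (F : ∀ (z' : A.Obj) (j : ℤ) (_ : (A.Hom z' z).X j), BarWord A x z' → N) :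
    first (cons i a w) F = F y i a w := by simp [first]

@[simp] lemma last_nil (x : A.Obj)
    (F : ∀ (z : A.Obj), BarWord A z x → ∀ (j : ℤ) (_ : (A.Hom x z).X j), N) :
    last (nil x) F = 0 := by simp [last]

@[simp] lemma last_single {x y : A.Obj} (i : ℤ) (a : (A.Hom x y).X i)
    (F : ∀ (z : A.Obj), BarWord A z y → ∀ (j : ℤ) (_ : (A.Hom x z).X j), N) :
    last (cons i a (nil x)) F = F y (nil y) i a := by simp [last]

lemma last_cons_cons {x y z t : A.Obj} (i : ℤ) (a : (A.Hom z t).X i) (j : ℤ)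
    (b : (A.Hom y z).X j) (w : BarWord A x y)
    (F : ∀ (z : A.Obj), BarWord A z t → ∀ (j : ℤ) (_ : (A.Hom x z).X j), N) :
    last (cons i a (cons j b w)) F =
      last (cons j b w) (fun z v l c => F z (cons i a v) l c) := by rw [last]

lemma first_congr {x y : A.Obj} (w : BarWord A x y)
    {F G : ∀ (z' : A.Obj) (j : ℤ) (_ : (A.Hom z' y).X j), BarWord A x z' → N}
    (h : ∀ z j a v, w = cons j a v → F z j a v = G z j a v) : first w F = first w G := by
  cases w with
  | nil => simp
  | cons i a w => simp [h _ i a w rfl]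

lemma first_lin {N' : Type*} [AddCommGroup N'] [Module k N'] (L : N →ₗ[k] N')
    {x y : A.Obj} (w : BarWord A x y)
    (F : ∀ (z' : A.Obj) (j : ℤ) (_ : (A.Hom z' y).X j), BarWord A x z' → N) :
    L (first w F) = first w (fun z j a v => L (F z j a v)) := by
  cases w <;> simp

lemma last_lin {N' : Type*} [AddCommGroup N'] [Module k N'] (L : N →ₗ[k] N')
    {x y : A.Obj} (w : BarWord A x y)
    (F : ∀ (z : A.Obj), BarWord A z y → ∀ (j : ℤ) (_ : (A.Hom x z).X j), N) :
    L (last w F) = last w (fun z v j a => L (F z v j a)) := by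
  induction w with
  | nil => simp
  | cons i a w ih =>
    cases w with
    | nil => simp
    | cons j b w => rw [last_cons_cons, last_cons_cons, ih]

lemma bdry_lin {N' : Type*} [AddCommGroup N'] [Module k N'] (L : N →ₗ[k] N')
    {x y : A.Obj} (w : BarWord A x y) (F : BarWord A x y → N) :
    L (bdry w F) = bdry w (fun v => L (F v)) := by
  induction w with
  | nil => simp
  | cons i a w ih => simp only [bdry_cons, map_sub, map_neg, map_smul, ih, first_lin]

lemma first_add {x y : A.Obj} (w : BarWord A x y)
    (F G : ∀ (z' : A.Obj) (j : ℤ) (_ : (A.Hom z' y).X j), BarWord A x z' → N) :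
    first w (fun z j a v => F z j a v + G z j a v) = first w F + first w G := by
  cases w <;> simp

lemma last_add {x y : A.Obj} (w : BarWord A x y)
    (F G : ∀ (z : A.Obj), BarWord A z y → ∀ (j : ℤ) (_ : (A.Hom x z).X j), N) :
    last w (fun z v j a => F z v j a + G z v j a) = last w F + last w G := by
  induction w with
  | nil => simp
  | cons i a w ih =>
    cases w with
    | nil => simp
    | cons j b w => simp only [last_cons_cons, ih]

lemma bdry_add {x y : A.Obj} (w : BarWord A x y) (F G : BarWord A x y → N) :
    bdry w (fun v => F v + G v) = bdry w F + bdry w G := by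
  induction w with
  | nil => simp
  | cons i a w ih => simp only [bdry_cons, ih, first_add, smul_add]; abel

lemma first_smul {x y : A.Obj} (c : k) (w : BarWord A x y)
    (F : ∀ (z' : A.Obj) (j : ℤ) (_ : (A.Hom z' y).X j), BarWord A x z' → N) :
    first w (fun z j a v => c • F z j a v) = c • first w F :=
  (first_lin (c • LinearMap.id) w F).symm

lemma last_smul {x y : A.Obj} (c : k) (w : BarWord A x y)
    (F : ∀ (z : A.Obj), BarWord A z y → ∀ (j : ℤ) (_ : (A.Hom x z).X j), N) :
    last w (fun z v j a => c • F z v j a) = c • last w F :=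
  (last_lin (c • LinearMap.id) w F).symm

lemma bdry_smul {x y : A.Obj} (c : k) (w : BarWord A x y) (F : BarWord A x y → N) :
    bdry w (fun v => c • F v) = c • bdry w F :=
  (bdry_lin (c • LinearMap.id) w F).symm

lemma last_neg {x y : A.Obj} (w : BarWord A x y)
    (F : ∀ (z : A.Obj), BarWord A z y → ∀ (j : ℤ) (_ : (A.Hom x z).X j), N) :
    last w (fun z v j a => -F z v j a) = -last w F :=
  (last_lin (-LinearMap.id : N →ₗ[k] N) w F).symm

lemma last_zero {x y : A.Obj} (w : BarWord A x y) :
    last w (fun _ _ _ _ => (0 : N)) = 0 := by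
  simpa using last_smul (0 : k) w (fun _ _ _ _ => (0 : N))

lemma bdry_zero {x y : A.Obj} (w : BarWord A x y) :
    bdry w (fun _ => (0 : N)) = 0 := by
  simpa using bdry_smul (0 : k) w (fun _ => (0 : N))

/-- `bdry (cons b w)` only depends on the values on non-empty words. -/
lemma bdry_cons_congr {x y z : A.Obj} (i : ℤ) (a : (A.Hom y z).X i) (w : BarWord A x y)
    {F G : BarWord A x z → N} (h : ∀ (y' : A.Obj) j (b : (A.Hom y' z).X j) (v : BarWord A x y'),
      F (cons j b v) = G (cons j b v)) : bdry (cons i a w) F = bdry (cons i a w) G := by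
  simp only [bdry_cons, h]

/-- The terms of the inner bar differential raise the degree by one. -/
lemma bdry_eq_zero {x y : A.Obj} (w : BarWord A x y) (F : BarWord A x y → N)
    (h : ∀ v, deg v = deg w + 1 → F v = 0) : bdry w F = 0 := by
  induction w with
  | nil => simp
  | cons i a w ih =>
    rw [bdry_cons, h _ (by simp only [deg]; ring), ih _ (fun v hv => h _ (by simp only [deg, hv]; ring))]
    cases w with
    | nil => simp
    | cons j b w => simp [h (cons (i + j) _ w) (by simp only [deg]; ring)]

lemma last_eq_zero {x y : A.Obj} (w : BarWord A x y)
    (F : ∀ (z : A.Obj), BarWord A z y → ∀ (j : ℤ) (_ : (A.Hom x z).X j), N)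
    (h : ∀ z v j a, deg v + (j - 1) = deg w → F z v j a = 0) : last w F = 0 := by
  induction w with
  | nil => simp
  | cons i a w ih =>
    cases w with
    | nil => rw [last_single]; exact h _ _ _ _ (by simp only [deg]; ring)
    | cons j b w =>
      rw [last_cons_cons]
      exact ih _ fun z v l c hv => h _ _ _ _ (by rw [deg, deg, ← hv]; ring)

lemma last_congr {x y : A.Obj} (w : BarWord A x y)
    {F G : ∀ (z : A.Obj), BarWord A z y → ∀ (j : ℤ) (_ : (A.Hom x z).X j), N}
    (h : ∀ z v j a, F z v j a = G z v j a) : last w F = last w G := by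
  congr 1
  funext z v j a
  exact h z v j a

lemma bdry_last {x y : A.Obj} (w : BarWord A x y)
    (G : ∀ (z : A.Obj), BarWord A z y → ∀ (j : ℤ) (_ : (A.Hom x z).X j), N) :
    bdry w (fun v => last v G) =
      last w (fun z v j a => bdry v (fun v' => G z v' j a) +
        (-sgn k (deg v)) • G z v (j + 1) ((A.Hom _ _).d j (j + 1) a) +
        (-1 : k) • last v (fun z' v' l b =>
          sgn k (deg v' + l) • G z' v' (l + j) (A.comp rfl b a))) := by
  induction w with
  | nil => simp
  | cons i a w ih =>
    cases w with
    | nil => simp [bdry_cons, deg, sgn_zero]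
    | cons j b w =>
      rw [bdry_cons, bdry_cons_congr j b w
        (G := fun v => last v (fun z v l c => G z (cons i a v) l c))
        (fun y' l c v => last_cons_cons _ _ _ _ _ _), ih, last_cons_cons, first_cons,
        last_cons_cons]
      cases w with
      | nil =>
        simp only [last_single, bdry_cons, first_nil, deg, sgn_add, sgn_sub, sgn_one, sgn_zero,
          bdry_nil, last_nil]
        module
      | cons l c w =>
        simp only [last_cons_cons, last_add, last_smul, bdry_cons _ a, first_cons,
          sub_eq_add_neg, ← neg_smul, ← neg_one_smul k (G _ _ _ _), deg, sgn_add, sgn_one, sgn_neg]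
        simp only [mul_smul, neg_smul, last_smul, last_neg, mul_neg, neg_mul, mul_one, neg_neg]
        module

lemma bdry_congr_deg {x y : A.Obj} (w : BarWord A x y) {F G : BarWord A x y → N}
    (h : ∀ v, deg v = deg w + 1 → F v = G v) : bdry w F = bdry w G := by
  have h0 : bdry w (fun v => F v + (-1 : k) • G v) = 0 :=
    bdry_eq_zero w _ fun v hv => by simp [h v hv]
  rw [bdry_add, bdry_smul] at h0
  have := neg_eq_of_add_eq_zero_left h0
  simpa using this.symm

lemma last_congr_deg {x y : A.Obj} (w : BarWord A x y)
    {F G : ∀ (z : A.Obj), BarWord A z y → ∀ (j : ℤ) (_ : (A.Hom x z).X j), N}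
    (h : ∀ z v j a, deg v + (j - 1) = deg w → F z v j a = G z v j a) : last w F = last w G := by
  have h0 : last w (fun z v j a => F z v j a + (-1 : k) • G z v j a) = 0 :=
    last_eq_zero w _ fun z v j a hv => by simp [h z v j a hv]
  rw [last_add, last_smul] at h0
  have := neg_eq_of_add_eq_zero_left h0
  simpa using this.symm

lemma IsNormalized.cons {x y z : A.Obj} {F : BarWord A x z → N} (hF : IsNormalized F)
    (i : ℤ) (a : (A.Hom y z).X i) : IsNormalized (fun w => F (BarWord.cons i a w)) where
  lin h := hF.lin (.tail i a h)
  degenerate h := hF.degenerate (.tail i a h)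

lemma IsNormalized.add' {x y z : A.Obj} {F : BarWord A x z → N} (hF : IsNormalized F)
    (i : ℤ) (a b : (A.Hom y z).X i) (w : BarWord A x y) :
    F (.cons i (a + b) w) = F (.cons i a w) + F (.cons i b w) := by
  simpa using hF.lin (.head (c := 1) i a b w)

lemma IsNormalized.zero' {x y z : A.Obj} {F : BarWord A x z → N} (hF : IsNormalized F)
    (i : ℤ) (w : BarWord A x y) :
    F (.cons i (0 : (A.Hom y z).X i) w) = 0 := by
  simpa using hF.add' i (0 : (A.Hom y z).X i) 0 w

lemma IsNormalized.smul' {x y z : A.Obj} {F : BarWord A x z → N} (hF : IsNormalized F)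
    (i : ℤ) (c : k) (a : (A.Hom y z).X i) (w : BarWord A x y) :
    F (.cons i (c • a) w) = c • F (.cons i a w) := by
  simpa [hF.zero'] using hF.lin (.head (c := c) i 0 a w)

lemma cons_comp {w x y z : A.Obj} {i j l : ℤ} (h : i + j = l) (a : (A.Hom y z).X i)
    (b : (A.Hom x y).X j) (v : BarWord A w x) :
    cons l (A.comp h a b) v = cons (i + j) (A.comp rfl a b) v := by
  subst h; rfl

lemma cons_comp_one {x y z : A.Obj} (i : ℤ) (a : (A.Hom y z).X i) (v : BarWord A x y) :
    cons (i + 0) (A.comp rfl a (A.one y)) v = cons i a v := by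
  rw [← cons_comp (add_zero i), A.comp_one]

lemma cons_one_comp {x y z : A.Obj} (i : ℤ) (a : (A.Hom y z).X i) (v : BarWord A x y) :
    cons (0 + i) (A.comp rfl (A.one z) a) v = cons i a v := by
  rw [← cons_comp (zero_add i), A.one_comp]

lemma cons_assoc {w x y z t : A.Obj} {i j l : ℤ} (a : (A.Hom z t).X i)
    (b : (A.Hom y z).X j) (c : (A.Hom x y).X l) (v : BarWord A w x) :
    cons (i + j + l) (A.comp rfl (A.comp rfl a b) c) v =
      cons (i + (j + l)) (A.comp rfl a (A.comp rfl b c)) v := by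
  rw [A.assoc rfl rfl rfl (add_assoc i j l).symm, cons_comp]

lemma bdry_bdry {x y : A.Obj} (w : BarWord A x y) {F : BarWord A x y → N} (hF : IsNormalized F) :
    bdry w (fun v => bdry v F) = 0 := by
  induction w with
  | nil => simp
  | cons i a w ih =>
    have hd : (A.Hom _ _).d (i + 1) (i + 1 + 1) ((A.Hom _ _).d i (i + 1) a) = 0 := by
      rw [← ModuleCat.comp_apply, HomologicalComplex.d_comp_d]; rfl
    simp only [bdry_cons _ a, bdry_cons _ ((A.Hom _ _).d i (i + 1) a), hd, hF.zero',
      sub_eq_add_neg, ← neg_smul, ← neg_one_smul k (F _), bdry_add, bdry_smul, ih (hF.cons i a)]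
    cases w with
    | nil => simp
    | cons j b v =>
      have h1 : F (cons (i + j + 1) ((A.Hom _ _).d (i + j) (i + j + 1) (A.comp rfl a b)) v) =
          F (cons (i + 1 + j) (A.comp rfl ((A.Hom _ _).d i (i + 1) a) b) v) +
          sgn k i • F (cons (i + (j + 1)) (A.comp rfl a ((A.Hom _ _).d j (j + 1) b)) v) := by
        rw [A.d_comp rfl rfl rfl rfl, hF.add', hF.smul',
          cons_comp (show i + 1 + j = i + j + 1 by omega),
          cons_comp (show i + (j + 1) = i + j + 1 by omega)]
      simp only [first_cons, bdry_cons, h1, cons_assoc, sgn_add, sgn_one]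
      match_scalars <;> ring

end lemmas

end BarWord

/-! ## Hochschild cochains with coefficients in a bimodule -/

section Hochschild
variable {A : DGCategory k} (M : DGBimodule A)
open BarWord

/-- Families of elements in all degrees of a complex. -/
abbrev Tot (K : CochainComplex (ModuleCat.{u} k) ℤ) : Type u := ∀ q : ℤ, K.X q

/-- The differential of a complex. -/
def totD (K : CochainComplex (ModuleCat.{u} k) ℤ) : Tot K →ₗ[k] Tot K :=
  LinearMap.pi fun q => (K.d (q - 1) q).hom ∘ₗ LinearMap.proj (q - 1)

/-- Left multiplication by a homogeneous morphism. -/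
def totL {x y z : A.Obj} {i : ℤ} (a : (A.Hom y z).X i) : Tot (M.M x y) →ₗ[k] Tot (M.M x z) :=
  LinearMap.pi fun q => M.lact (show i + (q - i) = q by omega) a ∘ₗ LinearMap.proj (q - i)

/-- Right multiplication by a homogeneous morphism. -/
def totR {x y z : A.Obj} {j : ℤ} (a : (A.Hom x y).X j) : Tot (M.M y z) →ₗ[k] Tot (M.M x z) :=
  LinearMap.pi fun q => (M.ract (show q - j + j = q by omega)).flip a ∘ₗ LinearMap.proj (q - j)

variable {M}

lemma totD_apply {K : CochainComplex (ModuleCat.{u} k) ℤ} (m : Tot K) {p q : ℤ} (h : p + 1 = q) :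
    totD K m q = K.d p q (m p) := by
  obtain rfl : p = q - 1 := by omega
  rfl

lemma totL_apply {x y z : A.Obj} {i : ℤ} (a : (A.Hom y z).X i) (m : Tot (M.M x y)) {p q : ℤ}
    (h : i + p = q) : totL M a m q = M.lact h a (m p) := by
  obtain rfl : p = q - i := by omega
  rfl

lemma totR_apply {x y z : A.Obj} {j : ℤ} (a : (A.Hom x y).X j) (m : Tot (M.M y z)) {p q : ℤ}
    (h : p + j = q) : totR M a m q = M.ract h (m p) a := by
  obtain rfl : p = q - j := by omega
  rfl

lemma totD_totD {K : CochainComplex (ModuleCat.{u} k) ℤ} (m : Tot K) : totD K (totD K m) = 0 := by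
  funext q
  rw [totD_apply _ (show q - 1 + 1 = q by omega),
    totD_apply _ (show q - 1 - 1 + 1 = q - 1 by omega), ← ModuleCat.comp_apply,
    HomologicalComplex.d_comp_d]
  rfl

lemma totL_totL {x y z t : A.Obj} {i j : ℤ} (a : (A.Hom z t).X i) (b : (A.Hom y z).X j)
    (m : Tot (M.M x y)) : totL M (A.comp (rfl : i + j = i + j) a b) m = totL M a (totL M b m) := by
  funext q
  rw [totL_apply _ _ (show i + j + (q - i - j) = q by omega),
    totL_apply _ _ (show i + (q - i) = q by omega),
    totL_apply _ _ (show j + (q - i - j) = q - i by omega), M.lact_lact]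

lemma totR_totR {x y z t : A.Obj} {i j : ℤ} (a : (A.Hom y z).X i) (b : (A.Hom x y).X j)
    (m : Tot (M.M z t)) : totR M (A.comp (rfl : i + j = i + j) a b) m = totR M b (totR M a m) := by
  funext q
  rw [totR_apply _ _ (show (q - i - j) + (i + j) = q by omega),
    totR_apply _ _ (show (q - j) + j = q by omega),
    totR_apply _ _ (show (q - i - j) + i = q - j by omega),
    M.ract_ract (show (q - i - j) + i = q - j by omega) rfl]

lemma totR_totL {x y z t : A.Obj} {i j : ℤ} (a : (A.Hom z t).X i) (b : (A.Hom x y).X j)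
    (m : Tot (M.M y z)) : totR M b (totL M a m) = totL M a (totR M b m) := by
  funext q
  rw [totR_apply _ _ (show (q - j) + j = q by omega),
    totL_apply _ _ (show i + (q - j - i) = q - j by omega),
    totL_apply _ _ (show i + (q - i) = q by omega),
    totR_apply _ _ (show (q - j - i) + j = q - i by omega),
    M.lact_ract _ (show (q - j - i) + j = q - i by omega)]

lemma totL_add {x y z : A.Obj} {i : ℤ} (a b : (A.Hom y z).X i) (m : Tot (M.M x y)) :
    totL M (a + b) m = totL M a m + totL M b m := by
  funext q; simp [totL]

lemma totL_smul {x y z : A.Obj} {i : ℤ} (c : k) (a : (A.Hom y z).X i) (m : Tot (M.M x y)) :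
    totL M (c • a) m = c • totL M a m := by
  funext q; simp [totL]

lemma totR_add {x y z : A.Obj} {i : ℤ} (a b : (A.Hom x y).X i) (m : Tot (M.M y z)) :
    totR M (a + b) m = totR M a m + totR M b m := by
  funext q; simp [totR]

lemma totR_smul {x y z : A.Obj} {i : ℤ} (c : k) (a : (A.Hom x y).X i) (m : Tot (M.M y z)) :
    totR M (c • a) m = c • totR M a m := by
  funext q; simp [totR]

lemma totL_one {x y : A.Obj} (m : Tot (M.M x y)) : totL M (A.one y) m = m := by
  funext q
  rw [totL_apply _ _ (zero_add q), M.one_lact]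

lemma totR_one {x y : A.Obj} (m : Tot (M.M x y)) : totR M (A.one x) m = m := by
  funext q
  rw [totR_apply _ _ (add_zero q), M.ract_one]

lemma totD_totL {x y z : A.Obj} {i : ℤ} (a : (A.Hom y z).X i) (m : Tot (M.M x y)) :
    totD _ (totL M a m) =
      totL M ((A.Hom y z).d i (i + 1) a) m + sgn k i • totL M a (totD _ m) := by
  funext q
  rw [totD_apply _ (show q - 1 + 1 = q by omega),
    totL_apply _ _ (show i + (q - 1 - i) = q - 1 by omega),
    M.d_lact _ rfl (show q - 1 - i + 1 = q - i by omega) (show q - 1 + 1 = q by omega)]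
  simp only [Pi.add_apply, Pi.smul_apply]
  rw [totL_apply _ _ (show i + 1 + (q - 1 - i) = q by omega),
    totL_apply _ _ (show i + (q - i) = q by omega),
    totD_apply _ (show q - 1 - i + 1 = q - i by omega)]

/-- `m` is concentrated in degree `s`. -/
def IsHomog {K : CochainComplex (ModuleCat.{u} k) ℤ} (s : ℤ) (m : Tot K) : Prop :=
  ∀ q, q ≠ s → m q = 0

lemma totD_totR {x y z : A.Obj} {j : ℤ} (a : (A.Hom x y).X j) {s : ℤ} (m : Tot (M.M y z))
    (hm : IsHomog s m) :
    totD _ (totR M a m) =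
      totR M a (totD _ m) + sgn k s • totR M ((A.Hom x y).d j (j + 1) a) m := by
  funext q
  rw [totD_apply _ (show q - 1 + 1 = q by omega),
    totR_apply _ _ (show (q - 1 - j) + j = q - 1 by omega),
    M.d_ract _ (show q - 1 - j + 1 = q - j by omega) rfl (show q - 1 + 1 = q by omega)]
  simp only [Pi.add_apply, Pi.smul_apply]
  rw [totR_apply _ _ (show q - j + j = q by omega),
    totR_apply _ _ (show (q - 1 - j) + (j + 1) = q by omega),
    totD_apply _ (show q - 1 - j + 1 = q - j by omega)]
  by_cases h : q - 1 - j = s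
  · rw [show sgn k (q - 1 - j) = sgn k s by rw [h]]
  · rw [hm _ h]; simp


variable (M) in
/-- The Hochschild differential of a cochain `φ` of degree `r`:
`(δφ)[a₁ | … | a_m] = d (φ[a₁ | … | a_m]) - (-1)^r (φ(∂[a₁ | … | a_m])
  + (-1)^{r |a₁|} a₁ φ[a₂ | … | a_m] - (-1)^{(|a₁| - 1) + … + (|a_{m-1}| - 1)} φ[a₁ | … | a_{m-1}] a_m)`. -/
def hochD (r : ℤ) {x y : A.Obj} (φ : ∀ x y : A.Obj, BarWord A x y → Tot (M.M x y))
    (w : BarWord A x y) : Tot (M.M x y) :=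
  totD _ (φ x y w) - sgn k r • (bdry w (φ x y) +
    first w (fun z i a v => sgn k (r * i) • totL M a (φ x z v)) -
    last w (fun z v _ a => sgn k (deg v) • totR M a (φ z y v)))

/-- A normalized Hochschild cochain of degree `r`. -/
structure IsHochschildCochain (M : DGBimodule A) (r : ℤ)
    (φ : ∀ x y : A.Obj, BarWord A x y → Tot (M.M x y)) : Prop where
  normalized : ∀ x y, IsNormalized (φ x y)
  homog : ∀ x y (w : BarWord A x y), IsHomog (deg w + r) (φ x y w)

end Hochschild

section Hochschild2
variable {A : DGCategory k} {N : Type*} [AddCommGroup N] [Module k N]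
open BarWord

namespace BarWord

lemma IsLinComb.deg_eq {c : k} {x y : A.Obj} {w w₁ w₂ : BarWord A x y} (h : IsLinComb c w w₁ w₂) :
    deg w₁ = deg w ∧ deg w₂ = deg w := by
  induction h with
  | head => simp [deg]
  | tail i a h ih => simp [deg, ih]

lemma IsLinComb.first_lin {c : k} {x y : A.Obj} {w w₁ w₂ : BarWord A x y}
    (h : IsLinComb c w w₁ w₂)
    (F : ∀ (z' : A.Obj) (j : ℤ) (_ : (A.Hom z' y).X j), BarWord A x z' → N)
    (h1 : ∀ z i (a b : (A.Hom z y).X i) v, F z i (a + c • b) v = F z i a v + c • F z i b v)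
    (h2 : ∀ z i (a : (A.Hom z y).X i) {v v₁ v₂}, IsLinComb c v v₁ v₂ →
      F z i a v = F z i a v₁ + c • F z i a v₂) :
    first w F = first w₁ F + c • first w₂ F := by
  cases h with
  | head i a b w => simpa using h1 _ _ _ _ _
  | tail i a h => simpa using h2 _ _ _ h

lemma IsLinComb.last_lin {c : k} {x y : A.Obj} {w w₁ w₂ : BarWord A x y}
    (h : IsLinComb c w w₁ w₂)
    (F : ∀ (z : A.Obj), BarWord A z y → ∀ (j : ℤ) (_ : (A.Hom x z).X j), N)
    (h1 : ∀ z v i (a b : (A.Hom x z).X i), F z v i (a + c • b) = F z v i a + c • F z v i b)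
    (h2 : ∀ z {v v₁ v₂} i (a : (A.Hom x z).X i), IsLinComb c v v₁ v₂ →
      F z v i a = F z v₁ i a + c • F z v₂ i a) :
    last w F = last w₁ F + c • last w₂ F := by
  induction h with
  | head i a b w =>
    cases w with
    | nil => simpa using h1 _ _ _ _ _
    | cons j b w =>
      simp only [last_cons_cons, ← last_smul, ← last_add]
      exact last_congr _ fun z v l e => h2 _ _ _ (.head _ _ _ _)
  | tail i a h ih =>
    have := ih (fun z v l e => F z (cons i a v) l e) (fun z v i a b => h1 _ _ _ _ _)
      (fun z v v₁ v₂ i a h => h2 _ _ _ (.tail _ _ h))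
    cases h <;> simpa only [last_cons_cons] using this

lemma IsLinComb.bdry_lin {c : k} {x y : A.Obj} {w w₁ w₂ : BarWord A x y}
    (h : IsLinComb c w w₁ w₂) {F : BarWord A x y → N} (hF : IsNormalized F) :
    bdry w F = bdry w₁ F + c • bdry w₂ F := by
  induction h with
  | head i a b w =>
    have h1 : bdry w (fun v => F (cons i (a + c • b) v)) =
        bdry w (fun v => F (cons i a v)) + c • bdry w (fun v => F (cons i b v)) := by
      simp only [hF.add', hF.smul', bdry_add, bdry_smul]
    have h2 : first w (fun _ j e v => F (cons (i + j) (A.comp rfl (a + c • b) e) v)) =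
        first w (fun _ j e v => F (cons (i + j) (A.comp rfl a e) v)) +
        c • first w (fun _ j e v => F (cons (i + j) (A.comp rfl b e) v)) := by
      simp only [map_add, map_smul, LinearMap.add_apply, LinearMap.smul_apply, hF.add', hF.smul',
        first_add, first_smul]
    rw [bdry_cons, bdry_cons, bdry_cons, h1, h2]
    simp only [map_add, map_smul, hF.add', hF.smul']
    module
  | tail i a h ih =>
    have h2 := h.first_lin (fun _ j e v => F (cons (i + j) (A.comp rfl a e) v))
      (fun z j b b' v => by simp only [map_add, map_smul, hF.add', hF.smul'])
      (fun z j b v v₁ v₂ h => hF.lin (.tail _ _ h))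
    rw [bdry_cons, bdry_cons, bdry_cons, ih (hF.cons i a), h2, hF.lin (.tail _ _ h)]
    module

lemma IsDegenerate.bdry_eq {x y : A.Obj} {w : BarWord A x y} (h : IsDegenerate w)
    {F : BarWord A x y → N} (hF : IsNormalized F)
    (Fr : ∀ (z' : A.Obj) (j : ℤ) (_ : (A.Hom z' y).X j), BarWord A x z' → N)
    (La : ∀ (z : A.Obj), BarWord A z y → ∀ (j : ℤ) (_ : (A.Hom x z).X j), N)
    (h1 : ∀ v, Fr y 0 (A.one y) v = F v)
    (h2 : ∀ z i (a : (A.Hom z y).X i) {v}, IsDegenerate v → Fr z i a v = 0)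
    (h3 : ∀ v, La x v 0 (A.one x) = sgn k (deg v) • F v)
    (h4 : ∀ z {v} i (a : (A.Hom x z).X i), IsDegenerate v → La z v i a = 0) :
    bdry w F + first w Fr - last w La = 0 := by
  induction h with
  | head w =>
    have h0 : (fun v => F (cons 0 (A.one _) v)) = fun _ => 0 :=
      funext fun v => hF.degenerate (.head v)
    have hd : F (cons (0 + 1) ((A.Hom _ _).d 0 (0 + 1) (A.one _)) w) = 0 := by
      rw [show (A.Hom _ _).d 0 (0 + 1) (A.one _) = 0 from A.d_one _, hF.zero']
    rw [bdry_cons, h0, bdry_zero, hd, first_cons, h1]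
    cases w with
    | nil => simp [h3, deg, sgn_zero]
    | cons j b w =>
      rw [last_cons_cons, first_cons, cons_one_comp, sgn_zero,
        last_congr _ (fun z v l e => h4 z l e (.head v)), last_zero]
      simp
  | tail i a h ih =>
    have := ih (hF.cons i a) (fun _ j e v => F (cons (i + j) (A.comp rfl a e) v))
      (fun z v l e => (-sgn k i) • La z (cons i a v) l e)
      (fun v => by rw [cons_comp_one])
      (fun z j b v hv => hF.degenerate (.tail _ _ hv))
      (fun v => by
        rw [h3, smul_smul, deg, sgn_add, sgn_sub, sgn_one]
        congr 1
        linear_combination sgn k (deg v) * sgn_mul_self k i)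
      (fun z v l e hv => by rw [h4 _ _ _ (.tail _ _ hv), smul_zero])
    rw [last_smul] at this
    have h5 : ∀ {x y z : A.Obj} {w : BarWord A x y} (_ : IsDegenerate w) (i : ℤ)
        (a : (A.Hom y z).X i) (L : ∀ (z' : A.Obj), BarWord A z' z → ∀ (j : ℤ)
        (_ : (A.Hom x z').X j), N), last (cons i a w) L =
        last w (fun z v l e => L z (cons i a v) l e) := by
      intro x y z w h i a L
      cases h <;> rw [last_cons_cons]
    rw [bdry_cons, hF.degenerate (.tail _ _ h), first_cons, h2 _ _ _ h, h5 h]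
    refine Eq.trans ?_ (congrArg ((-sgn k i) • ·) this |>.trans (smul_zero _))
    match_scalars
    · ring
    · ring
    · linear_combination sgn_mul_self k i

end BarWord

variable {M : DGBimodule A}

/-- The term `± a₁ φ[a₂ | … | a_m]` of the Hochschild differential. -/
def hochF (M : DGBimodule A) (r : ℤ) (φ : ∀ x y : A.Obj, BarWord A x y → Tot (M.M x y)) (x y : A.Obj) (w : BarWord A x y) :
    Tot (M.M x y) := first w (fun z i a v => sgn k (r * i) • totL M a (φ x z v))
/-- The term `± φ[a₁ | … | a_{m-1}] a_m` of the Hochschild differential. -/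
def hochL (M : DGBimodule A) (φ : ∀ x y : A.Obj, BarWord A x y → Tot (M.M x y)) (x y : A.Obj) (w : BarWord A x y) :
    Tot (M.M x y) := last w (fun z v _ a => sgn k (deg v) • totR M a (φ z y v))

lemma hochF_bdry (r : ℤ) (φ : ∀ x y : A.Obj, BarWord A x y → Tot (M.M x y)) (x y : A.Obj)
    (w : BarWord A x y) :
    bdry w (hochF M r φ x y) + hochF M (r + 1) (fun x y v => bdry v (φ x y)) x y w +
      hochF M (r + 1) (hochF M r φ) x y w =
    -sgn k r • first w (fun z i a v =>
      sgn k (r * i) • totL M ((A.Hom _ _).d i (i + 1) a) (φ x z v)) := by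
  cases w with
  | nil => simp [hochF]
  | cons i a w =>
    simp only [hochF, first_cons, bdry_cons, bdry_smul, ← BarWord.bdry_lin,
      BarWord.first_lin (totL M a), map_smul]
    cases w with
    | nil => simp [mul_add, sgn_add]; module
    | cons j b w =>
      simp only [first_cons, totL_totL, mul_add, add_mul, one_mul, mul_one, sgn_add]
      module

lemma hochF_totD (r : ℤ) (φ : ∀ x y : A.Obj, BarWord A x y → Tot (M.M x y)) (x y : A.Obj)
    (w : BarWord A x y) :
    totD _ (hochF M r φ x y w) = hochF M (r + 1) (fun x y v => totD _ (φ x y v)) x y w +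
    first w (fun z i a v =>
      sgn k (r * i) • totL M ((A.Hom _ _).d i (i + 1) a) (φ x z v)) := by
  cases w with
  | nil => simp [hochF]
  | cons i a w =>
    simp only [hochF, first_cons, map_smul, totD_totL, add_mul, one_mul, sgn_add]
    module

lemma hochL_bdry (φ : ∀ x y : A.Obj, BarWord A x y → Tot (M.M x y)) (x y : A.Obj)
    (w : BarWord A x y) :
    bdry w (hochL M φ x y) + hochL M (fun x y v => bdry v (φ x y)) x y w -
      hochL M (hochL M φ) x y w =
    - last w (fun z v i a => totR M ((A.Hom _ _).d i (i + 1) a) (φ z y v)) := by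
  have e : bdry w (hochL M φ x y) = bdry w (fun v => last v
    (fun z v _ a => sgn k (deg v) • totR M a (φ z y v))) := rfl
  rw [e, bdry_last, hochL, hochL, sub_eq_add_neg, ← last_neg, ← last_neg, ← last_add, ← last_add]
  refine last_congr _ fun z v j a => ?_
  have h1 : bdry v (fun v' => sgn k (deg v') • totR M a (φ z y v')) =
      sgn k (deg v + 1) • totR M a (bdry v (φ z y)) := by
    rw [BarWord.bdry_lin, ← bdry_smul]
    exact bdry_congr_deg _ fun v' hv => by rw [hv]
  have h2 : sgn k (deg v) • totR M a (hochL M φ z y v) = (-1 : k) • last v (fun z' v' l b =>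
      sgn k (deg v' + l) • sgn k (deg v') • totR M (A.comp (rfl : l + j = l + j) b a) (φ z' y v')) := by
    rw [hochL, BarWord.last_lin, ← last_smul, ← last_smul]
    refine last_congr_deg _ fun z' v' l b hv => ?_
    rw [← hv, map_smul, totR_totR]
    simp only [sgn_add, sgn_sub, sgn_one]
    module
  rw [h1, h2]
  simp only [sgn_add, sgn_one]
  match_scalars
  · ring
  · linear_combination -sgn_mul_self k (deg v)
  · ring

lemma hochL_totD {r : ℤ} {φ : ∀ x y : A.Obj, BarWord A x y → Tot (M.M x y)}
    (hφ : IsHochschildCochain M r φ) (x y : A.Obj) (w : BarWord A x y) :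
    totD _ (hochL M φ x y w) = hochL M (fun x y v => totD _ (φ x y v)) x y w +
    sgn k r • last w (fun z v i a => totR M ((A.Hom _ _).d i (i + 1) a) (φ z y v)) := by
  rw [hochL, BarWord.last_lin, hochL, ← last_smul, ← last_add]
  refine last_congr _ fun z v j a => ?_
  rw [map_smul, totD_totR a _ (hφ.homog z y v), smul_add, smul_smul, sgn_add, ← mul_assoc,
    sgn_mul_self, one_mul]

lemma hochF_hochL (r : ℤ) (φ : ∀ x y : A.Obj, BarWord A x y → Tot (M.M x y)) (x y : A.Obj)
    (w : BarWord A x y) :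
    hochF M (r + 1) (hochL M φ) x y w + hochL M (hochF M r φ) x y w = 0 := by
  cases w with
  | nil => simp [hochF, hochL]
  | cons i a w =>
    cases w with
    | nil => simp [hochF, hochL]
    | cons j b w =>
      simp only [hochF, hochL, first_cons, last_cons_cons, BarWord.last_lin (totL M a), ← last_smul,
        ← last_add]
      refine (last_congr _ fun z v l e => ?_).trans (last_zero _)
      rw [map_smul, map_smul, totR_totL, deg, add_mul, one_mul]
      simp only [sgn_add, sgn_sub, sgn_one]
      module

lemma hochD_eq (r : ℤ) (φ : ∀ x y : A.Obj, BarWord A x y → Tot (M.M x y)) (x y : A.Obj)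
    (w : BarWord A x y) : hochD M r φ w = totD _ (φ x y w) +
      (-sgn k r) • (bdry w (φ x y) + hochF M r φ x y w + (-1 : k) • hochL M φ x y w) := by
  rw [hochD, hochF, hochL]; module

lemma hochF_lin (r : ℤ) (c : k) (φ ψ : ∀ x y : A.Obj, BarWord A x y → Tot (M.M x y)) (x y : A.Obj)
    (w : BarWord A x y) : hochF M r (fun x y v => φ x y v + c • ψ x y v) x y w =
      hochF M r φ x y w + c • hochF M r ψ x y w := by
  simp only [hochF, map_add, map_smul, smul_add, smul_comm _ c, first_add, first_smul]

lemma hochL_lin (c : k) (φ ψ : ∀ x y : A.Obj, BarWord A x y → Tot (M.M x y)) (x y : A.Obj)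
    (w : BarWord A x y) : hochL M (fun x y v => φ x y v + c • ψ x y v) x y w =
      hochL M φ x y w + c • hochL M ψ x y w := by
  simp only [hochL, map_add, map_smul, smul_add, smul_comm _ c, last_add, last_smul]

lemma hochD_lin (r : ℤ) (c : k) (φ ψ : ∀ x y : A.Obj, BarWord A x y → Tot (M.M x y)) (x y : A.Obj)
    (w : BarWord A x y) : hochD M r (fun x y v => φ x y v + c • ψ x y v) w =
      hochD M r φ w + c • hochD M r ψ w := by
  simp only [hochD_eq, hochF_lin, hochL_lin, bdry_add, bdry_smul, map_add, map_smul]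
  module

lemma hochD_hochD {r : ℤ} {φ : ∀ x y : A.Obj, BarWord A x y → Tot (M.M x y)}
    (hφ : IsHochschildCochain M r φ) (x y : A.Obj) (w : BarWord A x y) :
    hochD M (r + 1) (fun _ _ v => hochD M r φ v) w = 0 := by
  have e : (fun (x y : A.Obj) (v : BarWord A x y) => hochD M r φ v) = fun x y v =>
      totD _ (φ x y v) + (-sgn k r) • ((bdry v (φ x y) + hochF M r φ x y v) +
        (-1 : k) • hochL M φ x y v) := by
    funext x y v; exact hochD_eq r φ x y v
  have e1 := hochF_lin (M := M) (r + 1) 1 (fun x y v => bdry v (φ x y)) (hochF M r φ) x y w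
  have e2 := hochL_lin (M := M) 1 (fun x y v => bdry v (φ x y)) (hochF M r φ) x y w
  simp only [one_smul] at e1 e2
  rw [e, hochD_eq, hochF_lin, hochF_lin, hochL_lin, hochL_lin, bdry_add, bdry_smul, bdry_add,
    bdry_add, bdry_smul, bdry_bdry w (hφ.normalized x y), e1, e2]
  simp only [map_add, map_smul, totD_totD, hochF_totD, hochL_totD hφ, BarWord.bdry_lin]
  have h1 := hochF_bdry (M := M) r φ x y w
  have h3 := hochL_bdry (M := M) φ x y w
  have h5 := hochF_hochL (M := M) r φ x y w
  set D1 := first w fun z i a v => sgn k (r * i) • totL M ((A.Hom _ _).d i (i + 1) a) (φ x z v)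
  set D2 := last w fun z v i a => totR M ((A.Hom _ _).d i (i + 1) a) (φ z y v)
  rw [← eq_sub_iff_add_eq] at h1 h5
  rw [sub_eq_iff_eq_add, ← eq_sub_iff_add_eq] at h3
  rw [← eq_sub_iff_add_eq] at h1
  rw [h1, h3, h5]
  have hr := sgn_mul_self k r
  simp only [sgn_add, sgn_one]
  match_scalars <;> first | ring1 | linear_combination hr | linear_combination -hr |
    linear_combination sgn k r * hr

lemma IsHomog.lact {x y z : A.Obj} {i s : ℤ} (a : (A.Hom y z).X i) {m : Tot (M.M x y)}
    (hm : IsHomog s m) : IsHomog (i + s) (totL M a m) := fun q hq => by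
  rw [totL_apply a m (show i + (q - i) = q by omega), hm _ (by omega), map_zero]

lemma IsHomog.ract {x y z : A.Obj} {i s : ℤ} (a : (A.Hom x y).X i) {m : Tot (M.M y z)}
    (hm : IsHomog s m) : IsHomog (s + i) (totR M a m) := fun q hq => by
  rw [totR_apply a m (show q - i + i = q by omega), hm _ (by omega), map_zero,
    LinearMap.zero_apply]

lemma IsHochschildCochain.hochD {r : ℤ} {φ : ∀ x y : A.Obj, BarWord A x y → Tot (M.M x y)}
    (hφ : IsHochschildCochain M r φ) :
    IsHochschildCochain M (r + 1) (fun _ _ w => hochD M r φ w) where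
  normalized x y :=
    { lin := fun {c w w₁ w₂} h => by
        have h1 := h.first_lin (fun z i a v => sgn k (r * i) • totL M a (φ x z v))
          (fun z i a b v => by rw [totL_add, totL_smul]; module)
          (fun z i a v v₁ v₂ h => by rw [(hφ.normalized _ _).lin h, map_add, map_smul]; module)
        have h2 := h.last_lin (fun z v _ a => sgn k (deg v) • totR M a (φ z y v))
          (fun z v i a b => by rw [totR_add, totR_smul]; module)
          (fun z v v₁ v₂ i a h => by
            rw [(hφ.normalized _ _).lin h, map_add, map_smul, h.deg_eq.1, h.deg_eq.2]; module)
        simp only [DGCY.hochD, h1, h2, h.bdry_lin (hφ.normalized x y), (hφ.normalized x y).lin h,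
          map_add, map_smul]
        module
      degenerate := fun {w} h => by
        have h1 := h.bdry_eq (hφ.normalized x y)
          (fun z i a v => sgn k (r * i) • totL M a (φ x z v))
          (fun z v _ a => sgn k (deg v) • totR M a (φ z y v))
          (fun v => by rw [totL_one, mul_zero, sgn_zero, one_smul])
          (fun z i a v hv => by rw [(hφ.normalized _ _).degenerate hv, map_zero, smul_zero])
          (fun v => by rw [totR_one])
          (fun z v i a hv => by rw [(hφ.normalized _ _).degenerate hv, map_zero, smul_zero])
        rw [DGCY.hochD, h1, (hφ.normalized _ _).degenerate h, map_zero, smul_zero, sub_zero] }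
  homog x y w q hq := by
    have h1 : bdry w (fun v => φ x y v q) = 0 :=
      bdry_eq_zero w _ fun v hv => hφ.homog _ _ _ _ (by omega)
    have h2 : first w (fun z i a v => (sgn k (r * i) • totL M a (φ x z v)) q) = 0 := by
      cases w with
      | nil => simp
      | cons i a w =>
        rw [first_cons, Pi.smul_apply, (hφ.homog _ _ w).lact a q (by simp only [deg] at hq; omega),
          smul_zero]
    have h3 : last w (fun z v _ a => (sgn k (deg v) • totR M a (φ z y v)) q) = 0 :=
      last_eq_zero w _ fun z v i a hv => by
        rw [Pi.smul_apply, (hφ.homog _ _ v).ract a q (by omega), smul_zero]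
    have e1 := BarWord.bdry_lin (LinearMap.proj (R := k) (φ := fun q => (M.M x y).X q) q) w (φ x y)
    have e2 := BarWord.first_lin (LinearMap.proj (R := k) (φ := fun q => (M.M x y).X q) q) w
      (fun z i a v => sgn k (r * i) • totL M a (φ x z v))
    have e3 := BarWord.last_lin (LinearMap.proj (R := k) (φ := fun q => (M.M x y).X q) q) w
      (fun z v _ a => sgn k (deg v) • totR M a (φ z y v))
    simp only [LinearMap.proj_apply] at e1 e2 e3
    rw [DGCY.hochD, Pi.sub_apply, Pi.smul_apply, Pi.sub_apply, Pi.add_apply, e1, e2, e3, h1, h2, h3,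
      totD_apply _ (show q - 1 + 1 = q by omega), hφ.homog _ _ _ _ (by omega)]
    simp

variable (M)

/-- The space of normalized Hochschild cochains of degree `r`. -/
def hochschildX (r : ℤ) : Submodule k (∀ x y : A.Obj, BarWord A x y → Tot (M.M x y)) where
  carrier := {φ | IsHochschildCochain M r φ}
  zero_mem' := ⟨fun _ _ => ⟨fun _ => by simp, fun _ => rfl⟩, fun _ _ _ _ _ => rfl⟩
  add_mem' {φ ψ} hφ hψ := ⟨fun x y => ⟨fun h => by
      simp only [Pi.add_apply, (hφ.normalized _ _).lin h, (hψ.normalized _ _).lin h]; module,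
    fun h => by simp [(hφ.normalized _ _).degenerate h, (hψ.normalized _ _).degenerate h]⟩,
    fun x y w q hq => by simp [hφ.homog x y w q hq, hψ.homog x y w q hq]⟩
  smul_mem' c φ hφ := ⟨fun x y => ⟨fun h => by
      simp only [Pi.smul_apply, (hφ.normalized _ _).lin h]; module,
    fun h => by simp [(hφ.normalized _ _).degenerate h]⟩,
    fun x y w q hq => by simp [hφ.homog x y w q hq]⟩

/-- The Hochschild differential in degree `r`. -/
def hochschildD {r r' : ℤ} (h : r + 1 = r') : hochschildX M r →ₗ[k] hochschildX M r' where
  toFun φ := ⟨fun _ _ w => hochD M r φ.1 w, h ▸ φ.2.hochD⟩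
  map_add' φ ψ := Subtype.ext <| by
    funext x y w
    have := hochD_lin (M := M) r 1 φ.1 ψ.1 x y w
    simp only [one_smul] at this
    exact this
  map_smul' c φ := Subtype.ext <| by
    funext x y w
    have := hochD_lin (M := M) r c 0 φ.1 x y w
    have h0 : hochD M r 0 w = 0 := by
      have := hochD_lin (M := M) r (-1) 0 0 x y w
      simp only [smul_zero, add_zero, Pi.zero_apply, neg_smul, one_smul, add_neg_cancel] at this
      exact this
    simp only [Pi.zero_apply, zero_add, h0] at this
    exact this

/-- The complex `C(A, M)` of normalized Hochschild cochains of `A` with coefficients in `M`,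
obtained by applying `Hom(-, M)` to the normalized bar resolution of the diagonal bimodule; it
represents `RHom(A, M)`, the derived morphisms of dg bimodules from the diagonal bimodule to `M`. -/
noncomputable def hochschildCochains : CochainComplex (ModuleCat.{u} k) ℤ where
  X r := ModuleCat.of k (hochschildX M r)
  d r r' := ModuleCat.ofHom (if h : r + 1 = r' then hochschildD M h else 0)
  shape r r' h := congrArg ModuleCat.ofHom (dif_neg h)
  d_comp_d' p q r hq hr := by
    have hq' : p + 1 = q := hq
    have hr' : q + 1 = r := hr
    subst hq'
    rw [dif_pos rfl, dif_pos hr']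
    refine ModuleCat.hom_ext (LinearMap.ext fun φ => Subtype.ext ?_)
    funext x y w
    exact hochD_hochD φ.2 x y w

end Hochschild2

open BarWord

section Functoriality
variable {A : DGCategory k} {M N : DGBimodule A}

/-- The map induced by a morphism of dg bimodules on families of elements in all degrees. -/
def DGBimodule.Hom.tot (F : M.Hom N) (x y : A.Obj) : Tot (M.M x y) →ₗ[k] Tot (N.M x y) :=
  LinearMap.pi fun q => ((F.app x y).f q).hom ∘ₗ LinearMap.proj q

lemma DGBimodule.Hom.tot_totD (F : M.Hom N) {x y : A.Obj} (m : Tot (M.M x y)) :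
    F.tot x y (totD _ m) = totD _ (F.tot x y m) := by
  funext q
  change (F.app x y).f q ((M.M x y).d (q - 1) q (m (q - 1))) =
    (N.M x y).d (q - 1) q ((F.app x y).f (q - 1) (m (q - 1)))
  rw [← ModuleCat.comp_apply, ← ModuleCat.comp_apply, HomologicalComplex.Hom.comm]

lemma hochD_tot (F : M.Hom N) (r : ℤ) (φ : ∀ x y : A.Obj, BarWord A x y → Tot (M.M x y))
    (x y : A.Obj) (w : BarWord A x y) :
    hochD N r (fun x y v => F.tot x y (φ x y v)) w = F.tot x y (hochD M r φ w) := by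
  have h1 : ∀ {x y z : A.Obj} (i : ℤ) (a : (A.Hom y z).X i) (m : Tot (M.M x y)),
      totL N a (F.tot x y m) = F.tot x z (totL M a m) :=
    fun i a m => funext fun q => (F.app_lact _ a _).symm
  have h2 : ∀ {x y z : A.Obj} (i : ℤ) (a : (A.Hom x y).X i) (m : Tot (M.M y z)),
      totR N a (F.tot y z m) = F.tot x z (totR M a m) :=
    fun i a m => funext fun q => (F.app_ract _ _ a).symm
  simp only [hochD, map_sub, map_smul, map_add, F.tot_totD, BarWord.bdry_lin, BarWord.first_lin,
    BarWord.last_lin, h1, h2]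

/-- The map `C(A, M) ⟶ C(A, N)` induced by a morphism of dg bimodules. -/
noncomputable def hochschildMap (F : M.Hom N) : hochschildCochains M ⟶ hochschildCochains N where
  f r := ModuleCat.ofHom
    { toFun := fun φ => ⟨fun x y w => F.tot x y (φ.1 x y w),
        ⟨fun x y => ⟨fun h => by rw [(φ.2.normalized x y).lin h, map_add, map_smul],
          fun h => by rw [(φ.2.normalized x y).degenerate h, map_zero]⟩,
        fun x y w q hq => by
          change (F.app x y).f q (φ.1 x y w q) = 0
          rw [φ.2.homog x y w q hq, map_zero]⟩⟩
      map_add' := fun φ ψ => Subtype.ext <| by funext x y w; exact map_add (F.tot x y) _ _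
      map_smul' := fun c φ => Subtype.ext <| by funext x y w; exact map_smul (F.tot x y) _ _ }
  comm' r r' h := by
    have h' : r + 1 = r' := h
    refine ModuleCat.hom_ext (LinearMap.ext fun φ => Subtype.ext ?_)
    simp only [hochschildCochains, dif_pos h']
    funext x y w
    exact hochD_tot F r φ.1 x y w

end Functoriality

/-! ## Smoothness and perfectness -/

/-- A dg category is smooth if its diagonal bimodule is a perfect dg bimodule, i.e. a compact object
of the derived category of dg bimodules: `RHom(A, -)` commutes with arbitrary direct sums. -/
def IsSmooth (A : DGCategory k) : Prop :=
  ∀ (ι : Type u) (N : ι → DGBimodule A),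
    QuasiIso (Limits.Sigma.desc fun a => hochschildMap (directSumIncl N a))

/-- A complex of vector spaces is perfect if its total cohomology is finite dimensional. -/
def IsPerfect (K : CochainComplex (ModuleCat.{u} k) ℤ) : Prop :=
  (∀ i, Module.Finite k (K.homology i)) ∧ {i | ¬ Limits.IsZero (K.homology i)}.Finite

/-- An object `p` is locally perfect if all complexes `A(a, p)` are perfect. -/
def IsLocallyPerfect (A : DGCategory k) (p : A.Obj) : Prop := ∀ a, IsPerfect (A.Hom a p)

/-- A dg category is proper if all its morphism complexes are perfect. -/
def IsProper (A : DGCategory k) : Prop := ∀ x y, IsPerfect (A.Hom x y)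

/-! ## Hochschild chains -/

/-- A Hochschild word `a₀[a₁ | … | a_m]`: a cyclically composable string of homogeneous
morphisms. -/
structure HHWord (A : DGCategory k) where
  {x y : A.Obj}
  {i : ℤ}
  a : (A.Hom y x).X i
  w : BarWord A x y

/-- The degree `|a₀| + ∑ (|aᵢ| - 1)`. -/
def HHWord.deg {A : DGCategory k} (W : HHWord A) : ℤ := W.i + W.w.deg

/-- Formal linear combinations of Hochschild words. The normalized cyclic bar complex `CB(A)` is
the quotient of this space by `chainRel`. -/
abbrev Chain (A : DGCategory k) : Type u := HHWord A →₀ k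

/-- The word `a₀[w]` as a chain. -/
noncomputable def word {A : DGCategory k} {x y : A.Obj} {i : ℤ} (a : (A.Hom y x).X i)
    (w : BarWord A x y) : Chain A := Finsupp.single ⟨a, w⟩ 1

/-- The relations of the normalized cyclic bar complex: `a₀[a₁ | … | a_m]` is linear in each entry,
and is zero if one of `a₁, …, a_m` is an identity. -/
noncomputable def chainRel (A : DGCategory k) : Submodule k (Chain A) :=
  Submodule.span k
    ({ξ | ∃ (x y : A.Obj) (i : ℤ) (a b : (A.Hom y x).X i) (c : k) (w : BarWord A x y),
        ξ = word (a + c • b) w - word a w - c • word b w} ∪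
     {ξ | ∃ (x y : A.Obj) (i : ℤ) (a : (A.Hom y x).X i) (c : k) (w w₁ w₂ : BarWord A x y),
        IsLinComb c w w₁ w₂ ∧ ξ = word a w - word a w₁ - c • word a w₂} ∪
     {ξ | ∃ (x y : A.Obj) (i : ℤ) (a : (A.Hom y x).X i) (w : BarWord A x y),
        IsDegenerate w ∧ ξ = word a w})

/-- The Hochschild differential (of degree `1`):
`b(a₀[a₁ | … | a_m]) = (d a₀)[a₁ | … | a_m] + (-1)^{|a₀|} a₀ ∂[a₁ | … | a_m]
  + (-1)^{|a₀|} a₀ a₁ [a₂ | … | a_m] - ± a_m a₀ [a₁ | … | a_{m-1}]`,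
where `±` is the sign `(-1)^{(|a_m| - 1) (|a₀| + (|a₁| - 1) + … + (|a_{m-1}| - 1))}`. -/
noncomputable def hochB (A : DGCategory k) : Chain A →ₗ[k] Chain A :=
  Finsupp.linearCombination k fun W =>
    word ((A.Hom _ _).d W.i (W.i + 1) W.a) W.w +
    sgn k W.i • bdry W.w (fun v => word W.a v) +
    sgn k W.i • first W.w (fun _ _ a v => word (A.comp rfl W.a a) v) -
    last W.w (fun _ v j a => sgn k ((j - 1) * (W.i + v.deg)) • word (A.comp rfl a W.a) v)

/-- The sum of `F w' w''` over all ways of cutting `w` into `w'` and `w''`. -/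
def BarWord.splits {A : DGCategory k} {N : Type u} [AddCommGroup N] {x : A.Obj} : ∀ {y : A.Obj},
    BarWord A x y → (∀ m : A.Obj, BarWord A m y → BarWord A x m → N) → N
  | _, .nil _, F => F x (nil x) (nil x)
  | _, .cons i a w, F =>
      F _ (nil _) (cons i a w) + splits w (fun m w' w'' => F m (cons i a w') w'')

/-- Connes' operator (of degree `-1`):
`B(a₀[a₁ | … | a_m]) = ∑ᵢ ± 1[a_{i+1} | … | a_m | a₀ | a₁ | … | aᵢ]`, with the Koszul sign of the
cyclic permutation for the degrees `|aᵢ| - 1`. -/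
noncomputable def connesB (A : DGCategory k) : Chain A →ₗ[k] Chain A :=
  Finsupp.linearCombination k fun W => W.w.splits fun m w' w'' =>
    sgn k ((W.i - 1 + w'.deg) * w''.deg) • word (A.one m) (append w'' (cons W.i W.a w'))

/-! ## Left Calabi-Yau structures -/

/-- The Hochschild word `a₀[w]` of degree `-n` sends a cochain `φ` of degree `r` with values in
`A(s, -) ⊗ A(-, t)`, say `φ(w) = ∑ f ⊗ g`, to `∑ (-1)^{r |a₀| + |g| (|a₀| + |f|)} g a₀ f`. -/
noncomputable def capWord {A : DGCategory k} (s t : A.Obj) (r p : ℤ) (W : HHWord A) :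
    TensorX A s t W.x W.y (p - W.i) →ₗ[k] (A.Hom s t).X p :=
  tlift A s t fun a b h => (sgn k (r * W.i) * sgn k (b * (W.i + a))) •
    ((A.comp (show b + (W.i + a) = p by omega)).flip.comp (A.comp rfl W.a))

/-- The pairing of Hochschild chains with Hochschild cochains with values in
`A(s, -) ⊗ A(-, t)`. -/
noncomputable def cap {A : DGCategory k} (s t : A.Obj) (ξ : Chain A) (r p : ℤ)
    (φ : hochschildX (representable A s t) r) : (A.Hom s t).X p :=
  ξ.sum fun W c => c • capWord s t r p W (φ.1 W.x W.y W.w (p - W.i))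

/-- An `n`-dimensional left Calabi-Yau structure on `A`: a cycle `∑ ξ_j u^j` of degree `-n` in the
negative cyclic complex `NC(A) = (CB(A)[[u]], b + u B)`, `|u| = 2`, such that the morphism
`A^! ⟶ A[-n]` from the inverse dualizing bimodule which corresponds to the Hochschild cycle `ξ_0` is
a quasi-isomorphism. Here `A^!(s, t) = RHom(A, A(s, -) ⊗ A(-, t))`. -/
structure LeftCalabiYau (A : DGCategory k) (n : ℤ) where
  ξ : ℕ → Chain A
  homog : ∀ j, ∀ W ∈ (ξ j).support, W.deg = -n - 2 * j
  cycle_zero : hochB A (ξ 0) ∈ chainRel A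
  cycle_succ : ∀ j, hochB A (ξ (j + 1)) + connesB A (ξ j) ∈ chainRel A
  nondegenerate : ∀ s t, ∃ f : hochschildCochains (representable A s t) ⟶ (A.Hom s t)⟦-n⟧,
    (∀ (r : ℤ) (φ : hochschildX (representable A s t) r),
      f.f r φ = sgn k (n * r) • cap s t (ξ 0) r (r + -n) φ) ∧ QuasiIso f

/-! ## Right Calabi-Yau structures -/

/-- `ω` is an `n`-dimensional right Calabi-Yau structure on `P`: `P` is proper, and `ω`, where `ω j`
records the values on `u^{-j} CB(P)`, is a morphism of complexes `CC(P) ⟶ k[-n]` from the cyclic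
complex `CC(P) = (CB(P)[u⁻¹], b + u B)`, `|u| = 2`, such that the morphism `P ⟶ P^*[-n]`,
`a ↦ (g ↦ ± ω_0(g a))`, of dg bimodules is a quasi-isomorphism. -/
structure IsRightCalabiYau (P : DGCategory k) (n : ℤ) (ω : ℕ → Chain P →ₗ[k] k) : Prop where
  proper : IsProper P
  rel : ∀ j, ∀ β ∈ chainRel P, ω j β = 0
  homog : ∀ (j : ℕ) (W : HHWord P), W.deg ≠ n + 2 * j → ω j (Finsupp.single W 1) = 0
  cocycle_zero : ∀ β, ω 0 (hochB P β) = 0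
  cocycle_succ : ∀ j β, ω (j + 1) (hochB P β) + ω j (connesB P β) = 0
  nondegenerate : ∀ x y, ∃ f : P.Hom x y ⟶ ((dualBimodule P).M x y)⟦-n⟧,
    (∀ (i : ℤ) (a : (P.Hom x y).X i) (g : (P.Hom y x).X (-(i + -n))),
      (show Module.Dual k ((P.Hom y x).X (-(i + -n))) from f.f i a) g =
        sgn k (n * i + i) • ω 0 (word (P.comp (show -(i + -n) + i = n by omega) g a) (nil x))) ∧
    QuasiIso f

/-! ## The trace on the dg category of perfect complexes -/

/-- The trace of a linear endomorphism of finite rank. -/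
noncomputable def finiteRankTrace {V : Type u} [AddCommGroup V] [Module k V] (T : V →ₗ[k] V) : k :=
  LinearMap.trace k (LinearMap.range T) (T.rangeRestrict ∘ₗ (LinearMap.range T).subtype)

/-- The supertrace of a degree `0` endomorphism of a complex which has finite rank. -/
noncomputable def supertrace {K : CochainComplex (ModuleCat.{u} k) ℤ}
    (z : CochainComplex.HomComplex.Cochain K K 0) : k :=
  ∑ᶠ p : ℤ, sgn k p * finiteRankTrace (z.v p p (add_zero p)).hom

/-- A contracting homotopy of a complex of vector spaces onto its cohomology: an operator `h` of
degree `-1` with `h² = 0`, `h d h = h` and `d h d = d`. Then `1 - d h - h d` is a projector onto a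
space of representatives of the cohomology. -/
structure Contraction (K : CochainComplex (ModuleCat.{u} k) ℤ) where
  h : ∀ i : ℤ, K.X (i + 1) →ₗ[k] K.X i
  h_h : ∀ i v, h i (h (i + 1) v) = 0
  h_d_h : ∀ i v, h i (K.d i (i + 1) (h i v)) = h i v
  d_h_d : ∀ i v, K.d i (i + 1) (h i (K.d i (i + 1) v)) = K.d i (i + 1) v

/-- Every complex of vector spaces has a contraction onto its cohomology. -/
theorem nonempty_contraction (K : CochainComplex (ModuleCat.{u} k) ℤ) :
    Nonempty (Contraction K) := by
  have h1 : ∀ i, ∃ g : K.X (i + 1) →ₗ[k] K.X i,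
      (∀ v, K.d i (i + 1) (g (K.d i (i + 1) v)) = K.d i (i + 1) v) ∧
      ∀ v, g (K.d i (i + 1) (g v)) = g v := by
    intro i
    obtain ⟨s, hs⟩ := (K.d i (i + 1)).hom.rangeRestrict.exists_rightInverse_of_surjective
      (LinearMap.range_rangeRestrict _)
    obtain ⟨g, hg⟩ := s.exists_extend
    have h : ∀ v, K.d i (i + 1) (g (K.d i (i + 1) v)) = K.d i (i + 1) v := fun v => by
      have h2 := LinearMap.congr_fun hg ⟨_, LinearMap.mem_range_self (K.d i (i + 1)).hom v⟩
      have h3 := congrArg Subtype.val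
        (LinearMap.congr_fun hs ⟨_, LinearMap.mem_range_self (K.d i (i + 1)).hom v⟩)
      exact (congrArg (K.d i (i + 1)).hom h2).trans h3
    exact ⟨g ∘ₗ (K.d i (i + 1)).hom ∘ₗ g, fun v => by
      change K.d i (i + 1) (g (K.d i (i + 1) (g (K.d i (i + 1) v)))) = _
      rw [h, h], fun v => by
      change g (K.d i (i + 1) (g (K.d i (i + 1) (g (K.d i (i + 1) (g v)))))) =
        g (K.d i (i + 1) (g v))
      rw [h, h]⟩
  choose g hd hg using h1
  have hdd : ∀ i v, K.d (i + 1) (i + 1 + 1) (K.d i (i + 1) v) = 0 := fun i v => by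
    rw [← ModuleCat.comp_apply, HomologicalComplex.d_comp_d]; rfl
  exact ⟨⟨fun i => g i ∘ₗ (LinearMap.id - g (i + 1) ∘ₗ (K.d (i + 1) (i + 1 + 1)).hom),
    fun i v => by
      change g i (_ - g (i + 1) (K.d (i + 1) (i + 1 + 1) (g (i + 1) (_ - _)))) = 0
      rw [hg]
      change g i (g (i + 1) (_ - _) - g (i + 1) (_ - _)) = 0
      rw [sub_self, map_zero],
    fun i v => by
      change g i (K.d i (i + 1) (g i (_ - _)) -
        g (i + 1) (K.d (i + 1) (i + 1 + 1) (K.d i (i + 1) (g i (_ - _))))) = g i (_ - _)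
      rw [hdd, map_zero, sub_zero, hg],
    fun i v => by
      change K.d i (i + 1) (g i (K.d i (i + 1) v -
        g (i + 1) (K.d (i + 1) (i + 1 + 1) (K.d i (i + 1) v)))) = _
      rw [hdd, map_zero, sub_zero, hd]⟩⟩

section Trace
variable {I : Type u} {V : I → CochainComplex (ModuleCat.{u} k) ℤ}
open CochainComplex.HomComplex

/-- The operator `h` of a contraction as a morphism of degree `-1`. -/
noncomputable def homotopyOp (c : ∀ i, Contraction (V i)) (x : I) :
    ((endoCategory V).Hom x x).X (-1) :=
  (Cochain.mk fun p q hpq => ((V x).XIsoOfEq (show p = q + 1 by omega)).hom ≫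
    ModuleCat.ofHom ((c x).h q) : Cochain (V x) (V x) (-1))

/-- The projector `e = 1 - d h - h d`. -/
noncomputable def projOp (c : ∀ i, Contraction (V i)) (x : I) : ((endoCategory V).Hom x x).X 0 :=
  (endoCategory V).one x - ((endoCategory V).Hom x x).d (-1) 0 (homotopyOp c x)

/-- `± h f₁ h f₂ ⋯ h f_m h` with the sign `(-1)^{(|f₁| - 1) + … + (|f_m| - 1)}`. -/
noncomputable def perturbH (c : ∀ i, Contraction (V i)) {x : I} : ∀ {y : I}
    (w : BarWord (endoCategory V) x y), ((endoCategory V).Hom x y).X (w.deg - 1)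
  | _, .nil _ => (endoCategory V).comp (show 0 + -1 = _ by simp [deg]) ((endoCategory V).one x)
      (homotopyOp c x)
  | _, .cons i f w => -sgn k i • (endoCategory V).comp
      (show -1 + (i + (w.deg - 1)) = (cons i f w).deg - 1 by simp only [deg]; ring)
      (homotopyOp c _) ((endoCategory V).comp rfl f (perturbH c w))

/-- The sum over `i` of the terms `± h f₁ h ⋯ f_i e f_{i+1} h ⋯ f_m h` in which one of the operators
`h` of `perturbH` is replaced by the projector `e`. -/
noncomputable def perturbG (c : ∀ i, Contraction (V i)) {x : I} : ∀ {y : I}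
    (w : BarWord (endoCategory V) x y), ((endoCategory V).Hom x y).X w.deg
  | _, .nil _ => projOp c x
  | _, .cons i f w =>
      -sgn k i • (endoCategory V).comp (show 0 + (i + (w.deg - 1)) = (cons i f w).deg by simp only [deg]; ring)
        (projOp c _) ((endoCategory V).comp rfl f (perturbH c w)) +
      (endoCategory V).comp (show -1 + (i + w.deg) = (cons i f w).deg by simp only [deg]; ring)
        (homotopyOp c _) ((endoCategory V).comp rfl f (perturbG c w))

/-- The trace functional on Hochschild chains of a dg category of perfect complexes,
`f₀[f₁ | … | f_m] ↦ str(f₀ ∑ ± h f₁ h ⋯ f_i e f_{i+1} h ⋯ f_m h)`. It extends `f₀ ↦ str(H(f₀))` on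
closed endomorphisms, vanishes on the images of `b` and of `B`, and is thus the identification
`HH(Perf(k)) ≃ k`, with its circle action. -/
noncomputable def traceFunctional (c : ∀ i, Contraction (V i)) {x y : I} {i : ℤ}
    (f : ((endoCategory V).Hom y x).X i) (w : BarWord (endoCategory V) x y) : k :=
  if h : i + w.deg = 0 then supertrace ((endoCategory V).comp h f (perturbG c w)) else 0

end Trace

/-! ## The comparison map -/

section Theta
variable (A : DGCategory k) (P : Set A.Obj)
open CochainComplex.HomComplex

/-- The reversal of a bar word, as a word in the opposite dg category. -/
def BarWord.reverse {A : DGCategory k} {x : A.Obj} : ∀ {y : A.Obj}, BarWord A x y → BarWord A.op y x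
  | _, .nil _ => nil (A := A.op) x
  | _, .cons (y := y) (z := z) i a w =>
      append (A := A.op) (reverse w) (cons (A := A.op) (x := z) (y := z) (z := y) i a (nil (A := A.op) z))

/-- The exponent of the sign in the isomorphism `HH(A) ≃ HH(A^op)`,
`a₀[a₁ | … | a_m] ↦ ± a₀[a_m | … | a₁]`, namely `m + ∑_{i < j} (|aᵢ| - 1) (|a_j| - 1)`. -/
def BarWord.reverseSign {A : DGCategory k} {x : A.Obj} : ∀ {y : A.Obj}, BarWord A x y → ℤ
  | _, .nil _ => 0
  | _, .cons i _ w => 1 + (i - 1) * deg w + reverseSign w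

/-- The complexes `A(a, p)`, for `a` in `A` and `p` in `P`. -/
def homFamily (X : A.Obj × P) : CochainComplex (ModuleCat.{u} k) ℤ := A.Hom X.1 X.2

/-- The dg category of the complexes `A(a, p)`. The functor `A^op ⊗ P ⟶ Perf(k)`,
`(a, p) ↦ A(a, p)`, takes values in it. -/
abbrev homCategory : DGCategory k := endoCategory (homFamily A P)

variable {A P}

/-- The action of a morphism of `A^op`: `v ↦ (-1)^{|a| |v|} v a`. -/
def actOp (p : P) {x y : A.Obj} {i : ℤ} (a : (A.op.Hom x y).X i) :
    ((homCategory A P).Hom (x, p) (y, p)).X i :=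
  (Cochain.mk fun q _ h => ModuleCat.ofHom (sgn k (i * q) • (A.comp h).flip a) :
    Cochain (A.Hom x p) (A.Hom y p) i)

/-- The action of a morphism of `P`: `v ↦ b v`. -/
def actFull (x : A.Obj) {p q : P} {j : ℤ} (b : ((A.full P).Hom p q).X j) :
    ((homCategory A P).Hom (x, p) (x, q)).X j :=
  (Cochain.mk fun _ _ h => ModuleCat.ofHom (A.comp (show j + _ = _ by omega) b) :
    Cochain (A.Hom x p) (A.Hom x q) j)

/-- Shuffles of the empty word with a word of `P`. -/
def shuffleNil (x : A.Obj) {p : P} : ∀ {q : P}, BarWord (A.full P) p q →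
    (BarWord (homCategory A P) (x, p) (x, q) → k) → k
  | _, .nil _, F => F (nil (A := homCategory A P) (x, p))
  | _, .cons j b v, F =>
      shuffleNil x v fun u => F (cons (A := homCategory A P) j (actFull x b) u)

/-- Shuffles of a word `[a | w]` of degree `l`, given the shuffles `S` of `w`. -/
def shuffleCons {x y z : A.Obj} (l : ℤ) {i : ℤ} (a : (A.op.Hom y z).X i)
    {p : P} (S : ∀ {q : P}, BarWord (A.full P) p q →
      (BarWord (homCategory A P) (x, p) (y, q) → k) → k) :
    ∀ {q : P}, BarWord (A.full P) p q → (BarWord (homCategory A P) (x, p) (z, q) → k) → k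
  | _, .nil _, F => S (nil (A := A.full P) p) fun u => F (cons (A := homCategory A P) i (actOp p a) u)
  | q, .cons j b v, F =>
      S (cons j b v) (fun u => F (cons (A := homCategory A P) i (actOp q a) u)) +
      sgn k ((j - 1) * l) • shuffleCons l a S v
        (fun u => F (cons (A := homCategory A P) j (actFull z b) u))

/-- The signed sum of the values of `F` on the shuffles of a word of `A^op` and a word of `P`, with
the Koszul signs for the degrees `|aᵢ| - 1`. -/
def shuffle {x : A.Obj} {p : P} : ∀ {y : A.Obj}, BarWord A.op x y → ∀ {q : P},
    BarWord (A.full P) p q → (BarWord (homCategory A P) (x, p) (y, q) → k) → k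
  | _, .nil _ => shuffleNil (A := A) x
  | _, .cons i a w => shuffleCons (deg (cons i a w)) a (shuffle w)

/-- The pairing of Hochschild words of `A` and `P`: the composition of `HH(A) ≃ HH(A^op)`, the
shuffle product `HH(A^op) ⊗ HH(P) ⟶ HH(A^op ⊗ P)`, the functor `(a, p) ↦ A(a, p)` and the trace. -/
noncomputable def pairing (c : ∀ X, Contraction (homFamily A P X)) (W : HHWord A)
    (U : HHWord (A.full P)) : k :=
  sgn k (W.w.reverseSign + U.i * W.w.deg) *
    shuffle W.w.reverse U.w (traceFunctional c
      ((homCategory A P).comp (x := (W.x, U.y)) (y := (W.x, U.x)) (z := (W.y, U.x)) rfl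
        (actOp U.x W.a) (actFull W.x U.a)))

/-- The functional `Θ̃(ξ)` on `CC(P)`: it sends `u^{-j} β` to `(-1)^j ⟨ξ_j, β⟩`. The sign is there
since `HH(A) ≃ HH(A^op)` reverses the circle, i.e. anticommutes with Connes' operators. -/
noncomputable def theta (c : ∀ X, Contraction (homFamily A P X)) (ξ : ℕ → Chain A) (j : ℕ) :
    Chain (A.full P) →ₗ[k] k :=
  Finsupp.linearCombination k fun U => sgn k j * (ξ j).sum fun W r => r * pairing c W U

end Theta
end DGCY

/-!
Morphisms of `A` and of `P` act on the complexes `A(a, p)`, and the signs are managed by working with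
operators on the total space `Total` of a complex, where the supertrace `str` of operators of finite
rank is additive and graded cyclic (`str_comm`). That the objects of `P` are locally perfect means
that the projectors `e = 1 - d h - h d` have finite rank (`OpContraction.isFiniteRank_e`).

**The cocycle conditions.** The operators `H = ∑ ± h f₁ h ⋯ f_m h` and
`G = ∑ ± h f₁ h ⋯ f_i e f_{i+1} h ⋯ f_m h` are cochains on bar words such that `δ H = 1 - G` and
`δ G = 0` (`hochschild_hWord`, `hochschild_gWord`). As `str` is graded cyclic, the functional
`τ(f₀[w]) = str(f₀ G(w))` vanishes on Hochschild boundaries (`strWord_hochB`) and is invariant under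
cyclic permutations (`strWord_append`). The shuffle product is compatible with `b`, and also with `B`
when it is evaluated by a cyclic functional (`hochFun_shuffleFun`, `connesFun_shuffleFun`). Reversal
of words commutes with `b` and anticommutes with `B` up to the sign of the reversal
(`hochFun_reverseFun`, `connesFun_reverseFun`), which is what the factor `(-1)^j` in `theta`
compensates. Since the `ξ_j` form a negative cyclic cycle, `theta c ξ` is a cyclic cocycle of `P`
(`theta_cocycle_zero`, `theta_cocycle_succ`).

**Nondegeneracy.** Let `ω` be the part of `theta c ξ` on Hochschild chains. The main point is
`exists_dual`: every functional `θ` on the cohomology of `A(y, p)`, where `p` and `y` are in `P`, has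
the form `g ↦ ± ω(g a)` for a closed morphism `a : p ⟶ y`. The left Calabi-Yau structure gives a
Hochschild cocycle `ψ` with values in `A(y, -) ⊗ A(-, y)` whose cap product with `ξ_0` is cohomologous
to `±1` (`exists_cap_eq_one`). Contraction of the first tensor factor with `θ` gives `a = (θ ⊗ 1) ψ([])`,
and two cochains with values in the operators `A(-, p) ⟶ A(-, y)`: `φ(w)(v) = ± (θ ⊗ 1)(v ψ(w))`, which
has finite rank, and `β(w)(v) = ± (θ ⊗ 1) ψ(v | w)`. The cocycle condition for `ψ` says that `φ` is
closed and `δ β = φ ∓ a`, where `a` acts by left multiplication (`delta_actContract`,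
`delta_barContract`). So `K = ± φ ∪ H + β ∪ G` satisfies `δ K = φ ∓ a G` and has finite rank
(`delta_transfer`). For closed `g` the Hochschild cycle `ξ_0` annihilates the supertrace of `g δ K`
(`linearCombination_str_delta`), so that the supertraces of `g φ` and of `g a G` agree on it up to
sign. The latter is `ω(g a)` (`pairing_nil`), and the former is, the operators `φ(w)` being sums of
operators of rank one, the value of `θ` on the product of `g` with the cap product of `ξ_0` and `ψ`
(`str_actContract`), which is `± θ(g)`.

This shows that the morphism from the diagonal bimodule to its shifted dual is surjective on
cohomology. The pairing is symmetric on cohomology (`wordMap_comm`), so the same statement with the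
two objects exchanged shows that it is injective (`quasiIso_dualMap`).
-/

namespace DGCY

variable {k : Type u} [Field k]

/-! ### Traces of operators of finite rank -/

section FiniteRank
variable {V W Z : Type u} [AddCommGroup V] [Module k V] [AddCommGroup W] [Module k W]
  [AddCommGroup Z] [Module k Z]

/-- The linear maps with finite dimensional range. -/
def IsFiniteRank (T : V →ₗ[k] W) : Prop := Module.Finite k (LinearMap.range T)

namespace IsFiniteRank

lemma of_le {T : V →ₗ[k] W} {S : Submodule k W} [Module.Finite k S] (h : LinearMap.range T ≤ S) :
    IsFiniteRank T :=
  Module.Finite.of_injective (Submodule.inclusion h) (Submodule.inclusion_injective h)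

lemma zero : IsFiniteRank (0 : V →ₗ[k] W) := by
  unfold IsFiniteRank
  rw [LinearMap.range_zero]
  infer_instance

lemma add {S T : V →ₗ[k] W} (hS : IsFiniteRank S) (hT : IsFiniteRank T) : IsFiniteRank (S + T) := by
  have := hS
  have := hT
  unfold IsFiniteRank at *
  exact of_le (S := LinearMap.range S ⊔ LinearMap.range T) (LinearMap.range_add_le S T)

lemma comp_left {T : V →ₗ[k] W} (hT : IsFiniteRank T) (S : W →ₗ[k] Z) : IsFiniteRank (S ∘ₗ T) := by
  have := hT
  unfold IsFiniteRank at *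
  rw [LinearMap.range_comp]
  infer_instance

lemma comp_right {T : V →ₗ[k] W} (hT : IsFiniteRank T) (S : Z →ₗ[k] V) : IsFiniteRank (T ∘ₗ S) := by
  have := hT
  unfold IsFiniteRank at *
  exact of_le (LinearMap.range_comp_le_range S T)

lemma smul {T : V →ₗ[k] W} (hT : IsFiniteRank T) (c : k) : IsFiniteRank (c • T) :=
  hT.comp_left (c • LinearMap.id)

lemma neg {T : V →ₗ[k] W} (hT : IsFiniteRank T) : IsFiniteRank (-T) :=
  hT.comp_left (-LinearMap.id)

lemma sub {S T : V →ₗ[k] W} (hS : IsFiniteRank S) (hT : IsFiniteRank T) : IsFiniteRank (S - T) := by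
  rw [sub_eq_add_neg]; exact hS.add hT.neg

lemma sum {ι : Type*} (s : Finset ι) {T : ι → V →ₗ[k] W} (h : ∀ i ∈ s, IsFiniteRank (T i)) :
    IsFiniteRank (∑ i ∈ s, T i) := by
  classical
  induction s using Finset.induction_on with
  | empty => exact zero
  | insert a s ha ih =>
    rw [Finset.sum_insert ha]
    exact (h a (by simp)).add (ih fun i hi => h i (by simp [hi]))

end IsFiniteRank

lemma finiteRankTrace_eq_trace {T : V →ₗ[k] V} {S : Submodule k V} [Module.Finite k S]
    (h : LinearMap.range T ≤ S) : finiteRankTrace T =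
      LinearMap.trace k S (T.restrict fun x _ => h (LinearMap.mem_range_self T x)) := by
  have : Module.Finite k (LinearMap.range T) := IsFiniteRank.of_le h
  exact (LinearMap.trace_comp_comm' (T.rangeRestrict ∘ₗ S.subtype) (Submodule.inclusion h)).symm

lemma finiteRankTrace_add {S T : V →ₗ[k] V} (hS : IsFiniteRank S) (hT : IsFiniteRank T) :
    finiteRankTrace (S + T) = finiteRankTrace S + finiteRankTrace T := by
  have := hS
  have := hT
  unfold IsFiniteRank at *
  rw [finiteRankTrace_eq_trace (LinearMap.range_add_le S T),
    finiteRankTrace_eq_trace (S := LinearMap.range S ⊔ LinearMap.range T) (T := S) le_sup_left,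
    finiteRankTrace_eq_trace (S := LinearMap.range S ⊔ LinearMap.range T) (T := T) le_sup_right,
    ← map_add]
  rfl

lemma finiteRankTrace_smul {T : V →ₗ[k] V} (hT : IsFiniteRank T) (c : k) :
    finiteRankTrace (c • T) = c * finiteRankTrace T := by
  have := hT
  unfold IsFiniteRank at *
  have h : LinearMap.range (c • T) ≤ LinearMap.range T := by
    rintro _ ⟨x, rfl⟩
    exact ⟨c • x, by simp⟩
  rw [finiteRankTrace_eq_trace h, finiteRankTrace_eq_trace (le_refl (LinearMap.range T)),
    ← smul_eq_mul, ← map_smul]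
  rfl

lemma finiteRankTrace_zero : finiteRankTrace (0 : V →ₗ[k] V) = 0 := by
  simpa using finiteRankTrace_smul (IsFiniteRank.zero (k := k) (V := V) (W := V)) 0

lemma finiteRankTrace_sum {ι : Type*} (s : Finset ι) {T : ι → V →ₗ[k] V}
    (h : ∀ i ∈ s, IsFiniteRank (T i)) :
    finiteRankTrace (∑ i ∈ s, T i) = ∑ i ∈ s, finiteRankTrace (T i) := by
  classical
  induction s using Finset.induction_on with
  | empty => exact finiteRankTrace_zero
  | insert a s ha ih =>
    rw [Finset.sum_insert ha, Finset.sum_insert ha, finiteRankTrace_add (h a (by simp))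
      (IsFiniteRank.sum s fun i hi => h i (by simp [hi])), ih fun i hi => h i (by simp [hi])]

lemma finiteRankTrace_comm {S : V →ₗ[k] W} (hS : IsFiniteRank S) (T : W →ₗ[k] V) :
    finiteRankTrace (S ∘ₗ T) = finiteRankTrace (T ∘ₗ S) := by
  have := hS
  unfold IsFiniteRank at *
  have h : LinearMap.range (T ∘ₗ S) ≤ (LinearMap.range S).map T := by rw [LinearMap.range_comp]
  rw [finiteRankTrace_eq_trace (LinearMap.range_comp_le_range T S), finiteRankTrace_eq_trace h]
  exact LinearMap.trace_comp_comm'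
    (T.submoduleMap (LinearMap.range S)) (S.rangeRestrict ∘ₗ ((LinearMap.range S).map T).subtype)

end FiniteRank

/-! ### Operators on the total space of a complex -/

section Operators
open CochainComplex.HomComplex
variable {K L N : CochainComplex (ModuleCat.{u} k) ℤ}

/-- The total space of a complex, i.e. the space of families of elements in all degrees. It is the
product rather than the direct sum, as are the coefficients of the Hochschild cochains. -/
def Total (K : CochainComplex (ModuleCat.{u} k) ℤ) : ModuleCat.{u} k := ModuleCat.of k (Tot K)

/-- The component of degree `q`. -/
def Total.proj (q : ℤ) : Total K →ₗ[k] K.X q := LinearMap.proj (R := k) (φ := fun q => K.X q) q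

/-- A linear map to the total space is given by its components. -/
def Total.pi {V : Type u} [AddCommGroup V] [Module k V] (f : ∀ q, V →ₗ[k] K.X q) :
    V →ₗ[k] Total K := LinearMap.pi (R := k) (φ := fun q => K.X q) f

open Classical in
/-- The inclusion of the part of degree `q`. -/
noncomputable def Total.incl (K : CochainComplex (ModuleCat.{u} k) ℤ) (q : ℤ) : K.X q →ₗ[k] Total K :=
  Total.pi fun r => if h : q = r then (K.XIsoOfEq h).hom.hom else 0

lemma Total.ext {m m' : Total K} (h : ∀ q, Total.proj q m = Total.proj q m') : m = m' := funext h

lemma Total.proj_pi {V : Type u} [AddCommGroup V] [Module k V] (f : ∀ q, V →ₗ[k] K.X q) (v : V)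
    (q : ℤ) : Total.proj q (Total.pi f v) = f q v := rfl

lemma Total.proj_incl_self (q : ℤ) (v : K.X q) : Total.proj q (Total.incl K q v) = v := by
  rw [incl, proj_pi, dif_pos rfl]
  simp [HomologicalComplex.XIsoOfEq]

lemma Total.proj_incl_of_ne {q r : ℤ} (h : q ≠ r) (v : K.X q) :
    Total.proj r (Total.incl K q v) = 0 := by
  rw [incl, proj_pi, dif_neg h]; rfl

/-- The grading operator `v ↦ (-1)^{|v|} v`. -/
def gradeOp (K : CochainComplex (ModuleCat.{u} k) ℤ) : Total K →ₗ[k] Total K :=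
  Total.pi fun q => sgn k q • Total.proj q

lemma proj_gradeOp (m : Total K) (q : ℤ) :
    Total.proj q (gradeOp K m) = sgn k q • Total.proj q m := rfl

/-- The differential, as an operator on the total space. -/
def diffOp (K : CochainComplex (ModuleCat.{u} k) ℤ) : Total K →ₗ[k] Total K :=
  Total.pi fun q => (K.d (q - 1) q).hom ∘ₗ Total.proj (q - 1)

lemma proj_diffOp (m : Total K) {p q : ℤ} (h : p + 1 = q) :
    Total.proj q (diffOp K m) = K.d p q (Total.proj p m) := by
  obtain rfl : p = q - 1 := by omega
  rfl

lemma diffOp_comp_diffOp : diffOp K ∘ₗ diffOp K = 0 := LinearMap.ext totD_totD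

/-- The operator on the total spaces defined by a morphism of degree `i`. -/
def cochainOp (K L : CochainComplex (ModuleCat.{u} k) ℤ) (i : ℤ) :
    Cochain K L i →ₗ[k] Total K →ₗ[k] Total L where
  toFun z := Total.pi fun q => (z.v (q - i) q (by omega)).hom ∘ₗ Total.proj (q - i)
  map_add' z w := by ext m : 1; exact Total.ext fun q => by simp [Total.proj_pi]
  map_smul' c z := by ext m : 1; exact Total.ext fun q => by simp [Total.proj_pi]

lemma proj_cochainOp {i : ℤ} (z : Cochain K L i) (m : Total K) {p q : ℤ} (h : p + i = q) :
    Total.proj q (cochainOp K L i z m) = z.v p q h (Total.proj p m) := by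
  obtain rfl : p = q - i := by omega
  rfl

lemma cochainOp_comp {i j l : ℤ} (z : Cochain K L i) (w : Cochain L N j) (h : i + j = l) :
    cochainOp K N l (z.comp w h) = cochainOp L N j w ∘ₗ cochainOp K L i z := by
  refine LinearMap.ext fun m => Total.ext fun q => ?_
  rw [proj_cochainOp _ _ (show q - l + l = q by omega), LinearMap.comp_apply,
    proj_cochainOp _ _ (show q - j + j = q by omega),
    proj_cochainOp _ _ (show q - l + i = q - j by omega),
    Cochain.comp_v z w h (q - l) (q - j) q (by omega) (by omega)]
  rfl

lemma cochainOp_id : cochainOp K K 0 (Cochain.ofHom (𝟙 K)) = LinearMap.id := by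
  refine LinearMap.ext fun m => Total.ext fun q => ?_
  rw [proj_cochainOp _ _ (add_zero q)]
  simp

lemma cochainOp_δ {i j : ℤ} (h : i + 1 = j) (z : Cochain K L i) :
    cochainOp K L j (δ i j z) =
      diffOp L ∘ₗ cochainOp K L i z - sgn k i • cochainOp K L i z ∘ₗ diffOp K := by
  refine LinearMap.ext fun m => Total.ext fun q => ?_
  rw [proj_cochainOp _ _ (show q - j + j = q by omega),
    δ_v i j h z (q - j) q (by omega) (q - 1) (q - j + 1) rfl rfl, LinearMap.sub_apply,
    LinearMap.smul_apply, LinearMap.comp_apply, LinearMap.comp_apply, map_sub, map_smul,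
    proj_diffOp _ (show q - 1 + 1 = q by omega),
    proj_cochainOp _ _ (show q - j + i = q - 1 by omega),
    proj_cochainOp _ _ (show q - j + 1 + i = q by omega), proj_diffOp _ rfl, negOnePow_smul k]
  subst h
  simp [sgn_add, sgn_one, sub_eq_add_neg]

/-- The operators of the parity of `i`: they commute with the grading operator up to `(-1)^i`. The
Koszul signs depend on the parity only, so no operator on a total space is required to be
homogeneous. -/
def HasParity (i : ℤ) (X : Total K →ₗ[k] Total L) : Prop :=
  gradeOp L ∘ₗ X = sgn k i • X ∘ₗ gradeOp K

lemma hasParity_cochainOp {i : ℤ} (z : Cochain K L i) : HasParity i (cochainOp K L i z) := by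
  refine LinearMap.ext fun m => Total.ext fun q => ?_
  rw [LinearMap.comp_apply, proj_gradeOp, LinearMap.smul_apply, LinearMap.comp_apply, map_smul,
    proj_cochainOp _ _ (show q - i + i = q by omega),
    proj_cochainOp _ _ (show q - i + i = q by omega), proj_gradeOp,
    map_smul, smul_smul, ← sgn_add]
  congr 2; ring

lemma hasParity_diffOp : HasParity 1 (diffOp K) := by
  refine LinearMap.ext fun m => Total.ext fun q => ?_
  rw [LinearMap.comp_apply, proj_gradeOp, LinearMap.smul_apply, LinearMap.comp_apply, map_smul,
    proj_diffOp _ (show q - 1 + 1 = q by omega), proj_diffOp _ (show q - 1 + 1 = q by omega),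
    proj_gradeOp, map_smul, smul_smul, ← sgn_add]
  congr 2; ring

namespace HasParity

lemma comp {i j : ℤ} {X : Total L →ₗ[k] Total N} {Y : Total K →ₗ[k] Total L} (hX : HasParity i X)
    (hY : HasParity j Y) : HasParity (i + j) (X ∘ₗ Y) := by
  unfold HasParity at *
  rw [← LinearMap.comp_assoc, hX, LinearMap.smul_comp, LinearMap.comp_assoc, hY, sgn_add,
    LinearMap.comp_smul, smul_smul, LinearMap.comp_assoc]

lemma add {i : ℤ} {X Y : Total K →ₗ[k] Total L} (hX : HasParity i X) (hY : HasParity i Y) :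
    HasParity i (X + Y) := by
  unfold HasParity at *
  rw [LinearMap.comp_add, hX, hY, LinearMap.add_comp, smul_add]

lemma smul {i : ℤ} {X : Total K →ₗ[k] Total L} (hX : HasParity i X) (c : k) :
    HasParity i (c • X) := by
  unfold HasParity at *
  rw [LinearMap.comp_smul, hX, LinearMap.smul_comp, smul_comm]

lemma neg {i : ℤ} {X : Total K →ₗ[k] Total L} (hX : HasParity i X) : HasParity i (-X) := by
  simpa only [neg_smul, one_smul] using hX.smul (-1)

lemma sub {i : ℤ} {X Y : Total K →ₗ[k] Total L} (hX : HasParity i X) (hY : HasParity i Y) :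
    HasParity i (X - Y) := by
  rw [sub_eq_add_neg]; exact hX.add hY.neg

lemma congr {i j : ℤ} {X : Total K →ₗ[k] Total L} (hX : HasParity i X) (h : sgn k i = sgn k j) :
    HasParity j X := by
  unfold HasParity at *
  rw [hX, h]

end HasParity

/-- The supertrace of an operator of finite rank, i.e. the trace of its composition with the grading
operator. -/
noncomputable def str (X : Total K →ₗ[k] Total K) : k := finiteRankTrace (gradeOp K ∘ₗ X)

lemma str_add {X Y : Total K →ₗ[k] Total K} (hX : IsFiniteRank X) (hY : IsFiniteRank Y) :
    str (X + Y) = str X + str Y := by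
  rw [str, LinearMap.comp_add, finiteRankTrace_add (hX.comp_left _) (hY.comp_left _)]; rfl

lemma str_smul {X : Total K →ₗ[k] Total K} (hX : IsFiniteRank X) (c : k) :
    str (c • X) = c * str X := by
  rw [str, LinearMap.comp_smul, finiteRankTrace_smul (hX.comp_left _)]; rfl

lemma str_zero : str (0 : Total K →ₗ[k] Total K) = 0 := by
  rw [str, LinearMap.comp_zero, finiteRankTrace_zero]

lemma str_neg {X : Total K →ₗ[k] Total K} (hX : IsFiniteRank X) : str (-X) = -str X := by
  simpa only [neg_smul, one_smul, neg_mul, one_mul] using str_smul hX (-1)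

lemma str_sub {X Y : Total K →ₗ[k] Total K} (hX : IsFiniteRank X) (hY : IsFiniteRank Y) :
    str (X - Y) = str X - str Y := by
  rw [sub_eq_add_neg, str_add hX hY.neg, str_neg hY, sub_eq_add_neg]

lemma sgn_of_even {i : ℤ} (h : Even i) : sgn k i = 1 := by simp [sgn, Int.negOnePow_even i h]

lemma sgn_of_odd {i : ℤ} (h : Odd i) : sgn k i = -1 := by simp [sgn, Int.negOnePow_odd i h]

/-- In characteristic other than two, the supertrace vanishes on operators of odd parity. -/
lemma str_eq_sgn_mul_str {i : ℤ} {X : Total K →ₗ[k] Total K} (hX : HasParity i X)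
    (h : IsFiniteRank X) : str X = sgn k i * str X := by
  have h1 : finiteRankTrace (X ∘ₗ gradeOp K) = str X := finiteRankTrace_comm h _
  conv_lhs => rw [str, hX, finiteRankTrace_smul (h.comp_right _), h1]

/-- The supertrace is graded cyclic. -/
lemma str_comm {i j : ℤ} {X : Total K →ₗ[k] Total L} {Y : Total L →ₗ[k] Total K}
    (hX : HasParity i X) (hY : HasParity j Y) (h : IsFiniteRank X ∨ IsFiniteRank Y) :
    str (X ∘ₗ Y) = sgn k (i * j) * str (Y ∘ₗ X) := by
  have hfr : IsFiniteRank (Y ∘ₗ X) := by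
    rcases h with h | h
    · exact h.comp_left _
    · exact h.comp_right _
  have h1 : str (X ∘ₗ Y) = sgn k i * finiteRankTrace (X ∘ₗ (gradeOp K ∘ₗ Y)) := by
    have h0 : IsFiniteRank (X ∘ₗ (gradeOp K ∘ₗ Y)) := by
      rcases h with h | h
      · exact h.comp_right _
      · exact (h.comp_left _).comp_left _
    rw [str, ← LinearMap.comp_assoc, hX, LinearMap.smul_comp, LinearMap.comp_assoc,
      finiteRankTrace_smul h0]
  have h2 : finiteRankTrace (X ∘ₗ (gradeOp K ∘ₗ Y)) = str (Y ∘ₗ X) := by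
    rw [str, ← LinearMap.comp_assoc]
    rcases h with h | h
    · rw [LinearMap.comp_assoc, finiteRankTrace_comm h, LinearMap.comp_assoc]
    · rw [LinearMap.comp_assoc, ← finiteRankTrace_comm (h.comp_left _), LinearMap.comp_assoc]
  have h3 := str_eq_sgn_mul_str (hY.comp hX) hfr
  rw [h1, h2]
  -- `(-1)^i` and `(-1)^(i * j)` differ only if `i` is odd and `j` is even, and then `Y ∘ₗ X` is odd
  rcases Int.even_or_odd i with hi | hi
  · rw [sgn_of_even hi, sgn_of_even (hi.mul_right j)]
  · rcases Int.even_or_odd j with hj | hj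
    · rw [sgn_of_odd (hj.add_odd hi)] at h3
      rw [sgn_of_odd hi, sgn_of_even (hj.mul_left i), one_mul]
      exact h3.symm
    · rw [sgn_of_odd hi, sgn_of_odd (hi.mul hj)]

/-- The supertrace vanishes on graded commutators with the differential. -/
lemma str_diffOp_comp {i : ℤ} {X : Total K →ₗ[k] Total K} (hX : HasParity i X)
    (h : IsFiniteRank X) : str (diffOp K ∘ₗ X) = sgn k i * str (X ∘ₗ diffOp K) := by
  rw [str_comm hasParity_diffOp hX (Or.inr h), one_mul]

lemma cochainOp_incl {i : ℤ} (z : Cochain K L i) {p q : ℤ} (h : p + i = q) (v : K.X p) :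
    cochainOp K L i z (Total.incl K p v) = Total.incl L q (z.v p q h v) := by
  refine Total.ext fun r => ?_
  rw [proj_cochainOp _ _ (show r - i + i = r by omega)]
  by_cases hr : q = r
  · subst hr
    obtain rfl : p = q - i := by omega
    rw [Total.proj_incl_self, Total.proj_incl_self]
  · rw [Total.proj_incl_of_ne hr, Total.proj_incl_of_ne (by omega), map_zero]

/-- A homogeneous operator of finite rank has finitely many nonzero components. -/
lemma finite_support_of_isFiniteRank {i : ℤ} (z : Cochain K L i)
    (h : IsFiniteRank (cochainOp K L i z)) : {p | z.v p (p + i) rfl ≠ 0}.Finite := by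
  classical
  have h1 : ∀ p : {p | z.v p (p + i) rfl ≠ 0}, ∃ v, z.v p.1 (p.1 + i) rfl v ≠ 0 := by
    rintro ⟨p, hp⟩
    by_contra! h0
    exact hp (ModuleCat.hom_ext (LinearMap.ext h0))
  choose v hv using h1
  -- one nonzero value in each degree of the support gives a linearly independent family in the range
  have h2 : LinearIndependent k fun p : {p | z.v p (p + i) rfl ≠ 0} =>
      (⟨cochainOp K L i z (Total.incl K p.1 (v p)), LinearMap.mem_range_self _ _⟩ :
        LinearMap.range (cochainOp K L i z)) := by
    rw [linearIndependent_iff']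
    intro s g hg p hp
    have h3 := congrArg (fun m => Total.proj (p.1 + i) ((LinearMap.range (cochainOp K L i z)).subtype m)) hg
    have h4 : ∀ x ∈ s, Total.proj (p.1 + i) ((LinearMap.range (cochainOp K L i z)).subtype (g x •
        (⟨cochainOp K L i z (Total.incl K x.1 (v x)),
        LinearMap.mem_range_self _ _⟩ : LinearMap.range (cochainOp K L i z)))) =
        if x = p then g p • z.v p.1 (p.1 + i) rfl (v p) else 0 := by
      intro x _
      rw [map_smul, map_smul]
      change g x • Total.proj _ (cochainOp K L i z (Total.incl K x.1 (v x))) = _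
      rw [cochainOp_incl z rfl]
      split_ifs with hx
      · subst hx; rw [Total.proj_incl_self]
      · rw [Total.proj_incl_of_ne (fun e => hx (Subtype.ext (by omega))), smul_zero]
    simp only [map_sum, map_zero] at h3
    rw [Finset.sum_congr rfl h4, Finset.sum_ite_eq' s p, if_pos hp] at h3
    exact (smul_eq_zero.1 h3).resolve_right (hv p)
  have : Module.Finite k (LinearMap.range (cochainOp K L i z)) := h
  exact h2.finite_of_isNoetherian

lemma isFiniteRank_component {i : ℤ} (z : Cochain K L i)
    (h : IsFiniteRank (cochainOp K L i z)) {p q : ℤ} (hpq : p + i = q) :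
    IsFiniteRank (z.v p q hpq).hom := by
  have e : (z.v p q hpq).hom = Total.proj q ∘ₗ cochainOp K L i z ∘ₗ Total.incl K p := by
    ext v
    rw [LinearMap.comp_apply, LinearMap.comp_apply, cochainOp_incl z hpq, Total.proj_incl_self]
  rw [e]
  exact (h.comp_right _).comp_left _

lemma cochainOp_eq_sum {i : ℤ} (z : Cochain K L i) (s : Finset ℤ)
    (hs : ∀ p, z.v p (p + i) rfl ≠ 0 → p ∈ s) :
    cochainOp K L i z =
      ∑ p ∈ s, Total.incl L (p + i) ∘ₗ (z.v p (p + i) rfl).hom ∘ₗ Total.proj p := by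
  refine LinearMap.ext fun m => Total.ext fun q => ?_
  obtain ⟨p, rfl⟩ : ∃ p, q = p + i := ⟨q - i, by ring⟩
  rw [proj_cochainOp z m rfl, LinearMap.sum_apply, map_sum]
  simp only [LinearMap.comp_apply]
  rw [Finset.sum_eq_single p, Total.proj_incl_self]
  · intro r _ hr
    rw [Total.proj_incl_of_ne (by omega)]
  · intro hp
    have : z.v p (p + i) rfl = 0 := by
      by_contra h0
      exact hp (hs p h0)
    rw [Total.proj_incl_self, this]; rfl

lemma gradeOp_comp_incl (q : ℤ) :
    gradeOp K ∘ₗ Total.incl K q = sgn k q • Total.incl K q := by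
  refine LinearMap.ext fun v => Total.ext fun r => ?_
  rw [LinearMap.comp_apply, proj_gradeOp, LinearMap.smul_apply, map_smul]
  by_cases h : q = r
  · subst h; rfl
  · rw [Total.proj_incl_of_ne h, smul_zero, smul_zero]

/-- The supertrace of a homogeneous operator of finite rank in terms of its components. -/
lemma str_cochainOp {i : ℤ} (z : Cochain K K i) (h : IsFiniteRank (cochainOp K K i z))
    (s : Finset ℤ) (hs : ∀ p, z.v p (p + i) rfl ≠ 0 → p ∈ s) :
    str (cochainOp K K i z) = ∑ p ∈ s, sgn k (p + i) *
      finiteRankTrace ((Total.proj p ∘ₗ Total.incl K (p + i)) ∘ₗ (z.v p (p + i) rfl).hom) := by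
  have hp : ∀ p, IsFiniteRank (z.v p (p + i) rfl).hom := fun p => isFiniteRank_component z h rfl
  have e : gradeOp K ∘ₗ cochainOp K K i z = ∑ p ∈ s,
      gradeOp K ∘ₗ Total.incl K (p + i) ∘ₗ (z.v p (p + i) rfl).hom ∘ₗ Total.proj p := by
    rw [cochainOp_eq_sum z s hs]
    exact LinearMap.ext fun m => by simp only [LinearMap.comp_apply, LinearMap.sum_apply, map_sum]
  rw [str, e, finiteRankTrace_sum _ fun p _ =>
    (((hp p).comp_right _).comp_left _).comp_left _]
  refine Finset.sum_congr rfl fun p _ => ?_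
  rw [← LinearMap.comp_assoc, gradeOp_comp_incl, LinearMap.smul_comp,
    finiteRankTrace_smul (((hp p).comp_right _).comp_left _), ← LinearMap.comp_assoc,
    finiteRankTrace_comm ((hp p).comp_left _), LinearMap.comp_assoc]

/-- The supertrace vanishes on operators of nonzero degree. Hence the case distinction in
`traceFunctional` disappears on total spaces. -/
lemma str_cochainOp_of_ne_zero {i : ℤ} (hi : i ≠ 0) (z : Cochain K K i)
    (h : IsFiniteRank (cochainOp K K i z)) : str (cochainOp K K i z) = 0 := by
  rw [str_cochainOp z h (finite_support_of_isFiniteRank z h).toFinset fun p hp => by simpa using hp]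
  refine Finset.sum_eq_zero fun p _ => ?_
  have h0 : Total.proj p ∘ₗ Total.incl K (p + i) = 0 :=
    LinearMap.ext fun v => Total.proj_incl_of_ne (by omega) v
  rw [h0, LinearMap.zero_comp, finiteRankTrace_zero, mul_zero]

/-- On operators of degree `0` and of finite rank, `supertrace` is the supertrace on the total space. -/
lemma supertrace_eq_str (z : Cochain K K 0) (h : IsFiniteRank (cochainOp K K 0 z)) :
    supertrace z = str (cochainOp K K 0 z) := by
  have key : ∀ p q (hpq : p + 0 = q) (hqp : q = p), sgn k q *
      finiteRankTrace ((Total.proj p ∘ₗ Total.incl K q) ∘ₗ (z.v p q hpq).hom) =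
      sgn k p * finiteRankTrace (z.v p p (add_zero p)).hom := by
    rintro p q hpq rfl
    have h0 : Total.proj q ∘ₗ Total.incl K q = LinearMap.id :=
      LinearMap.ext fun v => Total.proj_incl_self q v
    rw [h0, LinearMap.id_comp]
  rw [str_cochainOp z h (finite_support_of_isFiniteRank z h).toFinset fun p hp => by simpa using hp]
  rw [Finset.sum_congr rfl fun p _ => key p (p + 0) rfl (add_zero p)]
  refine finsum_eq_sum_of_support_subset _ fun p hp => ?_
  rw [Set.Finite.coe_toFinset]
  intro h0
  refine hp ?_
  have key2 : ∀ q (hpq : p + 0 = q), z.v p (p + 0) rfl = 0 → z.v p q hpq = 0 := by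
    rintro q rfl h; exact h
  dsimp only
  rw [key2 p (add_zero p) h0]
  change _ * finiteRankTrace 0 = 0
  rw [finiteRankTrace_zero, mul_zero]

end Operators

lemma sgn_eq_one_or (i : ℤ) : sgn k i = 1 ∨ sgn k i = -1 := by
  rcases Int.even_or_odd i with h | h
  · exact Or.inl (sgn_of_even h)
  · exact Or.inr (sgn_of_odd h)

open BarWord

section Linear
variable {A : DGCategory k} {U W Z : Type u} [AddCommGroup U] [Module k U] [AddCommGroup W]
  [Module k W] [AddCommGroup Z] [Module k Z] {x y : A.Obj} (w : BarWord A x y)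

lemma comp_bdry (X : W →ₗ[k] Z) (F : BarWord A x y → (U →ₗ[k] W)) :
    X ∘ₗ bdry w F = bdry w fun v => X ∘ₗ F v := BarWord.bdry_lin (LinearMap.llcomp k U W Z X) w F

lemma bdry_comp (X : U →ₗ[k] W) (F : BarWord A x y → (W →ₗ[k] Z)) :
    bdry w F ∘ₗ X = bdry w fun v => F v ∘ₗ X :=
  BarWord.bdry_lin ((LinearMap.llcomp k U W Z).flip X) w F

lemma comp_first (X : W →ₗ[k] Z)
    (F : ∀ (z : A.Obj) (j : ℤ) (_ : (A.Hom z y).X j), BarWord A x z → (U →ₗ[k] W)) :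
    X ∘ₗ first w F = first w fun z j a v => X ∘ₗ F z j a v :=
  BarWord.first_lin (LinearMap.llcomp k U W Z X) w F

lemma first_comp (X : U →ₗ[k] W)
    (F : ∀ (z : A.Obj) (j : ℤ) (_ : (A.Hom z y).X j), BarWord A x z → (W →ₗ[k] Z)) :
    first w F ∘ₗ X = first w fun z j a v => F z j a v ∘ₗ X :=
  BarWord.first_lin ((LinearMap.llcomp k U W Z).flip X) w F

lemma comp_last (X : W →ₗ[k] Z)
    (F : ∀ (z : A.Obj), BarWord A z y → ∀ (j : ℤ) (_ : (A.Hom x z).X j), (U →ₗ[k] W)) :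
    X ∘ₗ last w F = last w fun z v j a => X ∘ₗ F z v j a :=
  BarWord.last_lin (LinearMap.llcomp k U W Z X) w F

lemma last_comp (X : U →ₗ[k] W)
    (F : ∀ (z : A.Obj), BarWord A z y → ∀ (j : ℤ) (_ : (A.Hom x z).X j), (W →ₗ[k] Z)) :
    last w F ∘ₗ X = last w fun z v j a => F z v j a ∘ₗ X :=
  BarWord.last_lin ((LinearMap.llcomp k U W Z).flip X) w F

end Linear

/-! ### Contractions and representations -/

/-- A contraction of a complex as an operator on the total space. -/
structure OpContraction (K : CochainComplex (ModuleCat.{u} k) ℤ) where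
  h : Total K →ₗ[k] Total K
  h_h : h ∘ₗ h = 0
  h_d_h : h ∘ₗ diffOp K ∘ₗ h = h
  d_h_d : diffOp K ∘ₗ h ∘ₗ diffOp K = diffOp K
  parity : HasParity (-1) h

namespace OpContraction
variable {K : CochainComplex (ModuleCat.{u} k) ℤ} (C : OpContraction K)

/-- The projector onto a space of representatives of the cohomology. -/
noncomputable def e : Total K →ₗ[k] Total K :=
  LinearMap.id - diffOp K ∘ₗ C.h - C.h ∘ₗ diffOp K

lemma h_e : C.h ∘ₗ C.e = 0 := by
  rw [e, LinearMap.comp_sub, LinearMap.comp_sub, C.h_d_h, ← LinearMap.comp_assoc (diffOp K), C.h_h]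
  simp

lemma e_h : C.e ∘ₗ C.h = 0 := by
  rw [e, LinearMap.sub_comp, LinearMap.sub_comp, LinearMap.comp_assoc, LinearMap.comp_assoc,
    C.h_d_h, C.h_h]
  simp

lemma d_e : diffOp K ∘ₗ C.e = 0 := by
  rw [e, LinearMap.comp_sub, LinearMap.comp_sub, C.d_h_d, ← LinearMap.comp_assoc C.h,
    diffOp_comp_diffOp]
  simp

lemma e_d : C.e ∘ₗ diffOp K = 0 := by
  rw [e, LinearMap.sub_comp, LinearMap.sub_comp, LinearMap.comp_assoc, LinearMap.comp_assoc,
    C.d_h_d, diffOp_comp_diffOp]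
  simp

lemma d_h : diffOp K ∘ₗ C.h = LinearMap.id - C.e - C.h ∘ₗ diffOp K := by
  rw [e]; abel

lemma parity_e : HasParity 0 C.e := by
  have h1 : HasParity (K := K) (L := K) 0 LinearMap.id := by simp [HasParity, sgn_zero]
  exact (h1.sub (hasParity_diffOp.comp C.parity)).sub (C.parity.comp hasParity_diffOp)

end OpContraction

/-- A dg functor from a dg category to complexes, in terms of operators on total spaces. -/
structure DGRep (E : DGCategory k) where
  K : E.Obj → CochainComplex (ModuleCat.{u} k) ℤ
  op : ∀ {x y : E.Obj} {i : ℤ}, (E.Hom x y).X i →ₗ[k] Total (K x) →ₗ[k] Total (K y)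
  op_comp : ∀ {x y z : E.Obj} {i j l : ℤ} (h : i + j = l) (f : (E.Hom y z).X i)
    (g : (E.Hom x y).X j), op (E.comp h f g) = op f ∘ₗ op g
  op_one : ∀ x, op (E.one x) = LinearMap.id
  op_d : ∀ {x y : E.Obj} {i : ℤ} (f : (E.Hom x y).X i), op ((E.Hom x y).d i (i + 1) f) =
    diffOp (K y) ∘ₗ op f - sgn k i • op f ∘ₗ diffOp (K x)
  parity : ∀ {x y : E.Obj} {i : ℤ} (f : (E.Hom x y).X i), HasParity i (op f)

/-! ### The perturbed contraction -/

section Perturbation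
variable {E : DGCategory k} (R : DGRep E) (C : ∀ x, OpContraction (R.K x))

/-- The perturbed homotopy `± h f₁ h f₂ ⋯ f_m h` with the sign `(-1)^{(|f₁| - 1) + … + (|f_m| - 1)}`. -/
noncomputable def hWord {x : E.Obj} : ∀ {y : E.Obj}, BarWord E x y →
    (Total (R.K x) →ₗ[k] Total (R.K y))
  | _, .nil _ => (C x).h
  | _, .cons (z := z) i f w => -sgn k i • (C z).h ∘ₗ R.op f ∘ₗ hWord w

/-- The perturbed projector `∑ ± h f₁ h ⋯ f_i e f_{i+1} h ⋯ f_m h`. -/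
noncomputable def gWord {x : E.Obj} : ∀ {y : E.Obj}, BarWord E x y →
    (Total (R.K x) →ₗ[k] Total (R.K y))
  | _, .nil _ => (C x).e
  | _, .cons (z := z) i f w => -sgn k i • (C z).e ∘ₗ R.op f ∘ₗ hWord R C w +
      (C z).h ∘ₗ R.op f ∘ₗ gWord w

/-- The cochain on bar words whose value on empty words is the identity, and `0` on all others. -/
def unitWord {x : E.Obj} : ∀ {y : E.Obj}, BarWord E x y → (Total (R.K x) →ₗ[k] Total (R.K y))
  | _, .nil _ => LinearMap.id
  | _, .cons _ _ _ => 0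

variable {x y z : E.Obj}

@[simp] lemma hWord_nil (x : E.Obj) : hWord R C (nil x) = (C x).h := by simp [hWord]

@[simp] lemma gWord_nil (x : E.Obj) : gWord R C (nil x) = (C x).e := by simp [gWord]

lemma hWord_cons (i : ℤ) (f : (E.Hom y z).X i) (w : BarWord E x y) :
    hWord R C (cons i f w) = -sgn k i • (C z).h ∘ₗ R.op f ∘ₗ hWord R C w := by
  rw [hWord]

lemma gWord_cons (i : ℤ) (f : (E.Hom y z).X i) (w : BarWord E x y) :
    gWord R C (cons i f w) = -sgn k i • (C z).e ∘ₗ R.op f ∘ₗ hWord R C w +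
      (C z).h ∘ₗ R.op f ∘ₗ gWord R C w := by
  rw [gWord]

lemma hasParity_hWord (w : BarWord E x y) : HasParity (deg w - 1) (hWord R C w) := by
  induction w with
  | nil => rw [hWord_nil]; exact (C _).parity
  | cons i f w ih =>
    rw [hWord_cons]
    refine (((C _).parity.comp ((R.parity f).comp ih)).smul _).congr ?_
    rw [deg]; congr 1; ring

lemma hasParity_gWord (w : BarWord E x y) : HasParity (deg w) (gWord R C w) := by
  induction w with
  | nil => rw [gWord_nil]; exact (C _).parity_e
  | cons i f w ih =>
    rw [gWord_cons]
    refine HasParity.add ((((C _).parity_e.comp ((R.parity f).comp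
      (hasParity_hWord R C w))).smul _).congr ?_) (((C _).parity.comp ((R.parity f).comp ih)).congr ?_)
    · rw [deg]; congr 1; ring
    · rw [deg]; congr 1; ring

lemma isFiniteRank_gWord (hC : ∀ x, IsFiniteRank (C x).e) (w : BarWord E x y) :
    IsFiniteRank (gWord R C w) := by
  induction w with
  | nil => rw [gWord_nil]; exact hC _
  | cons i f w ih =>
    rw [gWord_cons]
    exact (((hC _).comp_right _).smul _).add ((ih.comp_left _).comp_left _)

lemma last_cons_hWord (i : ℤ) (f : (E.Hom y z).X i) (w : BarWord E x y) :
    last (cons i f w) (fun _ v _ g => sgn k (deg v) • hWord R C v ∘ₗ R.op g) =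
      (C z).h ∘ₗ R.op f ∘ₗ
        (last w (fun _ v _ g => sgn k (deg v) • hWord R C v ∘ₗ R.op g) + unitWord R w) := by
  cases w with
  | nil => simp [unitWord, deg, sgn_zero]
  | cons j g w =>
    rw [last_cons_cons, unitWord, add_zero, comp_last, comp_last]
    refine last_congr _ fun z v l e => ?_
    simp only [deg, hWord_cons, LinearMap.comp_smul, LinearMap.smul_comp, LinearMap.comp_assoc,
      smul_smul, sgn_add, sgn_sub, sgn_one]
    congr 1
    linear_combination sgn k (deg v) * sgn_mul_self k i

lemma first_hWord_comp (i : ℤ) (f : (E.Hom y z).X i) (w : BarWord E x y) :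
    first w (fun _ j b v => hWord R C (cons (i + j) (E.comp rfl f b) v)) =
      -sgn k i • (C z).h ∘ₗ R.op f ∘ₗ first w (fun _ j b v => sgn k j • R.op b ∘ₗ hWord R C v) := by
  rw [comp_first, comp_first, ← first_smul]
  simp only [hWord_cons, R.op_comp, sgn_add, LinearMap.comp_smul, smul_smul,
    LinearMap.comp_assoc, neg_mul]

lemma bdry_hWord_cons (i : ℤ) (f : (E.Hom y z).X i) (w : BarWord E x y) :
    bdry w (fun v => hWord R C (cons i f v)) =
      -sgn k i • (C z).h ∘ₗ R.op f ∘ₗ bdry w (hWord R C) := by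
  rw [comp_bdry, comp_bdry, ← bdry_smul]
  simp only [hWord_cons]

/-- The perturbed homotopy is a null homotopy of `1 - G`, where `G` is the perturbed projector. -/
lemma hochschild_hWord (w : BarWord E x y) :
    diffOp (R.K y) ∘ₗ hWord R C w + sgn k (deg w) • hWord R C w ∘ₗ diffOp (R.K x) +
      bdry w (hWord R C) + first w (fun _ i f v => sgn k i • R.op f ∘ₗ hWord R C v) -
      last w (fun _ v _ f => sgn k (deg v) • hWord R C v ∘ₗ R.op f) =
    unitWord R w - gWord R C w := by
  induction w with
  | nil =>
    simp only [hWord_nil, gWord_nil, bdry_nil, first_nil, last_nil, unitWord, deg, sgn_zero,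
      OpContraction.d_h]
    module
  | cons i f w ih =>
    rw [last_cons_hWord, bdry_cons, first_hWord_comp, bdry_hWord_cons, first_cons, hWord_cons,
      hWord_cons, gWord_cons, R.op_d, unitWord, deg]
    have ih' := congrArg (fun X => (C _).h ∘ₗ R.op f ∘ₗ X) ih
    have hd := congrArg (fun X => X ∘ₗ R.op f ∘ₗ hWord R C w) ((C _).d_h)
    simp only [LinearMap.comp_add, LinearMap.comp_sub, LinearMap.comp_smul,
      LinearMap.sub_comp, LinearMap.smul_comp, LinearMap.comp_assoc, LinearMap.id_comp,
      sgn_add, sgn_sub, sgn_one] at ih' hd ⊢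
    rw [hd]
    rcases sgn_eq_one_or (k := k) i with h | h <;> simp only [h] at ih' ⊢ <;>
    linear_combination (norm := module) ih'

lemma last_cons_gWord (i : ℤ) (f : (E.Hom y z).X i) (w : BarWord E x y) :
    last (cons i f w) (fun _ v _ g => sgn k (deg v) • gWord R C v ∘ₗ R.op g) =
      (C z).e ∘ₗ R.op f ∘ₗ
        (last w (fun _ v _ g => sgn k (deg v) • hWord R C v ∘ₗ R.op g) + unitWord R w) +
      -sgn k i • (C z).h ∘ₗ R.op f ∘ₗ
        last w (fun _ v _ g => sgn k (deg v) • gWord R C v ∘ₗ R.op g) := by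
  cases w with
  | nil => simp [unitWord, deg, sgn_zero]
  | cons j g w =>
    rw [last_cons_cons, unitWord, add_zero, comp_last, comp_last, comp_last, comp_last,
      ← last_smul, ← last_add]
    refine last_congr _ fun z v l e => ?_
    simp only [deg, gWord_cons, LinearMap.comp_smul, LinearMap.smul_comp, LinearMap.comp_assoc,
      smul_smul, sgn_add, sgn_sub, sgn_one, LinearMap.add_comp]
    rcases sgn_eq_one_or (k := k) i with h | h <;> simp only [h] <;> module

lemma first_gWord_comp (i : ℤ) (f : (E.Hom y z).X i) (w : BarWord E x y) :
    first w (fun _ j b v => gWord R C (cons (i + j) (E.comp rfl f b) v)) =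
      -sgn k i • (C z).e ∘ₗ R.op f ∘ₗ first w (fun _ j b v => sgn k j • R.op b ∘ₗ hWord R C v) +
      (C z).h ∘ₗ R.op f ∘ₗ first w (fun _ _ b v => R.op b ∘ₗ gWord R C v) := by
  rw [comp_first, comp_first, comp_first, comp_first, ← first_smul, ← first_add]
  simp only [gWord_cons, R.op_comp, sgn_add, LinearMap.comp_smul, smul_smul,
    LinearMap.comp_assoc, neg_mul]

lemma bdry_gWord_cons (i : ℤ) (f : (E.Hom y z).X i) (w : BarWord E x y) :
    bdry w (fun v => gWord R C (cons i f v)) =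
      -sgn k i • (C z).e ∘ₗ R.op f ∘ₗ bdry w (hWord R C) +
        (C z).h ∘ₗ R.op f ∘ₗ bdry w (gWord R C) := by
  rw [comp_bdry, comp_bdry, comp_bdry, comp_bdry, ← bdry_smul, ← bdry_add]
  simp only [gWord_cons]

/-- The perturbed projector is a Hochschild cocycle. -/
lemma hochschild_gWord (w : BarWord E x y) :
    diffOp (R.K y) ∘ₗ gWord R C w - sgn k (deg w) • gWord R C w ∘ₗ diffOp (R.K x) =
      bdry w (gWord R C) + first w (fun _ _ f v => R.op f ∘ₗ gWord R C v) -
      last w (fun _ v _ f => sgn k (deg v) • gWord R C v ∘ₗ R.op f) := by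
  induction w with
  | nil => simp [(C _).d_e, (C _).e_d]
  | cons i f w ih =>
    rw [last_cons_gWord, bdry_cons, first_gWord_comp, bdry_gWord_cons, first_cons, gWord_cons,
      gWord_cons, R.op_d, deg]
    have hw := congrArg (fun X => (C _).e ∘ₗ R.op f ∘ₗ X) (hochschild_hWord R C w)
    have ih' := congrArg (fun X => (C _).h ∘ₗ R.op f ∘ₗ X) ih
    have hd := fun X : Total (R.K x) →ₗ[k] _ => congrArg (fun Y => Y ∘ₗ R.op f ∘ₗ X) ((C _).d_h)
    have h1 := fun X : Total (R.K x) →ₗ[k] _ => congrArg (fun Y => Y ∘ₗ R.op f ∘ₗ X) ((C _).d_e)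
    have h2 := fun X : Total (R.K x) →ₗ[k] _ => congrArg (fun Y => Y ∘ₗ R.op f ∘ₗ X) ((C _).e_d)
    simp only [LinearMap.comp_add, LinearMap.comp_sub, LinearMap.comp_smul, LinearMap.add_comp,
      LinearMap.sub_comp, LinearMap.smul_comp, LinearMap.comp_assoc, LinearMap.id_comp,
      LinearMap.zero_comp, sgn_add, sgn_sub, sgn_one] at ih' hd hw h1 h2 ⊢
    rw [hd, h1, h2]
    rcases sgn_eq_one_or (k := k) i with h | h <;> simp only [h] at ih' hw ⊢
    · linear_combination (norm := module) -ih' - hw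
    · linear_combination (norm := module) ih' - hw

lemma hWord_append (v : BarWord E y z) {j : ℤ} {t : E.Obj} (f : (E.Hom x y).X j)
    (w : BarWord E t x) : hWord R C (append v (cons j f w)) =
      -sgn k j • hWord R C v ∘ₗ R.op f ∘ₗ hWord R C w := by
  induction v with
  | nil => rw [append, hWord_cons, hWord_nil]
  | cons i g v ih =>
    rw [append, hWord_cons, ih, hWord_cons]
    simp only [LinearMap.comp_smul, LinearMap.smul_comp, LinearMap.comp_assoc]
    module

lemma gWord_append (v : BarWord E y z) {j : ℤ} {t : E.Obj} (f : (E.Hom x y).X j)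
    (w : BarWord E t x) : gWord R C (append v (cons j f w)) =
      -sgn k j • gWord R C v ∘ₗ R.op f ∘ₗ hWord R C w +
        sgn k (deg v) • hWord R C v ∘ₗ R.op f ∘ₗ gWord R C w := by
  induction v with
  | nil => rw [append, gWord_cons, hWord_nil, gWord_nil, deg, sgn_zero, one_smul]
  | cons i g v ih =>
    rw [append, gWord_cons, ih, hWord_append, gWord_cons, hWord_cons, deg]
    simp only [LinearMap.comp_smul, LinearMap.smul_comp, LinearMap.comp_assoc, LinearMap.comp_add,
      LinearMap.add_comp, sgn_add, sgn_sub, sgn_one]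
    rcases sgn_eq_one_or (k := k) i with h | h <;> simp only [h] <;> module

lemma h_comp_hWord (w : BarWord E x y) : (C y).h ∘ₗ hWord R C w = 0 := by
  cases w with
  | nil => rw [hWord_nil, (C _).h_h]
  | cons i f w => rw [hWord_cons, LinearMap.comp_smul, ← LinearMap.comp_assoc, (C _).h_h]; simp

lemma e_comp_hWord (w : BarWord E x y) : (C y).e ∘ₗ hWord R C w = 0 := by
  cases w with
  | nil => rw [hWord_nil, (C _).e_h]
  | cons i f w => rw [hWord_cons, LinearMap.comp_smul, ← LinearMap.comp_assoc, (C _).e_h]; simp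

lemma h_comp_gWord (w : BarWord E x y) : (C y).h ∘ₗ gWord R C w = 0 := by
  cases w with
  | nil => rw [gWord_nil, (C _).h_e]
  | cons i f w =>
    rw [gWord_cons, LinearMap.comp_add, LinearMap.comp_smul, ← LinearMap.comp_assoc, (C _).h_e,
      ← LinearMap.comp_assoc (R.op f ∘ₗ _), (C _).h_h]
    simp

lemma isNormalized_hWord : IsNormalized (hWord R C : BarWord E x y → _) where
  lin h := by
    induction h with
    | head i a b w =>
      simp only [hWord_cons, map_add, map_smul, LinearMap.add_comp, LinearMap.comp_add,
        LinearMap.smul_comp, LinearMap.comp_smul]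
      module
    | tail i a h ih =>
      simp only [hWord_cons, ih, LinearMap.comp_add, LinearMap.comp_smul]
      module
  degenerate h := by
    induction h with
    | head w => rw [hWord_cons, R.op_one, LinearMap.id_comp, h_comp_hWord, smul_zero]
    | tail i a h ih => rw [hWord_cons, ih]; simp

lemma isNormalized_gWord : IsNormalized (gWord R C : BarWord E x y → _) where
  lin h := by
    induction h with
    | head i a b w =>
      simp only [gWord_cons, map_add, map_smul, LinearMap.add_comp, LinearMap.comp_add,
        LinearMap.smul_comp, LinearMap.comp_smul]
      module
    | tail i a h ih =>
      simp only [gWord_cons, ih, (isNormalized_hWord R C).lin h, LinearMap.comp_add,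
        LinearMap.comp_smul]
      module
  degenerate h := by
    induction h with
    | head w =>
      rw [gWord_cons, R.op_one, LinearMap.id_comp, LinearMap.id_comp, e_comp_hWord, h_comp_gWord,
        smul_zero, add_zero]
    | tail i a h ih => rw [gWord_cons, ih, (isNormalized_hWord R C).degenerate h]; simp

end Perturbation

/-! ### The trace functional on Hochschild words -/

section TraceFunctional

/-- The supertrace extends to a linear functional on all operators. The extension is not canonical; it
serves to evaluate the supertrace on sums by linearity. -/
lemma exists_linear_extension_str (K : CochainComplex (ModuleCat.{u} k) ℤ) :
    ∃ S : (Total K →ₗ[k] Total K) →ₗ[k] k, ∀ X, IsFiniteRank X → S X = str X := by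
  let p : Submodule k (Total K →ₗ[k] Total K) :=
    { carrier := {X | IsFiniteRank X}
      zero_mem' := IsFiniteRank.zero
      add_mem' := fun h h' => h.add h'
      smul_mem' := fun c _ h => h.smul c }
  let T : p →ₗ[k] k :=
    { toFun := fun X => str X.1
      map_add' := fun X Y => str_add X.2 Y.2
      map_smul' := fun c X => str_smul X.2 c }
  obtain ⟨S, hS⟩ := T.exists_extend
  exact ⟨S, fun X hX => LinearMap.congr_fun hS ⟨X, hX⟩⟩

variable {E : DGCategory k} (R : DGRep E) (C : ∀ x, OpContraction (R.K x))
  {x y z : E.Obj}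

/-- The functional `f₀[f₁ | … | f_m] ↦ str(f₀ ∑ ± h f₁ h ⋯ f_i e f_{i+1} h ⋯ f_m h)`. -/
noncomputable def strWord {i : ℤ} (f : (E.Hom y x).X i) (w : BarWord E x y) : k :=
  str (R.op f ∘ₗ gWord R C w)

variable (hC : ∀ x, IsFiniteRank (C x).e)
include hC

lemma isFiniteRank_op_comp_gWord {i : ℤ} (f : (E.Hom y z).X i) (w : BarWord E x y) :
    IsFiniteRank (R.op f ∘ₗ gWord R C w) := (isFiniteRank_gWord R C hC w).comp_left _

lemma strWord_add {i : ℤ} (f g : (E.Hom y x).X i) (w : BarWord E x y) :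
    strWord R C (f + g) w = strWord R C f w + strWord R C g w := by
  rw [strWord, map_add, LinearMap.add_comp, str_add (isFiniteRank_op_comp_gWord R C hC _ _)
    (isFiniteRank_op_comp_gWord R C hC _ _)]
  rfl

lemma strWord_smul {i : ℤ} (c : k) (f : (E.Hom y x).X i) (w : BarWord E x y) :
    strWord R C (c • f) w = c * strWord R C f w := by
  rw [strWord, map_smul, LinearMap.smul_comp, str_smul (isFiniteRank_op_comp_gWord R C hC _ _)]
  rfl

lemma isNormalized_strWord {i : ℤ} (f : (E.Hom y x).X i) :
    IsNormalized (strWord R C f) where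
  lin {c w w₁ w₂} h := by
    rw [strWord, (isNormalized_gWord R C).lin h, LinearMap.comp_add, LinearMap.comp_smul,
      str_add (isFiniteRank_op_comp_gWord R C hC _ _)
        ((isFiniteRank_op_comp_gWord R C hC _ _).smul _),
      str_smul (isFiniteRank_op_comp_gWord R C hC _ _)]
    rfl
  degenerate h := by
    rw [strWord, (isNormalized_gWord R C).degenerate h, LinearMap.comp_zero, str_zero]

/-- The trace functional vanishes on Hochschild boundaries. -/
lemma strWord_hochB {i : ℤ} (f : (E.Hom y x).X i) (w : BarWord E x y) :
    strWord R C ((E.Hom y x).d i (i + 1) f) w + sgn k i • bdry w (strWord R C f) +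
      sgn k i • first w (fun _ _ a v => strWord R C (E.comp rfl f a) v) -
      last w (fun _ v j a => sgn k ((j - 1) * (i + deg v)) • strWord R C (E.comp rfl a f) v) = 0 := by
  obtain ⟨S, hS⟩ := exists_linear_extension_str (R.K x)
  have hS' : ∀ {t : E.Obj} {j : ℤ} (g : (E.Hom t x).X j) (w : BarWord E x t),
      strWord R C g w = S (R.op g ∘ₗ gWord R C w) := fun g w => (hS _ (isFiniteRank_op_comp_gWord R C hC _ _)).symm
  have hfw := isFiniteRank_op_comp_gWord R C hC f w
  have hb : bdry w (strWord R C f) = S (R.op f ∘ₗ bdry w (gWord R C)) := by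
    rw [comp_bdry, BarWord.bdry_lin]
    exact congrArg _ (funext fun v => hS' f v)
  have hf : first w (fun _ _ a v => strWord R C (E.comp rfl f a) v) =
      S (R.op f ∘ₗ first w (fun _ _ f v => R.op f ∘ₗ gWord R C v)) := by
    rw [comp_first, BarWord.first_lin]
    refine first_congr w fun z j a v _ => ?_
    rw [hS', R.op_comp, LinearMap.comp_assoc]
  have hl : last w (fun _ v j a =>
      sgn k ((j - 1) * (i + deg v)) • strWord R C (E.comp rfl a f) v) =
      sgn k i • S (R.op f ∘ₗ last w (fun _ v _ f => sgn k (deg v) • gWord R C v ∘ₗ R.op f)) := by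
    rw [comp_last, BarWord.last_lin, ← last_smul]
    refine last_congr w fun z v j a => ?_
    have h1 := str_comm (R.parity a) ((R.parity f).comp (hasParity_gWord R C v))
      (Or.inr (isFiniteRank_op_comp_gWord R C hC f v))
    rw [LinearMap.comp_smul, map_smul, ← LinearMap.comp_assoc,
      hS _ ((isFiniteRank_op_comp_gWord R C hC f v).comp_right _), strWord, R.op_comp,
      LinearMap.comp_assoc, h1, sub_mul, one_mul, sgn_sub, sgn_add]
    simp only [smul_eq_mul]
    linear_combination (sgn k i * sgn k (deg v) * str ((R.op f ∘ₗ gWord R C v) ∘ₗ R.op a)) *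
      sgn_mul_self k (j * (i + deg v))
  have hd : S (diffOp _ ∘ₗ R.op f ∘ₗ gWord R C w) =
      sgn k (i + deg w) * S ((R.op f ∘ₗ gWord R C w) ∘ₗ diffOp _) := by
    rw [hS _ (hfw.comp_left _), hS _ (hfw.comp_right _)]
    exact str_diffOp_comp ((R.parity f).comp (hasParity_gWord R C w)) hfw
  have key := congrArg (fun X => S (R.op f ∘ₗ X)) (hochschild_gWord R C w)
  -- the outer terms of the boundary are those of `hochschild_gWord`, the last one by cyclicity
  rw [hb, hf, hl, hS', R.op_d]
  simp only [LinearMap.comp_add, LinearMap.comp_sub, LinearMap.sub_comp, LinearMap.smul_comp,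
    LinearMap.comp_smul, LinearMap.comp_assoc, map_sub, map_add, map_smul, smul_eq_mul,
    sgn_add] at key hd ⊢
  rw [hd]
  linear_combination -sgn k i * key

/-- The trace functional is invariant under cyclic permutations. -/
lemma strWord_append {s t : E.Obj} {i j : ℤ} (f : (E.Hom y x).X i) (v : BarWord E s y)
    (g : (E.Hom t s).X j) (w : BarWord E x t) :
    strWord R C f (append v (cons j g w)) =
      sgn k ((i + deg v - 1) * (j + deg w - 1)) * strWord R C g (append w (cons i f v)) := by
  have hG := fun {s t} (w : BarWord E s t) => isFiniteRank_gWord R C hC w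
  have h1 := str_comm ((R.parity f).comp (hasParity_gWord R C v))
    ((R.parity g).comp (hasParity_hWord R C w)) (Or.inl ((hG v).comp_left _))
  have h2 := str_comm ((R.parity f).comp (hasParity_hWord R C v))
    ((R.parity g).comp (hasParity_gWord R C w)) (Or.inr ((hG w).comp_left _))
  have fr1 := ((hG v).comp_right (R.op g ∘ₗ hWord R C w)).comp_left (R.op f)
  have fr2 := (((hG w).comp_left (R.op g)).comp_left (hWord R C v)).comp_left (R.op f)
  have fr3 := ((hG w).comp_right (R.op f ∘ₗ hWord R C v)).comp_left (R.op g)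
  have fr4 := (((hG v).comp_left (R.op f)).comp_left (hWord R C w)).comp_left (R.op g)
  simp only [LinearMap.comp_assoc] at h1 h2 fr1 fr2 fr3 fr4
  rw [strWord, strWord, gWord_append, gWord_append, LinearMap.comp_add, LinearMap.comp_add,
    LinearMap.comp_smul, LinearMap.comp_smul, LinearMap.comp_smul, LinearMap.comp_smul,
    str_add (fr1.smul _) (fr2.smul _), str_add (fr3.smul _) (fr4.smul _), str_smul fr1,
    str_smul fr2, str_smul fr3, str_smul fr4, h1, h2]
  have e1 : sgn k ((i + deg v) * (j + (deg w - 1))) =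
      sgn k ((i + deg v - 1) * (j + deg w - 1)) * (-(sgn k j * sgn k (deg w))) := by
    rw [show (i + deg v) * (j + (deg w - 1)) =
      (i + deg v - 1) * (j + deg w - 1) + (j + deg w - 1) by ring, sgn_add, sgn_sub, sgn_add,
      sgn_one]
    ring
  have e2 : sgn k ((i + (deg v - 1)) * (j + deg w)) =
      sgn k ((i + deg v - 1) * (j + deg w - 1)) * (-(sgn k i * sgn k (deg v))) := by
    rw [show (i + (deg v - 1)) * (j + deg w) =
      (i + deg v - 1) * (j + deg w - 1) + (i + deg v - 1) by ring, sgn_add, sgn_sub, sgn_add,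
      sgn_one]
    ring
  rw [e1, e2]
  have hj := sgn_mul_self k j
  have hv := sgn_mul_self k (deg v)
  linear_combination (sgn k ((i + deg v - 1) * (j + deg w - 1)) * sgn k (deg w) *
    str (R.op g ∘ₗ hWord R C w ∘ₗ R.op f ∘ₗ gWord R C v)) * hj +
    (-sgn k ((i + deg v - 1) * (j + deg w - 1)) * sgn k i *
    str (R.op g ∘ₗ gWord R C w ∘ₗ R.op f ∘ₗ hWord R C v)) * hv

end TraceFunctional

/-! ### Shuffles -/

/-- A dg functor `C ⊗ D ⟶ E`, given by its partial dg functors, which commute in the graded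
sense. -/
structure DGBifunctor (C D E : DGCategory k) where
  obj : C.Obj → D.Obj → E.Obj
  left : ∀ (p : D.Obj) {x y : C.Obj} {i : ℤ},
    (C.Hom x y).X i →ₗ[k] (E.Hom (obj x p) (obj y p)).X i
  right : ∀ (x : C.Obj) {p q : D.Obj} {j : ℤ},
    (D.Hom p q).X j →ₗ[k] (E.Hom (obj x p) (obj x q)).X j
  left_one : ∀ p x, left p (C.one x) = E.one (obj x p)
  right_one : ∀ x p, right x (D.one p) = E.one (obj x p)
  left_comp : ∀ p {x y z : C.Obj} {i j l : ℤ} (h : i + j = l) (a : (C.Hom y z).X i)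
    (b : (C.Hom x y).X j), left p (C.comp h a b) = E.comp h (left p a) (left p b)
  right_comp : ∀ x {p q r : D.Obj} {i j l : ℤ} (h : i + j = l) (a : (D.Hom q r).X i)
    (b : (D.Hom p q).X j), right x (D.comp h a b) = E.comp h (right x a) (right x b)
  left_d : ∀ p {x y : C.Obj} {i : ℤ} (a : (C.Hom x y).X i),
    left p ((C.Hom x y).d i (i + 1) a) = (E.Hom _ _).d i (i + 1) (left p a)
  right_d : ∀ x {p q : D.Obj} {j : ℤ} (b : (D.Hom p q).X j),
    right x ((D.Hom p q).d j (j + 1) b) = (E.Hom _ _).d j (j + 1) (right x b)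
  comm : ∀ {x y : C.Obj} {p q : D.Obj} {i j l : ℤ} (h : j + i = l) (h' : i + j = l)
    (a : (C.Hom x y).X i) (b : (D.Hom p q).X j),
    E.comp h (right y b) (left p a) = sgn k (i * j) • E.comp h' (left q a) (right x b)

namespace DGBifunctor
variable {C D E : DGCategory k} (Φ : DGBifunctor C D E) {N : Type*} [AddCommGroup N] [Module k N]

/-- Shuffles of the empty word with a word of `D`. -/
def shuffleNil (x : C.Obj) {p : D.Obj} : ∀ {q : D.Obj}, BarWord D p q →
    (BarWord E (Φ.obj x p) (Φ.obj x q) → N) → N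
  | _, .nil _, F => F (nil (Φ.obj x p))
  | _, .cons j b v, F => shuffleNil x v fun u => F (cons j (Φ.right x b) u)

/-- Shuffles of a word `[a | w]` of degree `l`, given the shuffles `S` of `w`. -/
def shuffleCons {x y z : C.Obj} (l : ℤ) {i : ℤ} (a : (C.Hom y z).X i) {p : D.Obj}
    (S : ∀ {q : D.Obj}, BarWord D p q → (BarWord E (Φ.obj x p) (Φ.obj y q) → N) → N) :
    ∀ {q : D.Obj}, BarWord D p q → (BarWord E (Φ.obj x p) (Φ.obj z q) → N) → N
  | _, .nil _, F => S (nil p) fun u => F (cons i (Φ.left p a) u)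
  | q, .cons j b v, F =>
      S (cons j b v) (fun u => F (cons i (Φ.left q a) u)) +
      sgn k ((j - 1) * l) • shuffleCons l a S v (fun u => F (cons j (Φ.right z b) u))

/-- The signed sum of the values of `F` on the shuffles of a word of `C` and a word of `D`, with
the Koszul signs for the degrees `|aᵢ| - 1`. -/
def shuffle {x : C.Obj} {p : D.Obj} : ∀ {y : C.Obj}, BarWord C x y → ∀ {q : D.Obj},
    BarWord D p q → (BarWord E (Φ.obj x p) (Φ.obj y q) → N) → N
  | _, .nil _ => Φ.shuffleNil x
  | _, .cons i a w => Φ.shuffleCons (deg (cons i a w)) a (shuffle w)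

variable {x y z : C.Obj} {p q r : D.Obj}

@[simp] lemma shuffle_nil_nil (F : BarWord E (Φ.obj x p) (Φ.obj x p) → N) :
    Φ.shuffle (nil x) (nil p) F = F (nil _) := by simp [shuffle, shuffleNil]

lemma shuffle_nil_cons (j : ℤ) (b : (D.Hom q r).X j) (v : BarWord D p q)
    (F : BarWord E (Φ.obj x p) (Φ.obj x r) → N) :
    Φ.shuffle (nil x) (cons j b v) F =
      Φ.shuffle (nil x) v (fun u => F (cons j (Φ.right x b) u)) := by
  simp [shuffle, shuffleNil]

lemma shuffle_cons_nil (i : ℤ) (a : (C.Hom y z).X i) (w : BarWord C x y)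
    (F : BarWord E (Φ.obj x p) (Φ.obj z p) → N) :
    Φ.shuffle (cons i a w) (nil p) F =
      Φ.shuffle w (nil p) (fun u => F (cons i (Φ.left p a) u)) := by
  simp [shuffle, shuffleCons]

lemma shuffle_cons_cons (i : ℤ) (a : (C.Hom y z).X i) (w : BarWord C x y) (j : ℤ)
    (b : (D.Hom q r).X j) (v : BarWord D p q) (F : BarWord E (Φ.obj x p) (Φ.obj z r) → N) :
    Φ.shuffle (cons i a w) (cons j b v) F =
      Φ.shuffle w (cons j b v) (fun u => F (cons i (Φ.left r a) u)) +
      sgn k ((j - 1) * deg (cons i a w)) •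
        Φ.shuffle (cons i a w) v (fun u => F (cons j (Φ.right z b) u)) := by
  simp [shuffle, shuffleCons]

/-- Induction over a pair of words along the recursion of `shuffle`. -/
lemma shuffle_induction {p : D.Obj} {x : C.Obj}
    {motive : ∀ {y : C.Obj} {q : D.Obj}, BarWord C x y → BarWord D p q → Prop}
    (nil_nil : motive (nil x) (nil p))
    (nil_cons : ∀ {q r : D.Obj} (j : ℤ) (b : (D.Hom q r).X j) (v : BarWord D p q),
      motive (nil x) v → motive (nil x) (cons j b v))
    (cons_nil : ∀ {y z : C.Obj} (i : ℤ) (a : (C.Hom y z).X i) (w : BarWord C x y),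
      motive w (nil p) → motive (cons i a w) (nil p))
    (cons_cons : ∀ {y z : C.Obj} {q r : D.Obj} (i : ℤ) (a : (C.Hom y z).X i) (w : BarWord C x y)
      (j : ℤ) (b : (D.Hom q r).X j) (v : BarWord D p q), motive w (cons j b v) →
      motive (cons i a w) v → motive (cons i a w) (cons j b v)) {y : C.Obj} {q : D.Obj}
    (w : BarWord C x y) (v : BarWord D p q) : motive w v := by
  induction w generalizing q with
  | nil =>
    induction v with
    | nil => exact nil_nil
    | cons j b v ih => exact nil_cons j b v ih
  | cons i a w ihw =>
    induction v with
    | nil => exact cons_nil i a w (ihw _)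
    | cons j b v ih =>
      exact cons_cons i a w j b v (ihw _) ih

lemma shuffle_add (w : BarWord C x y) (v : BarWord D p q)
    (F G : BarWord E (Φ.obj x p) (Φ.obj y q) → N) :
    Φ.shuffle w v (fun u => F u + G u) = Φ.shuffle w v F + Φ.shuffle w v G := by
  induction w, v using shuffle_induction with
  | nil_nil => simp
  | nil_cons j b v ih => simp only [shuffle_nil_cons, ih]
  | cons_nil i a w ih => simp only [shuffle_cons_nil, ih]
  | cons_cons i a w j b v ih ih' => simp only [shuffle_cons_cons, ih, ih']; module

lemma shuffle_lin {N' : Type*} [AddCommGroup N'] [Module k N'] (L : N →ₗ[k] N')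
    (w : BarWord C x y) (v : BarWord D p q) (F : BarWord E (Φ.obj x p) (Φ.obj y q) → N) :
    L (Φ.shuffle w v F) = Φ.shuffle w v (fun u => L (F u)) := by
  induction w, v using shuffle_induction with
  | nil_nil => simp
  | nil_cons j b v ih => simp only [shuffle_nil_cons, ih]
  | cons_nil i a w ih => simp only [shuffle_cons_nil, ih]
  | cons_cons i a w j b v ih ih' => simp only [shuffle_cons_cons, ih, ih', map_add, map_smul]

lemma shuffle_smul (c : k) (w : BarWord C x y) (v : BarWord D p q)
    (F : BarWord E (Φ.obj x p) (Φ.obj y q) → N) :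
    Φ.shuffle w v (fun u => c • F u) = c • Φ.shuffle w v F :=
  (Φ.shuffle_lin (c • LinearMap.id) w v F).symm

lemma shuffle_neg (w : BarWord C x y) (v : BarWord D p q)
    (F : BarWord E (Φ.obj x p) (Φ.obj y q) → N) :
    Φ.shuffle w v (fun u => -F u) = -Φ.shuffle w v F :=
  (Φ.shuffle_lin (-LinearMap.id : N →ₗ[k] N) w v F).symm

lemma shuffle_sub (w : BarWord C x y) (v : BarWord D p q)
    (F G : BarWord E (Φ.obj x p) (Φ.obj y q) → N) :
    Φ.shuffle w v (fun u => F u - G u) = Φ.shuffle w v F - Φ.shuffle w v G := by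
  simp only [sub_eq_add_neg, shuffle_add, shuffle_neg]

lemma shuffle_congr_deg (w : BarWord C x y) (v : BarWord D p q)
    {F G : BarWord E (Φ.obj x p) (Φ.obj y q) → N}
    (h : ∀ u, deg u = deg w + deg v → F u = G u) : Φ.shuffle w v F = Φ.shuffle w v G := by
  induction w, v using shuffle_induction with
  | nil_nil => simpa using h _ (by simp [deg])
  | nil_cons j b v ih =>
    simp only [shuffle_nil_cons]
    exact ih fun u hu => h _ (by simp only [deg, hu]; ring)
  | cons_nil i a w ih =>
    simp only [shuffle_cons_nil]
    exact ih fun u hu => h _ (by simp only [deg, hu]; ring)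
  | cons_cons i a w j b v ih ih' =>
    rw [shuffle_cons_cons, shuffle_cons_cons, ih fun u hu => h _ (by simp only [deg, hu]; ring),
      ih' fun u hu => h _ (by simp only [deg, hu]; ring)]

lemma shuffle_zero (w : BarWord C x y) (v : BarWord D p q) :
    Φ.shuffle w v (fun _ => (0 : N)) = 0 := by
  simpa using Φ.shuffle_smul (0 : k) w v (fun _ => (0 : N))

lemma shuffle_isLinComb_left {c : k} {w w₁ w₂ : BarWord C x y} (h : IsLinComb c w w₁ w₂)
    (v : BarWord D p q) {F : BarWord E (Φ.obj x p) (Φ.obj y q) → N} (hF : IsNormalized F) :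
    Φ.shuffle w v F = Φ.shuffle w₁ v F + c • Φ.shuffle w₂ v F := by
  induction h generalizing q with
  | head i a b w =>
    induction v with
    | nil => simp only [shuffle_cons_nil, map_add, map_smul, hF.add', hF.smul', shuffle_add, shuffle_smul]
    | cons j b v ih =>
      simp only [shuffle_cons_cons, map_add, map_smul, hF.add', hF.smul', shuffle_add, shuffle_smul, deg,
        ih (hF.cons j _)]
      module
  | tail i a h ih =>
    induction v with
    | nil => simp only [shuffle_cons_nil, ih _ (hF.cons i _)]
    | cons j b v ihv =>
      simp only [shuffle_cons_cons, ih _ (hF.cons i _), ihv (hF.cons j _), deg, h.deg_eq]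
      module

lemma shuffle_isLinComb_right {c : k} (w : BarWord C x y) {v v₁ v₂ : BarWord D p q}
    (h : IsLinComb c v v₁ v₂) {F : BarWord E (Φ.obj x p) (Φ.obj y q) → N} (hF : IsNormalized F) :
    Φ.shuffle w v F = Φ.shuffle w v₁ F + c • Φ.shuffle w v₂ F := by
  induction w generalizing q with
  | nil =>
    induction h with
    | head j a b v =>
      simp only [shuffle_nil_cons, map_add, map_smul, hF.add', hF.smul', shuffle_add, shuffle_smul]
    | tail j a h ih => simp only [shuffle_nil_cons, ih (hF.cons j _)]
  | cons i a w ihw =>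
    induction h with
    | head j b b' v =>
      simp only [shuffle_cons_cons, map_add, map_smul, hF.add', hF.smul', shuffle_add,
        shuffle_smul, ihw (.head j b b' v) (hF.cons i _)]
      module
    | tail j b h ih =>
      simp only [shuffle_cons_cons, ih (hF.cons j _), ihw (.tail j b h) (hF.cons i _)]
      module

lemma shuffle_isDegenerate_left {w : BarWord C x y} (h : IsDegenerate w)
    (v : BarWord D p q) {F : BarWord E (Φ.obj x p) (Φ.obj y q) → N} (hF : IsNormalized F) :
    Φ.shuffle w v F = 0 := by
  induction h generalizing q with
  | head w =>
    have e : ∀ (z : C.Obj) (r : D.Obj) (F : BarWord E (Φ.obj x p) (Φ.obj z r) → N) (_ : IsNormalized F) u,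
        F (cons 0 (Φ.left r (C.one z)) u) = 0 := fun z r F hF u => by
      rw [Φ.left_one]; exact hF.degenerate (.head u)
    induction v with
    | nil => simp only [shuffle_cons_nil, e _ _ F hF, shuffle_zero]
    | cons j b v ih =>
      simp only [shuffle_cons_cons, e _ _ F hF, shuffle_zero, ih (hF.cons j _), smul_zero, add_zero]
  | tail i a h ih =>
    induction v with
    | nil => simp only [shuffle_cons_nil, ih _ (hF.cons i _)]
    | cons j b v ihv =>
      simp only [shuffle_cons_cons, ih _ (hF.cons i _), ihv (hF.cons j _), smul_zero, add_zero]

lemma shuffle_isDegenerate_right (w : BarWord C x y) {v : BarWord D p q} (h : IsDegenerate v)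
    {F : BarWord E (Φ.obj x p) (Φ.obj y q) → N} (hF : IsNormalized F) :
    Φ.shuffle w v F = 0 := by
  induction w generalizing q with
  | nil =>
    induction h with
    | head v =>
      have e : ∀ u, F (cons 0 (Φ.right x (D.one _)) u) = 0 := fun u => by
        rw [Φ.right_one]; exact hF.degenerate (.head u)
      simp only [shuffle_nil_cons, e, shuffle_zero]
    | tail j a h ih => simp only [shuffle_nil_cons, ih (hF.cons j _)]
  | cons i a w ihw =>
    induction h with
    | head v =>
      have e : ∀ u, F (cons 0 (Φ.right _ (D.one _)) u) = 0 := fun u => by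
        rw [Φ.right_one]; exact hF.degenerate (.head u)
      simp only [shuffle_cons_cons, e, shuffle_zero, ihw (.head v) (hF.cons i _), smul_zero,
        add_zero]
    | tail j b h ih =>
      simp only [shuffle_cons_cons, ih (hF.cons j _), ihw (.tail j b h) (hF.cons i _),
        smul_zero, add_zero]

/-- The first letter of a shuffle is the first letter of one of the two words. -/
lemma shuffle_first (w : BarWord C x y) (v : BarWord D p q)
    (G : ∀ (t : E.Obj) (l : ℤ) (_ : (E.Hom t (Φ.obj y q)).X l), BarWord E (Φ.obj x p) t → N) :
    Φ.shuffle w v (fun u => first u G) =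
      first w (fun _ i a w' => Φ.shuffle w' v (fun u => G _ i (Φ.left q a) u)) +
      first v (fun _ j b v' => sgn k ((j - 1) * deg w) •
        Φ.shuffle w v' (fun u => G _ j (Φ.right y b) u)) := by
  cases w with
  | nil => cases v <;> simp [shuffle_nil_cons, deg, sgn_zero]
  | cons i a w => cases v <;> simp [shuffle_cons_nil, shuffle_cons_cons]

end DGBifunctor

namespace BarWord
variable {A : DGCategory k} {M : Type u} [AddCommGroup M] [Module k M] {x y z : A.Obj}

lemma splits_nil (F : ∀ m : A.Obj, BarWord A m x → BarWord A x m → M) :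
    splits (nil x) F = F x (nil x) (nil x) := by simp [splits]

lemma splits_cons (i : ℤ) (a : (A.Hom y z).X i) (w : BarWord A x y)
    (F : ∀ m : A.Obj, BarWord A m z → BarWord A x m → M) :
    splits (cons i a w) F =
      F _ (nil _) (cons i a w) + splits w (fun m w' w'' => F m (cons i a w') w'') := by
  simp [splits]

lemma splits_congr (w : BarWord A x y) {F G : ∀ m : A.Obj, BarWord A m y → BarWord A x m → M}
    (h : ∀ m w' w'', deg w' + deg w'' = deg w → F m w' w'' = G m w' w'') :
    splits w F = splits w G := by
  induction w with
  | nil => rw [splits_nil, splits_nil]; exact h _ _ _ rfl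
  | cons i a w ih =>
    rw [splits_cons, splits_cons, h _ _ _ (by simp [deg]),
      ih fun m w' w'' hd => h _ _ _ (by simp only [deg]; omega)]

lemma splits_add (w : BarWord A x y) (F G : ∀ m : A.Obj, BarWord A m y → BarWord A x m → M) :
    splits w (fun m w' w'' => F m w' w'' + G m w' w'') = splits w F + splits w G := by
  induction w with
  | nil => simp only [splits_nil]
  | cons i a w ih => simp only [splits_cons, ih]; abel

lemma splits_lin {M' : Type u} [AddCommGroup M'] [Module k M'] (L : M →ₗ[k] M')
    (w : BarWord A x y) (F : ∀ m : A.Obj, BarWord A m y → BarWord A x m → M) :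
    L (splits w F) = splits w (fun m w' w'' => L (F m w' w'')) := by
  induction w with
  | nil => simp only [splits_nil]
  | cons i a w ih => simp only [splits_cons, map_add, ih]

lemma splits_smul (c : k) (w : BarWord A x y)
    (F : ∀ m : A.Obj, BarWord A m y → BarWord A x m → M) :
    splits w (fun m w' w'' => c • F m w' w'') = c • splits w F :=
  (splits_lin (c • LinearMap.id) w F).symm

lemma splits_comm {B : DGCategory k} {p q : B.Obj} (w : BarWord A x y) (v : BarWord B p q)
    (F : ∀ m : A.Obj, BarWord A m y → BarWord A x m →
      ∀ n : B.Obj, BarWord B n q → BarWord B p n → M) :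
    splits w (fun m w' w'' => splits v (F m w' w'')) =
      splits v (fun n v' v'' => splits w (fun m w' w'' => F m w' w'' n v' v'')) := by
  induction w with
  | nil => simp only [splits_nil]
  | cons i a w ih => simp only [splits_cons, splits_add, ih]

lemma deg_append (w : BarWord A y z) (v : BarWord A x y) :
    deg (append w v) = deg w + deg v := by
  induction w with
  | nil => simp [append, deg]
  | cons i a w ih => simp only [append, deg, ih]; ring

end BarWord

namespace DGBifunctor
variable {C D E : DGCategory k} (Φ : DGBifunctor C D E) {N : Type*} [AddCommGroup N] [Module k N]
  {x y z : C.Obj} {p q r : D.Obj}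

/-- Shuffles with a non-empty word are non-empty. -/
lemma shuffle_cons_left_congr (i : ℤ) (a : (C.Hom y z).X i) (w : BarWord C x y) (v : BarWord D p q)
    {F G : BarWord E (Φ.obj x p) (Φ.obj z q) → N}
    (h : ∀ t l (c : (E.Hom t (Φ.obj z q)).X l) u, F (cons l c u) = G (cons l c u)) :
    Φ.shuffle (cons i a w) v F = Φ.shuffle (cons i a w) v G := by
  cases v with
  | nil => simp only [shuffle_cons_nil, h]
  | cons j b v => simp only [shuffle_cons_cons, h]

lemma shuffle_cons_right_congr (w : BarWord C x y) (j : ℤ) (b : (D.Hom q r).X j) (v : BarWord D p q)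
    {F G : BarWord E (Φ.obj x p) (Φ.obj y r) → N}
    (h : ∀ t l (c : (E.Hom t (Φ.obj y r)).X l) u, F (cons l c u) = G (cons l c u)) :
    Φ.shuffle w (cons j b v) F = Φ.shuffle w (cons j b v) G := by
  cases w with
  | nil => simp only [shuffle_nil_cons, h]
  | cons i a w => simp only [shuffle_cons_cons, h]

lemma shuffle_last_cons_left (i : ℤ) (a : (C.Hom y z).X i) (w : BarWord C x y) (v : BarWord D p q)
    {l : ℤ} {t : E.Obj} (c : (E.Hom (Φ.obj z q) t).X l)
    (G : ∀ (s : E.Obj), BarWord E s t → ∀ (l : ℤ) (_ : (E.Hom (Φ.obj x p) s).X l), N) :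
    Φ.shuffle (cons i a w) v (fun u => last (cons l c u) G) =
      Φ.shuffle (cons i a w) v (fun u => last u fun s u' l' c' => G s (cons l c u') l' c') :=
  Φ.shuffle_cons_left_congr _ _ _ _ fun _ _ _ _ => last_cons_cons _ _ _ _ _ _

lemma shuffle_last_cons_right (w : BarWord C x y) (j : ℤ) (b : (D.Hom q r).X j) (v : BarWord D p q)
    {l : ℤ} {t : E.Obj} (c : (E.Hom (Φ.obj y r) t).X l)
    (G : ∀ (s : E.Obj), BarWord E s t → ∀ (l : ℤ) (_ : (E.Hom (Φ.obj x p) s).X l), N) :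
    Φ.shuffle w (cons j b v) (fun u => last (cons l c u) G) =
      Φ.shuffle w (cons j b v) (fun u => last u fun s u' l' c' => G s (cons l c u') l' c') :=
  Φ.shuffle_cons_right_congr _ _ _ _ fun _ _ _ _ => last_cons_cons _ _ _ _ _ _

/-- The last letter of a shuffle is the last letter of one of the two words. -/
lemma shuffle_last (w : BarWord C x y) (v : BarWord D p q)
    (G : ∀ (t : E.Obj), BarWord E t (Φ.obj y q) → ∀ (l : ℤ) (_ : (E.Hom (Φ.obj x p) t).X l), N) :
    Φ.shuffle w v (fun u => last u G) =
      last w (fun _ w' i a => sgn k ((i - 1) * deg v) •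
        Φ.shuffle w' v (fun u => G _ u i (Φ.left p a))) +
      last v (fun _ v' j b => Φ.shuffle w v' (fun u => G _ u j (Φ.right x b))) := by
  induction w, v using shuffle_induction with
  | nil_nil => simp
  | nil_cons j b v ih =>
    cases v with
    | nil => simp [shuffle_nil_cons]
    | cons l c v =>
      rw [shuffle_nil_cons, shuffle_last_cons_right, ih, last_nil, last_nil, last_cons_cons]
      simp only [shuffle_nil_cons]
  | cons_nil i a w ih =>
    cases w with
    | nil => simp [shuffle_cons_nil, deg, sgn_zero]
    | cons l c w =>
      rw [shuffle_cons_nil, shuffle_last_cons_left, ih, last_nil, last_nil, last_cons_cons]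
      simp only [shuffle_cons_nil]
  | cons_cons i a w j b v ih ih' =>
    rw [shuffle_cons_cons, shuffle_last_cons_right, shuffle_last_cons_left, ih, ih', smul_add, ← last_smul, ← last_smul]
    have hw : last w (fun _ w' l c => sgn k ((l - 1) * deg (cons j b v)) •
          Φ.shuffle w' (cons j b v) (fun u => G _ (cons i (Φ.left _ a) u) l (Φ.left p c))) +
        last (cons i a w) (fun _ w' l c => sgn k ((j - 1) * deg (cons i a w)) •
          sgn k ((l - 1) * deg v) •
          Φ.shuffle w' v (fun u => G _ (cons j (Φ.right _ b) u) l (Φ.left p c))) =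
        last (cons i a w) (fun _ w' l c => sgn k ((l - 1) * deg (cons j b v)) •
          Φ.shuffle w' (cons j b v) (fun u => G _ u l (Φ.left p c))) := by
      cases w with
      | nil =>
        simp only [last_nil, last_single, shuffle_nil_cons, deg, zero_add, smul_smul, ← sgn_add]
        congr 2; ring
      | cons l c w =>
        rw [last_cons_cons, last_cons_cons, ← last_add]
        refine last_congr_deg _ fun t w' l' c' hd => ?_
        have hd' : deg w' + (l' - 1) = l - 1 + deg w := hd
        rw [shuffle_cons_cons, smul_add, smul_smul, smul_smul, ← sgn_add, ← sgn_add]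
        have e : (j - 1) * deg (cons i a (cons l c w)) + (l' - 1) * deg v =
            (l' - 1) * deg (cons j b v) + (j - 1) * deg (cons i a w') := by
          simp only [deg]
          linear_combination (1 - j) * hd'
        rw [e]
    have hv : last (cons j b v) (fun _ v' l c =>
          Φ.shuffle w v' (fun u => G _ (cons i (Φ.left _ a) u) l (Φ.right x c))) +
        last v (fun _ v' l c => sgn k ((j - 1) * deg (cons i a w)) •
          Φ.shuffle (cons i a w) v' (fun u => G _ (cons j (Φ.right _ b) u) l (Φ.right x c))) =
        last (cons j b v) (fun _ v' l c =>
          Φ.shuffle (cons i a w) v' (fun u => G _ u l (Φ.right x c))) := by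
      cases v with
      | nil => simp only [last_nil, last_single, shuffle_cons_nil, add_zero]
      | cons l c v =>
        rw [last_cons_cons, last_cons_cons, ← last_add]
        refine last_congr _ fun t v' l' c' => ?_
        rw [shuffle_cons_cons]
    rw [← hw, ← hv]
    abel

/-- The shuffle product is compatible with the inner parts of the bar differentials. -/
lemma shuffle_bdry (w : BarWord C x y) (v : BarWord D p q)
    {F : BarWord E (Φ.obj x p) (Φ.obj y q) → N} (hF : IsNormalized F) :
    Φ.shuffle w v (fun u => bdry u F) =
      bdry w (fun w' => Φ.shuffle w' v F) +
      sgn k (deg w) • bdry v (fun v' => Φ.shuffle w v' F) := by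
  induction w, v using shuffle_induction with
  | nil_nil => simp
  | nil_cons j b v ih =>
    have h1 := ih (hF.cons j (Φ.right x b))
    simp only [shuffle_nil_cons, bdry_cons, shuffle_sub, shuffle_neg, shuffle_smul, h1,
      shuffle_first, bdry_nil, first_nil, deg, sgn_zero, mul_zero, one_smul, zero_add,
      Φ.right_d, Φ.right_comp]
  | cons_nil i a w ih =>
    have h1 := ih (hF.cons i (Φ.left _ a))
    simp only [shuffle_cons_nil, bdry_cons, shuffle_sub, shuffle_neg, shuffle_smul, h1,
      shuffle_first, bdry_nil, first_nil, add_zero, smul_zero,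
      Φ.left_d, Φ.left_comp]
  | cons_cons i a w j b v ih ih' =>
    have h1 := ih (hF.cons i (Φ.left _ a))
    have h2 := ih' (hF.cons j (Φ.right _ b))
    have hw : bdry w (fun w' => Φ.shuffle (cons i a w') (cons j b v) F) =
        bdry w (fun w' => Φ.shuffle w' (cons j b v) (fun u => F (cons i (Φ.left _ a) u))) -
        sgn k ((j - 1) * deg (cons i a w)) • sgn k j •
          bdry w (fun w' => Φ.shuffle (cons i a w') v (fun u => F (cons j (Φ.right _ b) u))) := by
      rw [← bdry_smul, ← bdry_smul, sub_eq_add_neg, ← neg_one_smul k (bdry w _), ← bdry_smul,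
        ← bdry_add]
      refine bdry_congr_deg w fun w' hd => ?_
      rw [shuffle_cons_cons, deg, deg, hd, show (j - 1) * (i - 1 + (deg w + 1)) =
        (j - 1) * (i - 1 + deg w) + (j - 1) by ring, sgn_add, sgn_sub, sgn_one]
      module
    have hw1 : first w (fun _ l c w' => Φ.shuffle (cons (i + l) (C.comp rfl a c) w') (cons j b v) F) =
        first w (fun _ l c w' => Φ.shuffle w' (cons j b v)
          (fun u => F (cons (i + l) (Φ.left _ (C.comp rfl a c)) u))) -
        sgn k ((j - 1) * deg (cons i a w)) • sgn k j •
        first w (fun _ l c w' => Φ.shuffle (cons (i + l) (C.comp rfl a c) w') v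
          (fun u => F (cons j (Φ.right _ b) u))) := by
      cases w with
      | nil => simp
      | cons l c w =>
        simp only [first_cons]
        rw [shuffle_cons_cons, deg, deg, deg, show (j - 1) * (i + l - 1 + deg w) =
        (j - 1) * (i - 1 + (l - 1 + deg w)) + (j - 1) by ring, sgn_add, sgn_sub, sgn_one]
        module
    have hv : bdry v (fun v' => Φ.shuffle (cons i a w) (cons j b v') F) =
        bdry v (fun v' => Φ.shuffle w (cons j b v') (fun u => F (cons i (Φ.left _ a) u))) +
        sgn k ((j - 1) * deg (cons i a w)) • 
          bdry v (fun v' => Φ.shuffle (cons i a w) v' (fun u => F (cons j (Φ.right _ b) u))) := by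
      rw [← bdry_smul, ← bdry_add]
      refine bdry_congr_deg v fun v' hd => ?_
      rw [shuffle_cons_cons]
    have hv1 : first v (fun _ l c v' => Φ.shuffle (cons i a w) (cons (j + l) (D.comp rfl b c) v') F) =
        first v (fun _ l c v' => Φ.shuffle w (cons (j + l) (D.comp rfl b c) v')
          (fun u => F (cons i (Φ.left _ a) u))) +
        sgn k ((j - 1) * deg (cons i a w)) •
        sgn k (deg (cons i a w)) • first v (fun _ l c v' =>
          sgn k ((l - 1) * deg (cons i a w)) • Φ.shuffle (cons i a w) v'
          (fun u => F (cons (j + l) (Φ.right _ (D.comp rfl b c)) u))) := by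
      cases v with
      | nil => simp
      | cons l c v =>
        simp only [first_cons]
        rw [shuffle_cons_cons, show (j + l - 1) * deg (cons i a w) =
        (j - 1) * deg (cons i a w) + (deg (cons i a w) + (l - 1) * deg (cons i a w)) by ring, sgn_add,
          sgn_add, mul_smul, mul_smul]
    have hc : ∀ u, F (cons (j + i) (E.comp rfl (Φ.right _ b) (Φ.left _ a)) u) =
        sgn k (i * j) • F (cons (i + j) (E.comp rfl (Φ.left _ a) (Φ.right _ b)) u) := fun u => by
      rw [Φ.comm rfl (add_comm i j), hF.smul', cons_comp]
    rw [shuffle_cons_cons, bdry_cons, bdry_cons, hw, hw1, hv, hv1]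
    simp only [shuffle_cons_cons, bdry_cons i, bdry_cons j, shuffle_sub, shuffle_neg, shuffle_smul,
      h1, h2, shuffle_first, first_cons, hc, ← Φ.left_comp, ← Φ.right_comp, ← Φ.left_d,
      ← Φ.right_d]
    have e1 : sgn k ((j - 1) * deg (cons i a w)) =
      sgn k ((j - 1) * deg w) * (-(sgn k (i * j) * (sgn k i * sgn k j))) := by
      rw [deg, show (j - 1) * (i - 1 + deg w) = (j - 1) * deg w + (i * j - i - j + 1) by ring,
        sgn_add, sgn_add, sgn_sub, sgn_sub, sgn_one]
      ring
    have e2 : sgn k (deg (cons i a w)) = -(sgn k i * sgn k (deg w)) := by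
      rw [deg, sgn_add, sgn_sub, sgn_one]; ring
    have e3 : sgn k ((j - 1) * deg (cons (i + 1) ((C.Hom _ _).d i (i + 1) a) w)) =
        sgn k ((j - 1) * deg w) * (sgn k (i * j) * sgn k i) := by
      rw [deg, show (j - 1) * (i + 1 - 1 + deg w) = (j - 1) * deg w + (i * j - i) by ring,
        sgn_add, sgn_sub]
    have e4 : sgn k ((j + 1 - 1) * deg (cons i a w)) =
        sgn k ((j - 1) * deg (cons i a w)) * sgn k (deg (cons i a w)) := by
      rw [← sgn_add]; congr 1; ring
    rw [e3, e4, e1, e2]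
    rcases sgn_eq_one_or (k := k) i with hi | hi <;> rcases sgn_eq_one_or (k := k) j with hj | hj <;>
    rcases sgn_eq_one_or (k := k) (i * j) with hij | hij <;>
    rcases sgn_eq_one_or (k := k) (deg w) with hd | hd <;> simp only [hi, hj, hij, hd] <;> module

/-- A word is shuffled by cutting it at one of its letters, and cutting the other word
accordingly. -/
lemma shuffle_append_left {s t : C.Obj} (w₂ : BarWord C t y) {i : ℤ} (a : (C.Hom s t).X i)
    (w₁ : BarWord C x s) (v : BarWord D p q) {M : Type u} [AddCommGroup M] [Module k M]
    (F : BarWord E (Φ.obj x p) (Φ.obj y q) → M) :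
    Φ.shuffle (append w₂ (cons i a w₁)) v F = v.splits fun r v' v'' =>
      sgn k ((i - 1 + deg w₁) * deg v') • Φ.shuffle w₂ v' fun u' => Φ.shuffle w₁ v'' fun u'' =>
        F (append u' (cons i (Φ.left r a) u'')) := by
  induction w₂ generalizing q with
  | nil =>
    induction v with
    | nil => simp [splits_nil, append, shuffle_cons_nil, deg, sgn_zero]
    | cons j b v ih =>
      have h := ih fun u => F (cons j (Φ.right _ b) u)
      simp only [append] at h ⊢
      rw [shuffle_cons_cons, h, splits_cons, ← splits_smul]
      simp only [shuffle_nil_nil, append, deg, mul_zero, sgn_zero, one_smul, shuffle_nil_cons,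
        smul_smul, ← sgn_add]
      congr 1
      refine splits_congr _ fun r v' v'' _ => ?_
      congr 2; ring
  | cons l c w₂ ihw =>
    induction v with
    | nil =>
      have h := ihw (nil p) fun u => F (cons l (Φ.left _ c) u)
      simp only [splits_nil] at h
      simp only [append, shuffle_cons_nil, h, splits_nil]
    | cons j b v ih =>
      have h := ih fun u => F (cons j (Φ.right _ b) u)
      have h' := ihw (cons j b v) fun u => F (cons l (Φ.left _ c) u)
      simp only [append] at h ⊢
      rw [shuffle_cons_cons, h, h', splits_cons, splits_cons, ← splits_smul, add_assoc,
        ← splits_add]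
      simp only [shuffle_cons_nil, append]
      congr 1
      refine splits_congr _ fun r v' v'' _ => ?_
      simp only [shuffle_cons_cons, append, smul_add, smul_smul, ← sgn_add, deg, deg_append]
      congr 3; ring

lemma shuffle_append_right (w : BarWord C x y) {s t : D.Obj} (v₂ : BarWord D t q) {j : ℤ}
    (b : (D.Hom s t).X j) (v₁ : BarWord D p s) {M : Type u} [AddCommGroup M] [Module k M]
    (F : BarWord E (Φ.obj x p) (Φ.obj y q) → M) :
    Φ.shuffle w (append v₂ (cons j b v₁)) F = w.splits fun r w' w'' =>
      sgn k (deg w'' * (deg v₂ + (j - 1))) • Φ.shuffle w' v₂ fun u' => Φ.shuffle w'' v₁ fun u'' =>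
        F (append u' (cons j (Φ.right r b) u'')) := by
  induction w generalizing q with
  | nil =>
    induction v₂ with
    | nil => simp [splits_nil, append, shuffle_nil_cons, deg, sgn_zero]
    | cons l c v₂ ih =>
      have h := ih fun u => F (cons l (Φ.right _ c) u)
      simp only [append, splits_nil, shuffle_nil_cons, deg, zero_mul, sgn_zero, one_smul] at h ⊢
      exact h
  | cons i a w ihw =>
    induction v₂ with
    | nil =>
      have h := ihw (nil t) fun u => F (cons i (Φ.left _ a) u)
      simp only [append] at h ⊢
      rw [shuffle_cons_cons, h, splits_cons, add_comm]
      simp only [shuffle_nil_nil, append, deg, zero_add, shuffle_cons_nil, mul_comm (j - 1)]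
    | cons l c v₂ ih =>
      have h := ih fun u => F (cons l (Φ.right _ c) u)
      have h' := ihw (cons l c v₂) fun u => F (cons i (Φ.left _ a) u)
      simp only [append] at h h' ⊢
      rw [shuffle_cons_cons, h, h', splits_cons, splits_cons, smul_add, ← splits_smul,
        add_left_comm, ← splits_add]
      simp only [shuffle_nil_cons, append, smul_smul, ← sgn_add]
      congr 1
      · congr 2; simp only [deg]; ring
      refine splits_congr _ fun r v' v'' hd => ?_
      simp only [shuffle_cons_cons, append, smul_add, smul_smul, ← sgn_add, deg]
      congr 3; rw [← hd]; ring

end DGBifunctor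

lemma sgn_eq_of_eq_add_two_mul {i j m : ℤ} (h : i = j + 2 * m) : sgn k i = sgn k j := by
  rw [h, two_mul, sgn_add, sgn_add, sgn_mul_self, mul_one]

/-! ### Functionals on Hochschild words -/

section Functionals
variable {A : DGCategory k}

/-- A function on Hochschild words that is linear in each letter and vanishes on words `a₀[w]` such
that `w` contains an identity. -/
structure IsReduced (T : HHWord A → k) : Prop where
  lin : ∀ {x y : A.Obj} {i : ℤ} (a b : (A.Hom y x).X i) (c : k) (w : BarWord A x y),
    T ⟨a + c • b, w⟩ = T ⟨a, w⟩ + c * T ⟨b, w⟩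
  normalized : ∀ {x y : A.Obj} {i : ℤ} (a : (A.Hom y x).X i),
    IsNormalized fun w : BarWord A x y => T ⟨a, w⟩

namespace IsReduced
variable {T : HHWord A → k} (hT : IsReduced T)
include hT

lemma add {x y : A.Obj} {i : ℤ} (a b : (A.Hom y x).X i) (w : BarWord A x y) :
    T ⟨a + b, w⟩ = T ⟨a, w⟩ + T ⟨b, w⟩ := by
  simpa using hT.lin a b 1 w

lemma zero {x y : A.Obj} {i : ℤ} (w : BarWord A x y) : T ⟨(0 : (A.Hom y x).X i), w⟩ = 0 := by
  simpa using hT.add (0 : (A.Hom y x).X i) 0 w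

lemma smul {x y : A.Obj} {i : ℤ} (c : k) (a : (A.Hom y x).X i) (w : BarWord A x y) :
    T ⟨c • a, w⟩ = c * T ⟨a, w⟩ := by
  simpa [hT.zero] using hT.lin 0 a c w

/-- A reduced functional descends to the normalized cyclic bar complex. -/
lemma linearCombination_eq_zero {ξ : Chain A} (hξ : ξ ∈ chainRel A) :
    Finsupp.linearCombination k T ξ = 0 := by
  induction hξ using Submodule.span_induction with
  | zero => simp
  | add x y _ _ hx hy => rw [map_add, hx, hy, add_zero]
  | smul c x _ hx => rw [map_smul, hx, smul_zero]
  | mem ξ h =>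
    rcases h with (⟨x, y, i, a, b, c, w, rfl⟩ | ⟨x, y, i, a, c, w, w₁, w₂, h, rfl⟩) |
      ⟨x, y, i, a, w, h, rfl⟩
    · simp [word, hT.lin]
    · simp [word, (hT.normalized a).lin h]
    · simp [word, (hT.normalized a).degenerate h]

end IsReduced

lemma HHWord.comp_congr {x y z : A.Obj} {i j l : ℤ} (h : i + j = l) (a : (A.Hom y x).X i)
    (b : (A.Hom z y).X j) (w : BarWord A x z) :
    (⟨A.comp h a b, w⟩ : HHWord A) = ⟨A.comp rfl a b, w⟩ := by
  subst h; rfl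

lemma HHWord.one_comp {x y : A.Obj} {i : ℤ} (a : (A.Hom y x).X i) (w : BarWord A x y) :
    (⟨A.comp rfl (A.one x) a, w⟩ : HHWord A) = ⟨a, w⟩ := by
  rw [← HHWord.comp_congr (zero_add i), A.one_comp]

lemma HHWord.comp_one {x y : A.Obj} {i : ℤ} (a : (A.Hom y x).X i) (w : BarWord A x y) :
    (⟨A.comp rfl a (A.one y), w⟩ : HHWord A) = ⟨a, w⟩ := by
  rw [← HHWord.comp_congr (add_zero i), A.comp_one]

/-- The composition of a functional with the Hochschild differential. -/
noncomputable def hochFun (T : HHWord A → k) (W : HHWord A) : k :=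
  T ⟨(A.Hom _ _).d W.i (W.i + 1) W.a, W.w⟩ + sgn k W.i • bdry W.w (fun v => T ⟨W.a, v⟩) +
    sgn k W.i • first W.w (fun _ _ a v => T ⟨A.comp rfl W.a a, v⟩) -
    last W.w (fun _ v j a => sgn k ((j - 1) * (W.i + v.deg)) • T ⟨A.comp rfl a W.a, v⟩)

/-- The composition of a functional with Connes' operator. -/
noncomputable def connesFun (T : HHWord A → k) (W : HHWord A) : k :=
  W.w.splits fun m w' w'' =>
    sgn k ((W.i - 1 + w'.deg) * w''.deg) • T ⟨A.one m, append w'' (cons W.i W.a w')⟩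

lemma linearCombination_word (T : HHWord A → k) {x y : A.Obj} {i : ℤ} (a : (A.Hom y x).X i)
    (w : BarWord A x y) : Finsupp.linearCombination k T (word a w) = T ⟨a, w⟩ := by
  simp [word]

lemma linearCombination_hochB (T : HHWord A → k) (ξ : Chain A) :
    Finsupp.linearCombination k T (hochB A ξ) = Finsupp.linearCombination k (hochFun T) ξ := by
  have h : Finsupp.linearCombination k T ∘ₗ hochB A = Finsupp.linearCombination k (hochFun T) := by
    refine Finsupp.lhom_ext' fun W => LinearMap.ext_ring ?_
    simp only [LinearMap.comp_apply, Finsupp.lsingle_apply, hochB, Finsupp.linearCombination_single,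
      one_smul, map_add, map_sub, map_smul, linearCombination_word, BarWord.bdry_lin,
      BarWord.first_lin, BarWord.last_lin, hochFun]
  exact LinearMap.congr_fun h ξ

lemma linearCombination_connesB (T : HHWord A → k) (ξ : Chain A) :
    Finsupp.linearCombination k T (connesB A ξ) =
      Finsupp.linearCombination k (connesFun T) ξ := by
  have h : Finsupp.linearCombination k T ∘ₗ connesB A =
      Finsupp.linearCombination k (connesFun T) := by
    refine Finsupp.lhom_ext' fun W => LinearMap.ext_ring ?_
    simp only [LinearMap.comp_apply, Finsupp.lsingle_apply, connesB,
      Finsupp.linearCombination_single, one_smul, BarWord.splits_lin, map_smul,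
      linearCombination_word, connesFun]
  exact LinearMap.congr_fun h ξ

end Functionals

/-! ### Reversal of bar words -/

namespace BarWord
variable {A : DGCategory k} {N : Type*} [AddCommGroup N] [Module k N] {s t x y z : A.Obj}

lemma append_nil (w : BarWord A x y) : append w (nil x) = w := by
  induction w with
  | nil => rfl
  | cons i a w ih => rw [append, ih]

lemma append_assoc (u : BarWord A y z) (v : BarWord A x y) (w : BarWord A t x) :
    append (append u v) w = append u (append v w) := by
  induction u with
  | nil => rfl
  | cons i a u ih => rw [append, append, append, ih]

/-- The word with a single letter. -/
def single {i : ℤ} (a : (A.Hom x y).X i) : BarWord A x y := cons i a (nil x)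

lemma deg_single {i : ℤ} (a : (A.Hom x y).X i) : deg (single a) = i - 1 := by simp [single, deg]

lemma append_single (u : BarWord A y z) {i : ℤ} (a : (A.Hom x y).X i) (v : BarWord A t x) :
    append (append u (single a)) v = append u (cons i a v) := append_assoc _ _ _

lemma last_append_single (v : BarWord A y z) {i : ℤ} (a : (A.Hom x y).X i)
    (F : ∀ (t : A.Obj), BarWord A t z → ∀ (j : ℤ) (_ : (A.Hom x t).X j), N) :
    last (append v (single a)) F = F y v i a := by
  induction v with
  | nil => simp [append, single]
  | cons j b v ih =>
    cases v with
    | nil => simp [append, single, last_cons_cons]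
    | cons l c v =>
      rw [append, append, last_cons_cons]
      exact ih _

/-- Induction on bar words from the right. -/
lemma snoc_induction {y : A.Obj} {motive : ∀ {x : A.Obj}, BarWord A x y → Prop}
    (nil : motive (nil y))
    (snoc : ∀ {x z : A.Obj} (v : BarWord A z y) (j : ℤ) (a : (A.Hom x z).X j), motive v →
      motive (append v (single a))) {x : A.Obj} (w : BarWord A x y) : motive w := by
  have key : ∀ {x z : A.Obj} (w : BarWord A x z) (v : BarWord A z y), motive v →
      motive (append v w) := by
    intro x z w
    induction w with
    | nil => intro v hv; rwa [append_nil]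
    | cons i a w ih =>
      intro v hv
      rw [← append_single]
      exact ih _ (snoc v i a hv)
  exact key w (BarWord.nil y) nil

lemma first_append_single (v : BarWord A y z) {i : ℤ} (a : (A.Hom x y).X i) (j : ℤ)
    (b : (A.Hom z t).X j) 
    (F : ∀ (s : A.Obj) (j : ℤ) (_ : (A.Hom s t).X j), BarWord A x s → N) :
    first (append (cons j b v) (single a)) F =
      first (cons j b v) (fun s l c u => F s l c (append u (single a))) := by
  simp [append]

/-- The bar differential in terms of the last letter. -/
lemma bdry_append_single (v : BarWord A y z) {i : ℤ} (a : (A.Hom x y).X i)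
    (F : BarWord A x z → N) :
    bdry (append v (single a)) F = bdry v (fun u => F (append u (single a))) -
      sgn k (deg v) • F (append v (single ((A.Hom _ _).d i (i + 1) a))) -
      last v (fun _ u j b => sgn k (deg u + j) • F (append u (single (A.comp rfl b a)))) := by
  induction v with
  | nil => simp [append, single, bdry_cons, deg, sgn_zero]
  | cons l c v ih =>
    rw [append, bdry_cons, ih]
    cases v with
    | nil =>
      simp only [append, single, first_cons, bdry_cons, first_nil, bdry_nil, last_nil, last_single,
        deg, sgn_add, sgn_sub, sgn_one, sgn_zero]
      module
    | cons j b v =>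
      rw [first_append_single, bdry_cons l c, last_cons_cons]
      simp only [append, first_cons, deg, sgn_add, sgn_sub, sgn_one, mul_smul, last_smul, last_neg,
        neg_smul, mul_neg, mul_one, smul_neg]
      module

lemma splits_append_single {M : Type u} [AddCommGroup M] [Module k M] (v : BarWord A y z) {i : ℤ}
    (a : (A.Hom x y).X i) (F : ∀ m : A.Obj, BarWord A m z → BarWord A x m → M) :
    splits (append v (single a)) F = splits v (fun m w' w'' => F m w' (append w'' (single a))) +
      F x (append v (single a)) (nil x) := by
  induction v with
  | nil => simp [append, single, splits_cons, splits_nil]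
  | cons l c v ih =>
    rw [append, splits_cons, splits_cons, ih]
    simp only [append]
    abel

lemma reverseSign_append (u : BarWord A y z) (v : BarWord A x y) :
    reverseSign (append u v) = reverseSign u + reverseSign v + deg u * deg v := by
  induction u with
  | nil => simp [append, reverseSign, deg]
  | cons i a u ih => simp only [append, reverseSign, ih, deg, deg_append]; ring

lemma reverseSign_single {i : ℤ} (a : (A.Hom x y).X i) : reverseSign (single a) = 1 := by
  simp [single, reverseSign, deg]

lemma isLinComb_append_left {c : k} {v v₁ v₂ : BarWord A y z} (h : IsLinComb c v v₁ v₂)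
    (w : BarWord A x y) : IsLinComb c (append v w) (append v₁ w) (append v₂ w) := by
  induction h with
  | head i a b v => exact .head i a b _
  | tail i a _ ih => exact .tail i a ih

lemma isLinComb_append_right {c : k} (v : BarWord A y z) {w w₁ w₂ : BarWord A x y}
    (h : IsLinComb c w w₁ w₂) : IsLinComb c (append v w) (append v w₁) (append v w₂) := by
  induction v with
  | nil => exact h
  | cons i a v ih => exact .tail i a ih

lemma isDegenerate_append_left {v : BarWord A y z} (h : IsDegenerate v)
    (w : BarWord A x y) : IsDegenerate (append v w) := by
  induction h with
  | head v => exact .head _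
  | tail i a _ ih => exact .tail i a ih

lemma isDegenerate_append_right (v : BarWord A y z) {w : BarWord A x y}
    (h : IsDegenerate w) : IsDegenerate (append v w) := by
  induction v with
  | nil => exact h
  | cons i a v ih => exact .tail i a ih

lemma IsNormalized.append_left {F : BarWord A x z → N} (hF : IsNormalized F) (v : BarWord A y z) :
    IsNormalized fun w => F (append v w) :=
  ⟨fun h => hF.lin (isLinComb_append_right v h),
    fun h => hF.degenerate (isDegenerate_append_right v h)⟩

lemma IsNormalized.append_right {F : BarWord A x z → N} (hF : IsNormalized F) (w : BarWord A x y) :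
    IsNormalized fun v => F (append v w) :=
  ⟨fun h => hF.lin (isLinComb_append_left h w),
    fun h => hF.degenerate (isDegenerate_append_left h w)⟩

lemma IsLinComb.reverseSign_eq {c : k} {w w₁ w₂ : BarWord A x y} (h : IsLinComb c w w₁ w₂) :
    reverseSign w₁ = reverseSign w ∧ reverseSign w₂ = reverseSign w := by
  induction h with
  | head i a b w => simp [reverseSign]
  | tail i a h ih => simp [reverseSign, ih, h.deg_eq]

lemma splits_congr_append {M : Type u} [AddCommGroup M] (w : BarWord A x y)
    {F G : ∀ m : A.Obj, BarWord A m y → BarWord A x m → M}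
    (h : ∀ m w' w'', append w' w'' = w → F m w' w'' = G m w' w'') :
    splits w F = splits w G := by
  induction w with
  | nil => simp only [splits]; exact h _ _ _ rfl
  | cons i a w ih =>
    simp only [splits]
    rw [h _ _ _ (by simp [append]), ih fun m w' w'' hd => h _ _ _ (by rw [append, hd])]

lemma last_congr_append (w : BarWord A x y)
    {F G : ∀ (t : A.Obj), BarWord A t y → ∀ (j : ℤ) (_ : (A.Hom x t).X j), N}
    (h : ∀ t v j a, w = append v (single a) → F t v j a = G t v j a) : last w F = last w G := by
  induction w using snoc_induction with
  | nil => rw [last_nil, last_nil]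
  | snoc v j a ih => rw [last_append_single, last_append_single]; exact h _ _ _ _ rfl

end BarWord

/-- A contravariant dg functor. -/
structure DGAntifunctor (A B : DGCategory k) where
  obj : A.Obj → B.Obj
  map : ∀ {x y : A.Obj} {i : ℤ}, (A.Hom x y).X i →ₗ[k] (B.Hom (obj y) (obj x)).X i
  map_one : ∀ x, map (A.one x) = B.one (obj x)
  map_comp : ∀ {x y z : A.Obj} {i j l : ℤ} (h : i + j = l) (h' : j + i = l) (a : (A.Hom y z).X i)
    (b : (A.Hom x y).X j), map (A.comp h a b) = sgn k (i * j) • B.comp h' (map b) (map a)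
  map_d : ∀ {x y : A.Obj} {i : ℤ} (a : (A.Hom x y).X i),
    map ((A.Hom x y).d i (i + 1) a) = (B.Hom _ _).d i (i + 1) (map a)

namespace DGAntifunctor
variable {A B : DGCategory k} (Ψ : DGAntifunctor A B) {N : Type*} [AddCommGroup N] [Module k N]
  {t x y z : A.Obj}

/-- The image of a bar word under a contravariant functor, without the sign of the reversal. -/
def reverse {x : A.Obj} : ∀ {y : A.Obj}, BarWord A x y → BarWord B (Ψ.obj y) (Ψ.obj x)
  | _, .nil _ => nil (Ψ.obj x)
  | _, .cons _ a w => append (reverse w) (single (Ψ.map a))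

lemma reverse_nil (x : A.Obj) : Ψ.reverse (nil x) = nil (Ψ.obj x) := by simp [reverse]

lemma reverse_cons (i : ℤ) (a : (A.Hom y z).X i) (w : BarWord A x y) :
    Ψ.reverse (cons i a w) = append (Ψ.reverse w) (single (Ψ.map a)) := by simp [reverse]

lemma deg_reverse (w : BarWord A x y) : deg (Ψ.reverse w) = deg w := by
  induction w with
  | nil => simp [reverse_nil, deg]
  | cons i a w ih => rw [reverse_cons, deg_append, ih, deg, deg_single]; ring

lemma reverse_append (u : BarWord A y z) (v : BarWord A x y) :
    Ψ.reverse (append u v) = append (Ψ.reverse v) (Ψ.reverse u) := by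
  induction u with
  | nil => rw [append, reverse_nil, append_nil]
  | cons i a u ih => rw [append, reverse_cons, ih, reverse_cons, append_assoc]

lemma reverse_append_single (v : BarWord A y z) {i : ℤ} (a : (A.Hom x y).X i) :
    Ψ.reverse (append v (single a)) = cons i (Ψ.map a) (Ψ.reverse v) := by
  rw [reverse_append, single, reverse_cons, reverse_nil]; rfl

lemma first_reverse (w : BarWord A x y)
    (F : ∀ (t : B.Obj) (j : ℤ) (_ : (B.Hom t (Ψ.obj x)).X j), BarWord B (Ψ.obj y) t → N) :
    first (Ψ.reverse w) F = last w (fun _ u j a => F _ j (Ψ.map a) (Ψ.reverse u)) := by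
  induction w using snoc_induction with
  | nil => rw [reverse_nil, last_nil, first_nil]
  | snoc v j a ih => rw [reverse_append_single, last_append_single, first_cons]

lemma last_reverse (w : BarWord A x y)
    (F : ∀ (t : B.Obj), BarWord B t (Ψ.obj x) → ∀ (j : ℤ) (_ : (B.Hom (Ψ.obj y) t).X j), N) :
    last (Ψ.reverse w) F = first w (fun _ j a u => F _ (Ψ.reverse u) j (Ψ.map a)) := by
  cases w with
  | nil => rw [reverse_nil, first_nil, last_nil]
  | cons i a w => rw [reverse_cons, first_cons, last_append_single]

lemma splits_reverse {M : Type u} [AddCommGroup M] [Module k M] (w : BarWord A x y)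
    (F : ∀ m : B.Obj, BarWord B m (Ψ.obj x) → BarWord B (Ψ.obj y) m → M) :
    splits (Ψ.reverse w) F = splits w (fun _ w' w'' => F _ (Ψ.reverse w'') (Ψ.reverse w')) := by
  induction w with
  | nil => rw [reverse_nil, splits_nil, splits_nil, reverse_nil]
  | cons i a w ih =>
    rw [reverse_cons, splits_append_single, ih, splits_cons, add_comm]
    simp only [reverse_cons, reverse_nil]

lemma reverse_isLinComb {c : k} {w w₁ w₂ : BarWord A x y} (h : IsLinComb c w w₁ w₂) :
    IsLinComb c (Ψ.reverse w) (Ψ.reverse w₁) (Ψ.reverse w₂) := by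
  induction h with
  | head i a b w =>
    simp only [reverse_cons, map_add, map_smul]
    exact isLinComb_append_right _ (.head i _ _ _)
  | tail i a _ ih =>
    simp only [reverse_cons]
    exact isLinComb_append_left ih _

lemma reverse_isDegenerate {w : BarWord A x y} (h : IsDegenerate w) :
    IsDegenerate (Ψ.reverse w) := by
  induction h with
  | head w =>
    rw [reverse_cons, Ψ.map_one]
    exact isDegenerate_append_right _ (.head _)
  | tail i a _ ih =>
    rw [reverse_cons]
    exact isDegenerate_append_left ih _

/-- Reversal is compatible with the inner parts of the bar differentials. -/
lemma bdry_reverse (w : BarWord A x y) {F : BarWord B (Ψ.obj y) (Ψ.obj x) → N}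
    (hF : IsNormalized F) :
    sgn k (reverseSign w) • bdry (Ψ.reverse w) F =
      bdry w (fun v => sgn k (reverseSign v) • F (Ψ.reverse v)) := by
  induction w with
  | nil => rw [reverse_nil, bdry_nil, bdry_nil, smul_zero]
  | cons i a w ih =>
    have hw : bdry w (fun v => sgn k (reverseSign (cons i a v)) • F (Ψ.reverse (cons i a v))) =
        (sgn k i * sgn k ((i - 1) * deg w)) • bdry w (fun v => sgn k (reverseSign v) •
          F (append (Ψ.reverse v) (single (Ψ.map a)))) := by
      rw [← bdry_smul]
      refine bdry_congr_deg w fun v hv => ?_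
      rw [reverse_cons, smul_smul]
      congr 1
      rw [reverseSign, hv, show (1 + (i - 1) * (deg w + 1) + reverseSign v) =
        i + (i - 1) * deg w + reverseSign v by ring, sgn_add, sgn_add]
    have hf : first w (fun _ l c v => sgn k (reverseSign (cons (i + l) (A.comp rfl a c) v)) •
          F (Ψ.reverse (cons (i + l) (A.comp rfl a c) v))) =
        (sgn k i * sgn k (reverseSign (cons i a w))) • first w (fun _ l c v => sgn k (deg v + l) •
          F (append (Ψ.reverse v) (single (B.comp rfl (Ψ.map c) (Ψ.map a))))) := by
      cases w with
      | nil => simp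
      | cons l c w =>
        have hs : ∀ (r : k) (b : (B.Hom _ _).X (i + l)),
            F (append (Ψ.reverse w) (single (r • b))) = r • F (append (Ψ.reverse w) (single b)) := by
          exact fun r b => (hF.append_left (Ψ.reverse w)).smul' (i + l) r b (nil _)
        have hc : single (B.comp (add_comm l i) (Ψ.map c) (Ψ.map a)) =
            single (B.comp rfl (Ψ.map c) (Ψ.map a)) := cons_comp _ _ _ _
        rw [first_cons, first_cons, reverse_cons, Ψ.map_comp rfl (add_comm l i), hs, hc, smul_smul,
          smul_smul]
        congr 1
        simp only [reverseSign, deg, ← sgn_add]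
        exact sgn_eq_of_eq_add_two_mul (m := -1) (by ring)
    have e1 : sgn k (reverseSign (cons i a w)) =
        -(sgn k ((i - 1) * deg w) * sgn k (reverseSign w)) := by
      rw [reverseSign, sgn_add, sgn_add, sgn_one]; ring
    have e2 : sgn k (reverseSign (cons (i + 1) ((A.Hom _ _).d i (i + 1) a) w)) =
        -(sgn k ((i - 1) * deg w) * sgn k (deg w) * sgn k (reverseSign w)) := by
      rw [reverseSign, show 1 + (i + 1 - 1) * deg w + reverseSign w =
        1 + ((i - 1) * deg w + deg w + reverseSign w) by ring, sgn_add, sgn_add, sgn_add, sgn_one]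
      ring
    rw [bdry_cons, hw, hf, ← ih (hF.append_right (single (Ψ.map a))), reverse_cons,
      reverse_cons, bdry_append_single, last_reverse, deg_reverse, e1, e2, Ψ.map_d]
    simp only [deg_reverse]
    rcases sgn_eq_one_or (k := k) i with hi | hi <;> simp only [hi] <;> module

/-- The pullback of a functional on Hochschild words under a contravariant functor, with the sign of
the reversal. -/
noncomputable def reverseFun (T : HHWord B → k) (W : HHWord A) : k :=
  sgn k (reverseSign W.w) * T ⟨Ψ.map W.a, Ψ.reverse W.w⟩

variable {T : HHWord B → k}

lemma reverseFun_mk {i : ℤ} (a : (A.Hom y x).X i) (w : BarWord A x y) :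
    Ψ.reverseFun T ⟨a, w⟩ = sgn k (reverseSign w) * T ⟨Ψ.map a, Ψ.reverse w⟩ := rfl

/-- Reversal commutes with the Hochschild differential. It exchanges the two outer terms. -/
lemma hochFun_reverseFun (hT : IsReduced T) (W : HHWord A) : hochFun (Ψ.reverseFun T) W =
    sgn k (reverseSign W.w) * hochFun T ⟨Ψ.map W.a, Ψ.reverse W.w⟩ := by
  obtain ⟨a, w⟩ := W
  rename_i x y i
  have hb := Ψ.bdry_reverse w (hT.normalized (Ψ.map a))
  have hf : first w (fun _ l c v => Ψ.reverseFun T ⟨A.comp rfl a c, v⟩) =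
      -(sgn k i * sgn k (reverseSign w)) • first w (fun _ l c v => sgn k ((l - 1) * (i + deg v)) •
          T ⟨B.comp rfl (Ψ.map c) (Ψ.map a), Ψ.reverse v⟩) := by
    cases w with
    | nil => simp
    | cons l c w =>
      rw [first_cons, first_cons, reverseFun_mk, Ψ.map_comp rfl (add_comm l i), hT.smul,
        HHWord.comp_congr, smul_smul, smul_eq_mul, ← mul_assoc]
      congr 1
      simp only [reverseSign]
      rw [neg_mul, ← neg_one_mul, ← sgn_one k, ← sgn_add, ← sgn_add, ← sgn_add, ← sgn_add]
      exact sgn_eq_of_eq_add_two_mul (m := -1 - (l - 1) * deg w) (by ring)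
  have hl : last w (fun _ v l c => sgn k ((l - 1) * (i + deg v)) •
        Ψ.reverseFun T ⟨A.comp rfl c a, v⟩) =
      -(sgn k i * sgn k (reverseSign w)) • last w (fun _ v l c =>
          T ⟨B.comp rfl (Ψ.map a) (Ψ.map c), Ψ.reverse v⟩) := by
    rw [← last_smul]
    refine last_congr_append w fun t v l c hw => ?_
    rw [reverseFun_mk, Ψ.map_comp rfl (add_comm i l), hT.smul, HHWord.comp_congr, smul_eq_mul,
      smul_eq_mul, ← mul_assoc, ← mul_assoc, hw, reverseSign_append, reverseSign_single, deg_single]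
    congr 1
    rw [← neg_one_mul, ← sgn_one k, ← sgn_add, ← sgn_add, ← sgn_add, ← sgn_add]
    exact sgn_eq_of_eq_add_two_mul (m := i * l - i - 1) (by ring)
  rw [hochFun, hochFun, hf, hl]
  simp only [first_reverse, last_reverse, deg_reverse, smul_eq_mul, reverseFun_mk, Ψ.map_d] at hb ⊢
  linear_combination -sgn k i * hb -
    sgn k (reverseSign w) * (first w (fun _ l c v => sgn k ((l - 1) * (i + deg v)) *
          T ⟨B.comp rfl (Ψ.map c) (Ψ.map a), Ψ.reverse v⟩)) * sgn_mul_self k i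

/-- Reversal anticommutes with Connes' operator: it reverses the circle. -/
lemma connesFun_reverseFun (T : HHWord B → k) (W : HHWord A) : connesFun (Ψ.reverseFun T) W =
    -sgn k (reverseSign W.w) * connesFun T ⟨Ψ.map W.a, Ψ.reverse W.w⟩ := by
  rw [connesFun, connesFun, splits_reverse, ← smul_eq_mul, ← splits_smul]
  refine splits_congr_append _ fun m w' w'' hw => ?_
  simp only [reverseFun, reverse_append, reverse_cons, append_single, Ψ.map_one, deg_reverse,
    smul_eq_mul, ← mul_assoc]
  congr 1
  rw [← hw, reverseSign_append, reverseSign_append, reverseSign, deg, ← neg_one_mul, ← sgn_one k,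
    ← sgn_add, ← sgn_add, ← sgn_add]
  exact sgn_eq_of_eq_add_two_mul (m := deg w'' * (W.i - 1)) (by ring)

end DGAntifunctor

/-! ### The shuffle product of Hochschild words -/

namespace DGBifunctor
variable {C D E : DGCategory k} (Φ : DGBifunctor C D E) {N : Type*} [AddCommGroup N] [Module k N]

/-- The functional on pairs of Hochschild words that is induced by the shuffle product and a
bifunctor. -/
noncomputable def shuffleFun (T : HHWord E → k) (W : HHWord C) (U : HHWord D) : k :=
  sgn k (U.i * deg W.w) *
    Φ.shuffle W.w U.w fun u => T ⟨E.comp rfl (Φ.left U.x W.a) (Φ.right W.y U.a), u⟩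

lemma shuffleFun_mk (T : HHWord E → k) {x y : C.Obj} {p q : D.Obj} {i j : ℤ}
    (a : (C.Hom y x).X i) (w : BarWord C x y) (b : (D.Hom q p).X j) (v : BarWord D p q) :
    Φ.shuffleFun T ⟨a, w⟩ ⟨b, v⟩ = sgn k (j * deg w) *
      Φ.shuffle w v fun u => T ⟨E.comp rfl (Φ.left p a) (Φ.right y b), u⟩ := rfl

section Hochschild
variable {T : HHWord E → k} (hT : IsReduced T)
include hT

lemma isReduced_shuffleFun_left (U : HHWord D) : IsReduced fun W => Φ.shuffleFun T W U where
  lin a b c w := by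
    obtain ⟨b', v⟩ := U
    simp only [shuffleFun_mk, map_add, map_smul, LinearMap.add_apply, LinearMap.smul_apply,
      hT.add, hT.smul, shuffle_add, ← smul_eq_mul (_ : k) (T _), shuffle_smul]
    simp only [smul_eq_mul]
    ring
  normalized a := by
    obtain ⟨b', v⟩ := U
    refine ⟨fun h => ?_, fun h => ?_⟩
    · simp only [shuffleFun_mk, h.deg_eq, Φ.shuffle_isLinComb_left h _ (hT.normalized _),
        smul_eq_mul]
      ring
    · simp only [shuffleFun_mk, Φ.shuffle_isDegenerate_left h _ (hT.normalized _), mul_zero]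

lemma isReduced_shuffleFun_right (W : HHWord C) : IsReduced fun U => Φ.shuffleFun T W U where
  lin a b c w := by
    obtain ⟨a', v⟩ := W
    simp only [shuffleFun_mk, map_add, map_smul,
      hT.add, hT.smul, shuffle_add, ← smul_eq_mul (_ : k) (T _), shuffle_smul]
    simp only [smul_eq_mul]
    ring
  normalized a := by
    obtain ⟨a', v⟩ := W
    refine ⟨fun h => ?_, fun h => ?_⟩
    · simp only [shuffleFun_mk, Φ.shuffle_isLinComb_right _ h (hT.normalized _), smul_eq_mul]
      ring
    · simp only [shuffleFun_mk, Φ.shuffle_isDegenerate_right _ h (hT.normalized _), mul_zero]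

/-- The shuffle product is compatible with the Hochschild differentials. -/
lemma hochFun_shuffleFun (hb : ∀ W, hochFun T W = 0) (W : HHWord C) (U : HHWord D) :
    hochFun (fun W => Φ.shuffleFun T W U) W +
      sgn k W.deg * hochFun (fun U => Φ.shuffleFun T W U) U = 0 := by
  obtain ⟨a, w⟩ := W
  obtain ⟨b, v⟩ := U
  rename_i x y i p q j
  set f := E.comp rfl (Φ.left p a) (Φ.right y b) with hf
  -- the cocycle condition on all words `(a b)[u]`, where `u` is a shuffle of `w` and `v`
  have h0 : Φ.shuffle w v (fun u => hochFun T ⟨f, u⟩) = 0 := by simp only [hb, shuffle_zero]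
  have hd : ∀ u, T ⟨(E.Hom _ _).d (i + j) (i + j + 1) f, u⟩ =
      T ⟨E.comp rfl (Φ.left p ((C.Hom _ _).d i (i + 1) a)) (Φ.right y b), u⟩ +
      sgn k i • T ⟨E.comp rfl (Φ.left p a) (Φ.right y ((D.Hom _ _).d j (j + 1) b)), u⟩ := fun u => by
    rw [hf, E.d_comp rfl rfl rfl rfl, hT.add, hT.smul, HHWord.comp_congr, Φ.left_d, Φ.right_d,
      smul_eq_mul, HHWord.comp_congr (show i + (j + 1) = i + j + 1 by ring)]
  have hfl : ∀ {z} {l} (c : (C.Hom z y).X l) u, T ⟨E.comp rfl f (Φ.left q c), u⟩ =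
      sgn k (l * j) • T ⟨E.comp rfl (Φ.left p (C.comp rfl a c)) (Φ.right z b), u⟩ := fun {z l} c u => by
    rw [hf, E.assoc rfl rfl rfl (add_assoc i j l).symm, Φ.comm rfl (add_comm l j), map_smul,
      hT.smul, ← E.assoc rfl (add_comm l j) (show i + l + j = i + j + l by ring) (by ring),
      Φ.left_comp, HHWord.comp_congr, smul_eq_mul]
  have hfr : ∀ {z} {l} (c : (D.Hom z q).X l) u, T ⟨E.comp rfl f (Φ.right y c), u⟩ =
      T ⟨E.comp rfl (Φ.left p a) (Φ.right y (D.comp rfl b c)), u⟩ := fun {z l} c u => by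
    rw [hf, E.assoc rfl rfl rfl (add_assoc i j l).symm, Φ.right_comp,
      HHWord.comp_congr (add_assoc i j l).symm]
  have hlf : ∀ {z} {l} (c : (C.Hom x z).X l) u, T ⟨E.comp rfl (Φ.left p c) f, u⟩ =
      T ⟨E.comp rfl (Φ.left p (C.comp rfl c a)) (Φ.right y b), u⟩ := fun {z l} c u => by
    rw [hf, ← E.assoc rfl rfl (add_assoc l i j) rfl, Φ.left_comp, HHWord.comp_congr]
  have hrf : ∀ {z} {l} (c : (D.Hom p z).X l) u, T ⟨E.comp rfl (Φ.right x c) f, u⟩ =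
      sgn k (i * l) • T ⟨E.comp rfl (Φ.left z a) (Φ.right y (D.comp rfl c b)), u⟩ :=
    fun {z l} c u => by
    rw [hf, ← E.assoc rfl rfl (add_assoc l i j) rfl, Φ.comm rfl (add_comm i l), map_smul,
      LinearMap.smul_apply, hT.smul, E.assoc (add_comm i l) rfl _ (show i + (l + j) = _ by ring),
      Φ.right_comp, HHWord.comp_congr, smul_eq_mul]
  -- the outer terms of the boundary of a shuffle are indexed by the outer letters of both words
  have hF : Φ.shuffle w v (fun u => first u fun _ _ c u' => T ⟨E.comp rfl f c, u'⟩) =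
      first w (fun z l c w' => sgn k (l * j) • Φ.shuffle w' v fun u =>
        T ⟨E.comp rfl (Φ.left p (C.comp rfl a c)) (Φ.right z b), u⟩) +
      first v (fun _ l c v' => sgn k ((l - 1) * deg w) • Φ.shuffle w v' fun u =>
        T ⟨E.comp rfl (Φ.left p a) (Φ.right y (D.comp rfl b c)), u⟩) := by
    rw [shuffle_first]
    simp only [hfl, hfr, shuffle_smul]
  have hL : Φ.shuffle w v (fun u => last u fun _ u' l c =>
        sgn k ((l - 1) * (i + j + deg u')) • T ⟨E.comp rfl c f, u'⟩) =
      last w (fun _ w' l c => sgn k ((l - 1) * (i + j + deg w')) • Φ.shuffle w' v fun u =>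
        T ⟨E.comp rfl (Φ.left p (C.comp rfl c a)) (Φ.right y b), u⟩) +
      last v (fun z v' l c => (sgn k (i * l) * sgn k ((l - 1) * (i + j + deg w + deg v'))) •
        Φ.shuffle w v' fun u =>
          T ⟨E.comp rfl (Φ.left z a) (Φ.right y (D.comp rfl c b)), u⟩) := by
    rw [shuffle_last]
    congr 1
    · refine last_congr _ fun z w' l c => ?_
      rw [Φ.shuffle_congr_deg w' v (G := fun u => sgn k ((l - 1) * (i + j + (deg w' + deg v))) •
        T ⟨E.comp rfl (Φ.left p (C.comp rfl c a)) (Φ.right y b), u⟩) fun u hu => by rw [hlf, hu],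
        shuffle_smul, smul_smul, ← sgn_add]
      congr 1
      exact sgn_eq_of_eq_add_two_mul (m := (l - 1) * deg v) (by ring)
    · refine last_congr _ fun z v' l c => ?_
      rw [Φ.shuffle_congr_deg w v' (G := fun u => (sgn k (i * l) *
        sgn k ((l - 1) * (i + j + deg w + deg v'))) • T ⟨E.comp rfl (Φ.left z a)
          (Φ.right y (D.comp rfl c b)), u⟩) fun u hu => by
            rw [hrf, hu, smul_smul, mul_comm (sgn k (i * l)), ← add_assoc (i + j)], shuffle_smul]
  -- the terms of the boundaries of the two factors
  have tF1 : first w (fun _ _ c w' => Φ.shuffleFun T ⟨C.comp rfl a c, w'⟩ ⟨b, v⟩) =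
      (sgn k (j * deg w) * sgn k j) • first w (fun z l c w' => sgn k (l * j) •
        Φ.shuffle w' v fun u => T ⟨E.comp rfl (Φ.left p (C.comp rfl a c)) (Φ.right z b), u⟩) := by
    rw [← first_smul]
    refine first_congr w fun z l c w' hw => ?_
    rw [shuffleFun_mk, smul_smul, ← smul_eq_mul, hw]
    congr 1
    rw [← sgn_add, ← sgn_add]
    exact sgn_eq_of_eq_add_two_mul (m := -(l * j)) (by simp only [deg]; ring)
  have tF2 : first v (fun _ _ c v' => Φ.shuffleFun T ⟨a, w⟩ ⟨D.comp rfl b c, v'⟩) =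
      (sgn k (j * deg w) * sgn k (deg w)) • first v (fun _ l c v' => sgn k ((l - 1) * deg w) •
        Φ.shuffle w v' fun u =>
          T ⟨E.comp rfl (Φ.left p a) (Φ.right y (D.comp rfl b c)), u⟩) := by
    rw [← first_smul]
    refine first_congr v fun z l c v' _ => ?_
    rw [shuffleFun_mk, smul_smul, ← smul_eq_mul, ← sgn_add, ← sgn_add]
    congr 2; ring
  have tL1 : last w (fun _ w' l c => sgn k ((l - 1) * (i + deg w')) •
        Φ.shuffleFun T ⟨C.comp rfl c a, w'⟩ ⟨b, v⟩) = sgn k (j * deg w) •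
      last w (fun _ w' l c => sgn k ((l - 1) * (i + j + deg w')) • Φ.shuffle w' v fun u =>
        T ⟨E.comp rfl (Φ.left p (C.comp rfl c a)) (Φ.right y b), u⟩) := by
    rw [← last_smul]
    refine last_congr_deg w fun z w' l c hd => ?_
    rw [shuffleFun_mk, smul_eq_mul, ← mul_assoc, smul_smul, smul_eq_mul, ← sgn_add, ← sgn_add, ← hd]
    congr 1
    exact sgn_eq_of_eq_add_two_mul (m := -(j * (l - 1))) (by ring)
  have tL2 : last v (fun _ v' l c => sgn k ((l - 1) * (j + deg v')) •
        Φ.shuffleFun T ⟨a, w⟩ ⟨D.comp rfl c b, v'⟩) =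
      (sgn k (j * deg w) * sgn k i * sgn k (deg w)) •
      last v (fun z v' l c => (sgn k (i * l) * sgn k ((l - 1) * (i + j + deg w + deg v'))) •
        Φ.shuffle w v' fun u =>
          T ⟨E.comp rfl (Φ.left z a) (Φ.right y (D.comp rfl c b)), u⟩) := by
    rw [← last_smul]
    refine last_congr v fun z v' l c => ?_
    rw [shuffleFun_mk, smul_eq_mul, ← mul_assoc, smul_smul, smul_eq_mul, ← sgn_add, ← sgn_add,
      ← sgn_add, ← sgn_add, ← sgn_add]
    congr 1
    exact sgn_eq_of_eq_add_two_mul (m := -(i * l)) (by ring)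
  have tB1 : bdry w (fun w' => Φ.shuffleFun T ⟨a, w'⟩ ⟨b, v⟩) = (sgn k (j * deg w) * sgn k j) •
      bdry w (fun w' => Φ.shuffle w' v fun u => T ⟨f, u⟩) := by
    rw [← bdry_smul]
    refine bdry_congr_deg w fun w' hd => ?_
    rw [shuffleFun_mk, smul_eq_mul, hd, ← sgn_add, mul_add, mul_one]
  have tB2 : bdry v (fun v' => Φ.shuffleFun T ⟨a, w⟩ ⟨b, v'⟩) = sgn k (j * deg w) •
      bdry v (fun v' => Φ.shuffle w v' fun u => T ⟨f, u⟩) := by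
    rw [← bdry_smul]; rfl
  have h1 : ∀ u, hochFun T ⟨f, u⟩ = T ⟨(E.Hom _ _).d (i + j) (i + j + 1) f, u⟩ +
      sgn k (i + j) • bdry u (fun u' => T ⟨f, u'⟩) +
      sgn k (i + j) • first u (fun _ _ c u' => T ⟨E.comp rfl f c, u'⟩) -
      last u (fun _ u' l c => sgn k ((l - 1) * (i + j + deg u')) • T ⟨E.comp rfl c f, u'⟩) :=
    fun u => rfl
  simp only [h1, hd, shuffle_sub, shuffle_add, shuffle_smul] at h0
  rw [hF, hL, Φ.shuffle_bdry w v (hT.normalized f)] at h0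
  simp only [hochFun, HHWord.deg, tF1, tF2, tL1, tL2, tB1, tB2]
  simp only [shuffleFun_mk, sgn_add, add_mul, one_mul]
  simp only [sgn_add, smul_eq_mul] at h0 ⊢
  rcases sgn_eq_one_or (k := k) i with hi | hi <;> rcases sgn_eq_one_or (k := k) j with hj | hj <;>
  rcases sgn_eq_one_or (k := k) (deg w) with hw | hw <;> simp only [hi, hj, hw] at h0 ⊢ <;>
  linear_combination sgn k (j * deg w) * h0

end Hochschild

/-- Iterated shuffles may be interchanged. -/
lemma shuffle_comm {x y x' y' : C.Obj} {p q p' q' : D.Obj} (w : BarWord C x y) (v : BarWord D p q)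
    (w' : BarWord C x' y') (v' : BarWord D p' q')
    (G : BarWord E (Φ.obj x p) (Φ.obj y q) → BarWord E (Φ.obj x' p') (Φ.obj y' q') → N) :
    Φ.shuffle w v (fun u => Φ.shuffle w' v' (fun u' => G u u')) =
      Φ.shuffle w' v' (fun u' => Φ.shuffle w v (fun u => G u u')) := by
  induction w, v using shuffle_induction with
  | nil_nil => simp
  | nil_cons j b v ih => simp only [shuffle_nil_cons, ih]
  | cons_nil i a w ih => simp only [shuffle_cons_nil, ih]
  | cons_cons i a w j b v ih ih' =>
    simp only [shuffle_cons_cons, ih, ih', shuffle_add, shuffle_smul]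

/-- A function on Hochschild words that is invariant under cyclic permutations of the letters. -/
def _root_.DGCY.IsCyclic {E : DGCategory k} (T : HHWord E → k) : Prop :=
  ∀ {x y s t : E.Obj} {i j : ℤ} (f : (E.Hom y x).X i) (u : BarWord E t y) (g : (E.Hom s t).X j)
    (u' : BarWord E x s), T ⟨f, append u (cons j g u')⟩ =
      sgn k ((i + deg u - 1) * (j + deg u' - 1)) * T ⟨g, append u' (cons i f u)⟩

/-- The shuffle product is compatible with Connes' operators, when evaluated by a cyclic
functional. -/
lemma connesFun_shuffleFun {T : HHWord E → k} (hT : IsCyclic T) (W : HHWord C) (U : HHWord D) :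
    connesFun (fun W => Φ.shuffleFun T W U) W =
      -sgn k W.deg * connesFun (fun U => Φ.shuffleFun T W U) U := by
  obtain ⟨a, w⟩ := W
  obtain ⟨b, v⟩ := U
  rename_i x y i p q j
  -- both sides are sums over the ways of cutting both words; on the left one of the two cuts is made
  -- by the position of `a` in the shuffles, and the cyclic symmetry moves `a` to the front
  have hl : connesFun (fun W => Φ.shuffleFun T W ⟨b, v⟩) ⟨a, w⟩ =
      splits w fun m w' w'' => splits v fun r v' v'' =>
        sgn k ((i - 1 + deg w') * deg w'' + j * (deg w'' + (i - 1 + deg w')) +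
          (i - 1 + deg w') * deg v' + (j + (deg w'' + deg v') - 1) *
          (i + (deg w' + deg v'') - 1)) • Φ.shuffle w'' v' fun u' => Φ.shuffle w' v'' fun u'' =>
            T ⟨Φ.left r a, append u'' (cons j (Φ.right m b) u')⟩ := by
    refine splits_congr _ fun m w' w'' _ => ?_
    beta_reduce
    rw [shuffleFun_mk, Φ.left_one]
    simp only [HHWord.one_comp]
    rw [shuffle_append_left, deg_append, deg, smul_eq_mul, ← mul_assoc, ← smul_eq_mul (_ * _),
      ← splits_smul]
    refine splits_congr _ fun r v' v'' _ => ?_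
    rw [Φ.shuffle_congr_deg w'' v' (G := fun u' => sgn k ((j + (deg w'' + deg v') - 1) *
          (i + (deg w' + deg v'') - 1)) • Φ.shuffle w' v'' fun u'' =>
            T ⟨Φ.left r a, append u'' (cons j (Φ.right m b) u')⟩) fun u' hu' => ?_]
    · rw [shuffle_smul, smul_smul, smul_smul, sgn_add, sgn_add, sgn_add]
    · rw [← shuffle_smul]
      refine Φ.shuffle_congr_deg w' v'' fun u'' hu'' => ?_
      rw [hT, hu', hu'', smul_eq_mul]
  have hr : connesFun (fun U => Φ.shuffleFun T ⟨a, w⟩ U) ⟨b, v⟩ =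
      splits v fun r v' v'' => splits w fun m w' w'' =>
        sgn k ((j - 1 + deg v') * deg v'' + deg w'' * (deg v'' + (j - 1))) •
          Φ.shuffle w'' v' fun u' => Φ.shuffle w' v'' fun u'' =>
            T ⟨Φ.left r a, append u'' (cons j (Φ.right m b) u')⟩ := by
    refine splits_congr _ fun r v' v'' _ => ?_
    beta_reduce
    rw [shuffleFun_mk, Φ.right_one]
    simp only [HHWord.comp_one]
    rw [shuffle_append_right, zero_mul, sgn_zero, one_mul, ← splits_smul]
    refine splits_congr _ fun m w' w'' _ => ?_
    rw [shuffle_comm, smul_smul, sgn_add]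
  rw [hl, hr, splits_comm, ← smul_eq_mul, ← splits_smul]
  refine splits_congr _ fun r v' v'' _ => ?_
  rw [← splits_smul]
  refine splits_congr _ fun m w' w'' hw => ?_
  rw [smul_smul]
  congr 1
  rw [HHWord.deg, ← hw, ← neg_one_mul, ← sgn_one k, ← sgn_add, ← sgn_add]
  exact sgn_eq_of_eq_add_two_mul (m := (i - 1 + deg w') * (deg w'' + j + deg v' - 1) - 1)
    (by ring)

end DGBifunctor

/-! ### Complexes as a representation of their endomorphism category -/

section Endo
variable {I : Type u} (V : I → CochainComplex (ModuleCat.{u} k) ℤ)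
open CochainComplex.HomComplex

/-- The tautological dg functor on the dg category of the complexes `V`. -/
noncomputable def endoRep : DGRep (endoCategory V) where
  K := V
  op {x y i} := cochainOp (V x) (V y) i
  op_comp {x y z i j l} h f g := cochainOp_comp (K := V x) (L := V y) (N := V z) g f (by omega)
  op_one x := cochainOp_id
  op_d {x y i} f := cochainOp_δ (K := V x) (L := V y) rfl f
  parity {x y i} f := hasParity_cochainOp (K := V x) (L := V y) f

/-- A contraction as an operator on the total space. -/
noncomputable def Contraction.toOp {K : CochainComplex (ModuleCat.{u} k) ℤ} (c : Contraction K) :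
    OpContraction K where
  h := Total.pi fun q => c.h q ∘ₗ Total.proj (q + 1)
  h_h := LinearMap.ext fun m => Total.ext fun q => c.h_h q _
  h_d_h := LinearMap.ext fun m => Total.ext fun q => by
    refine Eq.trans (congrArg (c.h q) ?_) (c.h_d_h q (Total.proj (q + 1) m))
    exact proj_diffOp _ rfl
  d_h_d := LinearMap.ext fun m => Total.ext fun q => by
    obtain ⟨p, rfl⟩ : ∃ p, q = p + 1 := ⟨q - 1, by ring⟩
    rw [LinearMap.comp_apply, LinearMap.comp_apply, proj_diffOp _ rfl, proj_diffOp _ rfl,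
      Total.proj_pi, LinearMap.comp_apply, proj_diffOp _ rfl]
    exact c.d_h_d p _
  parity := LinearMap.ext fun m => Total.ext fun q => by
    rw [LinearMap.comp_apply, proj_gradeOp, LinearMap.smul_apply, LinearMap.comp_apply, map_smul,
      Total.proj_pi, Total.proj_pi, LinearMap.comp_apply, LinearMap.comp_apply, proj_gradeOp,
      map_smul, smul_smul, ← sgn_add]
    congr 2; ring

variable {V} (c : ∀ i, Contraction (V i))

/-- The family of the contractions `c` as operators on the total spaces. -/
noncomputable def opContraction (x : (endoCategory V).Obj) : OpContraction ((endoRep V).K x) :=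
  (c x).toOp

lemma op_homotopyOp (x : (endoCategory V).Obj) :
    (endoRep V).op (show ((endoCategory V).Hom x x).X (-1) from homotopyOp c x) =
      (opContraction c x).h := by
  refine LinearMap.ext fun m => Total.ext fun q => ?_
  refine (proj_cochainOp (K := V x) (L := V x) (homotopyOp c x) m
    (show q + 1 + -1 = q by omega)).trans ?_
  simp [homotopyOp, Cochain.mk_v, HomologicalComplex.XIsoOfEq]
  rfl

lemma op_projOp (x : (endoCategory V).Obj) :
    (endoRep V).op (show ((endoCategory V).Hom x x).X 0 from projOp c x) =
      (opContraction c x).e := by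
  have h := (endoRep V).op_d (show ((endoCategory V).Hom x x).X (-1) from homotopyOp c x)
  rw [op_homotopyOp, sgn_neg, sgn_one, neg_one_smul, sub_neg_eq_add] at h
  refine ((endoRep V).op.map_sub _ _).trans ?_
  rw [(endoRep V).op_one, OpContraction.e, sub_sub, ← h]
  rfl

lemma op_perturbH {x y : (endoCategory V).Obj} (w : BarWord (endoCategory V) x y) :
    (endoRep V).op (perturbH c w) = hWord (endoRep V) (opContraction c) w := by
  induction w with
  | nil =>
    have h : perturbH c (nil x) = (endoCategory V).comp (show 0 + -1 = _ by simp [deg])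
      ((endoCategory V).one x) (show ((endoCategory V).Hom x x).X (-1) from homotopyOp c x) := rfl
    rw [h, (endoRep V).op_comp, (endoRep V).op_one, LinearMap.id_comp, hWord_nil, op_homotopyOp]
  | cons i f w ih =>
    rename_i y z
    have h : perturbH c (cons i f w) = -sgn k i • (endoCategory V).comp
      (show -1 + (i + (w.deg - 1)) = (cons i f w).deg - 1 by simp only [deg]; ring)
      (show ((endoCategory V).Hom z z).X (-1) from homotopyOp c z)
      ((endoCategory V).comp rfl f (perturbH c w)) := rfl
    rw [h, map_smul, (endoRep V).op_comp, (endoRep V).op_comp, ih, hWord, op_homotopyOp]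

lemma op_perturbG {x y : (endoCategory V).Obj} (w : BarWord (endoCategory V) x y) :
    (endoRep V).op (perturbG c w) = gWord (endoRep V) (opContraction c) w := by
  induction w with
  | nil =>
    rw [gWord_nil, ← op_projOp]; rfl
  | cons i f w ih =>
    rename_i y z
    have h : perturbG c (cons i f w) = -sgn k i • (endoCategory V).comp
        (show 0 + (i + (w.deg - 1)) = (cons i f w).deg by simp only [deg]; ring)
        (show ((endoCategory V).Hom z z).X 0 from projOp c z)
        ((endoCategory V).comp rfl f (perturbH c w)) +
      (endoCategory V).comp (show -1 + (i + w.deg) = (cons i f w).deg by simp only [deg]; ring)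
        (show ((endoCategory V).Hom z z).X (-1) from homotopyOp c z)
        ((endoCategory V).comp rfl f (perturbG c w)) := rfl
    rw [h, map_add, map_smul, (endoRep V).op_comp, (endoRep V).op_comp,
      (endoRep V).op_comp, (endoRep V).op_comp, ih, op_perturbH, op_projOp, op_homotopyOp, gWord]

variable (hc : ∀ x, IsFiniteRank (opContraction c x).e)
include hc

/-- The trace functional of the family of complexes, in terms of operators on total spaces. -/
lemma traceFunctional_eq_strWord {x y : (endoCategory V).Obj} {i : ℤ}
    (f : ((endoCategory V).Hom y x).X i) (w : BarWord (endoCategory V) x y) :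
    traceFunctional c f w = strWord (endoRep V) (opContraction c) f w := by
  have h0 : (endoRep V).op ((endoCategory V).comp rfl f (perturbG c w)) =
      (endoRep V).op f ∘ₗ gWord (endoRep V) (opContraction c) w := by
    rw [(endoRep V).op_comp, op_perturbG]
  have hfr := isFiniteRank_op_comp_gWord (endoRep V) (opContraction c) hc f w
  by_cases h : i + w.deg = 0
  · have h1 : (endoRep V).op ((endoCategory V).comp h f (perturbG c w)) =
        (endoRep V).op f ∘ₗ gWord (endoRep V) (opContraction c) w := by
      rw [(endoRep V).op_comp, op_perturbG]
    rw [← h1] at hfr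
    refine Eq.trans (dif_pos h) ?_
    rw [strWord, ← h1]
    exact supertrace_eq_str (K := V x) _ hfr
  · rw [← h0] at hfr
    refine Eq.trans (dif_neg h) ?_
    rw [strWord, ← h0]
    exact (str_cochainOp_of_ne_zero (K := V x) h _ hfr).symm

end Endo

/-! ### The functor `(a, p) ↦ A(a, p)` -/

section ActionIdentities
variable (A : DGCategory k) {x y z t : A.Obj}

lemma sgn_smul_comp_comp {i j l q r s : ℤ} (h : j + i = l) (hq : q + l = r) (h₁ : q + j = s)
    (h₂ : s + i = r) (a : (A.Hom x y).X i) (b : (A.Hom y z).X j) (v : (A.Hom z t).X q) :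
    sgn k (l * q) • A.comp hq v (sgn k (i * j) • A.comp h b a) =
      sgn k (i * s) • A.comp h₂ (sgn k (j * q) • A.comp h₁ v b) a := by
  rw [map_smul, map_smul, LinearMap.smul_apply, smul_smul, smul_smul, ← sgn_add, ← sgn_add,
    A.assoc h₁ h h₂ hq]
  congr 1
  exact sgn_eq_of_eq_add_two_mul (m := 0) (by subst h h₁; ring)

lemma sgn_smul_comp_d {i q r r' : ℤ} (h : q + (i + 1) = r) (h₁ : q + i = r')
    (h₂ : q + 1 + i = r) (a : (A.Hom x y).X i) (v : (A.Hom y z).X q) :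
    sgn k ((i + 1) * q) • A.comp h v ((A.Hom x y).d i (i + 1) a) =
      (A.Hom x z).d r' r (sgn k (i * q) • A.comp h₁ v a) + (i + 1).negOnePow •
        (sgn k (i * (q + 1)) • A.comp h₂ ((A.Hom y z).d q (q + 1) v) a) := by
  rw [negOnePow_smul k, map_smul, A.d_comp h₁ rfl rfl (by omega)]
  simp only [add_mul, mul_add, one_mul, mul_one, sgn_add, sgn_one, smul_add, smul_smul]
  linear_combination (norm := module) (sgn k (i * q) • sgn_mul_self k i) •
    A.comp h₂ ((A.Hom y z).d q (q + 1) v) a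

lemma comp_d_left {j q r r' : ℤ} (h : j + 1 + q = r) (h₁ : j + q = r') (h₂ : j + (q + 1) = r)
    (b : (A.Hom y z).X j) (v : (A.Hom x y).X q) :
    A.comp h ((A.Hom y z).d j (j + 1) b) v = (A.Hom x z).d r' r (A.comp h₁ b v) +
      (j + 1).negOnePow • A.comp h₂ b ((A.Hom x y).d q (q + 1) v) := by
  rw [negOnePow_smul k, A.d_comp h₁ rfl rfl (by omega), sgn_add, sgn_one]
  module

lemma comp_sgn_smul_comp {i j q r s t' : ℤ} (h₁ : q + i = s) (h₂ : j + s = r) (h₃ : j + q = t')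
    (h₄ : t' + i = r) (a : (A.Hom x y).X i) (b : (A.Hom z t).X j) (v : (A.Hom y z).X q) :
    A.comp h₂ b (sgn k (i * q) • A.comp h₁ v a) =
      sgn k (i * j) • sgn k (i * (q + j)) • A.comp h₄ (A.comp h₃ b v) a := by
  rw [map_smul, smul_smul, ← sgn_add, A.assoc h₃ h₁ h₄ h₂]
  congr 1
  exact sgn_eq_of_eq_add_two_mul (m := -(i * j)) (by ring)

end ActionIdentities

section HomFunctor
variable (A : DGCategory k) (P : Set A.Obj)
open CochainComplex.HomComplex

/-- The identity, as a contravariant functor from `A` to its opposite. -/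
def opAntifunctor : DGAntifunctor A A.op where
  obj := id
  map := LinearMap.id
  map_one _ := rfl
  map_comp {x y z i j l} h h' a b := by
    change A.comp h a b = sgn k (i * j) • sgn k (j * i) • A.comp h a b
    rw [smul_smul, mul_comm j i, sgn_mul_self, one_smul]
  map_d _ := rfl

/-- The dg functor `A^op ⊗ P ⟶ Ch(k)`, `(a, p) ↦ A(a, p)`. -/
def homBifunctor : DGBifunctor A.op (A.full P) (homCategory A P) where
  obj a p := (a, p)
  left p {x y i} :=
    { toFun := fun a => actOp p a
      map_add' := fun a b => by
        refine Cochain.ext _ _ fun q r h => ModuleCat.hom_ext (LinearMap.ext fun v => ?_)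
        exact (congrArg (sgn k (i * q) • ·) (map_add ((A.comp h) v) a b)).trans (smul_add _ _ _)
      map_smul' := fun c a => by
        refine Cochain.ext _ _ fun q r h => ModuleCat.hom_ext (LinearMap.ext fun v => ?_)
        exact (congrArg (sgn k (i * q) • ·) (map_smul ((A.comp h) v) c a)).trans
          (smul_comm (sgn k (i * q)) c (A.comp h v a)) }
  right x {p q j} :=
    { toFun := fun b => actFull (A := A) (P := P) x b
      map_add' := fun a b => by
        refine Cochain.ext _ _ fun q r h => ModuleCat.hom_ext (LinearMap.ext fun v => ?_)
        exact LinearMap.congr_fun (map_add (A.comp _) a b) v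
      map_smul' := fun c a => by
        refine Cochain.ext _ _ fun q r h => ModuleCat.hom_ext (LinearMap.ext fun v => ?_)
        exact LinearMap.congr_fun (map_smul (A.comp _) c a) v }
  left_one p x := by
    refine Cochain.ext _ _ fun q r h => ModuleCat.hom_ext (LinearMap.ext fun v => ?_)
    obtain rfl : q = r := by omega
    refine Eq.trans ?_ (congrArg (fun X => X.hom v)
      (Cochain.ofHom_v (𝟙 (homFamily A P (x, p))) q)).symm
    change sgn k (0 * q) • A.comp h v (A.one x) = v
    rw [zero_mul, sgn_zero, one_smul]
    exact A.comp_one v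
  right_one x p := by
    refine Cochain.ext _ _ fun q r h => ModuleCat.hom_ext (LinearMap.ext fun v => ?_)
    obtain rfl : q = r := by omega
    refine Eq.trans ?_ (congrArg (fun X => X.hom v)
      (Cochain.ofHom_v (𝟙 (homFamily A P (x, p))) q)).symm
    exact A.one_comp v
  left_comp p {x y z i j l} h a b := by
    refine Cochain.ext _ _ fun q r hq => ModuleCat.hom_ext (LinearMap.ext fun v => ?_)
    refine Eq.trans ?_ (congrArg (fun X => X.hom v) (Cochain.comp_v (actOp (P := P) p b)
      (actOp p a) (show j + i = l by omega) q (q + j) r rfl (by omega))).symm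
    exact sgn_smul_comp_comp A (by omega) hq rfl (by omega) a b v
  right_comp x {p q r i j l} h a b := by
    refine Cochain.ext _ _ fun s t hq => ModuleCat.hom_ext (LinearMap.ext fun v => ?_)
    refine Eq.trans ?_ (congrArg (fun X => X.hom v) (Cochain.comp_v (actFull (A := A) (P := P) x b)
      (actFull (A := A) (P := P) x a) (show j + i = l by omega) s (s + j) t rfl (by omega))).symm
    exact A.assoc h (add_comm j s) _ (by omega) a b v
  left_d p {x y i} a := by
    refine Cochain.ext _ _ fun q r hq => ModuleCat.hom_ext (LinearMap.ext fun v => ?_)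
    refine Eq.trans ?_ (congrArg (fun X => X.hom v) (δ_v i (i + 1) rfl (actOp (P := P) p a) q r hq
      (r - 1) (q + 1) (by omega) rfl)).symm
    exact sgn_smul_comp_d A hq (by omega) (by omega) a v
  right_d x {p q j} b := by
    refine Cochain.ext _ _ fun s t hq => ModuleCat.hom_ext (LinearMap.ext fun v => ?_)
    refine Eq.trans ?_ (congrArg (fun X => X.hom v) (δ_v j (j + 1) rfl
      (actFull (A := A) (P := P) x b) s t hq (t - 1) (s + 1) (by omega) rfl)).symm
    exact comp_d_left A _ _ _ b v
  comm {x y p q i j l} h h' a b := by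
    refine Cochain.ext _ _ fun s t hq => ModuleCat.hom_ext (LinearMap.ext fun v => ?_)
    refine Eq.trans (congrArg (fun X => X.hom v) (Cochain.comp_v (actOp (P := P) p a)
      (actFull (A := A) (P := P) y b) (show i + j = l by omega) s (s + i) t rfl (by omega))) ?_
    refine Eq.trans ?_ (congrArg (fun X => sgn k (i * j) • X.hom v)
      (Cochain.comp_v (actFull (A := A) (P := P) x b) (actOp (P := P) q a)
        (show j + i = l by omega) s (s + j) t rfl (by omega))).symm
    exact comp_sgn_smul_comp A rfl _ _ (by omega) a b v

variable {A P}

lemma reverse_eq {x y : A.Obj} (w : BarWord A x y) :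
    BarWord.reverse w = (opAntifunctor A).reverse w := by
  induction w with
  | nil => rfl
  | cons i a w ih =>
    exact congrArg (fun u => append (A := A.op) u (single ((opAntifunctor A).map a))) ih

lemma shuffle_eq {x y : A.op.Obj} (w : BarWord A.op x y) {p q : (A.full P).Obj}
    (v : BarWord (A.full P) p q)
    (F : BarWord (homCategory A P) ((homBifunctor A P).obj x p) ((homBifunctor A P).obj y q) → k) :
    shuffle (A := A) (P := P) w v F = (homBifunctor A P).shuffle w v F := by
  induction w, v using DGBifunctor.shuffle_induction with
  | nil_nil => rfl
  | nil_cons j b v ih =>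
    have h : shuffle (A := A) (P := P) (nil x) (cons j b v) F = shuffle (A := A) (P := P) (nil x) v
        fun u => F (cons j ((homBifunctor A P).right x b) u) := rfl
    exact h.trans ((ih _).trans ((homBifunctor A P).shuffle_nil_cons j b v F).symm)
  | cons_nil i a w ih =>
    have h : shuffle (A := A) (P := P) (cons i a w) (nil p) F =
        shuffle (A := A) (P := P) w (nil p)
          fun u => F (cons i ((homBifunctor A P).left p a) u) := rfl
    exact h.trans ((ih _).trans ((homBifunctor A P).shuffle_cons_nil i a w F).symm)
  | cons_cons i a w j b v ih ih' =>
    rename_i y z q r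
    have h : shuffle (A := A) (P := P) (cons i a w) (cons j b v) F =
      shuffle (A := A) (P := P) w (cons j b v)
          (fun u => F (cons i ((homBifunctor A P).left r a) u)) +
        sgn k ((j - 1) * deg (cons i a w)) • shuffle (A := A) (P := P) (cons i a w) v
          (fun u => F (cons j ((homBifunctor A P).right z b) u)) := rfl
    refine h.trans (Eq.trans ?_ ((homBifunctor A P).shuffle_cons_cons i a w j b v F).symm)
    exact congrArg₂ (· + ·) (ih _) (congrArg (sgn k _ • ·) (ih' _))

end HomFunctor

/-! ### The pairing of the Hochschild complexes -/

section
variable {A B : DGCategory k}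

lemma hochFun_smul (r : k) (T : HHWord A → k) (W : HHWord A) :
    hochFun (fun W => r * T W) W = r * hochFun T W := by
  have hl : last W.w (fun _ v j a => sgn k ((j - 1) * (W.i + v.deg)) •
      (r * T ⟨A.comp rfl a W.a, v⟩)) = r • last W.w (fun _ v j a =>
        sgn k ((j - 1) * (W.i + v.deg)) • T ⟨A.comp rfl a W.a, v⟩) := by
    rw [← last_smul]
    exact last_congr _ fun _ _ _ _ => smul_comm _ r _
  rw [hochFun, hochFun, hl]
  simp only [← smul_eq_mul r, bdry_smul, first_smul]
  module

lemma connesFun_smul (r : k) (T : HHWord A → k) (W : HHWord A) :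
    connesFun (fun W => r * T W) W = r * connesFun T W := by
  rw [connesFun, connesFun, ← smul_eq_mul, ← splits_smul]
  exact splits_congr _ fun _ _ _ _ => smul_comm _ r _

lemma DGAntifunctor.isReduced_reverseFun (Ψ : DGAntifunctor A B) {T : HHWord B → k}
    (hT : IsReduced T) : IsReduced (Ψ.reverseFun T) where
  lin a b r w := by
    simp only [reverseFun_mk, map_add, map_smul, hT.lin]
    ring
  normalized a := by
    refine ⟨fun h => ?_, fun h => ?_⟩
    · simp only [reverseFun_mk, (hT.normalized _).lin (Ψ.reverse_isLinComb h), h.reverseSign_eq.1, h.reverseSign_eq.2,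
        smul_eq_mul]
      ring
    · simp only [reverseFun_mk, (hT.normalized _).degenerate (Ψ.reverse_isDegenerate h), mul_zero]

end

section Pairing
variable {A : DGCategory k} {P : Set A.Obj} (c : ∀ X : A.Obj × P, Contraction (homFamily A P X))

/-- The trace functional on the Hochschild words of the category of the complexes `A(a, p)`. -/
noncomputable def traceFun (W : HHWord (homCategory A P)) : k :=
  strWord (endoRep (homFamily A P)) (opContraction c) W.a W.w

lemma deg_map_reverse (W : HHWord A) : HHWord.deg (⟨(opAntifunctor A).map W.a,
    (opAntifunctor A).reverse W.w⟩ : HHWord A.op) = W.deg := by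
  rw [HHWord.deg, HHWord.deg, DGAntifunctor.deg_reverse]

/-- The pairing is of degree `0`. -/
lemma pairing_eq_zero (W : HHWord A) (U : HHWord (A.full P)) (h : W.deg + U.deg ≠ 0) :
    pairing c W U = 0 := by
  obtain ⟨a, w⟩ := W
  obtain ⟨b, v⟩ := U
  rename_i x y i p q j
  rw [pairing]
  refine (congrArg (_ * ·) ?_).trans (mul_zero _)
  refine (shuffle_eq _ _ _).trans (Eq.trans ?_ ((homBifunctor A P).shuffle_zero (N := k) w.reverse v))
  refine DGBifunctor.shuffle_congr_deg _ _ v fun u hu => dif_neg fun h0 => h ?_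
  have e : deg w.reverse = deg w := by
    rw [reverse_eq]
    exact (opAntifunctor A).deg_reverse w
  have h1 : i + j + deg u = 0 := h0
  have h2 : deg u = deg w.reverse + deg v := hu
  change i + deg w + (j + deg v) = 0
  rw [← h1, h2, e]
  ring

variable (hc : ∀ X, IsFiniteRank (opContraction c X).e)
include hc

lemma isReduced_traceFun : IsReduced (traceFun c) where
  lin a b r w := by
    simp only [traceFun, strWord_add _ _ hc, strWord_smul _ _ hc]
  normalized a := isNormalized_strWord _ _ hc a

lemma hochFun_traceFun (W : HHWord (homCategory A P)) : hochFun (traceFun c) W = 0 :=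
  strWord_hochB _ _ hc W.a W.w

lemma isCyclic_traceFun : IsCyclic (traceFun c) := fun f u g u' => strWord_append _ _ hc f u g u'

/-- The pairing is the trace functional, evaluated on the shuffle product of the reversed word of `A`
and the word of `P`. -/
lemma pairing_eq (W : HHWord A) (U : HHWord (A.full P)) :
    pairing c W U = (opAntifunctor A).reverseFun
      (fun W => (homBifunctor A P).shuffleFun (traceFun c) W U) W := by
  obtain ⟨a, w⟩ := W
  obtain ⟨b, v⟩ := U
  rename_i x y i p q j
  rw [DGAntifunctor.reverseFun_mk, pairing, sgn_add, mul_assoc]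
  refine congrArg (sgn k w.reverseSign * ·) ?_
  refine Eq.trans ?_ ((homBifunctor A P).shuffleFun_mk (traceFun c) _ _ b v).symm
  rw [DGAntifunctor.deg_reverse]
  refine congrArg (sgn k (j * w.deg) * ·) ?_
  rw [← shuffle_eq, ← reverse_eq]
  refine congrArg (shuffle (A := A) (P := P) w.reverse v) (funext fun u => ?_)
  exact traceFunctional_eq_strWord c hc _ u

lemma isReduced_pairing_left (U : HHWord (A.full P)) : IsReduced fun W => pairing c W U := by
  simp only [pairing_eq c hc]
  exact (opAntifunctor A).isReduced_reverseFun
    ((homBifunctor A P).isReduced_shuffleFun_left (isReduced_traceFun c hc) U)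

lemma isReduced_pairing_right (W : HHWord A) : IsReduced fun U => pairing c W U := by
  have h := (homBifunctor A P).isReduced_shuffleFun_right (isReduced_traceFun c hc)
    ⟨(opAntifunctor A).map W.a, (opAntifunctor A).reverse W.w⟩
  simp only [pairing_eq c hc, DGAntifunctor.reverseFun]
  refine ⟨fun a b r w => ?_, fun a => ⟨fun hw => ?_, fun hw => ?_⟩⟩
  · rw [h.lin]; ring
  · rw [(h.normalized a).lin hw, smul_eq_mul, smul_eq_mul]; ring
  · rw [(h.normalized a).degenerate hw, mul_zero]

/-- The pairing is compatible with the Hochschild differentials. -/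
lemma hochFun_pairing (W : HHWord A) (U : HHWord (A.full P)) :
    hochFun (fun W => pairing c W U) W + sgn k W.deg * hochFun (fun U => pairing c W U) U = 0 := by
  have h := (homBifunctor A P).hochFun_shuffleFun (isReduced_traceFun c hc)
    (hochFun_traceFun c hc) ⟨(opAntifunctor A).map W.a, (opAntifunctor A).reverse W.w⟩ U
  rw [deg_map_reverse] at h
  simp only [pairing_eq c hc]
  rw [(opAntifunctor A).hochFun_reverseFun ((homBifunctor A P).isReduced_shuffleFun_left
    (isReduced_traceFun c hc) U)]
  simp only [DGAntifunctor.reverseFun]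
  rw [hochFun_smul]
  linear_combination sgn k W.w.reverseSign * h

/-- The pairing is compatible with Connes' operators. -/
lemma connesFun_pairing (W : HHWord A) (U : HHWord (A.full P)) :
    connesFun (fun W => pairing c W U) W = sgn k W.deg * connesFun (fun U => pairing c W U) U := by
  have h := (homBifunctor A P).connesFun_shuffleFun (isCyclic_traceFun c hc)
    ⟨(opAntifunctor A).map W.a, (opAntifunctor A).reverse W.w⟩ U
  rw [deg_map_reverse] at h
  simp only [pairing_eq c hc]
  rw [DGAntifunctor.connesFun_reverseFun]
  simp only [DGAntifunctor.reverseFun]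
  rw [connesFun_smul, h]
  ring

end Pairing

/-! ### The functional `theta` -/

section Theta
variable {A : DGCategory k} {P : Set A.Obj} (c : ∀ X : A.Obj × P, Contraction (homFamily A P X))

section
variable {X Y : Type*}

lemma linearCombination_comm (f : X → Y → k) (ξ : X →₀ k) (β : Y →₀ k) :
    Finsupp.linearCombination k (fun x => Finsupp.linearCombination k (f x) β) ξ =
      Finsupp.linearCombination k (fun y => Finsupp.linearCombination k (fun x => f x y) ξ) β := by
  simp only [Finsupp.linearCombination_apply, Finsupp.sum, smul_eq_mul, Finset.mul_sum]
  rw [Finset.sum_comm]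
  exact Finset.sum_congr rfl fun _ _ => Finset.sum_congr rfl fun _ _ => by ring

lemma linearCombination_congr {f g : X → k} {ξ : X →₀ k} (h : ∀ x ∈ ξ.support, f x = g x) :
    Finsupp.linearCombination k f ξ = Finsupp.linearCombination k g ξ := by
  rw [Finsupp.linearCombination_apply, Finsupp.linearCombination_apply]
  exact Finset.sum_congr rfl fun x hx => congrArg (ξ x • ·) (h x hx)

lemma linearCombination_mul (r : k) (f : X → k) (ξ : X →₀ k) :
    Finsupp.linearCombination k (fun x => r * f x) ξ = r * Finsupp.linearCombination k f ξ := by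
  simp only [Finsupp.linearCombination_apply, Finsupp.sum, smul_eq_mul, Finset.mul_sum]
  exact Finset.sum_congr rfl fun _ _ => by ring

lemma linearCombination_zero (ξ : X →₀ k) :
    Finsupp.linearCombination k (fun _ => (0 : k)) ξ = 0 := by
  simp [Finsupp.linearCombination_apply]

end

/-- The bilinear extension of the pairing to chains. -/
noncomputable def pairingChain (ξ : Chain A) (β : Chain (A.full P)) : k :=
  Finsupp.linearCombination k (fun W => Finsupp.linearCombination k (fun U => pairing c W U) β) ξ

lemma theta_eq (ξ : ℕ → Chain A) (j : ℕ) (β : Chain (A.full P)) :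
    theta c ξ j β = sgn k j * pairingChain c (ξ j) β := by
  rw [pairingChain, linearCombination_comm, theta, ← linearCombination_mul]
  rfl

lemma theta_homog (n : ℤ) (ξ : ℕ → Chain A) (h : ∀ j, ∀ W ∈ (ξ j).support, W.deg = -n - 2 * j)
    (j : ℕ) (U : HHWord (A.full P)) (hU : U.deg ≠ n + 2 * j) :
    theta c ξ j (Finsupp.single U 1) = 0 := by
  rw [theta_eq, pairingChain, linearCombination_congr (g := fun _ => 0), linearCombination_zero,
    mul_zero]
  intro W hW
  rw [Finsupp.linearCombination_single, one_smul]
  refine pairing_eq_zero c W U fun h0 => hU ?_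
  rw [h j W hW] at h0
  linear_combination h0

lemma sgn_cycle (n : ℤ) (j : ℕ) : sgn k (-n - 2 * j) = sgn k n := by
  rw [← sgn_neg]
  exact sgn_eq_of_eq_add_two_mul (m := j) (by ring)

variable (hc : ∀ X, IsFiniteRank (opContraction c X).e)
include hc

lemma pairingChain_eq_zero_left {ξ : Chain A} (hξ : ξ ∈ chainRel A) (β : Chain (A.full P)) :
    pairingChain c ξ β = 0 := by
  rw [pairingChain, linearCombination_comm]
  simp only [(isReduced_pairing_left c hc _).linearCombination_eq_zero hξ, linearCombination_zero]

lemma pairingChain_eq_zero_right (ξ : Chain A) {β : Chain (A.full P)}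
    (hβ : β ∈ chainRel (A.full P)) : pairingChain c ξ β = 0 := by
  rw [pairingChain]
  simp only [(isReduced_pairing_right c hc _).linearCombination_eq_zero hβ, linearCombination_zero]

lemma pairingChain_hochB {ξ : Chain A} {m : ℤ} (hξ : ∀ W ∈ ξ.support, W.deg = m)
    (β : Chain (A.full P)) :
    pairingChain c (hochB A ξ) β = -sgn k m * pairingChain c ξ (hochB _ β) := by
  rw [pairingChain, linearCombination_comm]
  simp only [linearCombination_hochB]
  rw [← linearCombination_comm, pairingChain, ← linearCombination_mul]
  refine linearCombination_congr fun W hW => ?_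
  rw [linearCombination_hochB, ← linearCombination_mul]
  refine linearCombination_congr fun U _ => ?_
  rw [← hξ W hW]
  linear_combination hochFun_pairing c hc W U

lemma pairingChain_connesB {ξ : Chain A} {m : ℤ} (hξ : ∀ W ∈ ξ.support, W.deg = m)
    (β : Chain (A.full P)) :
    pairingChain c (connesB A ξ) β = sgn k m * pairingChain c ξ (connesB _ β) := by
  rw [pairingChain, linearCombination_comm]
  simp only [linearCombination_connesB]
  rw [← linearCombination_comm, pairingChain, ← linearCombination_mul]
  refine linearCombination_congr fun W hW => ?_
  rw [linearCombination_connesB, ← linearCombination_mul]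
  refine linearCombination_congr fun U _ => ?_
  rw [← hξ W hW]
  exact connesFun_pairing c hc W U

variable (n : ℤ) (Λ : LeftCalabiYau A n)

lemma theta_cocycle_zero (β : Chain (A.full P)) : theta c Λ.ξ 0 (hochB _ β) = 0 := by
  have h := pairingChain_hochB c hc (Λ.homog 0) β
  rw [pairingChain_eq_zero_left c hc Λ.cycle_zero] at h
  rw [theta_eq]
  have := sgn_mul_self k (-n - 2 * (0 : ℕ))
  linear_combination (-sgn k (0 : ℕ) * sgn k (-n - 2 * (0 : ℕ))) * (-h) -
    sgn k (0 : ℕ) * pairingChain c (Λ.ξ 0) (hochB _ β) * this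

lemma theta_cocycle_succ (j : ℕ) (β : Chain (A.full P)) :
    theta c Λ.ξ (j + 1) (hochB _ β) + theta c Λ.ξ j (connesB _ β) = 0 := by
  have h1 := pairingChain_hochB c hc (Λ.homog (j + 1)) β
  have h2 := pairingChain_connesB c hc (Λ.homog j) β
  have h3 := pairingChain_eq_zero_left c hc (Λ.cycle_succ j) β
  rw [pairingChain, map_add] at h3
  change pairingChain c _ β + pairingChain c _ β = 0 at h3
  rw [sgn_cycle] at h1 h2
  rw [theta_eq, theta_eq, Nat.cast_succ, sgn_add, sgn_one]
  have := sgn_mul_self k n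
  linear_combination (sgn k (j : ℤ) * sgn k n) * (h3 - h1 - h2) - sgn k (j : ℤ) *
    (pairingChain c (Λ.ξ j) (connesB _ β) - pairingChain c (Λ.ξ (j + 1)) (hochB _ β)) * this

end Theta

/-! ### Cohomology classes -/

section Homology
variable (K : CochainComplex (ModuleCat.{u} k) ℤ) {L : CochainComplex (ModuleCat.{u} k) ℤ}

/-- A cocycle, as an element of the object of cycles. -/
noncomputable def toCocycle (q : ℤ) : LinearMap.ker (K.d q (q + 1)).hom →ₗ[k] K.cycles q :=
  (K.liftCycles (ModuleCat.ofHom (LinearMap.ker (K.d q (q + 1)).hom).subtype) (q + 1) (by simp)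
    (ModuleCat.hom_ext (LinearMap.ext fun v => v.2))).hom

lemma iCycles_toCocycle (q : ℤ) (v : LinearMap.ker (K.d q (q + 1)).hom) :
    K.iCycles q (toCocycle K q v) = v.1 :=
  congrArg (fun F => F.hom v) (K.liftCycles_i (ModuleCat.ofHom
    (LinearMap.ker (K.d q (q + 1)).hom).subtype) (q + 1) (by simp)
    (ModuleCat.hom_ext (LinearMap.ext fun v => v.2)))

lemma iCycles_injective (q : ℤ) : Function.Injective (K.iCycles q) :=
  (ModuleCat.mono_iff_injective (K.iCycles q)).1 inferInstance

/-- The cohomology class of a cocycle. -/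
noncomputable def cohomologyClass (q : ℤ) :
    LinearMap.ker (K.d q (q + 1)).hom →ₗ[k] K.homology q :=
  (K.homologyπ q).hom ∘ₗ toCocycle K q

lemma cohomologyClass_surjective (q : ℤ) : Function.Surjective (cohomologyClass K q) := by
  intro η
  obtain ⟨z, rfl⟩ := (ModuleCat.epi_iff_surjective (K.homologyπ q)).1 inferInstance η
  have hz : K.d q (q + 1) (K.iCycles q z) = 0 := by
    rw [← ModuleCat.comp_apply, K.iCycles_d]; rfl
  refine ⟨⟨K.iCycles q z, hz⟩, ?_⟩
  exact congrArg (K.homologyπ q) (iCycles_injective K q (iCycles_toCocycle K q _))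

lemma cohomologyClass_eq_zero_iff {p q : ℤ} (h : p + 1 = q)
    (v : LinearMap.ker (K.d q (q + 1)).hom) :
    cohomologyClass K q v = 0 ↔ ∃ w, K.d p q w = v.1 := by
  have hp : (ComplexShape.up ℤ).prev q = p := by simp [← h]
  have hex := (ShortComplex.moduleCat_exact_iff _).1
    (ShortComplex.exact_of_g_is_cokernel (ShortComplex.mk _ _ (K.toCycles_comp_homologyπ p q))
      (K.homologyIsCokernel p q hp))
  have ht : ∀ w, K.iCycles q (K.toCycles p q w) = K.d p q w := fun w => by
    rw [← ModuleCat.comp_apply, K.toCycles_i]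
  constructor
  · intro h0
    obtain ⟨w, hw⟩ := hex _ h0
    refine ⟨w, ?_⟩
    rw [← ht, ← iCycles_toCocycle K q v]
    exact congrArg _ hw
  · rintro ⟨w, hw⟩
    have : toCocycle K q v = K.toCycles p q w := by
      apply iCycles_injective K q
      rw [iCycles_toCocycle, ht, hw]
    refine (congrArg (K.homologyπ q) this).trans ?_
    rw [← ModuleCat.comp_apply, K.toCycles_comp_homologyπ]; rfl

variable {K} (f : K ⟶ L)

lemma map_mem_ker {q : ℤ} {v : K.X q} (hv : K.d q (q + 1) v = 0) : L.d q (q + 1) (f.f q v) = 0 := by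
  rw [← ModuleCat.comp_apply, f.comm, ModuleCat.comp_apply, hv, map_zero]

lemma homologyMap_cohomologyClass {q : ℤ} {v : K.X q} (hv : K.d q (q + 1) v = 0) :
    HomologicalComplex.homologyMap f q (cohomologyClass K q ⟨v, hv⟩) =
      cohomologyClass L q ⟨f.f q v, map_mem_ker f hv⟩ := by
  change HomologicalComplex.homologyMap f q (K.homologyπ q _) = L.homologyπ q _
  rw [← ModuleCat.comp_apply, HomologicalComplex.homologyπ_naturality, ModuleCat.comp_apply]
  refine congrArg (L.homologyπ q) ?_
  apply iCycles_injective L q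
  rw [← ModuleCat.comp_apply, HomologicalComplex.cyclesMap_i, ModuleCat.comp_apply]
  exact (congrArg (f.f q) (iCycles_toCocycle K q ⟨v, hv⟩)).trans
    (iCycles_toCocycle L q ⟨f.f q v, map_mem_ker f hv⟩).symm

/-- A quasi-isomorphism is surjective on cocycles up to coboundaries. -/
lemma exists_of_quasiIso [QuasiIso f] {p q : ℤ} (h : p + 1 = q) (b : L.X q)
    (hb : L.d q (q + 1) b = 0) :
    ∃ a, K.d q (q + 1) a = 0 ∧ ∃ w, f.f q a = b + L.d p q w := by
  have hi : IsIso (HomologicalComplex.homologyMap f q) :=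
    (quasiIsoAt_iff_isIso_homologyMap f q).1 inferInstance
  obtain ⟨η, hη⟩ := (ModuleCat.epi_iff_surjective (HomologicalComplex.homologyMap f q)).1
    inferInstance (cohomologyClass L q ⟨b, hb⟩)
  obtain ⟨⟨a, ha⟩, rfl⟩ := cohomologyClass_surjective K q η
  refine ⟨a, ha, ?_⟩
  rw [homologyMap_cohomologyClass f ha, ← sub_eq_zero, ← map_sub,
    cohomologyClass_eq_zero_iff L h] at hη
  obtain ⟨w, hw⟩ := hη
  exact ⟨w, by rw [hw]; simp⟩

/-- A criterion for a chain map to be a quasi-isomorphism in terms of cocycles. -/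
lemma quasiIso_of_cocycles
    (hs : ∀ p q (_ : p + 1 = q) (b : L.X q), L.d q (q + 1) b = 0 →
      ∃ a, K.d q (q + 1) a = 0 ∧ ∃ w, f.f q a = b + L.d p q w)
    (hi : ∀ p q (_ : p + 1 = q) (a : K.X q), K.d q (q + 1) a = 0 →
      ∀ w, f.f q a = L.d p q w → ∃ v, a = K.d p q v) : QuasiIso f := by
  refine (quasiIso_iff f).2 fun q => (quasiIsoAt_iff_isIso_homologyMap f q).2 ?_
  have hpq : q - 1 + 1 = q := by ring
  refine (ConcreteCategory.isIso_iff_bijective _).2 ⟨?_, ?_⟩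
  · refine (injective_iff_map_eq_zero (HomologicalComplex.homologyMap f q).hom).2 fun η hη => ?_
    obtain ⟨⟨a, ha⟩, rfl⟩ := cohomologyClass_surjective K q η
    rw [homologyMap_cohomologyClass f ha, cohomologyClass_eq_zero_iff L hpq] at hη
    obtain ⟨w, hw⟩ := hη
    obtain ⟨v, hv⟩ := hi _ q hpq a ha w hw.symm
    exact (cohomologyClass_eq_zero_iff K hpq _).2 ⟨v, hv.symm⟩
  · intro η
    obtain ⟨⟨b, hb⟩, rfl⟩ := cohomologyClass_surjective L q η
    obtain ⟨a, ha, w, hw⟩ := hs _ q hpq b hb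
    refine ⟨cohomologyClass K q ⟨a, ha⟩, ?_⟩
    rw [homologyMap_cohomologyClass f ha, ← sub_eq_zero, ← map_sub,
      cohomologyClass_eq_zero_iff L hpq]
    exact ⟨w, by simp [hw]⟩

/-- The projector of a contraction of a perfect complex has finite rank. -/
lemma OpContraction.isFiniteRank_e (C : OpContraction K) (hK : IsPerfect K) :
    IsFiniteRank C.e := by
  obtain ⟨hfin, hsupp⟩ := hK
  have hee : ∀ m : LinearMap.range C.e, C.e m.1 = m.1 := by
    rintro ⟨_, m, rfl⟩
    have : C.e ∘ₗ C.e = C.e := by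
      have h : C.e ∘ₗ C.e = C.e - diffOp K ∘ₗ C.h ∘ₗ C.e - C.h ∘ₗ diffOp K ∘ₗ C.e := rfl
      rw [h, C.h_e, C.d_e, LinearMap.comp_zero, LinearMap.comp_zero, sub_zero, sub_zero]
    exact LinearMap.congr_fun this m
  have hd : ∀ (m : LinearMap.range C.e) q, K.d q (q + 1) (Total.proj q m.1) = 0 := by
    intro m q
    rw [← proj_diffOp m.1 rfl, ← hee m]
    exact (congrArg (Total.proj (q + 1)) (LinearMap.congr_fun C.d_e m.1)).trans (map_zero _)
  let S := {i | ¬ Limits.IsZero (K.homology i)}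
  have : Finite S := hsupp
  let F : LinearMap.range C.e →ₗ[k] ∀ q : S, K.homology q.1 :=
    LinearMap.pi fun q => cohomologyClass K q.1 ∘ₗ
      LinearMap.codRestrict _ (Total.proj q.1 ∘ₗ (LinearMap.range C.e).subtype) fun m => hd m q.1
  -- the range of the projector consists of cocycles, and embeds into the total cohomology
  have hF : Function.Injective F := by
    refine (injective_iff_map_eq_zero F).2 fun m hm => ?_
    have h1 : ∀ q, ∃ w, K.d q (q + 1) w = Total.proj (q + 1) m.1 := by
      intro q
      refine (cohomologyClass_eq_zero_iff K rfl ⟨_, hd m (q + 1)⟩).1 ?_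
      by_cases hq : Limits.IsZero (K.homology (q + 1))
      · have := ModuleCat.subsingleton_of_isZero hq
        exact Subsingleton.elim _ _
      · exact congrFun hm ⟨q + 1, hq⟩
    choose w hw using h1
    have h2 : m.1 = diffOp K (show Total K from w) := by
      refine Total.ext fun q => ?_
      obtain ⟨p, rfl⟩ : ∃ p, q = p + 1 := ⟨q - 1, by ring⟩
      rw [proj_diffOp _ rfl, ← hw]
      rfl
    refine Subtype.ext ?_
    rw [← hee m, h2]
    exact LinearMap.congr_fun C.e_d _
  exact Module.Finite.of_injective F hF

end Homology

/-! ### Cochains on bar words with values in operators -/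

namespace BarWord
variable {A : DGCategory k} {M : Type u} [AddCommGroup M] [Module k M] {x y z : A.Obj}

lemma splits_sub (w : BarWord A x y) (F G : ∀ m : A.Obj, BarWord A m y → BarWord A x m → M) :
    splits w (fun m w' w'' => F m w' w'' - G m w' w'') = splits w F - splits w G := by
  induction w with
  | nil => simp only [splits_nil]
  | cons i a w ih => simp only [splits_cons, ih]; abel

lemma first_splits (w : BarWord A x y)
    (F : ∀ (z : A.Obj) (j : ℤ) (_ : (A.Hom z y).X j) (m : A.Obj), BarWord A m z → BarWord A x m → M) :
    first w (fun z j a v => splits v (F z j a)) =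
      splits w (fun m w' w'' => first w' fun z j a u => F z j a m u w'') := by
  cases w with
  | nil => simp [splits_nil]
  | cons i a w => simp [splits_cons]

/-- Deconcatenation is compatible with the inner part of the bar differential. -/
lemma bdry_splits (w : BarWord A x y) (F : ∀ m : A.Obj, BarWord A m y → BarWord A x m → M) :
    bdry w (fun v => splits v F) =
      splits w (fun m w' w'' => bdry w' (fun u => F m u w'')) +
      splits w (fun m w' w'' => sgn k (deg w') • bdry w'' (fun u => F m w' u)) := by
  induction w with
  | nil => simp [splits_nil]
  | cons i a w ih =>
    have h1 := ih fun m u w'' => F m (cons i a u) w''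
    have h2 : splits w (fun m w' w'' => bdry (cons i a w') fun u => F m u w'') =
        (-1 : k) • splits w (fun m w' w'' => F m (cons (i + 1) ((A.Hom _ _).d i (i + 1) a) w') w'') -
        sgn k i • splits w (fun m w' w'' => bdry w' fun u => F m (cons i a u) w'') -
        sgn k i • splits w (fun m w' w'' =>
          first w' fun _ j b u => F m (cons (i + j) (A.comp rfl a b) u) w'') := by
      rw [← splits_smul, ← splits_smul, ← splits_smul, ← splits_sub, ← splits_sub]
      refine splits_congr w fun m w' w'' _ => ?_
      rw [bdry_cons]
      module
    have h3 : splits w (fun m w' w'' => sgn k (deg (cons i a w')) •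
        bdry w'' fun u => F m (cons i a w') u) =
        (-sgn k i) • splits w (fun m w' w'' => sgn k (deg w') •
          bdry w'' fun u => F m (cons i a w') u) := by
      rw [← splits_smul]
      refine splits_congr w fun m w' w'' _ => ?_
      rw [deg, sgn_add, sgn_sub, sgn_one]
      module
    have h4 := first_splits w fun _ j b m u w'' => F m (cons (i + j) (A.comp rfl a b) u) w''
    rw [bdry_cons, splits_cons, splits_cons, splits_cons, h2, h3]
    simp only [splits_cons, bdry_nil, zero_add, bdry_add, first_add, h1, h4, bdry_cons i a w, deg,
      sgn_zero, one_smul]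
    module

lemma last_splits (w : BarWord A x y)
    (F : ∀ m : A.Obj, BarWord A m y → ∀ z : A.Obj, BarWord A z m → ∀ (j : ℤ) (_ : (A.Hom x z).X j), M) :
    last w (fun z v j a => splits v (fun m w' w'' => F m w' z w'' j a)) =
      splits w (fun m w' w'' => last w'' fun z u j a => F m w' z u j a) := by
  induction w using snoc_induction with
  | nil => simp [splits_nil]
  | snoc v j a ih => simp [last_append_single, splits_append_single]

lemma splits_last_cons (i : ℤ) (a : (A.Hom y z).X i) (w : BarWord A x y)
    (F : ∀ (m : A.Obj) (t : A.Obj), BarWord A t z → ∀ (j : ℤ) (_ : (A.Hom m t).X j),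
      BarWord A x m → M) :
    splits w (fun m w' w'' => last (cons i a w') fun t u j b => F m t u j b w'') =
      F y z (nil z) i a w +
      splits w (fun m w' w'' => last w' fun t u j b => F m t (cons i a u) j b w'') := by
  cases w with
  | nil => simp [splits_nil]
  | cons j b w => simp [splits_cons, last_cons_cons]

/-- The two ways of splitting off a letter in the middle of a word. -/
lemma splits_first_eq_splits_last (w : BarWord A x y)
    (F : ∀ (m : A.Obj) (t : A.Obj), BarWord A t y → ∀ (j : ℤ) (_ : (A.Hom m t).X j),
      BarWord A x m → M) :
    splits w (fun t w' w'' => first w'' fun m j a u => F m t w' j a u) =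
      splits w (fun m w' w'' => last w' fun t u j a => F m t u j a w'') := by
  induction w with
  | nil => simp [splits_nil]
  | cons i a w ih =>
    rw [splits_cons, splits_cons, last_nil, zero_add, first_cons, splits_last_cons,
      ih fun m t u j b w'' => F m t (cons i a u) j b w'']

lemma IsLinComb.splits_lin {c : k} {w w₁ w₂ : BarWord A x y} (h : IsLinComb c w w₁ w₂)
    {F : ∀ m : A.Obj, BarWord A m y → BarWord A x m → M}
    (h1 : ∀ m {v v₁ v₂} u, IsLinComb c v v₁ v₂ → F m v u = F m v₁ u + c • F m v₂ u)
    (h2 : ∀ m {v v₁ v₂} u, IsLinComb c v v₁ v₂ → F m u v = F m u v₁ + c • F m u v₂) :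
    splits w F = splits w₁ F + c • splits w₂ F := by
  induction h with
  | head i a b w =>
    rw [splits_cons, splits_cons, splits_cons, h2 _ _ (.head i a b w), splits_congr w
      fun m w' w'' _ => h1 m w'' (.head i a b w'), splits_add, splits_smul]
    module
  | tail i a h ih =>
    rw [splits_cons, splits_cons, splits_cons, h2 _ _ (.tail i a h),
      ih (fun m v v₁ v₂ u h => h1 m u (.tail i a h)) (fun m v v₁ v₂ u h => h2 m _ h)]
    module

lemma IsDegenerate.splits_eq_zero {w : BarWord A x y} (h : IsDegenerate w)
    {F : ∀ m : A.Obj, BarWord A m y → BarWord A x m → M}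
    (h1 : ∀ m {v} u, IsDegenerate v → F m v u = 0) (h2 : ∀ m {v} u, IsDegenerate v → F m u v = 0) :
    splits w F = 0 := by
  have hz : ∀ {x y : A.Obj} (w : BarWord A x y),
      splits w (fun _ _ _ => (0 : M)) = 0 := fun w => by
    simpa using splits_smul (0 : k) w fun _ _ _ => (0 : M)
  induction h with
  | head w =>
    rw [splits_cons, h2 _ _ (.head w), splits_congr w fun m w' w'' _ => h1 m w'' (.head w'), hz,
      add_zero]
  | tail i a h ih =>
    rw [splits_cons, h2 _ _ (.tail i a h),
      ih (fun m v u h => h1 m u (.tail i a h)) (fun m v u h => h2 m _ h), add_zero]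

end BarWord

section Linear
variable {A : DGCategory k} {U W Z : Type u} [AddCommGroup U] [Module k U] [AddCommGroup W]
  [Module k W] [AddCommGroup Z] [Module k Z] {x y : A.Obj} (w : BarWord A x y)

lemma comp_splits (X : W →ₗ[k] Z) (F : ∀ m, BarWord A m y → BarWord A x m → (U →ₗ[k] W)) :
    X ∘ₗ splits w F = splits w fun m v v' => X ∘ₗ F m v v' :=
  splits_lin (LinearMap.llcomp k U W Z X) w F

lemma splits_comp (X : U →ₗ[k] W) (F : ∀ m, BarWord A m y → BarWord A x m → (W →ₗ[k] Z)) :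
    splits w F ∘ₗ X = splits w fun m v v' => F m v v' ∘ₗ X :=
  splits_lin ((LinearMap.llcomp k U W Z).flip X) w F

end Linear

/-- The space of operators of finite rank. -/
def finiteRankOps (U V : Type u) [AddCommGroup U] [Module k U] [AddCommGroup V] [Module k V] :
    Submodule k (U →ₗ[k] V) where
  carrier := {X | IsFiniteRank X}
  zero_mem' := IsFiniteRank.zero
  add_mem' h h' := h.add h'
  smul_mem' c _ h := h.smul c

/-- Families of operators between two representations, indexed by the bar words. The normalized
ones are the Hochschild cochains with values in the bimodule of these operators. -/
abbrev OpCochain {E : DGCategory k} (R R' : DGRep E) : Type u :=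
  ∀ ⦃x y : E.Obj⦄, BarWord E x y → (Total (R.K x) →ₗ[k] Total (R'.K y))

namespace OpCochain
variable {E : DGCategory k} {R R' R'' : DGRep E} {x y : E.Obj}

/-- The Hochschild differential of a cochain of degree `r`. -/
noncomputable def delta (r : ℤ) (F : OpCochain R R') : OpCochain R R' := fun x y w =>
  diffOp (R'.K y) ∘ₗ F w - sgn k (deg w + r) • F w ∘ₗ diffOp (R.K x) -
    sgn k r • (bdry w (fun v => F v) + first w (fun _ i f v => sgn k (r * i) • R'.op f ∘ₗ F v) -
      last w (fun _ v _ f => sgn k (deg v) • F v ∘ₗ R.op f))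

/-- The composition product of cochains, the second of which has degree `s`. -/
noncomputable def cup (s : ℤ) (F : OpCochain R' R'') (X : OpCochain R R') : OpCochain R R'' :=
  fun _ _ w => splits w fun _ w' w'' => sgn k (s * deg w') • F w' ∘ₗ X w''

/-- The Leibniz rule. -/
lemma delta_cup (r s : ℤ) (F : OpCochain R' R'') (X : OpCochain R R') (w : BarWord E x y) :
    delta (r + s) (cup s F X) w =
      cup s (delta r F) X w + sgn k r • cup (s + 1) F (delta s X) w := by
  have hb : bdry w (fun v => cup s F X v) =
      sgn k s • splits w (fun _ w' w'' => sgn k (s * deg w') • bdry w' (fun v => F v) ∘ₗ X w'') +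
      splits w (fun _ w' w'' => sgn k ((s + 1) * deg w') • F w' ∘ₗ bdry w'' (fun v => X v)) := by
    refine (bdry_splits w _).trans ?_
    rw [← splits_smul]
    refine congrArg₂ _ (splits_congr w fun m w' w'' _ => ?_) (splits_congr w fun m w' w'' _ => ?_)
    · rw [bdry_comp, smul_smul, ← sgn_add, ← bdry_smul]
      refine bdry_congr_deg w' fun v hv => ?_
      rw [hv]
      congr 2; ring
    · rw [comp_bdry, bdry_smul, smul_smul, ← sgn_add]
      congr 2; ring
  have hf : first w (fun _ i f v => sgn k ((r + s) * i) • R''.op f ∘ₗ cup s F X v) =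
      sgn k s • splits w (fun _ w' w'' => sgn k (s * deg w') •
        first w' (fun _ i f v => sgn k (r * i) • R''.op f ∘ₗ F v) ∘ₗ X w'') := by
    rw [← splits_smul]
    have h1 := first_splits w fun _ i f m v w'' =>
      sgn k ((r + s) * i + s * deg v) • R''.op f ∘ₗ F v ∘ₗ X w''
    refine Eq.trans ?_ (h1.trans (splits_congr w fun m w' w'' _ => ?_))
    · refine first_congr w fun z i f v _ => ?_
      rw [cup, comp_splits, ← splits_smul]
      refine splits_congr v fun m w' w'' _ => ?_
      rw [LinearMap.comp_smul, smul_smul, sgn_add]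
    · rw [first_comp, smul_smul, ← sgn_add, ← first_smul]
      refine first_congr w' fun z i f v hv => ?_
      rw [hv, deg, LinearMap.smul_comp, smul_smul, ← sgn_add, LinearMap.comp_assoc]
      congr 1
      exact sgn_eq_of_eq_add_two_mul (m := 0) (by ring)
  have hl : last w (fun _ v _ f => sgn k (deg v) • cup s F X v ∘ₗ R.op f) =
      splits w (fun _ w' w'' => sgn k ((s + 1) * deg w') •
        F w' ∘ₗ last w'' (fun _ v _ f => sgn k (deg v) • X v ∘ₗ R.op f)) := by
    have h1 := last_splits w fun m w' z v j f =>
      sgn k ((s + 1) * deg w' + deg v) • F w' ∘ₗ X v ∘ₗ R.op f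
    refine Eq.trans ?_ (h1.trans (splits_congr w fun m w' w'' _ => ?_))
    · refine last_congr w fun z v i f => ?_
      rw [cup, splits_comp, ← splits_smul]
      refine splits_congr v fun m w' w'' hv => ?_
      rw [← hv, LinearMap.smul_comp, smul_smul, ← sgn_add, LinearMap.comp_assoc]
      congr 1
      exact sgn_eq_of_eq_add_two_mul (m := 0) (by ring)
    · rw [comp_last, ← last_smul]
      refine last_congr w'' fun z v i f => ?_
      rw [LinearMap.comp_smul, smul_smul, ← sgn_add]
  -- the terms in which a letter between the two factors acts on one of them cancel
  have hm : splits w (fun _ w' w'' => sgn k ((s + 1) * deg w') •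
        F w' ∘ₗ first w'' (fun _ i f v => sgn k (s * i) • R'.op f ∘ₗ X v)) =
      sgn k s • splits w (fun _ w' w'' => sgn k (s * deg w') •
        last w' (fun _ v _ f => sgn k (deg v) • F v ∘ₗ R'.op f) ∘ₗ X w'') := by
    have h1 := splits_first_eq_splits_last w fun m t w' j f u =>
      sgn k ((s + 1) * deg w' + s * j) • F w' ∘ₗ R'.op f ∘ₗ X u
    refine Eq.trans (splits_congr w fun m w' w'' _ => ?_) (h1.trans ?_)
    · rw [comp_first, ← first_smul]
      refine first_congr w'' fun z i f v _ => ?_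
      rw [LinearMap.comp_smul, smul_smul, ← sgn_add]
    · rw [← splits_smul]
      refine splits_congr w fun m w' w'' _ => ?_
      rw [last_comp, smul_smul, ← sgn_add, ← last_smul]
      refine last_congr_deg w' fun z v i f hv => ?_
      rw [LinearMap.smul_comp, smul_smul, ← sgn_add, LinearMap.comp_assoc, ← hv]
      congr 1
      exact sgn_eq_of_eq_add_two_mul (m := 0) (by ring)
  have h1 : cup s (delta r F) X w =
      splits w (fun _ w' w'' => sgn k (s * deg w') • diffOp _ ∘ₗ F w' ∘ₗ X w'') -
      sgn k r • splits w (fun _ w' w'' => sgn k ((s + 1) * deg w') • F w' ∘ₗ diffOp _ ∘ₗ X w'') -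
      sgn k r • (splits w (fun _ w' w'' => sgn k (s * deg w') • bdry w' (fun v => F v) ∘ₗ X w'') +
      splits w (fun _ w' w'' => sgn k (s * deg w') •
        first w' (fun _ i f v => sgn k (r * i) • R''.op f ∘ₗ F v) ∘ₗ X w'') -
      splits w (fun _ w' w'' => sgn k (s * deg w') •
        last w' (fun _ v _ f => sgn k (deg v) • F v ∘ₗ R'.op f) ∘ₗ X w'')) := by
    rw [← splits_add, ← splits_sub, ← splits_smul, ← splits_smul, ← splits_sub, ← splits_sub, cup]
    refine splits_congr w fun m w' w'' _ => ?_
    simp only [delta, LinearMap.sub_comp, LinearMap.add_comp, LinearMap.smul_comp,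
      LinearMap.comp_assoc, add_mul, one_mul, sgn_add]
    module
  have h2 : cup (s + 1) F (delta s X) w =
      splits w (fun _ w' w'' => sgn k ((s + 1) * deg w') • F w' ∘ₗ diffOp _ ∘ₗ X w'') -
      (sgn k (deg w) * sgn k s) •
        splits w (fun _ w' w'' => sgn k (s * deg w') • F w' ∘ₗ X w'' ∘ₗ diffOp _) -
      sgn k s • (splits w (fun _ w' w'' => sgn k ((s + 1) * deg w') •
        F w' ∘ₗ bdry w'' (fun v => X v)) +
      splits w (fun _ w' w'' => sgn k ((s + 1) * deg w') •
        F w' ∘ₗ first w'' (fun _ i f v => sgn k (s * i) • R'.op f ∘ₗ X v)) -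
      splits w (fun _ w' w'' => sgn k ((s + 1) * deg w') •
        F w' ∘ₗ last w'' (fun _ v _ f => sgn k (deg v) • X v ∘ₗ R.op f))) := by
    rw [← splits_add, ← splits_sub, ← splits_smul, ← splits_smul, ← splits_sub, ← splits_sub, cup]
    refine splits_congr w fun m w' w'' hw => ?_
    simp only [delta, LinearMap.comp_sub, LinearMap.comp_add, LinearMap.comp_smul, add_mul,
      one_mul, sgn_add, ← hw]
    module
  have h3 : diffOp _ ∘ₗ cup s F X w =
      splits w (fun _ w' w'' => sgn k (s * deg w') • diffOp _ ∘ₗ F w' ∘ₗ X w'') := by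
    rw [cup, comp_splits]
    simp only [LinearMap.comp_smul]
  have h4 : cup s F X w ∘ₗ diffOp _ =
      splits w (fun _ w' w'' => sgn k (s * deg w') • F w' ∘ₗ X w'' ∘ₗ diffOp _) := by
    rw [cup, splits_comp]
    simp only [LinearMap.smul_comp, LinearMap.comp_assoc]
  rw [delta, hb, hf, hl, h1, h2, h3, h4, hm]
  simp only [sgn_add]
  rcases sgn_eq_one_or (k := k) s with h | h <;> simp only [h] <;> module

section Properties
variable {s : ℤ} {F : OpCochain R' R''} {X : OpCochain R R'}

lemma isNormalized_cup (hF : ∀ x y, IsNormalized (F (x := x) (y := y)))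
    (hX : ∀ x y, IsNormalized (X (x := x) (y := y))) :
    IsNormalized (cup s F X (x := x) (y := y)) where
  lin h := h.splits_lin
    (fun m v v₁ v₂ u h => by
      rw [(hF _ _).lin h, h.deg_eq.1, h.deg_eq.2, LinearMap.add_comp, LinearMap.smul_comp]; module)
    (fun m v v₁ v₂ u h => by rw [(hX _ _).lin h, LinearMap.comp_add, LinearMap.comp_smul]; module)
  degenerate h := h.splits_eq_zero
    (fun m v u h => by rw [(hF _ _).degenerate h, LinearMap.zero_comp, smul_zero])
    (fun m v u h => by rw [(hX _ _).degenerate h, LinearMap.comp_zero, smul_zero])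

lemma splits_induction {M : Type u} [AddCommGroup M] [Module k M] {p : M → Prop}
    (hadd : ∀ a b, p a → p b → p (a + b)) (w : BarWord E x y) {G : ∀ m, BarWord E m y → BarWord E x m → M}
    (h : ∀ m w' w'', deg w' + deg w'' = deg w → p (G m w' w'')) : p (splits w G) := by
  induction w with
  | nil => rw [splits_nil]; exact h _ _ _ rfl
  | cons i a w ih =>
    rw [splits_cons]
    exact hadd _ _ (h _ _ _ (by simp [deg])) (ih fun m w' w'' hd => h _ _ _ (by simp only [deg]; omega))

lemma hasParity_cup {r : ℤ} (hF : ∀ {x y} (w : BarWord E x y), HasParity (deg w + r) (F w))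
    (hX : ∀ {x y} (w : BarWord E x y), HasParity (deg w + s) (X w)) (w : BarWord E x y) :
    HasParity (deg w + (r + s)) (cup s F X w) := by
  refine splits_induction (p := HasParity (deg w + (r + s))) (fun _ _ => HasParity.add) w
    fun m w' w'' hw => ?_
  refine (((hF w').comp (hX w'')).smul _).congr ?_
  rw [← hw]; congr 1; ring

lemma isFiniteRank_cup_left (hF : ∀ {x y} (w : BarWord E x y), IsFiniteRank (F w))
    (w : BarWord E x y) : IsFiniteRank (cup s F X w) :=
  splits_induction (p := IsFiniteRank) (fun _ _ => IsFiniteRank.add) w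
    fun _ w' _ _ => ((hF w').comp_right _).smul _

lemma isFiniteRank_cup_right (hX : ∀ {x y} (w : BarWord E x y), IsFiniteRank (X w))
    (w : BarWord E x y) : IsFiniteRank (cup s F X w) :=
  splits_induction (p := IsFiniteRank) (fun _ _ => IsFiniteRank.add) w
    fun _ _ w'' _ => ((hX w'').comp_left _).smul _

end Properties

lemma delta_add (r : ℤ) (F G : OpCochain R R') (w : BarWord E x y) :
    delta r (fun _ _ v => F v + G v) w = delta r F w + delta r G w := by
  simp only [delta, LinearMap.comp_add, LinearMap.add_comp, bdry_add, smul_add, first_add, last_add]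
  module

lemma delta_smul (r : ℤ) (c : k) (F : OpCochain R R') (w : BarWord E x y) :
    delta r (fun _ _ v => c • F v) w = c • delta r F w := by
  simp only [delta, LinearMap.comp_smul, LinearMap.smul_comp, bdry_smul, smul_comm _ c, first_smul,
    last_smul]
  module

/-- Composition with a closed natural transformation of degree `j`. -/
lemma delta_comp_left {j : ℤ} {T : ∀ z, Total (R'.K z) →ₗ[k] Total (R''.K z)}
    (hd : ∀ z, diffOp (R''.K z) ∘ₗ T z = sgn k j • T z ∘ₗ diffOp (R'.K z))
    (hT : ∀ {x y : E.Obj} {i : ℤ} (f : (E.Hom x y).X i),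
      R''.op f ∘ₗ T x = sgn k (j * i) • T y ∘ₗ R'.op f)
    (r : ℤ) (F : OpCochain R R') (w : BarWord E x y) :
    delta (r + j) (fun _ _ v => T _ ∘ₗ F v) w = sgn k j • T _ ∘ₗ delta r F w := by
  have hf : first w (fun _ i f v => sgn k ((r + j) * i) • R''.op f ∘ₗ T _ ∘ₗ F v) =
      T _ ∘ₗ first w (fun _ i f v => sgn k (r * i) • R'.op f ∘ₗ F v) := by
    rw [comp_first]
    refine first_congr w fun z i f v _ => ?_
    rw [← LinearMap.comp_assoc (F v), hT, LinearMap.smul_comp, smul_smul, ← sgn_add,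
      LinearMap.comp_smul, LinearMap.comp_assoc]
    congr 1
    exact sgn_eq_of_eq_add_two_mul (m := j * i) (by ring)
  have hl : last w (fun _ v _ f => sgn k (deg v) • (T _ ∘ₗ F v) ∘ₗ R.op f) =
      T _ ∘ₗ last w (fun _ v _ f => sgn k (deg v) • F v ∘ₗ R.op f) := by
    rw [comp_last]
    simp only [LinearMap.comp_smul, LinearMap.comp_assoc]
  rw [delta, delta, hf, hl, ← comp_bdry, ← LinearMap.comp_assoc, hd]
  simp only [LinearMap.comp_add, LinearMap.comp_sub, LinearMap.comp_smul, LinearMap.smul_comp,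
    LinearMap.comp_assoc, sgn_add]
  rcases sgn_eq_one_or (k := k) j with h | h <;> simp only [h] <;> module

lemma first_induction {M : Type u} [AddCommGroup M] [Module k M] {p : M → Prop} (h0 : p 0)
    (w : BarWord E x y) {G : ∀ (z : E.Obj) (j : ℤ) (_ : (E.Hom z y).X j), BarWord E x z → M}
    (h : ∀ z j a v, p (G z j a v)) : p (first w G) := by
  cases w with
  | nil => rwa [first_nil]
  | cons i a w => rw [first_cons]; exact h _ _ _ _

lemma last_induction {M : Type u} [AddCommGroup M] [Module k M] {p : M → Prop} (h0 : p 0)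
    (w : BarWord E x y) {G : ∀ (z : E.Obj), BarWord E z y → ∀ (j : ℤ) (_ : (E.Hom x z).X j), M}
    (h : ∀ z v j a, p (G z v j a)) : p (last w G) := by
  induction w using snoc_induction with
  | nil => rwa [last_nil]
  | snoc v j a ih => rw [last_append_single]; exact h _ _ _ _

lemma bdry_induction {M : Type u} [AddCommGroup M] [Module k M] {p : Submodule k M}
    (w : BarWord E x y) {G : BarWord E x y → M} (h : ∀ v, G v ∈ p) : bdry w G ∈ p := by
  induction w with
  | nil => rw [bdry_nil]; exact p.zero_mem
  | cons i a w ih =>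
    rw [bdry_cons]
    exact p.sub_mem (p.sub_mem (p.neg_mem (h _)) (p.smul_mem _ (ih fun v => h _)))
      (p.smul_mem _ (first_induction (k := k) p.zero_mem w fun _ _ _ _ => h _))

lemma isFiniteRank_delta {F : OpCochain R R'}
    (hF : ∀ {x y : E.Obj} (w : BarWord E x y), IsFiniteRank (F w)) (r : ℤ) (w : BarWord E x y) :
    IsFiniteRank (delta r F w) := by
  have hb : IsFiniteRank (bdry w fun v => F v) :=
    bdry_induction (p := finiteRankOps _ _) w fun v => hF v
  exact (((hF w).comp_left _).sub (((hF w).comp_right _).smul _)).sub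
    (((hb.add (first_induction (k := k) .zero w fun _ _ _ v => ((hF v).comp_left _).smul _)).sub
      (last_induction (k := k) .zero w fun _ v _ _ => ((hF v).comp_right _).smul _)).smul _)

/-- The functional on Hochschild words given by the supertrace of a cochain of degree `r`. -/
noncomputable def strFun (r : ℤ) (F : OpCochain R R) (W : HHWord E) : k :=
  sgn k (r * deg W.w) * str (R.op W.a ∘ₗ F W.w)

section StrFun
variable {r : ℤ} {F : OpCochain R R} (hF : ∀ {x y : E.Obj} (w : BarWord E x y), IsFiniteRank (F w))
include hF

lemma isReduced_strFun (hn : ∀ x y, IsNormalized (F (x := x) (y := y))) :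
    IsReduced (strFun r F) where
  lin a b c w := by
    simp only [strFun]
    rw [map_add, map_smul, LinearMap.add_comp, LinearMap.smul_comp,
      str_add ((hF w).comp_left _) (((hF w).comp_left _).smul _), str_smul ((hF w).comp_left _)]
    ring
  normalized a :=
    { lin := fun {c w w₁ w₂} h => by
        simp only [strFun]
        rw [(hn _ _).lin h, LinearMap.comp_add, LinearMap.comp_smul,
          str_add ((hF w₁).comp_left _) (((hF w₂).comp_left _).smul _),
          str_smul ((hF w₂).comp_left _), h.deg_eq.1, h.deg_eq.2, smul_eq_mul]
        ring
      degenerate := fun {w} h => by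
        simp only [strFun]
        rw [(hn _ _).degenerate h, LinearMap.comp_zero, str_zero, mul_zero] }

/-- The supertrace intertwines the Hochschild differentials of chains and cochains. -/
lemma hochFun_strFun (hp : ∀ {x y : E.Obj} (w : BarWord E x y), HasParity (deg w + r) (F w))
    {i : ℤ} (f : (E.Hom y x).X i) (w : BarWord E x y) :
    hochFun (strFun r F) ⟨f, w⟩ =
      -sgn k (i + r * deg w) * str (R.op f ∘ₗ delta r F w) := by
  obtain ⟨S, hS⟩ := exists_linear_extension_str (R.K x)
  have hfr : ∀ {t : E.Obj} {j : ℤ} (g : (E.Hom t x).X j) (w : BarWord E x t),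
      IsFiniteRank (R.op g ∘ₗ F w) := fun g w => (hF w).comp_left _
  have hS' : ∀ {t : E.Obj} {j : ℤ} (g : (E.Hom t x).X j) (w : BarWord E x t),
      strFun r F ⟨g, w⟩ = sgn k (r * deg w) * S (R.op g ∘ₗ F w) := fun g w =>
    congrArg _ (hS _ (hfr g w)).symm
  have hb : bdry w (fun v => strFun r F ⟨f, v⟩) =
      sgn k (r * deg w + r) * S (R.op f ∘ₗ bdry w (fun v => F v)) := by
    rw [comp_bdry, BarWord.bdry_lin, ← smul_eq_mul, ← bdry_smul]
    refine bdry_congr_deg w fun v hv => ?_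
    rw [hS', hv, smul_eq_mul]
    congr 2; ring
  have hf : first w (fun _ _ a v => strFun r F ⟨E.comp rfl f a, v⟩) =
      sgn k (r * deg w + r) *
        S (R.op f ∘ₗ first w (fun _ i f v => sgn k (r * i) • R.op f ∘ₗ F v)) := by
    rw [comp_first, BarWord.first_lin, ← smul_eq_mul, ← first_smul]
    refine first_congr w fun z j a v hv => ?_
    rw [hS', R.op_comp, LinearMap.comp_assoc, LinearMap.comp_smul, map_smul, smul_smul, smul_eq_mul,
      ← sgn_add, hv, deg]
    congr 1
    exact sgn_eq_of_eq_add_two_mul (m := -(r * j)) (by ring)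
  have hl : last w (fun _ v j a =>
      sgn k ((j - 1) * (i + deg v)) • strFun r F ⟨E.comp rfl a f, v⟩) =
      sgn k (i + r * deg w + r) *
        S (R.op f ∘ₗ last w (fun _ v _ f => sgn k (deg v) • F v ∘ₗ R.op f)) := by
    rw [comp_last, BarWord.last_lin, ← smul_eq_mul, ← last_smul]
    refine last_congr_deg w fun z v j a hv => ?_
    have h1 := str_comm (R.parity a) ((R.parity f).comp (hp v)) (Or.inr ((hF v).comp_left _))
    rw [LinearMap.comp_smul, map_smul, ← LinearMap.comp_assoc, hS _ (((hF v).comp_left _).comp_right _),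
      strFun, R.op_comp, LinearMap.comp_assoc, h1, smul_smul, smul_eq_mul, smul_eq_mul, ← mul_assoc,
      ← mul_assoc, ← sgn_add, ← sgn_add, ← sgn_add, ← hv]
    congr 1
    exact sgn_eq_of_eq_add_two_mul (m := i * j - i + j * deg v - deg v) (by ring)
  have hd : S (diffOp _ ∘ₗ R.op f ∘ₗ F w) =
      sgn k (i + (deg w + r)) * S ((R.op f ∘ₗ F w) ∘ₗ diffOp _) := by
    rw [hS _ ((hfr f w).comp_left _), hS _ ((hfr f w).comp_right _)]
    exact str_diffOp_comp ((R.parity f).comp (hp w)) (hfr f w)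
  have hδ := hS _ ((isFiniteRank_delta hF r w).comp_left (R.op f))
  rw [hochFun, hb, hf, hl, hS', R.op_d, ← hδ, delta]
  simp only [LinearMap.comp_add, LinearMap.comp_sub, LinearMap.sub_comp, LinearMap.smul_comp,
    LinearMap.comp_smul, LinearMap.comp_assoc, map_sub, map_add, map_smul, smul_eq_mul,
    sgn_add] at hd ⊢
  rw [hd]
  rcases sgn_eq_one_or (k := k) i with h | h <;> rcases sgn_eq_one_or (k := k) r with h' | h' <;>
    simp only [h, h'] <;> ring

end StrFun

/-- The cochain which is concentrated on the empty words, with values `T`. -/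
def unitCochain (T : ∀ z, Total (R.K z) →ₗ[k] Total (R'.K z)) : OpCochain R R'
  | _, _, .nil z => T z
  | _, _, .cons _ _ _ => 0

@[simp] lemma unitCochain_nil (T : ∀ z, Total (R.K z) →ₗ[k] Total (R'.K z)) (z : E.Obj) :
    unitCochain T (nil z) = T z := by simp [unitCochain]

@[simp] lemma unitCochain_cons (T : ∀ z, Total (R.K z) →ₗ[k] Total (R'.K z)) {t : E.Obj} {i : ℤ}
    (f : (E.Hom y t).X i) (w : BarWord E x y) : unitCochain T (cons i f w) = 0 := by
  simp [unitCochain]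

lemma splits_zero {M : Type u} [AddCommGroup M] [Module k M] (w : BarWord E x y) :
    splits w (fun _ _ _ => (0 : M)) = 0 := by
  simpa using splits_smul (0 : k) w fun _ _ _ => (0 : M)

lemma unitCochain_cup (T : ∀ z, Total (R'.K z) →ₗ[k] Total (R''.K z)) (s : ℤ) (X : OpCochain R R')
    (w : BarWord E x y) : cup s (unitCochain T) X w = T y ∘ₗ X w := by
  cases w with
  | nil => simp [cup, splits_nil, deg, sgn_zero]
  | cons i a w => simp [cup, splits_cons, deg, sgn_zero, splits_zero (k := k)]

lemma cup_unitWord (F : OpCochain R R') (w : BarWord E x y) :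
    cup 0 F (fun _ _ v => unitWord R v) w = F w := by
  induction w using snoc_induction with
  | nil => simp [cup, splits_nil, sgn_zero, unitWord]
  | snoc v j a ih =>
    have h : ∀ {s t z : E.Obj} (u : BarWord E t z) {j : ℤ} (a : (E.Hom s t).X j),
        unitWord R (append u (single a)) = 0 := by
      intro s t z u j a
      cases u <;> simp [single, append, unitWord]
    have hn : ∀ t, unitWord R (nil t) = LinearMap.id := fun t => by simp [unitWord]
    simp [cup, splits_append_single, sgn_zero, h, hn, splits_zero (k := k)]

section Perturb
variable (C : ∀ x, OpContraction (R.K x)) {r : ℤ} {β φ : OpCochain R R'} {c : k}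
  {T : ∀ z, Total (R.K z) →ₗ[k] Total (R'.K z)}

lemma delta_hWord (w : BarWord E x y) :
    delta (-1) (fun _ _ v => hWord R C v) w = unitWord R w - gWord R C w := by
  rw [← hochschild_hWord, delta]
  simp only [neg_mul, one_mul, sgn_neg, sgn_one, sgn_add]
  module

lemma delta_gWord (w : BarWord E x y) : delta 0 (fun _ _ v => gWord R C v) w = 0 := by
  simp only [delta, zero_mul, sgn_zero, one_smul, add_zero, hochschild_gWord R C w, sub_self]

/-- The cochain `± φ ∪ H + β ∪ G`, where `H` and `G` are the perturbed homotopy and the perturbed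
projector. If `β` is a homotopy between a cocycle `φ` and a cochain `T` on the empty words, then this
is a homotopy between `φ` and `T ∘ G`, and unlike `β` it has finite rank if `φ` does. -/
noncomputable def transfer (r : ℤ) (β φ : OpCochain R R') : OpCochain R R' := fun _ _ w =>
  (-sgn k r) • cup (-1) φ (fun _ _ v => hWord R C v) w + cup 0 β (fun _ _ v => gWord R C v) w

lemma delta_transfer (hβ : ∀ {x y : E.Obj} (w : BarWord E x y),
      delta r β w = φ w - c • unitCochain T w)
    (hφ : ∀ {x y : E.Obj} (w : BarWord E x y), delta (r + 1) φ w = 0) (w : BarWord E x y) :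
    delta r (transfer C r β φ) w = φ w - c • T y ∘ₗ gWord R C w := by
  have h1 := delta_cup (r + 1) (-1) φ (fun _ _ v => hWord R C v) w
  have h2 := delta_cup r 0 β (fun _ _ v => gWord R C v) w
  have e1 : delta (r + 1) φ = fun _ _ _ => 0 := by funext x y w; exact hφ w
  have e2 : delta r β = fun _ _ w => φ w - c • unitCochain T w := by funext x y w; exact hβ w
  have e3 : delta (-1) (fun _ _ v => hWord R C v) = fun _ _ w => unitWord R w - gWord R C w := by
    funext x y w; exact delta_hWord C w
  have e4 : delta 0 (fun _ _ v => gWord R C v) = fun _ _ _ => 0 := by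
    funext x y w; exact delta_gWord C w
  have e5 : cup (-1) (fun _ _ _ => 0 : OpCochain R R') (fun _ _ v => hWord R C v) w = 0 := by
    simp [cup, splits_zero (k := k)]
  have e6 : cup (0 + 1) β (fun _ _ _ => 0 : OpCochain R R) w = 0 := by
    simp [cup, splits_zero (k := k)]
  have e7 : cup (-1 + 1) φ (fun _ _ w => unitWord R w - gWord R C w) w =
      φ w - cup 0 φ (fun _ _ w => gWord R C w) w := by
    rw [neg_add_cancel]
    conv_rhs => rw [← cup_unitWord φ w]
    simp only [cup, LinearMap.comp_sub, smul_sub, splits_sub]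
  have e8 : cup 0 (fun _ _ w => φ w - c • unitCochain T w : OpCochain R R')
      (fun _ _ w => gWord R C w) w = cup 0 φ (fun _ _ w => gWord R C w) w -
        c • T y ∘ₗ gWord R C w := by
    rw [← unitCochain_cup T 0 (fun _ _ w => gWord R C w) w]
    simp only [cup, LinearMap.sub_comp, LinearMap.smul_comp, smul_sub, splits_sub, smul_comm _ c,
      splits_smul]
  rw [e1, e3, e5, e7] at h1
  rw [e2, e4, e6, e8] at h2
  have h3 : r + 1 + -1 = r := by ring
  rw [h3] at h1
  rw [add_zero] at h2
  have h4 := delta_add r (fun _ _ v => (-sgn k r) • cup (-1) φ (fun _ _ v => hWord R C v) v)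
    (cup 0 β fun _ _ v => gWord R C v) w
  rw [delta_smul r (-sgn k r) (cup (-1) φ fun _ _ v => hWord R C v), h1, h2] at h4
  refine h4.trans ?_
  rw [sgn_add, sgn_one]
  rcases sgn_eq_one_or (k := k) r with h | h <;> simp only [h] <;> module

end Perturb

end OpCochain

-- the morphism complexes of the opposite category have to unify with those of the category
attribute [reducible] DGCategory.op

/-! ### Contraction of the values of Hochschild cochains with a functional -/

section Contract
variable {A : DGCategory k} {s t p x z : A.Obj} {j : ℤ} (θ : (A.Hom s p).X j →ₗ[k] k)

/-- The map `A(s, p) ⊗ A(x, t) ⟶ A(x, t)`, `f ⊗ g ↦ θ(f) g`, where `θ` is extended by zero to the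
elements whose degree is not `j`. -/
noncomputable def contractX {q q' : ℤ} (h : j + q' = q) :
    TensorX A s t x p q →ₗ[k] (A.Hom x t).X q' :=
  tlift A s t fun a b hab => if ha : a = j then
    ((LinearMap.lsmul k ((A.Hom x t).X q')).comp
      (θ ∘ₗ ((A.Hom s p).XIsoOfEq ha).hom.hom)).compl₂
        ((A.Hom x t).XIsoOfEq (show b = q' by omega)).hom.hom else 0

lemma contractX_tmk {q q' : ℤ} (h : j + q' = q) (f : (A.Hom s p).X j) (g : (A.Hom x t).X q') :
    contractX θ h (tmk A s t x p h f g) = θ f • g := by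
  simp [contractX, HomologicalComplex.XIsoOfEq]

lemma contractX_tmk_of_ne {a b q q' : ℤ} (h : j + q' = q) (hab : a + b = q) (ha : a ≠ j)
    (f : (A.Hom s p).X a) (g : (A.Hom x t).X b) :
    contractX θ h (tmk A s t x p hab f g) = 0 := by
  simp [contractX, ha]

variable (x t) in
/-- The contraction with `θ` in all degrees. -/
noncomputable def contract :
    Tot ((representable A s t).M x p) →ₗ[k] Total (A.Hom x t) :=
  Total.pi fun q => contractX θ (rfl : j + q = j + q) ∘ₗ LinearMap.proj (j + q)

lemma proj_contract (m : Tot ((representable A s t).M x p)) {q q' : ℤ} (h : j + q' = q) :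
    Total.proj q' (contract t x θ m) = contractX θ h (m q) := by
  subst h; rfl

lemma contractX_tensorR {i : ℤ} (b : (A.Hom z x).X i) {q q' l l' : ℤ} (hl : j + q = l)
    (hl' : j + q' = l') (h : q + i = q') (m : TensorX A s t x p l) :
    contractX θ hl' (tensorR A s t (show l + i = l' by omega) b m) =
      A.comp h (contractX θ hl m) b := by
  induction m using tensor_induction with
  | h0 => simp
  | hadd m n hm hn => simp only [map_add, hm, hn, LinearMap.add_apply]
  | htmk a c hac f g =>
    by_cases ha : a = j
    · subst ha
      obtain rfl : c = q := by omega
      rw [tensorR_tmk _ _ h, contractX_tmk, contractX_tmk, map_smul, LinearMap.smul_apply]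
    · rw [tensorR_tmk _ hac rfl, contractX_tmk_of_ne θ _ _ ha, contractX_tmk_of_ne θ _ _ ha,
        map_zero, LinearMap.zero_apply]

lemma contract_totR {i : ℤ} (b : (A.Hom z x).X i) (m : Tot ((representable A s t).M x p))
    {q q' : ℤ} (h : q + i = q') :
    Total.proj q' (contract t z θ (totR _ b m)) =
      A.comp h (Total.proj q (contract t x θ m)) b := by
  rw [proj_contract θ _ rfl, proj_contract θ _ rfl,
    totR_apply b m (show j + q + i = j + q' by omega)]
  exact contractX_tensorR θ b rfl rfl h (m (j + q))

variable (hθ : ∀ (i : ℤ) (_ : i + 1 = j) (v : (A.Hom s p).X i), θ ((A.Hom s p).d i j v) = 0)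
include hθ

lemma contractX_tensorD {q q' l l' : ℤ} (hl : j + q = l) (hl' : j + q' = l') (h : q + 1 = q')
    (m : TensorX A s t x p l) :
    contractX θ hl' (tensorD A s t x p (show l + 1 = l' by omega) m) =
      sgn k j • (A.Hom x t).d q q' (contractX θ hl m) := by
  induction m using tensor_induction with
  | h0 => simp
  | hadd m n hm hn => simp only [map_add, hm, hn, smul_add]
  | htmk a c hac f g =>
    rw [tensorD_tmk _ hac rfl rfl, map_add, map_smul]
    by_cases ha : a = j
    · subst ha
      obtain rfl : c = q := by omega
      subst h
      rw [contractX_tmk, contractX_tmk, contractX_tmk_of_ne θ _ _ (by omega), map_smul, zero_add]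
    · rw [contractX_tmk_of_ne θ _ hac ha, contractX_tmk_of_ne θ _ _ ha, map_zero, smul_zero,
        smul_zero, add_zero]
      by_cases ha' : a + 1 = j
      · subst ha'
        obtain rfl : c = q' := by omega
        rw [contractX_tmk, hθ a rfl, zero_smul]
      · rw [contractX_tmk_of_ne θ _ _ ha']

lemma contract_totD (m : Tot ((representable A s t).M x p)) :
    contract t x θ (totD _ m) = sgn k j • diffOp _ (contract t x θ m) := by
  refine Total.ext fun q' => ?_
  obtain ⟨q, rfl⟩ : ∃ q, q' = q + 1 := ⟨q' - 1, by ring⟩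
  rw [proj_contract θ _ rfl, map_smul, proj_diffOp _ rfl, proj_contract θ _ rfl,
    totD_apply m (show j + q + 1 = j + (q + 1) by ring)]
  have h : (((representable A s t).M x p).d (j + q) (j + (q + 1))).hom =
      tensorD A s t x p (show j + q + 1 = j + (q + 1) by ring) := dif_pos _
  exact (congrArg (contractX θ rfl) (LinearMap.congr_fun h (m (j + q)))).trans
    (contractX_tensorD θ hθ rfl rfl rfl (m (j + q)))

end Contract

/-! ### Cochains on the opposite category -/

section Opposite
variable (A : DGCategory k)

/-- The contravariant functor from the opposite category. -/
@[reducible] def unopAntifunctor : DGAntifunctor A.op A where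
  obj x := x
  map := LinearMap.id
  map_one _ := rfl
  map_comp _ _ _ _ := rfl
  map_d _ := rfl

variable {A} (R R' : DGRep A.op)

/-- Families of operators between two representations of the opposite category, indexed by the bar
words of the category. -/
abbrev ContraCochain : Type u :=
  ∀ ⦃z x : A.Obj⦄, BarWord A z x → (Total (R.K x) →ₗ[k] Total (R'.K z))

variable {R R'}

namespace ContraCochain

/-- The Hochschild differential of a contravariant cochain of degree `r`. The signs are those which
make `toCovariant` compatible with the differentials. -/
noncomputable def delta (r : ℤ) (F : ContraCochain R R') : ContraCochain R R' := fun z x w =>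
  diffOp (R'.K z) ∘ₗ F w - sgn k (deg w + r) • F w ∘ₗ diffOp (R.K x) -
    sgn k r • (bdry w (fun v => F v) +
      first w (fun y i a v => sgn k (i * deg v) • F v ∘ₗ R.op (x := x) (y := y) a) -
      last w (fun y v l a => sgn k (deg v + l * deg v + l * r) • R'.op (x := y) (y := z) a ∘ₗ F v))

/-- The corresponding covariant cochain on the bar words of the opposite category. -/
noncomputable def toCovariant (F : ContraCochain R R') : OpCochain R R' := fun _ _ u =>
  sgn k (reverseSign u) • F ((unopAntifunctor A).reverse u)

lemma isNormalized_toCovariant {F : ContraCochain R R'}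
    (hF : ∀ z x, IsNormalized (F (z := z) (x := x))) (x y : A.op.Obj) :
    IsNormalized (F.toCovariant (x := x) (y := y)) where
  lin h := by
    rw [toCovariant, toCovariant, toCovariant,
      (hF _ _).lin ((unopAntifunctor A).reverse_isLinComb h), h.reverseSign_eq.1,
      h.reverseSign_eq.2]
    module
  degenerate h := by
    rw [toCovariant, (hF _ _).degenerate ((unopAntifunctor A).reverse_isDegenerate h), smul_zero]

lemma delta_toCovariant {F : ContraCochain R R'}
    (hF : ∀ z x, IsNormalized (F (z := z) (x := x))) (r : ℤ) {x y : A.op.Obj} (u : BarWord A.op x y) :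
    F.toCovariant.delta r u = sgn k (reverseSign u) • F.delta r ((unopAntifunctor A).reverse u) := by
  have hb := (unopAntifunctor A).bdry_reverse u (hF _ _)
  have hf : first u (fun _ i f v => sgn k (r * i) • R'.op f ∘ₗ F.toCovariant v) =
      -sgn k (reverseSign u) • last ((unopAntifunctor A).reverse u) (fun z v l a =>
        sgn k (deg v + l * deg v + l * r) • R'.op (x := z) (y := y) a ∘ₗ F v) := by
    rw [DGAntifunctor.last_reverse, ← first_smul]
    refine first_congr u fun z i f v hv => ?_
    rw [hv, reverseSign, DGAntifunctor.deg_reverse, toCovariant, LinearMap.comp_smul, smul_smul,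
      smul_smul, neg_mul, ← sgn_add, ← sgn_add, ← neg_one_mul, ← sgn_one, ← sgn_add]
    congr 1
    exact sgn_eq_of_eq_add_two_mul (m := -1 - i * deg v) (by ring)
  have hl : last u (fun _ v _ f => sgn k (deg v) • F.toCovariant v ∘ₗ R.op f) =
      -sgn k (reverseSign u) • first ((unopAntifunctor A).reverse u) (fun z i a v =>
        sgn k (i * deg v) • F v ∘ₗ R.op (x := x) (y := z) a) := by
    induction u using snoc_induction with
    | nil => rw [last_nil, DGAntifunctor.reverse_nil, first_nil, smul_zero]
    | snoc v i f ih =>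
      rw [last_append_single, DGAntifunctor.reverse_append_single, first_cons, toCovariant,
        LinearMap.smul_comp, smul_smul, smul_smul, DGAntifunctor.deg_reverse, reverseSign_append,
        reverseSign_single, deg_single, neg_mul, ← sgn_add, ← sgn_add, ← neg_one_mul, ← sgn_one,
        ← sgn_add]
      congr 1
      exact sgn_eq_of_eq_add_two_mul (m := -1 - i * deg v + deg v) (by ring)
  have hb' : bdry u (fun v => F.toCovariant v) =
    sgn k (reverseSign u) • bdry ((unopAntifunctor A).reverse u) (fun v => F v) := hb.symm
  rw [OpCochain.delta, hf, hl, hb', delta, toCovariant, DGAntifunctor.deg_reverse,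
    LinearMap.comp_smul, LinearMap.smul_comp]
  module

end ContraCochain

end Opposite

/-! ### The representations `z ↦ A(z, p)` -/

section HomRep
variable {A : DGCategory k} {P : Set A.Obj}

/-- The dg functor `z ↦ A(z, p)` on the opposite category. -/
@[reducible] noncomputable def homRep (p : P) : DGRep A.op where
  K z := A.Hom z p
  op {x y i} := cochainOp (A.Hom x p) (A.Hom y p) i ∘ₗ (homBifunctor A P).left p
  op_comp {x y z _ _ _} h f g :=
    (congrArg (endoRep (homFamily A P)).op ((homBifunctor A P).left_comp p h f g)).trans
      ((endoRep (homFamily A P)).op_comp (x := (x, p)) (y := (y, p)) (z := (z, p)) h _ _)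
  op_one x := (congrArg (endoRep (homFamily A P)).op ((homBifunctor A P).left_one p x)).trans
    ((endoRep (homFamily A P)).op_one (x, p))
  op_d {x y _} f := (congrArg (endoRep (homFamily A P)).op ((homBifunctor A P).left_d p f)).trans
    ((endoRep (homFamily A P)).op_d (x := (x, p)) (y := (y, p)) _)
  parity {x y _} _ := (endoRep (homFamily A P)).parity (x := (x, p)) (y := (y, p)) _

lemma proj_homRep_op (p : P) {x z : A.Obj} {i : ℤ} (a : (A.Hom z x).X i) (m : Total (A.Hom x p))
    {q q' : ℤ} (h : q + i = q') :
    Total.proj q' ((homRep p).op (x := x) (y := z) a m) =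
      sgn k (i * q) • A.comp h (Total.proj q m) a :=
  proj_cochainOp (K := A.Hom x p) (L := A.Hom z p) _ m h

/-- The operators of left multiplication. -/
noncomputable def leftOp {p p' : P} {j : ℤ} (b : (A.Hom p p').X j) (z : A.Obj) :
    Total (A.Hom z p) →ₗ[k] Total (A.Hom z p') :=
  cochainOp (A.Hom z p) (A.Hom z p') j ((homBifunctor A P).right z b)

lemma proj_leftOp {p p' : P} {j : ℤ} (b : (A.Hom p p').X j) (z : A.Obj) (m : Total (A.Hom z p))
    {q q' : ℤ} (h : j + q = q') :
    Total.proj q' (leftOp (P := P) b z m) = A.comp h b (Total.proj q m) :=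
  proj_cochainOp (K := A.Hom z p) (L := A.Hom z p') _ m (show q + j = q' by omega)

lemma hasParity_leftOp {p p' : P} {j : ℤ} (b : (A.Hom p p').X j) (z : A.Obj) :
    HasParity j (leftOp (P := P) b z) := hasParity_cochainOp _

lemma leftOp_comp {p p' p'' : P} {i j l : ℤ} (h : i + j = l) (a : (A.Hom p' p'').X i)
    (b : (A.Hom p p').X j) (z : A.Obj) :
    leftOp (P := P) (A.comp h a b) z = leftOp (P := P) a z ∘ₗ leftOp (P := P) b z :=
  (congrArg (endoRep (homFamily A P)).op ((homBifunctor A P).right_comp z h a b)).trans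
    ((endoRep (homFamily A P)).op_comp (x := (z, p)) (y := (z, p')) (z := (z, p'')) h _ _)

lemma diffOp_comp_leftOp {p p' : P} {j : ℤ} {b : (A.Hom p p').X j}
    (hb : (A.Hom p p').d j (j + 1) b = 0) (z : A.Obj) :
    diffOp (A.Hom z p') ∘ₗ leftOp (P := P) b z = sgn k j • leftOp (P := P) b z ∘ₗ diffOp (A.Hom z p) := by
  have h1 := (endoRep (homFamily A P)).op_d (x := (z, p)) (y := (z, p')) ((homBifunctor A P).right z b)
  have h2 := (homBifunctor A P).right_d z b
  have h3 : (endoRep (homFamily A P)).op ((homBifunctor A P).right z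
      (((A.full P).Hom p p').d j (j + 1) b)) = 0 := by
    have h4 : ((A.full P).Hom p p').d j (j + 1) b = 0 := hb
    rw [h4, map_zero, map_zero]
  have h5 := (congrArg (endoRep (homFamily A P)).op h2).symm.trans h3
  exact sub_eq_zero.1 (h1.symm.trans h5)

lemma homRep_op_comp_leftOp {p p' : P} {j : ℤ} (b : (A.Hom p p').X j) {x y : A.op.Obj} {i : ℤ}
    (f : (A.op.Hom x y).X i) :
    (homRep p').op f ∘ₗ leftOp (P := P) b x = sgn k (j * i) • leftOp (P := P) b y ∘ₗ (homRep p).op f := by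
  have h := (homBifunctor A P).comm (p := p) (q := p') (rfl : j + i = j + i) (add_comm i j) f b
  have h1 := congrArg (endoRep (homFamily A P)).op h
  have h2 := (endoRep (homFamily A P)).op_comp (x := (x, p)) (y := (y, p)) (z := (y, p'))
    (rfl : j + i = j + i) ((homBifunctor A P).right y b) ((homBifunctor A P).left p f)
  have h3 := (endoRep (homFamily A P)).op_comp (x := (x, p)) (y := (x, p')) (z := (y, p'))
    (add_comm i j) ((homBifunctor A P).left p' f) ((homBifunctor A P).right x b)
  rw [map_smul] at h1
  have h4 := h2.symm.trans (h1.trans (congrArg (sgn k (i * j) • ·) h3))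
  have h5 : leftOp (P := P) b y ∘ₗ (homRep p).op f =
    sgn k (i * j) • (homRep p').op f ∘ₗ leftOp (P := P) b x := h4
  rw [h5, smul_smul, mul_comm j i, sgn_mul_self, one_smul]

end HomRep

/-! ### The cochains defined by a Hochschild cocycle and a functional -/

/-- A normalized function on words as a linear function of the first letter. -/
def BarWord.IsNormalized.consMap {A : DGCategory k} {N : Type u} [AddCommGroup N] [Module k N]
    {x y z : A.Obj} {F : BarWord A x z → N} (hF : IsNormalized F) (i : ℤ) (w : BarWord A x y) :
    (A.Hom y z).X i →ₗ[k] N where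
  toFun a := F (BarWord.cons i a w)
  map_add' a b := hF.add' i a b w
  map_smul' c a := hF.smul' i c a w

section Contract
variable {A : DGCategory k} {s t p x z : A.Obj} {j : ℤ} (θ : (A.Hom s p).X j →ₗ[k] k)

/-- The operator `v ↦ ± (θ ⊗ 1)(v m)` for an element `m` of degree `l` of `A(s, x) ⊗ A(z, t)`. -/
noncomputable def leftContract (l : ℤ) (m : TensorX A s t z x l) :
    Total (A.Hom x p) →ₗ[k] Total (A.Hom z t) :=
  Total.pi fun q' => sgn k ((j + q' - l) * l) •
    ((contractX θ (rfl : j + q' = j + q') : TensorX A s t z p (j + q') →ₗ[k] _) ∘ₗ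
    (((representable A s t).lact (show (j + q' - l) + l = j + q' by ring)).flip m :
      (A.Hom x p).X (j + q' - l) →ₗ[k] TensorX A s t z p (j + q')) ∘ₗ Total.proj (j + q' - l))

lemma proj_leftContract {l : ℤ} (m : TensorX A s t z x l) (v : Total (A.Hom x p)) {q q' r : ℤ}
    (h : q + l = r) (h' : j + q' = r) : Total.proj q' (leftContract θ l m v) =
      sgn k (q * l) • contractX θ h' (tensorL A s t h (Total.proj q v) m) := by
  subst h'
  obtain rfl : q = j + q' - l := by omega
  rfl

lemma leftContract_add {l : ℤ} (m m' : TensorX A s t z x l) :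
    leftContract θ l (m + m') = leftContract θ l m + leftContract θ l m' := by
  refine LinearMap.ext fun v => Total.ext fun q' => ?_
  have h : (j + q' - l) + l = j + q' := by ring
  rw [LinearMap.add_apply, map_add, proj_leftContract θ _ _ h rfl, proj_leftContract θ _ _ h rfl,
    proj_leftContract θ _ _ h rfl, map_add, map_add, smul_add]

lemma leftContract_smul {l : ℤ} (c : k) (m : TensorX A s t z x l) :
    leftContract θ l (c • m) = c • leftContract θ l m := by
  refine LinearMap.ext fun v => Total.ext fun q' => ?_
  have h : (j + q' - l) + l = j + q' := by ring
  rw [LinearMap.smul_apply, map_smul, proj_leftContract θ _ _ h rfl, proj_leftContract θ _ _ h rfl,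
    map_smul, map_smul, smul_comm]

lemma leftContract_tmk {a b l : ℤ} (h : a + b = l) (f : (A.Hom s x).X a) (g : (A.Hom z t).X b) :
    leftContract θ l (tmk A s t z x h f g) = sgn k ((j - a) * l) •
      LinearMap.toSpanSingleton k _ (Total.incl (A.Hom z t) b g) ∘ₗ θ ∘ₗ
        (A.comp (show j - a + a = j by ring)).flip f ∘ₗ Total.proj (j - a) := by
  refine LinearMap.ext fun v => Total.ext fun q' => ?_
  simp only [LinearMap.smul_apply, LinearMap.comp_apply, LinearMap.toSpanSingleton_apply, map_smul,
    LinearMap.flip_apply]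
  by_cases hb : b = q'
  · subst hb
    rw [proj_leftContract θ _ _ (show (j - a) + l = j + b by omega) rfl, Total.proj_incl_self,
      tensorL_tmk _ _ (show j - a + a = j by ring), contractX_tmk]
  · rw [proj_leftContract θ _ _ (show (j + q' - l) + l = j + q' by ring) rfl,
      Total.proj_incl_of_ne hb, smul_zero, smul_zero, tensorL_tmk _ _ rfl,
      contractX_tmk_of_ne θ _ _ (by omega), smul_zero]

lemma hasParity_leftContract {l : ℤ} (m : TensorX A s t z x l) :
    HasParity (l - j) (leftContract θ l m) := by
  refine LinearMap.ext fun v => Total.ext fun q' => ?_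
  have h : (j + q' - l) + l = j + q' := by ring
  rw [LinearMap.comp_apply, proj_gradeOp, LinearMap.smul_apply, LinearMap.comp_apply, map_smul,
    proj_leftContract θ _ _ h rfl, proj_leftContract θ _ _ h rfl, proj_gradeOp,
    tensorL_smul, map_smul, smul_smul, smul_smul, smul_smul, ← sgn_add, ← sgn_add, ← sgn_add]
  congr 1
  exact sgn_eq_of_eq_add_two_mul (m := 0) (by ring)

/-- For `m = ∑ f ⊗ g`, the operator `v ↦ ± ∑ θ(v f) g` takes its values in the span of the `g`. -/
lemma isFiniteRank_leftContract {l : ℤ} (m : TensorX A s t z x l) :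
    IsFiniteRank (leftContract θ l m) := by
  induction m using tensor_induction with
  | h0 =>
    have h : leftContract θ l (0 : TensorX A s t z x l) = 0 := by
      simpa using leftContract_smul θ (0 : k) (0 : TensorX A s t z x l)
    rw [h]
    exact IsFiniteRank.zero
  | hadd m m' hm hm' => rw [leftContract_add]; exact hm.add hm'
  | htmk a b h f g =>
    rw [leftContract_tmk]
    refine IsFiniteRank.smul (IsFiniteRank.comp_right ?_ _) _
    unfold IsFiniteRank
    infer_instance

end Contract

section Cocycle
variable {A : DGCategory k} {P : Set A.Obj} {p y : P} {j n : ℤ} (θ : (A.Hom y p).X j →ₗ[k] k)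
  {ψ : ∀ x z : A.Obj, BarWord A x z → Tot ((representable A y y).M x z)}
  (hψ : IsHochschildCochain (representable A y y) n ψ)

/-- The cochain `w ↦ (v ↦ ± (θ ⊗ 1) ψ(v | w))` of degree `n - j - 1`. -/
noncomputable def barContract : ContraCochain (homRep p) (homRep y) := fun z _ w =>
  Total.pi fun q' => sgn k ((j + q' - deg w - n + 1) * deg w) •
    (Total.proj q' ∘ₗ contract (y : A.Obj) z θ ∘ₗ
      (hψ.normalized z p).consMap (j + q' - deg w - n + 1) w ∘ₗ Total.proj (j + q' - deg w - n + 1))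

lemma proj_barContract {x z : A.Obj} (w : BarWord A z x) (m : Total (A.Hom x p)) {q q' : ℤ}
    (h : q - 1 + deg w + n = j + q') : Total.proj q' (barContract θ hψ w m) =
      sgn k (q * deg w) • Total.proj q' (contract (y : A.Obj) z θ
        (ψ z p (cons q (Total.proj q m) w))) := by
  obtain rfl : q = j + q' - deg w - n + 1 := by omega
  rfl

variable (ψ) in
/-- The cochain `w ↦ (v ↦ ± (θ ⊗ 1)(v ψ(w)))` of degree `n - j`. -/
noncomputable def actContract (n : ℤ) : ContraCochain (homRep p) (homRep y) := fun z x w =>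
  sgn k (n + j) • leftContract θ (deg w + n) (ψ z x w (deg w + n))

lemma proj_actContract {x z : A.Obj} (w : BarWord A z x) (m : Total (A.Hom x p)) {q q' : ℤ}
    (h : q + deg w + n = j + q') : Total.proj q' (actContract θ ψ n w m) =
      sgn k (n + j + q * (deg w + n)) • Total.proj q' (contract (y : A.Obj) z θ
        (totL _ (Total.proj q m) (ψ z x w))) := by
  have h1 := proj_leftContract θ
    (show TensorX A (y : A.Obj) y z x (deg w + n) from ψ z x w (deg w + n)) m
    (show q + (deg w + n) = j + q' by omega) rfl
  rw [proj_contract θ _ rfl, totL_apply _ _ (show q + (deg w + n) = j + q' by omega), sgn_add,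
    mul_smul]
  exact congrArg (sgn k (n + j) • ·) h1

/-- A component of the value of an operator, as a linear function of the operator. -/
noncomputable def evalProj {K L : CochainComplex (ModuleCat.{u} k) ℤ} (m : Total K) (q : ℤ) :
    (Total K →ₗ[k] Total L) →ₗ[k] L.X q := Total.proj q ∘ₗ LinearMap.applyₗ m

lemma evalProj_apply {K L : CochainComplex (ModuleCat.{u} k) ℤ} (m : Total K) (q : ℤ)
    (X : Total K →ₗ[k] Total L) : evalProj m q X = Total.proj q (X m) := rfl

/-- The contravariant cochain which is concentrated on the empty words, with values `T`. -/
def ContraCochain.unit {R R' : DGRep A.op} (T : ∀ z, Total (R.K z) →ₗ[k] Total (R'.K z)) :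
    ContraCochain R R'
  | _, _, .nil z => T z
  | _, _, .cons _ _ _ => 0

lemma isNormalized_barContract (z x : A.Obj) :
    IsNormalized (barContract θ hψ (z := z) (x := x)) where
  lin {c w w₁ w₂} h := by
    refine LinearMap.ext fun m => Total.ext fun q' => ?_
    have h0 : (j + q' - deg w - n + 1) - 1 + deg w + n = j + q' := by ring
    rw [LinearMap.add_apply, map_add, LinearMap.smul_apply, map_smul, proj_barContract θ hψ _ _ h0,
      proj_barContract θ hψ w₁ m (by rw [h.deg_eq.1]; exact h0),
      proj_barContract θ hψ w₂ m (by rw [h.deg_eq.2]; exact h0),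
      (hψ.normalized z p).lin (h.tail _ _), map_add, map_add, map_smul, map_smul, h.deg_eq.1,
      h.deg_eq.2]
    module
  degenerate {w} h := by
    refine LinearMap.ext fun m => Total.ext fun q' => ?_
    have h0 : (j + q' - deg w - n + 1) - 1 + deg w + n = j + q' := by ring
    rw [proj_barContract θ hψ _ _ h0, (hψ.normalized z p).degenerate (h.tail _ _), map_zero,
      map_zero, smul_zero, LinearMap.zero_apply, map_zero]

lemma hasParity_barContract {z x : A.Obj} (w : BarWord A z x) :
    HasParity (deg w + (n - j - 1)) (barContract θ hψ w) := by
  refine LinearMap.ext fun m => Total.ext fun q' => ?_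
  have h0 : (j + q' - deg w - n + 1) - 1 + deg w + n = j + q' := by ring
  have h1 := ((hψ.normalized z p).consMap (j + q' - deg w - n + 1) w).map_smul
    (sgn k (j + q' - deg w - n + 1)) (Total.proj (j + q' - deg w - n + 1) m)
  have h2 : ψ z p (cons (j + q' - deg w - n + 1) (sgn k (j + q' - deg w - n + 1) •
      Total.proj (j + q' - deg w - n + 1) m) w) = sgn k (j + q' - deg w - n + 1) •
      ψ z p (cons (j + q' - deg w - n + 1) (Total.proj (j + q' - deg w - n + 1) m) w) := h1
  rw [LinearMap.comp_apply, proj_gradeOp, LinearMap.smul_apply, LinearMap.comp_apply, map_smul,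
    proj_barContract θ hψ _ _ h0, proj_barContract θ hψ _ _ h0, proj_gradeOp, h2, map_smul,
    map_smul, smul_smul, smul_smul, smul_smul, ← sgn_add, ← sgn_add, ← sgn_add]
  congr 1
  exact sgn_eq_of_eq_add_two_mul (m := 0) (by ring)

include hψ in
lemma isNormalized_actContract (z x : A.Obj) :
    IsNormalized (actContract θ ψ n (p := p) (y := y) (z := z) (x := x)) where
  lin {c w w₁ w₂} h := by
    rw [actContract, actContract, actContract, h.deg_eq.1, h.deg_eq.2, (hψ.normalized z x).lin h]
    have h1 := leftContract_add θ (p := (p : A.Obj)) (l := deg w + n) (ψ z x w₁ (deg w + n))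
      (c • ψ z x w₂ (deg w + n))
    have h2 := leftContract_smul θ (p := (p : A.Obj)) (l := deg w + n) c (ψ z x w₂ (deg w + n))
    refine (congrArg (sgn k (n + j) • ·) (h1.trans (congrArg (_ + ·) h2))).trans ?_
    module
  degenerate {w} h := by
    rw [actContract, (hψ.normalized z x).degenerate h]
    have h2 := leftContract_smul θ (s := (y : A.Obj)) (t := (y : A.Obj)) (p := (p : A.Obj)) (z := z)
      (x := x) (l := deg w + n) (0 : k) 0
    rw [zero_smul, zero_smul] at h2
    exact (congrArg (sgn k (n + j) • ·) h2).trans (smul_zero _)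

lemma hasParity_actContract {z x : A.Obj} (w : BarWord A z x) :
    HasParity (deg w + (n - j)) (actContract θ ψ n (p := p) (y := y) w) :=
  HasParity.smul ((hasParity_leftContract θ (l := deg w + n) (ψ z x w (deg w + n))).congr
    (congrArg (sgn k) (show deg w + n - j = deg w + (n - j) by ring))) _

lemma isFiniteRank_actContract {z x : A.Obj} (w : BarWord A z x) :
    IsFiniteRank (actContract θ ψ n (p := p) (y := y) w) :=
  (isFiniteRank_leftContract θ _).smul _

lemma ContraCochain.toCovariant_unit {R R' : DGRep A.op}
    (T : ∀ z, Total (R.K z) →ₗ[k] Total (R'.K z)) {x z : A.op.Obj} (u : BarWord A.op x z) :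
    (ContraCochain.unit T).toCovariant u = OpCochain.unitCochain T u := by
  cases u with
  | nil =>
    rw [toCovariant, DGAntifunctor.reverse_nil, reverseSign, sgn_zero, one_smul,
      OpCochain.unitCochain_nil]
    rfl
  | cons i a u =>
    rw [toCovariant, DGAntifunctor.reverse_cons, OpCochain.unitCochain_cons]
    generalize (unopAntifunctor A).reverse u = v
    cases v <;> exact smul_zero _

variable (hd : ∀ x z (w : BarWord A x z), hochD (representable A y y) n ψ w = 0)
  (hθ : ∀ (i : ℤ) (_ : i + 1 = j) (v : (A.Hom y p).X i), θ ((A.Hom y p).d i j v) = 0)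
include hd hθ

/-- The cochain `actContract` is closed: its differential at `w` evaluated on `v` is the contraction of
`v` times the differential of `ψ` at `w`. -/
lemma delta_actContract {z x : A.Obj} (w : BarWord A z x) :
    (actContract θ ψ n).delta (n - j) w = 0 := by
  refine LinearMap.ext fun m => Total.ext fun q' => ?_
  obtain ⟨q, hq⟩ : ∃ q, q + deg w + n + 1 = j + q' := ⟨j + q' - deg w - n - 1, by ring⟩
  set v := Total.proj q m with hv
  let L : Tot ((representable A y y).M z p) →ₗ[k] (A.Hom z y).X q' :=
    Total.proj q' ∘ₗ contract (y : A.Obj) z θ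
  have h0 := congrArg (fun X => L (totL _ v X)) (hd z x w)
  have hdiff : Total.proj q' (diffOp _ (actContract θ ψ n w m)) =
      sgn k (n + j + q * (deg w + n)) • (sgn k j • (L (totL _ ((A.Hom x p).d q (q + 1) v) (ψ z x w) +
        sgn k q • totL _ v (totD _ (ψ z x w))))) := by
    have h1 := congrArg (Total.proj q') (contract_totD θ hθ (totL _ v (ψ z x w)))
    rw [totD_totL, map_smul, proj_diffOp _ (show q' - 1 + 1 = q' by ring)] at h1
    rw [proj_diffOp _ (show q' - 1 + 1 = q' by ring),
      proj_actContract θ w m (show q + deg w + n = j + (q' - 1) by omega), map_smul]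
    refine congrArg _ (Eq.symm ((congrArg (sgn k j • ·) h1).trans ?_))
    dsimp only
    rw [smul_smul, sgn_mul_self, one_smul]
  have hdm : Total.proj q' (actContract θ ψ n w (diffOp _ m)) =
      sgn k (n + j + (q + 1) * (deg w + n)) • L (totL _ ((A.Hom x p).d q (q + 1) v) (ψ z x w)) := by
    rw [proj_actContract θ w _ (show q + 1 + deg w + n = j + q' by omega), proj_diffOp m rfl]
    rfl
  have hb : Total.proj q' (bdry w (fun v => actContract θ ψ n v) m) =
      sgn k (n + j + q * (deg w + 1 + n)) • L (totL _ v (bdry w (ψ z x))) := by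
    rw [← evalProj_apply, BarWord.bdry_lin, BarWord.bdry_lin, BarWord.bdry_lin, ← bdry_smul]
    refine bdry_congr_deg w fun u hu => ?_
    rw [evalProj_apply, proj_actContract θ u m (show q + deg u + n = j + q' by omega), hu]
    rfl
  have hf : Total.proj q' (first w (fun y' i a u => sgn k (i * deg u) •
      actContract θ ψ n u ∘ₗ (homRep p).op (x := x) (y := y') a) m) =
      sgn k (n + j + q * (deg w + 1 + n)) • L (totL _ v (first w fun _ i a u =>
        sgn k (n * i) • totL _ a (ψ _ _ u))) := by
    rw [← evalProj_apply, BarWord.first_lin, BarWord.first_lin, BarWord.first_lin, ← first_smul]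
    refine first_congr w fun y' i a u hu => ?_
    subst hu
    rw [map_smul, evalProj_apply, LinearMap.comp_apply, proj_actContract θ u _
      (show q + i + deg u + n = j + q' by simp only [deg] at hq; omega), proj_homRep_op p a m rfl,
      totL_smul, totL_totL]
    simp only [L, LinearMap.comp_apply, map_smul, smul_smul, ← sgn_add, ← hv]
    congr 1
    exact sgn_eq_of_eq_add_two_mul (m := i * deg u) (by simp only [deg]; ring)
  have hl : Total.proj q' (last w (fun y' u l a => sgn k (deg u + l * deg u + l * (n - j)) •
      (homRep y).op (x := y') (y := z) a ∘ₗ actContract θ ψ n u) m) =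
      sgn k (n + j + q * (deg w + 1 + n)) • L (totL _ v (last w fun _ u _ a =>
        sgn k (deg u) • totR _ a (ψ _ _ u))) := by
    rw [← evalProj_apply, BarWord.last_lin, BarWord.last_lin, BarWord.last_lin, ← last_smul]
    refine last_congr_deg w fun y' u l a hu => ?_
    rw [map_smul, evalProj_apply, LinearMap.comp_apply,
      proj_homRep_op y a _ (show q' - l + l = q' by ring),
      proj_actContract θ u m (show q + deg u + n = j + (q' - l) by omega),
      map_smul, LinearMap.smul_apply, ← contract_totR θ a _ (show q' - l + l = q' by ring), totR_totL]
    simp only [L, LinearMap.comp_apply, map_smul, smul_smul, ← sgn_add, ← hv]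
    congr 1
    rw [show q' = q + deg w + n + 1 - j by omega, ← hu]
    exact sgn_eq_of_eq_add_two_mul (m := l * deg u + l * n - l * j) (by ring)
  rw [hochD] at h0
  rw [ContraCochain.delta]
  replace h0 := congrArg ((sgn k n * sgn k q * sgn k (q * deg w) * sgn k (q * n)) • ·) h0
  simp only [LinearMap.sub_apply, LinearMap.add_apply, LinearMap.smul_apply, LinearMap.comp_apply,
    map_sub, map_add, map_smul, map_zero, LinearMap.zero_apply] at h0 ⊢
  rw [hdiff, hdm, hb, hf, hl]
  simp only [map_add, map_smul, mul_add, add_mul, one_mul, mul_one, sgn_add, sgn_sub] at h0 ⊢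
  rcases sgn_eq_one_or (k := k) q with h1 | h1 <;> rcases sgn_eq_one_or (k := k) n with h2 | h2 <;>
  rcases sgn_eq_one_or (k := k) j with h3 | h3 <;>
  rcases sgn_eq_one_or (k := k) (deg w) with h4 | h4 <;>
  simp only [h1, h2, h3, h4] at h0 ⊢ <;>
  linear_combination (norm := module) h0

/-- The cochain `barContract` is a homotopy between `actContract` and left multiplication by
`(θ ⊗ 1) ψ([])`: this is the cocycle condition for `ψ` on the words `v | w`. The term in which `v` is
the last letter occurs on empty words `w` only. -/
lemma delta_barContract {z x : A.Obj} (w : BarWord A z x) :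
    (barContract θ hψ).delta (n - j - 1) w = actContract θ ψ n w - sgn k (n + j) •
      ContraCochain.unit (R := homRep p) (R' := homRep y) (fun z => leftOp (P := P) (Total.proj (n - j)
        (contract (y : A.Obj) (p : A.Obj) θ (ψ p p (.nil _)))) z) w := by
  refine LinearMap.ext fun m => Total.ext fun q' => ?_
  obtain ⟨q, hq⟩ : ∃ q, q + deg w + n = j + q' := ⟨j + q' - deg w - n, by ring⟩
  set v := Total.proj q m with hv
  obtain ⟨U, hUdef⟩ : ∃ U : (A.Hom z y).X q', U = Total.proj q' (ContraCochain.unit (R := homRep p) (R' := homRep y)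
        (fun z => leftOp (P := P) (Total.proj (n - j)
        (contract (y : A.Obj) (p : A.Obj) θ (ψ p p (.nil _)))) z) w m) := ⟨_, rfl⟩
  let L : Tot ((representable A y y).M z p) →ₗ[k] (A.Hom z y).X q' :=
    Total.proj q' ∘ₗ contract (y : A.Obj) z θ
  have h0 := congrArg L (hd z p (cons q v w))
  have hdiff : Total.proj q' (diffOp _ (barContract θ hψ w m)) =
      sgn k (q * deg w) • (sgn k j • L (totD _ (ψ z p (cons q v w)))) := by
    have h1 := congrArg (Total.proj q') (contract_totD θ hθ (ψ z p (cons q v w)))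
    rw [map_smul, proj_diffOp _ (show q' - 1 + 1 = q' by ring)] at h1
    rw [proj_diffOp _ (show q' - 1 + 1 = q' by ring),
      proj_barContract θ hψ w m (show q - 1 + deg w + n = j + (q' - 1) by omega), map_smul]
    refine congrArg _ (Eq.symm ((congrArg (sgn k j • ·) h1).trans ?_))
    dsimp only
    rw [smul_smul, sgn_mul_self, one_smul]
  have hdm : Total.proj q' (barContract θ hψ w (diffOp _ m)) =
      sgn k ((q + 1) * deg w) • L (ψ z p (cons (q + 1) ((A.Hom x p).d q (q + 1) v) w)) := by
    rw [proj_barContract θ hψ w _ (show q + 1 - 1 + deg w + n = j + q' by omega),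
      proj_diffOp m rfl]
    rfl
  have hb : Total.proj q' (bdry w (fun v => barContract θ hψ v) m) =
      sgn k (q * (deg w + 1)) • L (bdry w fun u => ψ z p (cons q v u)) := by
    rw [← evalProj_apply, BarWord.bdry_lin, BarWord.bdry_lin, ← bdry_smul]
    refine bdry_congr_deg w fun u hu => ?_
    rw [evalProj_apply, proj_barContract θ hψ u m (show q - 1 + deg u + n = j + q' by omega), hu]
    rfl
  have hf : Total.proj q' (first w (fun y' i a u => sgn k (i * deg u) •
      barContract θ hψ u ∘ₗ (homRep p).op (x := x) (y := y') a) m) =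
      sgn k (q * (deg w + 1)) • L (first w fun _ i a u =>
        ψ z p (cons (q + i) (A.comp rfl v a) u)) := by
    rw [← evalProj_apply, BarWord.first_lin, BarWord.first_lin, ← first_smul]
    refine first_congr w fun y' i a u hu => ?_
    subst hu
    rw [map_smul, evalProj_apply, LinearMap.comp_apply, proj_barContract θ hψ u _
      (show q + i - 1 + deg u + n = j + q' by simp only [deg] at hq; omega),
      proj_homRep_op p a m rfl]
    have h1 := ((hψ.normalized z p).consMap (q + i) u).map_smul (sgn k (i * q))
      (A.comp (rfl : q + i = q + i) v a)
    have h2 : ψ z p (cons (q + i) (sgn k (i * q) • A.comp (rfl : q + i = q + i) v a) u) =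
      sgn k (i * q) • ψ z p (cons (q + i) (A.comp (rfl : q + i = q + i) v a) u) := h1
    rw [h2]
    simp only [L, LinearMap.comp_apply, map_smul, smul_smul, ← sgn_add]
    congr 1
    exact sgn_eq_of_eq_add_two_mul (m := i * deg u) (by simp only [deg]; ring)
  have hl : Total.proj q' (last w (fun y' u l a =>
      sgn k (deg u + l * deg u + l * (n - j - 1)) •
      (homRep y).op (x := y') (y := z) a ∘ₗ barContract θ hψ u) m) =
      sgn k (q * (deg w + 1) + (q - 1)) • L (last w fun y' u _ a =>
        sgn k (deg (cons q v u)) • totR _ a (ψ y' p (cons q v u))) := by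
    rw [← evalProj_apply, BarWord.last_lin, BarWord.last_lin, ← last_smul]
    refine last_congr_deg w fun y' u l a hu => ?_
    rw [map_smul, evalProj_apply, LinearMap.comp_apply,
      proj_homRep_op y a _ (show q' - l + l = q' by ring),
      proj_barContract θ hψ u m (show q - 1 + deg u + n = j + (q' - l) by omega),
      map_smul, LinearMap.smul_apply, ← contract_totR θ a _ (show q' - l + l = q' by ring)]
    simp only [L, LinearMap.comp_apply, map_smul, smul_smul, ← sgn_add, ← hv, deg]
    congr 1
    rw [show q' = q + deg w + n - j by omega, ← hu]
    exact sgn_eq_of_eq_add_two_mul (m := l * deg u + l * n - l * j - l - q + 1) (by ring)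
  -- if `w` is empty then `v` is also the last letter, which gives the term with `leftOp`
  have hlast : L (last (cons q v w) fun y' u _ a =>
      sgn k (deg u) • totR _ a (ψ y' p u)) = L (last w fun y' u _ a =>
        sgn k (deg (cons q v u)) • totR _ a (ψ y' p (cons q v u))) +
      U := by
    subst hUdef
    cases w with
    | nil =>
      simp only [deg] at hq
      rw [last_single, last_nil, map_zero, zero_add, deg, sgn_zero, one_smul]
      exact (contract_totR θ v _ (show n - j + q = q' by omega)).trans
        (proj_leftOp (P := P) _ _ m _).symm
    | cons i a w =>
      rw [last_cons_cons]
      simp [ContraCochain.unit]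
  have hact : Total.proj q' (actContract θ ψ n w m) =
      sgn k (n + j + q * (deg w + n)) • L (totL _ v (ψ z x w)) :=
    proj_actContract θ w m hq
  rw [hochD, bdry_cons, first_cons] at h0
  rw [ContraCochain.delta]
  replace h0 := congrArg ((sgn k (q * deg w) * sgn k j) • ·) h0
  simp only [LinearMap.sub_apply, LinearMap.add_apply, LinearMap.smul_apply, LinearMap.comp_apply,
    map_sub, map_add, map_smul, map_neg, map_zero] at h0 ⊢
  rw [hlast] at h0
  rw [hdiff, hdm, hb, hf, hl, hact, ← hUdef]
  have hU : sgn k (q * deg w) • U = U := by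
    subst hUdef
    cases w with
    | nil => simp only [deg, mul_zero, sgn_zero, one_smul]
    | cons => simp [ContraCochain.unit]
  simp only [mul_add, add_mul, one_mul, mul_one, sgn_add, sgn_sub, sgn_one] at h0 ⊢
  replace hU := congrArg ((sgn k n * sgn k j) • ·) hU
  rcases sgn_eq_one_or (k := k) q with h1 | h1 <;> rcases sgn_eq_one_or (k := k) n with h2 | h2 <;>
  rcases sgn_eq_one_or (k := k) j with h3 | h3 <;>
  rcases sgn_eq_one_or (k := k) (deg w) with h4 | h4 <;>
  simp only [h1, h2, h3, h4] at h0 hU ⊢ <;>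
  rw [mul_comm q n] <;>
  linear_combination (norm := module) h0 - hU

/-- The cocycle condition for `ψ` on the empty word. -/
lemma d_contract_nil : (A.Hom p y).d (n - j) (n - j + 1) (Total.proj (n - j)
    (contract (y : A.Obj) (p : A.Obj) θ (ψ p p (.nil _)))) = 0 := by
  have h0 := hd p p (.nil _)
  rw [hochD, bdry_nil, first_nil, last_nil, add_zero, sub_zero, smul_zero, sub_zero] at h0
  have h1 := contract_totD θ hθ (ψ p p (.nil _))
  rw [h0, map_zero] at h1
  have h2 := congrArg (fun X => sgn k j • Total.proj (n - j + 1) X) h1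
  rw [map_smul, smul_smul, sgn_mul_self, one_smul, map_zero, smul_zero, proj_diffOp _ rfl] at h2
  exact h2.symm

end Cocycle

/-! ### Supertraces of operators of rank one -/

lemma finiteRankTrace_field (X : k →ₗ[k] k) : finiteRankTrace X = X 1 := by
  have h : X = X 1 • LinearMap.id := LinearMap.ext_ring (by simp)
  have hid : finiteRankTrace (LinearMap.id : k →ₗ[k] k) = 1 := by
    rw [finiteRankTrace_eq_trace (S := ⊤) le_top]
    refine (LinearMap.trace_id k (⊤ : Submodule k k)).trans ?_
    rw [finrank_top, Module.finrank_self, Nat.cast_one]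
  rw [h, finiteRankTrace_smul (by unfold IsFiniteRank; infer_instance), hid]
  simp

/-- The supertrace of the operator `v ↦ Y(v) u`. -/
lemma str_toSpanSingleton_comp {K : CochainComplex (ModuleCat.{u} k) ℤ} (Y : Total K →ₗ[k] k)
    (u : Total K) : str (LinearMap.toSpanSingleton k _ u ∘ₗ Y) = Y (gradeOp K u) := by
  have h : gradeOp K ∘ₗ LinearMap.toSpanSingleton k _ u ∘ₗ Y =
      LinearMap.toSpanSingleton k _ (gradeOp K u) ∘ₗ Y := LinearMap.ext fun v => by simp
  rw [str, h, finiteRankTrace_comm (by unfold IsFiniteRank; infer_instance), finiteRankTrace_field]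
  simp

/-! ### Words with reversed or mapped letters -/

section Words
variable {A : DGCategory k} {P : Set A.Obj}

lemma DGAntifunctor.reverseSign_reverse {B : DGCategory k} (Ψ : DGAntifunctor A B) {x y : A.Obj}
    (w : BarWord A x y) : reverseSign (Ψ.reverse w) = reverseSign w := by
  induction w with
  | nil => rw [Ψ.reverse_nil, reverseSign, reverseSign]
  | cons i a w ih =>
    rw [Ψ.reverse_cons, reverseSign_append, reverseSign_single, ih, Ψ.deg_reverse, deg_single,
      reverseSign]
    ring

lemma reverse_reverse {x y : A.Obj} (w : BarWord A x y) :
    (unopAntifunctor A).reverse ((opAntifunctor A).reverse w) = w := by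
  induction w with
  | nil => rw [DGAntifunctor.reverse_nil]; exact (unopAntifunctor A).reverse_nil _
  | cons i a w ih =>
    rw [DGAntifunctor.reverse_cons]
    refine ((unopAntifunctor A).reverse_append_single _ _).trans ?_
    rw [ih]
    rfl

/-- The image of a word under the dg functor `x ↦ Φ(x, p)`. -/
def DGBifunctor.mapLeft {C D E : DGCategory k} (Φ : DGBifunctor C D E) (p : D.Obj) {x : C.Obj} :
    ∀ {y : C.Obj}, BarWord C x y → BarWord E (Φ.obj x p) (Φ.obj y p)
  | _, .nil _ => nil _
  | _, .cons i a w => cons i (Φ.left p a) (mapLeft Φ p w)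

lemma DGBifunctor.shuffle_nil_right {C D E : DGCategory k} (Φ : DGBifunctor C D E) (p : D.Obj)
    {x y : C.Obj} {N : Type u} [AddCommGroup N] [Module k N] (w : BarWord C x y)
    (F : BarWord E (Φ.obj x p) (Φ.obj y p) → N) :
    Φ.shuffle w (nil p) F = F (Φ.mapLeft p w) := by
  induction w with
  | nil => rw [shuffle_nil_nil, mapLeft]
  | cons i a w ih => rw [shuffle_cons_nil, ih, mapLeft]

variable (c : ∀ X : A.Obj × P, Contraction (homFamily A P X))

/-- The contractions of the complexes `A(z, p)` for a fixed `p`. -/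
noncomputable def homContraction (p : P) (z : A.op.Obj) : OpContraction ((homRep p).K z) :=
  opContraction c (z, p)

lemma hWord_mapLeft (p : P) {x y : A.op.Obj} (w : BarWord A.op x y) :
    hWord (endoRep (homFamily A P)) (opContraction c) ((homBifunctor A P).mapLeft p w) =
      hWord (homRep p) (homContraction c p) w := by
  induction w with
  | nil => rfl
  | cons i a w ih =>
    rename_i y z
    exact congrArg (fun X : Total (A.Hom x p) →ₗ[k] Total (A.Hom y p) =>
      -sgn k i • (homContraction c p z).h ∘ₗ (homRep p).op a ∘ₗ X) ih

lemma gWord_mapLeft (p : P) {x y : A.op.Obj} (w : BarWord A.op x y) :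
    gWord (endoRep (homFamily A P)) (opContraction c) ((homBifunctor A P).mapLeft p w) =
      gWord (homRep p) (homContraction c p) w := by
  induction w with
  | nil => rfl
  | cons i a w ih =>
    rename_i y z
    exact congrArg₂ (fun X Y : Total (A.Hom x p) →ₗ[k] Total (A.Hom y p) =>
      -sgn k i • (homContraction c p z).e ∘ₗ (homRep p).op a ∘ₗ X +
        (homContraction c p z).h ∘ₗ (homRep p).op a ∘ₗ Y) (hWord_mapLeft c p w) ih

/-- The pairing with a word of length zero. -/
lemma pairing_nil (hc : ∀ X, IsFiniteRank (opContraction c X).e) {x y : A.Obj} {i n : ℤ}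
    (a : (A.Hom y x).X i) (w : BarWord A x y) {p : P} (b : (A.Hom p p).X n) :
    pairing c ⟨a, w⟩ (⟨b, nil (A := A.full P) p⟩ : HHWord (A.full P)) =
      sgn k (reverseSign w + n * deg w) * str ((homRep p).op (x := x) (y := y) a ∘ₗ
        leftOp (P := P) b x ∘ₗ
          gWord (homRep p) (homContraction c p) ((opAntifunctor A).reverse w)) := by
  rw [pairing_eq c hc, DGAntifunctor.reverseFun_mk, sgn_add, mul_assoc]
  refine congrArg (sgn k (reverseSign w) * ·) ?_
  refine ((homBifunctor A P).shuffleFun_mk (traceFun c) _ _ _ _).trans ?_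
  rw [DGAntifunctor.deg_reverse]
  refine congrArg (sgn k (n * deg w) * ·) ?_
  refine ((homBifunctor A P).shuffle_nil_right (N := k) p _ _).trans ?_
  refine (congrArg (fun X : Total (A.Hom x p) →ₗ[k] Total (A.Hom y p) =>
    str (X ∘ₗ gWord (endoRep (homFamily A P)) (opContraction c)
      ((homBifunctor A P).mapLeft p ((opAntifunctor A).reverse w))))
    ((endoRep (homFamily A P)).op_comp (x := (x, p)) (y := (x, p)) (z := (y, p)) rfl
      ((homBifunctor A P).left p ((opAntifunctor A).map a)) ((homBifunctor A P).right x b))).trans ?_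
  exact congrArg (fun X : Total (A.Hom y p) →ₗ[k] Total (A.Hom x p) =>
    str ((homRep p).op (x := x) (y := y) a ∘ₗ leftOp (P := P) b x ∘ₗ X))
      (gWord_mapLeft c p ((opAntifunctor A).reverse w))

end Words

section CapWord
variable {A : DGCategory k} {P : Set A.Obj} {p y : P} {j n : ℤ} (θ : (A.Hom y p).X j →ₗ[k] k)

lemma leftOp_incl {p p' : P} {j b l : ℤ} (h : j + b = l) (g : (A.Hom p p').X j) {z : A.Obj}
    (v : (A.Hom z p).X b) : leftOp (P := P) g z (Total.incl _ b v) =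
      Total.incl (A.Hom z p') l (A.comp h g v) := by
  refine Total.ext fun q => ?_
  rw [proj_leftOp g z _ (show j + (q - j) = q by ring)]
  by_cases hq : l = q
  · subst hq
    obtain rfl : b = l - j := by omega
    rw [Total.proj_incl_self, Total.proj_incl_self]
  · rw [Total.proj_incl_of_ne hq, Total.proj_incl_of_ne (by omega), map_zero]

lemma homRep_op_incl (p : P) {x z : A.Obj} {i b l : ℤ} (h : b + i = l) (a : (A.Hom z x).X i)
    (v : (A.Hom x p).X b) : (homRep p).op (x := x) (y := z) a (Total.incl _ b v) =
      sgn k (i * b) • Total.incl (A.Hom z p) l (A.comp h v a) := by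
  refine Total.ext fun q => ?_
  rw [proj_homRep_op p a _ (show q - i + i = q by ring), map_smul]
  by_cases hq : l = q
  · subst hq
    obtain rfl : b = l - i := by omega
    rw [Total.proj_incl_self, Total.proj_incl_self]
  · rw [Total.proj_incl_of_ne hq, Total.proj_incl_of_ne (by omega), map_zero,
      LinearMap.zero_apply, smul_zero, smul_zero]

/-- The supertrace of the operator `v ↦ ± (θ ⊗ g')(v m) a₀` is the value of `θ` on the product of
`g'` and the cap product of the word `a₀[w]` and `m`. -/
lemma str_leftContract (g' : (A.Hom y p).X j) (W : HHWord A) {r : ℤ} (hr : r = 0)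
    (m : TensorX A (y : A.Obj) (y : A.Obj) W.x W.y (r - W.i)) :
    str ((homRep p).op (x := W.x) (y := W.y) W.a ∘ₗ leftOp (P := P) g' W.x ∘ₗ
      leftContract θ (r - W.i) m) = sgn k (j + n * W.i) *
        θ (A.comp (show j + r = j by omega) g' (capWord (y : A.Obj) (y : A.Obj) n r W m)) := by
  obtain ⟨a, w⟩ := W
  rename_i x z i
  have hfr : ∀ m : TensorX A (y : A.Obj) (y : A.Obj) x z (r - i),
      IsFiniteRank ((homRep p).op (x := x) (y := z) a ∘ₗ leftOp (P := P) g' x ∘ₗ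
        leftContract θ (r - i) m) := fun m =>
    ((isFiniteRank_leftContract θ m).comp_left _).comp_left _
  dsimp only at m ⊢
  induction m using tensor_induction with
  | h0 =>
    have h : leftContract θ (r - i) (0 : TensorX A (y : A.Obj) y x z (r - i)) = 0 := by
      simpa using leftContract_smul θ (0 : k) (0 : TensorX A (y : A.Obj) y x z (r - i))
    rw [map_zero, map_zero, map_zero, mul_zero, h, LinearMap.comp_zero, LinearMap.comp_zero, str_zero]
  | hadd m m' hm hm' =>
    rw [leftContract_add, LinearMap.comp_add, LinearMap.comp_add, str_add (hfr m) (hfr m'), hm, hm',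
      map_add, map_add, map_add, mul_add]
  | htmk b b' h f g =>
    have h1 : (homRep p).op (x := x) (y := z) a ∘ₗ leftOp (P := P) g' x ∘ₗ
        leftContract θ (r - i) (tmk A y y x z h f g) =
        (sgn k ((j - b) * (r - i)) * sgn k (i * (j + b'))) •
          LinearMap.toSpanSingleton k _ (Total.incl (A.Hom z p) (j - b)
            (A.comp (show j + b' + i = j - b by omega) (A.comp rfl g' g) a)) ∘ₗ θ ∘ₗ
              (A.comp (show j - b + b = j by ring)).flip f ∘ₗ Total.proj (j - b) := by
      rw [leftContract_tmk]
      refine LinearMap.ext fun v => ?_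
      simp only [LinearMap.comp_apply, LinearMap.smul_apply, LinearMap.toSpanSingleton_apply,
        map_smul, leftOp_incl (P := P) rfl, smul_smul]
      have h2 := homRep_op_incl p (show j + b' + i = j - b by omega) a (A.comp rfl g' g)
      rw [h2, smul_smul]
      congr 1
      ring
    have h3 : A.comp (show j - b + b = j by ring)
        (A.comp (show j + b' + i = j - b by omega) (A.comp rfl g' g) a) f =
      A.comp (show j + r = j by omega) g'
        (A.comp (show b' + (i + b) = r by omega) g (A.comp rfl a f)) := by
      rw [A.assoc (show j + b' + i = j - b by omega) (rfl : i + b = i + b) _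
        (show j + b' + (i + b) = j by omega), A.assoc rfl (show b' + (i + b) = r by omega)]
    rw [h1, str_smul ?_, str_toSpanSingleton_comp, capWord, tlift_tmk]
    · simp only [LinearMap.comp_apply, LinearMap.flip_apply, proj_gradeOp, map_smul,
        Total.proj_incl_self, LinearMap.smul_apply, smul_eq_mul, h3]
      simp only [← mul_assoc, ← sgn_add]
      congr 1
      obtain rfl : r = 0 := hr
      obtain rfl : i = -(b + b') := by omega
      -- `b * (b + 1)` is even
      obtain ⟨t, ht⟩ := Int.even_mul_succ_self b
      exact sgn_eq_of_eq_add_two_mul (m := n * (b + b') - b * b' - t) (by linear_combination -ht)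
    · refine IsFiniteRank.comp_right ?_ _
      unfold IsFiniteRank
      infer_instance

variable {ψ : ∀ x z : A.Obj, BarWord A x z → Tot ((representable A y y).M x z)}

/-- The case of `str_leftContract` where the element of the tensor product is the value of a cochain
of degree `n`. -/
lemma str_actContract (g' : (A.Hom y p).X j) (W : HHWord A) (hW : W.deg = -n) :
    sgn k (n * deg W.w) * str ((homRep p).op (x := W.x) (y := W.y) W.a ∘ₗ leftOp (P := P) g' W.x ∘ₗ
      actContract θ ψ n W.w) = θ (A.comp (show j + (n + -n) = j by omega) g'
        (capWord (y : A.Obj) (y : A.Obj) n (n + -n) W (ψ W.x W.y W.w (n + -n - W.i)))) := by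
  have h : deg W.w + n = n + -n - W.i := by
    rw [HHWord.deg] at hW
    omega
  have h1 := str_leftContract θ (n := n) g' W (add_neg_cancel n) (ψ W.x W.y W.w (n + -n - W.i))
  have hfr := ((isFiniteRank_leftContract θ (p := (p : A.Obj)) (l := n + -n - W.i)
    (ψ W.x W.y W.w (n + -n - W.i))).comp_left (leftOp (P := P) g' W.x)).comp_left
      ((homRep p).op (x := W.x) (y := W.y) W.a)
  have h2 : actContract θ ψ n (p := p) W.w = sgn k (n + j) •
      leftContract θ (n + -n - W.i) (ψ W.x W.y W.w (n + -n - W.i)) := by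
    rw [actContract, h]
  rw [h2, LinearMap.comp_smul, LinearMap.comp_smul]
  refine (congrArg (sgn k (n * deg W.w) * ·) ((str_smul hfr _).trans
    (congrArg (sgn k (n + j) * ·) h1))).trans ?_
  simp only [← mul_assoc, ← sgn_add]
  refine (congrArg (· * _) ?_).trans (one_mul _)
  rw [← sgn_zero k]
  obtain ⟨t, ht⟩ := Int.even_mul_succ_self n
  refine sgn_eq_of_eq_add_two_mul (m := j - t + n) ?_
  have h3 : deg W.w = - n - W.i := by omega
  rw [h3]
  linear_combination -ht

end CapWord

/-! ### Duality of morphism complexes -/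

namespace OpCochain
variable {E : DGCategory k} {R R' : DGRep E} (C : ∀ x, OpContraction (R.K x)) {r : ℤ}
  {β φ : OpCochain R R'}

lemma isNormalized_transfer (hβ : ∀ x y, IsNormalized (β (x := x) (y := y)))
    (hφ : ∀ x y, IsNormalized (φ (x := x) (y := y))) (x y : E.Obj) :
    IsNormalized (transfer C r β φ (x := x) (y := y)) where
  lin h := by
    rw [transfer, transfer, transfer,
      (isNormalized_cup hφ fun _ _ => isNormalized_hWord R C).lin h,
      (isNormalized_cup hβ fun _ _ => isNormalized_gWord R C).lin h]
    module
  degenerate h := by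
    rw [transfer, (isNormalized_cup hφ fun _ _ => isNormalized_hWord R C).degenerate h,
      (isNormalized_cup hβ fun _ _ => isNormalized_gWord R C).degenerate h, smul_zero, add_zero]

lemma hasParity_transfer (hβ : ∀ {x y} (w : BarWord E x y), HasParity (deg w + r) (β w))
    (hφ : ∀ {x y} (w : BarWord E x y), HasParity (deg w + (r + 1)) (φ w)) {x y : E.Obj}
    (w : BarWord E x y) : HasParity (deg w + r) (transfer C r β φ w) := by
  have h1 := hasParity_cup (s := -1) (X := fun _ _ v => hWord R C v) hφ
    (fun w => hasParity_hWord R C w) w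
  have h2 := hasParity_cup (s := 0) (X := fun _ _ v => gWord R C v) hβ
    (fun w => (hasParity_gWord R C w).congr (by rw [add_zero])) w
  exact ((h1.congr (by congr 1; ring)).smul _).add (h2.congr (by rw [add_zero]))

lemma isFiniteRank_transfer (hC : ∀ x, IsFiniteRank (C x).e)
    (hφ : ∀ {x y} (w : BarWord E x y), IsFiniteRank (φ w)) {x y : E.Obj} (w : BarWord E x y) :
    IsFiniteRank (transfer C r β φ w) :=
  ((isFiniteRank_cup_left hφ w).smul _).add
    (isFiniteRank_cup_right (fun w => isFiniteRank_gWord R C hC w) w)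

end OpCochain

/-- The supertrace of the composition of an operator and a difference of two operators. -/
lemma str_comp_smul_comp_sub {K K' L L' : CochainComplex (ModuleCat.{u} k) ℤ}
    {X : Total K →ₗ[k] Total L} {Y : Total K' →ₗ[k] Total K} {D : Total L →ₗ[k] Total K}
    {B : Total L →ₗ[k] Total K'} {Z : Total L' →ₗ[k] Total K'} {G : Total L →ₗ[k] Total L'}
    {r s t : k} (h : D = r • Y ∘ₗ (s • B - t • Z ∘ₗ G)) (hB : IsFiniteRank (X ∘ₗ Y ∘ₗ B))
    (hG : IsFiniteRank (X ∘ₗ (Y ∘ₗ Z) ∘ₗ G)) :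
    str (X ∘ₗ D) = r * (s * str (X ∘ₗ Y ∘ₗ B) - t * str (X ∘ₗ (Y ∘ₗ Z) ∘ₗ G)) := by
  have h1 : X ∘ₗ D = r • (s • (X ∘ₗ Y ∘ₗ B) - t • (X ∘ₗ (Y ∘ₗ Z) ∘ₗ G)) := by
    rw [h]
    simp only [LinearMap.comp_smul, LinearMap.comp_sub, LinearMap.comp_assoc]
  rw [h1, str_smul ((hB.smul _).sub (hG.smul _)), str_sub (hB.smul _) (hG.smul _), str_smul hB,
    str_smul hG]

section Core
variable {A : DGCategory k} {P : Set A.Obj} {p : P} {n : ℤ}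

/-- Hochschild cycles annihilate the functionals which are defined by coboundaries. -/
lemma linearCombination_str_delta {F : OpCochain (homRep p) (homRep p)}
    (hF : ∀ {x y : A.op.Obj} (u : BarWord A.op x y), IsFiniteRank (F u))
    (hp : ∀ {x y : A.op.Obj} (u : BarWord A.op x y), HasParity (deg u + (n - 1)) (F u))
    (hn : ∀ x y, IsNormalized (F (x := x) (y := y))) {ξ : Chain A} (hξ : hochB A ξ ∈ chainRel A)
    (hdeg : ∀ W ∈ ξ.support, W.deg = -n) :
    Finsupp.linearCombination k (fun W => sgn k (reverseSign W.w + n * deg W.w) *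
      str ((homRep p).op (x := W.x) (y := W.y) W.a ∘ₗ
        F.delta (n - 1) ((opAntifunctor A).reverse W.w))) ξ = 0 := by
  have hr := OpCochain.isReduced_strFun (r := n - 1) hF hn
  have h1 := ((opAntifunctor A).isReduced_reverseFun hr).linearCombination_eq_zero hξ
  rw [linearCombination_hochB] at h1
  have h2 : Finsupp.linearCombination k
      (hochFun ((opAntifunctor A).reverseFun (OpCochain.strFun (n - 1) F))) ξ =
      Finsupp.linearCombination k (fun W => -sgn k n * (sgn k (reverseSign W.w + n * deg W.w) *
      str ((homRep p).op (x := W.x) (y := W.y) W.a ∘ₗ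
        F.delta (n - 1) ((opAntifunctor A).reverse W.w)))) ξ := by
    refine linearCombination_congr fun W hW => ?_
    rw [DGAntifunctor.hochFun_reverseFun _ hr]
    have h3 := OpCochain.hochFun_strFun hF hp ((opAntifunctor A).map W.a)
      ((opAntifunctor A).reverse W.w)
    refine (congrArg (sgn k (reverseSign W.w) * ·) h3).trans ?_
    have h4 := hdeg W hW
    rw [HHWord.deg] at h4
    rw [DGAntifunctor.deg_reverse, ← mul_assoc, ← mul_assoc, mul_neg, neg_mul (sgn k n), ← sgn_add,
      ← sgn_add]
    refine congrArg (· * _) (congrArg (-·) ?_)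
    exact sgn_eq_of_eq_add_two_mul (m := -n - deg W.w) (by rw [show W.i = -n - deg W.w by omega]; ring)
  rw [h2, linearCombination_mul] at h1
  refine (mul_eq_zero.1 h1).resolve_left ?_
  rcases sgn_eq_one_or (k := k) n with h | h <;> simp [h]

/-- The unit, as an element of a degree which is only propositionally equal to zero. -/
lemma exists_one (A : DGCategory k) (y : A.Obj) {m : ℤ} (hm : m = 0) :
    ∃ e : (A.Hom y y).X m, (A.Hom y y).d m (m + 1) e = 0 ∧
      ∀ (z : A.Obj) (j : ℤ) (h : j + m = j) (g : (A.Hom y z).X j), A.comp h g e = g := by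
  subst hm
  exact ⟨A.one y, A.d_one y, fun z j h g => A.comp_one g⟩

lemma shift_d (K : CochainComplex (ModuleCat.{u} k) ℤ) (m i j : ℤ) (v : K.X (i + m)) :
    (K⟦m⟧).d i j v = sgn k m • K.d (i + m) (j + m) v := by
  change (m.negOnePow • K.d (i + m) (j + m)).hom v = _
  rw [Units.smul_def, ModuleCat.hom_zsmul, LinearMap.smul_apply, sgn, Int.cast_smul_eq_zsmul]

/-- A functional that vanishes on boundaries vanishes on products of a cocycle and a boundary. -/
lemma map_comp_d_eq_zero {x y z : A.Obj} {j l m m' : ℤ} (θ : (A.Hom x z).X j →ₗ[k] k)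
    (hθ : ∀ (i : ℤ) (_ : i + 1 = j) (v : (A.Hom x z).X i), θ ((A.Hom x z).d i j v) = 0)
    {r : ℤ} {g : (A.Hom y z).X r} (hg : (A.Hom y z).d r (r + 1) g = 0) (h : r + m = l) (hm : m + 1 = m')
    (h' : r + m' = j) (u : (A.Hom x y).X m) :
    θ (A.comp h' g ((A.Hom x y).d m m' u)) = 0 := by
  have h4 := congrArg (fun X => sgn k r * θ X) (A.d_comp h rfl hm (show l + 1 = j by omega) g u)
  dsimp only at h4
  rw [hθ _ (by omega), hg, map_zero, LinearMap.zero_apply, zero_add, map_smul, smul_eq_mul,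
    ← mul_assoc, sgn_mul_self, one_mul, mul_zero] at h4
  exact h4.symm

/-- A left Calabi-Yau structure produces a Hochschild cocycle whose cap product with `ξ₀` is
cohomologous to `±1`. -/
lemma exists_cap_eq_one (Λ : LeftCalabiYau A n) (y : A.Obj) :
    ∃ ψ : hochschildX (representable A y y) n,
      (∀ x z (w : BarWord A x z), hochD (representable A y y) n ψ.1 w = 0) ∧
      ∀ (z : A.Obj) (j : ℤ) (θ : (A.Hom y z).X j →ₗ[k] k),
        (∀ (i : ℤ) (_ : i + 1 = j) (v : (A.Hom y z).X i), θ ((A.Hom y z).d i j v) = 0) →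
        ∀ g : (A.Hom y z).X j, (A.Hom y z).d j (j + 1) g = 0 →
          θ (A.comp (show j + (n + -n) = j by omega) g (cap y y (Λ.ξ 0) n (n + -n) ψ)) =
            sgn k n * θ g := by
  obtain ⟨f, hf, hq⟩ := Λ.nondegenerate y y
  obtain ⟨e, he, hge⟩ := exists_one A y (add_neg_cancel n)
  have he' : ((A.Hom y y)⟦-n⟧).d n (n + 1) e = 0 := by
    have h1 : (A.Hom y y).d (n + -n) (n + 1 + -n) e = 0 := by
      rw [show n + 1 + -n = n + -n + 1 by ring]; exact he
    exact (shift_d _ _ _ _ _).trans ((congrArg _ h1).trans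
      (smul_zero (A := (A.Hom y y).X (n + 1 + -n)) _))
  obtain ⟨ψ, hψ, u, hu⟩ := exists_of_quasiIso f (sub_add_cancel n 1) e he'
  refine ⟨ψ, fun x z w => ?_, fun z j θ hθ g hg => ?_⟩
  · have h1 : hochschildD (representable A y y) (rfl : n + 1 = n + 1) ψ = 0 := by
      have h2 : (hochschildCochains (representable A y y)).d n (n + 1) =
        ModuleCat.ofHom (hochschildD (representable A y y) rfl) :=
        congrArg ModuleCat.ofHom (dif_pos rfl)
      rw [h2] at hψ
      exact hψ
    exact congrFun (congrFun (congrFun (congrArg Subtype.val h1) x) z) w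
  · have h1 : sgn k (n * n) • cap y y (Λ.ξ 0) n (n + -n) ψ =
        e + sgn k (-n) • (A.Hom y y).d (n - 1 + -n) (n + -n) u :=
      (hf n ψ).symm.trans (hu.trans (congrArg (e + ·) (shift_d (A.Hom y y) (-n) (n - 1) n u)))
    -- the boundary does not contribute since `θ` vanishes on boundaries and `g` is closed
    have h2 := map_comp_d_eq_zero θ hθ hg (show j + (n - 1 + -n) = j - 1 by omega)
      (show n - 1 + -n + 1 = n + -n by ring) (show j + (n + -n) = j by omega) u
    have h5 := congrArg (fun X => θ (A.comp (show j + (n + -n) = j by omega) g X)) h1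
    simp only [map_smul, map_add, hge, h2, add_zero, smul_eq_mul, mul_zero] at h5
    have h6 : sgn k (n * n) = sgn k n := by
      obtain ⟨t, ht⟩ := Int.even_mul_succ_self n
      exact sgn_eq_of_eq_add_two_mul (m := t - n) (by linear_combination ht)
    rw [h6] at h5
    rw [← h5, ← mul_assoc, sgn_mul_self, one_mul]

variable (Λ : LeftCalabiYau A n) (c : ∀ X : A.Obj × P, Contraction (homFamily A P X))
  (hc : ∀ X, IsFiniteRank (opContraction c X).e)
include hc

/-- Every functional on the cohomology of `A(y, p)` is the pairing with a closed morphism, namely with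
`(θ ⊗ 1) ψ([])` for the cocycle `ψ` of `exists_cap_eq_one`. -/
lemma exists_dual {y : P} {j : ℤ} (θ : (A.Hom y p).X j →ₗ[k] k)
    (hθ : ∀ (i : ℤ) (_ : i + 1 = j) (v : (A.Hom y p).X i), θ ((A.Hom y p).d i j v) = 0) :
    ∃ a : (A.Hom p y).X (n - j), (A.Hom p y).d (n - j) (n - j + 1) a = 0 ∧
      ∀ g : (A.Hom y p).X j, (A.Hom y p).d j (j + 1) g = 0 →
        theta c Λ.ξ 0 (word (A := A.full P) (x := p) (y := p) (i := n)
          (A.comp (show j + (n - j) = n by omega) g a) (nil (A := A.full P) p)) = sgn k j * θ g := by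
  obtain ⟨ψ, hd, hcap⟩ := exists_cap_eq_one Λ (y : A.Obj)
  refine ⟨Total.proj (n - j) (contract (y : A.Obj) (p : A.Obj) θ (ψ.1 p p (nil (p : A.Obj)))),
    d_contract_nil θ hd hθ, fun g hg => ?_⟩
  have hβ := fun x z => delta_barContract θ ψ.2 hd hθ (z := z) (x := x)
  set a := Total.proj (n - j) (contract (y : A.Obj) (p : A.Obj) θ (ψ.1 p p (nil (p : A.Obj)))) with ha
  -- `K` is a homotopy of finite rank between `φ` and `± a G`, and `F = g K`
  let β : OpCochain (homRep p) (homRep y) := (barContract θ ψ.2).toCovariant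
  let φ : OpCochain (homRep p) (homRep y) := (actContract θ ψ.1 n).toCovariant
  let K : OpCochain (homRep p) (homRep y) :=
    OpCochain.transfer (homContraction c p) (n - j - 1) β φ
  let F : OpCochain (homRep p) (homRep p) := fun _ z u => leftOp (P := P) g z ∘ₗ K u
  have hβ' : ∀ {x z : A.op.Obj} (u : BarWord A.op x z), β.delta (n - j - 1) u =
      φ u - sgn k (n + j) • OpCochain.unitCochain (R := homRep p) (R' := homRep y)
        (fun z => leftOp (P := P) a z) u := by
    intro x z u
    rw [ContraCochain.delta_toCovariant (isNormalized_barContract θ ψ.2), hβ, smul_sub, smul_comm]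
    rw [← ContraCochain.toCovariant_unit]
    rfl
  have hφ : ∀ {x z : A.op.Obj} (u : BarWord A.op x z), φ.delta (n - j - 1 + 1) u = 0 := by
    intro x z u
    rw [sub_add_cancel, ContraCochain.delta_toCovariant (isNormalized_actContract θ ψ.2),
      delta_actContract θ hd hθ, smul_zero]
  have hK : ∀ {x z : A.op.Obj} (u : BarWord A.op x z), K.delta (n - j - 1) u = φ u - sgn k (n + j) •
      leftOp (P := P) a z ∘ₗ gWord (homRep p) (homContraction c p) u := fun u =>
    OpCochain.delta_transfer (homContraction c p) hβ' hφ u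
  have hF : ∀ {x z : A.op.Obj} (u : BarWord A.op x z), F.delta (n - 1) u = sgn k j •
      leftOp (P := P) g z ∘ₗ (φ u - sgn k (n + j) •
        leftOp (P := P) a z ∘ₗ gWord (homRep p) (homContraction c p) u) := by
    intro x z u
    have h1 := OpCochain.delta_comp_left (E := A.op) (R := homRep p) (R' := homRep y)
      (R'' := homRep p) (T := fun z => leftOp (P := P) g z) (fun z => diffOp_comp_leftOp (P := P) hg z)
      (fun f => homRep_op_comp_leftOp (P := P) g f) (n - j - 1) K u
    rw [show n - j - 1 + j = n - 1 by ring, hK] at h1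
    exact h1
  have hφr : ∀ {x z : A.op.Obj} (u : BarWord A.op x z), IsFiniteRank (φ u) :=
    fun u => (isFiniteRank_actContract θ _).smul _
  have hFr : ∀ {x z : A.op.Obj} (u : BarWord A.op x z), IsFiniteRank (F u) := fun u =>
    (OpCochain.isFiniteRank_transfer (homContraction c p) (fun z => hc (z, p)) hφr u).comp_left _
  have hFp : ∀ {x z : A.op.Obj} (u : BarWord A.op x z), HasParity (deg u + (n - 1)) (F u) := by
    intro x z u
    have h1 := OpCochain.hasParity_transfer (homContraction c p) (r := n - j - 1) (β := β) (φ := φ)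
      (fun u => ((hasParity_barContract θ ψ.2 _).smul _).congr (by rw [DGAntifunctor.deg_reverse]))
      (fun u => ((hasParity_actContract θ _).smul _).congr
        (by rw [DGAntifunctor.deg_reverse, sub_add_cancel])) u
    exact ((hasParity_leftOp (P := P) g z).comp h1).congr (by congr 1; ring)
  have hFn : ∀ x z, IsNormalized (F (x := x) (y := z)) := by
    intro x z
    have h1 := OpCochain.isNormalized_transfer (homContraction c p) (r := n - j - 1) (β := β) (φ := φ)
      (ContraCochain.isNormalized_toCovariant (isNormalized_barContract θ ψ.2))
      (ContraCochain.isNormalized_toCovariant (isNormalized_actContract θ ψ.2)) x z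
    refine ⟨fun h => ?_, fun h => ?_⟩
    · exact (congrArg (leftOp (P := P) g z ∘ₗ ·) (h1.lin h)).trans
        ((LinearMap.comp_add _ _ _).trans (congrArg (_ + ·) (LinearMap.comp_smul _ _ _)))
    · exact (congrArg (leftOp (P := P) g z ∘ₗ ·) (h1.degenerate h)).trans (LinearMap.comp_zero _)
  have hdeg : ∀ W ∈ (Λ.ξ 0).support, W.deg = -n := fun W hW => by
    rw [Λ.homog 0 W hW]; simp
  have h0 := linearCombination_str_delta hFr hFp hFn Λ.cycle_zero hdeg
  -- the supertrace of `g (φ ∓ a G)` on a word: the first part is a cap product, the second the pairing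
  have hW : ∀ W ∈ (Λ.ξ 0).support, sgn k (reverseSign W.w + n * deg W.w) *
      str ((homRep p).op (x := W.x) (y := W.y) W.a ∘ₗ
        F.delta (n - 1) ((opAntifunctor A).reverse W.w)) =
      sgn k j * (θ (A.comp (show j + (n + -n) = j by omega) g (capWord (y : A.Obj) (y : A.Obj) n
        (n + -n) W (ψ.1 W.x W.y W.w (n + -n - W.i)))) - sgn k (n + j) * pairing c W
          (⟨A.comp (show j + (n - j) = n by omega) g a, nil (A := A.full P) p⟩ :
            HHWord (A.full P))) := by
    intro W hW
    have h1 := str_actContract θ (ψ := ψ.1) g W (hdeg W hW)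
    have h2 := pairing_nil c hc W.a W.w (p := p) (A.comp (show j + (n - j) = n by omega) g a)
    rw [leftOp_comp] at h2
    have h3 : φ ((opAntifunctor A).reverse W.w) =
        sgn k (reverseSign W.w) • actContract θ ψ.1 n W.w := by
      refine (congrArg (sgn k · • _) ((opAntifunctor A).reverseSign_reverse W.w)).trans ?_
      exact congrArg (fun u : BarWord A W.x W.y => sgn k (reverseSign W.w) •
        (actContract θ ψ.1 n u : Total (A.Hom W.y p) →ₗ[k] Total (A.Hom W.x y))) (reverse_reverse W.w)
    -- the value of `gWord` is generalized, since its type agrees with that of `G` up to `op` only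
    obtain ⟨G, hG⟩ : ∃ G : Total (A.Hom W.y p) →ₗ[k] Total (A.Hom W.x p),
      G = gWord (homRep p) (homContraction c p) ((opAntifunctor A).reverse W.w) := ⟨_, rfl⟩
    have hr1 : IsFiniteRank ((homRep p).op (x := W.x) (y := W.y) W.a ∘ₗ leftOp (P := P) g W.x ∘ₗ
      actContract θ ψ.1 n W.w) := ((isFiniteRank_actContract θ W.w).comp_left _).comp_left _
    have hr2 : IsFiniteRank ((homRep p).op (x := W.x) (y := W.y) W.a ∘ₗ
        (leftOp (P := P) g W.x ∘ₗ leftOp (P := P) a W.x) ∘ₗ G) := by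
      rw [hG]
      exact ((isFiniteRank_gWord (homRep p) (homContraction c p) (fun z => hc (z, p)) _).comp_left
        _).comp_left _
    have h4 : F.delta (n - 1) ((opAntifunctor A).reverse W.w) = sgn k j • leftOp (P := P) g W.x ∘ₗ
        (sgn k (reverseSign W.w) • actContract θ ψ.1 n W.w - sgn k (n + j) •
          leftOp (P := P) a W.x ∘ₗ G) := by
      rw [hG, ← h3]
      exact hF _
    have h5 := str_comp_smul_comp_sub h4 hr1 hr2
    replace h2 := h2.trans (congrArg (fun X : Total (A.Hom W.y p) →ₗ[k] Total (A.Hom W.x p) =>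
      sgn k (reverseSign W.w + n * deg W.w) * str ((homRep p).op (x := W.x) (y := W.y) W.a ∘ₗ
        (leftOp (P := P) g W.x ∘ₗ leftOp (P := P) a W.x) ∘ₗ X)) hG.symm)
    refine (congrArg (sgn k (reverseSign W.w + n * deg W.w) * ·) h5).trans ?_
    rw [← h1]
    refine Eq.trans ?_ (congrArg (fun X => sgn k j * (_ - sgn k (n + j) * X)) h2.symm)
    rw [sgn_add k (reverseSign W.w)]
    have h6 : ∀ r d s t X Y : k, r * r = 1 →
        r * d * (s * (r * X - t * Y)) = s * (d * X - t * (r * d * Y)) := by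
      intro r d s t X Y hr
      linear_combination d * s * X * hr
    exact h6 _ _ _ _ _ _ (sgn_mul_self k (reverseSign W.w))
  rw [linearCombination_congr hW, linearCombination_mul] at h0
  set U : HHWord (A.full P) :=
    ⟨A.comp (show j + (n - j) = n by omega) g a, nil (A := A.full P) p⟩ with hU
  have h1 := hcap p j θ hθ g hg
  have h2 : theta c Λ.ξ 0 (word (A := A.full P) (x := p) (y := p) (i := n)
      (A.comp (show j + (n - j) = n by omega) g a) (nil (A := A.full P) p)) =
      Finsupp.linearCombination k (fun W => pairing c W U) (Λ.ξ 0) := by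
    rw [theta_eq, Nat.cast_zero, sgn_zero, one_mul, pairingChain]
    refine linearCombination_congr fun W _ => ?_
    refine (Finsupp.linearCombination_single k 1 U).trans (one_smul k _)
  have h3 : Finsupp.linearCombination k (fun W => θ (A.comp (show j + (n + -n) = j by omega) g
      (capWord (y : A.Obj) (y : A.Obj) n (n + -n) W (ψ.1 W.x W.y W.w (n + -n - W.i)))) -
      sgn k (n + j) * pairing c W U) (Λ.ξ 0) = sgn k n * θ g - sgn k (n + j) *
        Finsupp.linearCombination k (fun W => pairing c W U) (Λ.ξ 0) := by
    rw [← h1, cap]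
    simp only [Finsupp.linearCombination_apply, Finsupp.sum, map_sum, map_smul, mul_sub,
      Finset.sum_sub_distrib, smul_eq_mul, Finset.mul_sum]
    congr 1
    exact Finset.sum_congr rfl fun W _ => mul_left_comm _ _ _
  rw [h2]
  have h4 := sgn_mul_self k n
  have h5 := sgn_mul_self k j
  have h6 := h0.symm.trans (congrArg (sgn k j * ·) h3)
  rw [sgn_add] at h6
  generalize Finsupp.linearCombination k (fun W => pairing c W U) (Λ.ξ 0) = X at h6 ⊢
  linear_combination sgn k n * h6 - (X * sgn k j * sgn k j - sgn k j * θ g) * h4 - X * h5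

end Core

/-! ### The morphism from the diagonal bimodule to its dual -/

section Shift
variable {Q : DGCategory k} {n : ℤ} {x y : Q.Obj}

/-- An element of the shifted dual bimodule, as a functional. -/
def toDual {q : ℤ} (φ : (((dualBimodule Q).M x y)⟦-n⟧).X q) :
    Module.Dual k ((Q.Hom y x).X (-(q + -n))) := φ

lemma toDual_d {p q : ℤ} (φ : (((dualBimodule Q).M x y)⟦-n⟧).X p)
    (g : (Q.Hom y x).X (-(q + -n))) :
    toDual ((((dualBimodule Q).M x y)⟦-n⟧).d p q φ) g =
      -sgn k p * toDual φ ((Q.Hom y x).d (-(q + -n)) (-(p + -n)) g) := by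
  refine (congrArg (fun T : Module.Dual k ((Q.Hom y x).X (-(q + -n))) => T g)
    (shift_d ((dualBimodule Q).M x y) (-n) p q φ)).trans ?_
  change sgn k (-n) * (-sgn k (p + -n) * toDual φ _) = _
  rw [sgn_add, sgn_neg]
  have h := sgn_mul_self k n
  linear_combination -(sgn k p * toDual φ ((Q.Hom y x).d (-(q + -n)) (-(p + -n)) g)) * h

end Shift

section Dual
variable {Q : DGCategory k} {n : ℤ} {ω : Chain Q →ₗ[k] k} (hrel : ∀ β ∈ chainRel Q, ω β = 0)
include hrel

lemma map_word_add_smul {x y : Q.Obj} {i : ℤ} (a b : (Q.Hom y x).X i) (r : k) (w : BarWord Q x y) :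
    ω (word (a + r • b) w) = ω (word a w) + r * ω (word b w) := by
  have h := hrel _ (Submodule.subset_span (Or.inl (Or.inl ⟨x, y, i, a, b, r, w, rfl⟩)))
  rw [map_sub, map_sub, map_smul, smul_eq_mul] at h
  linear_combination h

lemma map_word_zero {x y : Q.Obj} {i : ℤ} (w : BarWord Q x y) :
    ω (word (0 : (Q.Hom y x).X i) w) = 0 := by
  simpa using map_word_add_smul hrel (0 : (Q.Hom y x).X i) 0 1 w

/-- A functional on Hochschild chains, restricted to the words of length zero. -/
noncomputable def wordMap (x : Q.Obj) (i : ℤ) : (Q.Hom x x).X i →ₗ[k] k where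
  toFun a := ω (word a (nil x))
  map_add' a b := by simpa using map_word_add_smul hrel a b 1 (nil x)
  map_smul' r a := by simpa [map_word_zero hrel] using map_word_add_smul hrel 0 a r (nil x)

variable (hb : ∀ β, ω (hochB Q β) = 0)
include hb

lemma wordMap_d {x : Q.Obj} {i i' : ℤ} (h : i + 1 = i') (a : (Q.Hom x x).X i) :
    wordMap hrel x i' ((Q.Hom x x).d i i' a) = 0 := by
  subst h
  have h1 := hb (word a (nil x))
  simp only [hochB, word, Finsupp.linearCombination_single, one_smul, bdry_nil, first_nil, last_nil,
    smul_zero, add_zero, sub_zero] at h1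
  exact h1

/-- The pairing which is defined by a Hochschild cocycle is symmetric on cohomology: this is the
cocycle condition on the words `g[a]`. -/
lemma wordMap_comm {x y : Q.Obj} {i j m : ℤ} {g : (Q.Hom y x).X i} {a : (Q.Hom x y).X j}
    (hg : (Q.Hom y x).d i (i + 1) g = 0) (ha : (Q.Hom x y).d j (j + 1) a = 0) (h : i + j = m)
    (h' : j + i = m) : wordMap hrel x m (Q.comp h g a) =
      sgn k (i * j) * wordMap hrel y m (Q.comp h' a g) := by
  subst h
  have h0 : ω (word g (cons (j + 1) (0 : (Q.Hom x y).X (j + 1)) (nil x))) = 0 := by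
    have h := hrel _ (Submodule.subset_span (Or.inl (Or.inr ⟨x, y, i, g, 1, _, _, _,
      IsLinComb.head (j + 1) (0 : (Q.Hom x y).X (j + 1)) 0 (nil x), rfl⟩)))
    simp only [smul_zero, add_zero, one_smul, sub_self, zero_sub] at h
    exact neg_eq_zero.1 ((map_neg ω _).symm.trans h)
  have h1 := hb (word g (single a))
  rw [word] at h1
  simp only [hochB, Finsupp.linearCombination_single, one_smul, single, bdry_cons, first_cons,
    last_single, bdry_nil, first_nil, smul_zero, sub_zero, hg, ha, map_sub, map_add, map_smul,
    map_neg, map_word_zero hrel, h0, neg_zero, zero_add, deg, add_zero, smul_eq_mul, mul_zero] at h1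
  have h2 : sgn k i * wordMap hrel x (i + j) (Q.comp rfl g a) -
      sgn k ((j - 1) * i) * wordMap hrel y (j + i) (Q.comp rfl a g) = 0 := h1
  have h3 : ∀ l (hl : j + i = l), wordMap hrel y (j + i) (Q.comp rfl a g) =
      wordMap hrel y l (Q.comp hl a g) := by
    rintro l rfl
    rfl
  rw [h3 _ h', sub_mul, one_mul, sgn_sub, mul_comm j i] at h2
  have h4 := sgn_mul_self k i
  generalize wordMap hrel y _ _ = Y at h2 ⊢
  generalize wordMap hrel x _ _ = X at h2 ⊢
  linear_combination sgn k i * h2 - (X - sgn k (i * j) * Y) * h4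

variable (x y : Q.Obj)

/-- The morphism `Q(x, y) ⟶ Q^*(x, y)[-n]`, `a ↦ (g ↦ ± ω(g a))`. -/
noncomputable def dualMap : Q.Hom x y ⟶ ((dualBimodule Q).M x y)⟦-n⟧ where
  f i := ModuleCat.ofHom (Y := (((dualBimodule Q).M x y)⟦-n⟧).X i) (sgn k (n * i + i) •
    (Q.comp (show -(i + -n) + i = n by omega)).flip.compr₂ (wordMap hrel x n) :
      (Q.Hom x y).X i →ₗ[k] Module.Dual k ((Q.Hom y x).X (-(i + -n))))
  comm' i i' h := by
    have hi : i + 1 = i' := h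
    ext a
    refine (shift_d _ _ _ _ _).trans ?_
    refine LinearMap.ext fun (g : (Q.Hom y x).X (-(i' + -n))) => ?_
    have h1 := wordMap_d hrel hb (show n - 1 + 1 = n by omega)
      (Q.comp (show -(i' + -n) + i = n - 1 by omega) g a)
    rw [Q.d_comp _ (show -(i' + -n) + 1 = -(i + -n) by omega) hi (by omega), map_add, map_smul,
      smul_eq_mul] at h1
    change sgn k (-n) * (-sgn k (i + -n) * (sgn k (n * i + i) * wordMap hrel x n (Q.comp _
      ((Q.Hom y x).d (-(i' + -n)) (-(i + -n)) g) a))) =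
      sgn k (n * i' + i') * wordMap hrel x n (Q.comp _ g ((Q.Hom x y).d i i' a))
    rw [eq_neg_of_add_eq_zero_left h1]
    generalize wordMap hrel x n _ = X
    subst hi
    simp only [mul_add, sgn_add, sgn_neg, mul_one, sgn_one]
    have h2 := sgn_mul_self k n
    have h3 := sgn_mul_self k i
    generalize sgn k i = t at *
    generalize sgn k n = s at *
    generalize sgn k (n * i) = r at *
    linear_combination -(r * t * X * s * s * s) * h3 - r * t * X * s * h2

lemma toDual_dualMap (i : ℤ) (a : (Q.Hom x y).X i) (g : (Q.Hom y x).X (-(i + -n))) :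
    toDual ((dualMap hrel hb x y).f i a) g =
      sgn k (n * i + i) * wordMap hrel x n (Q.comp (show -(i + -n) + i = n by omega) g a) :=
  rfl

/-- The morphism into the dual bimodule is a quasi-isomorphism as soon as every functional on
cohomology is given by pairing with a cocycle. The symmetry of the pairing turns the same property, for `x` and `y`
exchanged, into injectivity. -/
lemma quasiIso_dualMap
    (hD : ∀ (p y : Q.Obj) (j m : ℤ) (h : j + m = n) (θ : (Q.Hom y p).X j →ₗ[k] k),
      (∀ i (_ : i + 1 = j) v, θ ((Q.Hom y p).d i j v) = 0) →
      ∃ a : (Q.Hom p y).X m, (Q.Hom p y).d m (m + 1) a = 0 ∧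
        ∀ g : (Q.Hom y p).X j, (Q.Hom y p).d j (j + 1) g = 0 →
          wordMap hrel p n (Q.comp h g a) = sgn k j * θ g) :
    QuasiIso (dualMap (n := n) hrel hb x y) := by
  refine quasiIso_of_cocycles _ ?_ ?_
  · intro p q hpq b hb0
    have hb1 : ∀ i (_ : i + 1 = -(q + -n)) v,
        toDual b ((Q.Hom y x).d i (-(q + -n)) v) = 0 := by
      intro i hi v
      obtain rfl : i = -(q + 1 + -n) := by omega
      have h := toDual_d (q := q + 1) b v
      rw [hb0] at h
      exact (mul_eq_zero.1 h.symm).resolve_left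
        (neg_ne_zero.2 (left_ne_zero_of_mul_eq_one (sgn_mul_self k q)))
    obtain ⟨a, ha, h⟩ := hD x y (-(q + -n)) q (by omega) (toDual b) hb1
    let r := sgn k (-(q + -n)) * sgn k (n * q + q)
    have hr : sgn k (-(q + -n)) * sgn k (-(q + -n)) = 1 := sgn_mul_self k _
    have hr' : sgn k (n * q + q) * sgn k (n * q + q) = 1 := sgn_mul_self k _
    let D := ((Q.Hom y x).d (-(q + -n)) (-(p + -n))).hom
    let F := toDual ((dualMap (n := n) hrel hb x y).f q (r • a))
    have hF : ∀ g, D g = 0 → (F - toDual b) g = 0 := by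
      intro g hg
      have hg' : (Q.Hom y x).d (-(q + -n)) (-(q + -n) + 1) g = 0 := by
        have hp : -(q + -n) + 1 = -(p + -n) := by omega
        rw [hp]
        exact hg
      have h1 := toDual_dualMap hrel hb x y q (r • a) g
      rw [map_smul (Q.comp _ g), map_smul (wordMap hrel x n), smul_eq_mul, h g hg'] at h1
      refine sub_eq_zero.2 (h1.trans ?_)
      simp only [r]
      linear_combination toDual b g * hr +
        sgn k (-(q + -n)) * sgn k (-(q + -n)) * toDual b g * hr'
    have hF' : F - toDual b ∈ LinearMap.range D.dualMap := by
      rw [LinearMap.range_dualMap_eq_dualAnnihilator_ker]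
      exact (Submodule.mem_dualAnnihilator _).2 fun g hg => hF g hg
    -- a functional that vanishes on the kernel of the differential factors through it
    obtain ⟨χ, hχ⟩ := hF'
    let w : (((dualBimodule Q).M x y)⟦-n⟧).X p :=
      (show Module.Dual k ((Q.Hom y x).X (-(p + -n))) from (-sgn k p) • χ)
    refine ⟨r • a, by rw [map_smul, ha, smul_zero], w, ?_⟩
    have h2 : F = toDual b + χ ∘ₗ D := sub_eq_iff_eq_add'.1 hχ.symm
    refine h2.trans (congrArg (toDual b + ·) ?_)
    refine LinearMap.ext fun g => Eq.trans ?_ (toDual_d w g).symm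
    change χ (D g) = -sgn k p * (-sgn k p * χ (D g))
    linear_combination -(χ (D g)) * sgn_mul_self k p
  · intro p q hpq a ha w hw
    by_contra! hne
    -- a functional that separates `a` from the boundaries is, by the symmetry of the pairing,
    -- the pairing of `a` with some cocycle `a'`, but these pairings vanish if the image of `a` is a boundary
    obtain ⟨θ, hθ0, hθ⟩ := Submodule.exists_le_ker_of_notMem
      (p := LinearMap.range ((Q.Hom x y).d p q).hom) (v := a) (by
        rintro ⟨v, hv⟩
        exact hne v hv.symm)
    obtain ⟨a', ha', h⟩ := hD y x q (-(q + -n)) (by omega) θ (by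
      intro i hi v
      obtain rfl : i = p := by omega
      exact hθ ⟨v, rfl⟩)
    have h1 := h a ha
    rw [wordMap_comm hrel hb ha ha' _ (show -(q + -n) + q = n by omega)] at h1
    have h2 := toDual_dualMap hrel hb x y q a a'
    have hp : ∀ l, -(q + -n) + 1 = l → (Q.Hom y x).d (-(q + -n)) l a' = 0 := by
      rintro l rfl
      exact ha'
    rw [hw, toDual_d, hp _ (by omega), map_zero, mul_zero] at h2
    have hne' : ∀ i, sgn k i ≠ 0 := fun i => left_ne_zero_of_mul_eq_one (sgn_mul_self k i)
    rw [(mul_eq_zero.1 h2.symm).resolve_left (hne' _), mul_zero] at h1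
    exact hθ0 ((mul_eq_zero.1 h1.symm).resolve_left (hne' _))

end Dual

end DGCY

theorem theorem3p3 {k : Type u} [Field k] (A : DGCY.DGCategory k) (hA : DGCY.IsSmooth A) (n : ℤ)
    (Λ : DGCY.LeftCalabiYau A n) (P : Set A.Obj) (hP : ∀ p ∈ P, DGCY.IsLocallyPerfect A p)
    (c : ∀ X : A.Obj × P, DGCY.Contraction (DGCY.homFamily A P X)) :
    DGCY.IsRightCalabiYau (A.full P) n (DGCY.theta c Λ.ξ) := by
  have hc : ∀ X, DGCY.IsFiniteRank (DGCY.opContraction c X).e := fun X =>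
    (DGCY.opContraction c X).isFiniteRank_e (hP X.2 X.2.2 X.1)
  have hrel : ∀ j, ∀ β ∈ DGCY.chainRel (A.full P), DGCY.theta c Λ.ξ j β = 0 := fun j β hβ => by
    rw [DGCY.theta_eq, DGCY.pairingChain_eq_zero_right c hc _ hβ, mul_zero]
  have hb := DGCY.theta_cocycle_zero c hc n Λ
  refine ⟨fun (x y : P) => hP y y.2 x, hrel, DGCY.theta_homog c n Λ.ξ Λ.homog, hb,
    DGCY.theta_cocycle_succ c hc n Λ, fun x y => ?_⟩
  refine ⟨DGCY.dualMap (n := n) (hrel 0) hb x y, fun i a g => rfl,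
    DGCY.quasiIso_dualMap (hrel 0) hb x y ?_⟩
  intro p q j m h θ hθ
  obtain rfl : m = n - j := by omega
  exact DGCY.exists_dual Λ c hc θ hθ
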